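/- Let $M$ be a smooth manifold and let $\mathbb{E}\to M$ be a Courant algebroid, that is, a vector bundle with a bundle map $\mathbf{a}:\mathbb{E}\to TM$, a (possibly indefinite) non-degenerate bundle metric $\langle\cdot,\cdot\rangle$ and an $\mathbb{R}$-bilinear bracket $[\![\cdot,\cdot]\!]$ on $\Gamma(\mathbb{E})$ satisfying $[\![\sigma_1,[\![\sigma_2,\sigma_3]\!]]\!]=[\![[\![\sigma_1,\sigma_2]\!],\sigma_3]\!]+[\![\sigma_2,[\![\sigma_1,\sigma_3]\!]]\!]$, $\mathbf{a}(\sigma_1)\langle\sigma_2,\sigma_3\rangle=\langle[\![\sigma_1,\sigma_2]\!],\sigma_3\rangle+\langle\sigma_2,[\![\sigma_1,\sigma_3]\!]\rangle$ and $[\![\sigma_1,\sigma_2]\!]+[\![\sigma_2,\sigma_1]\!]=\mathbf{a}^*d\langle\sigma_1,\sigma_2\rangle$. For $\sigma\in\Gamma(\mathbb{E})$ let $\sigma_T=d\sigma$ and $\sigma_C$ be its tangent lift and its core (vertical) lift to sections of $T\mathbb{E}\to TM$, and for $f\in C^\infty(M)$ let $f_T=df$ and $f_C=q_{TM/M}^*f$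 in $C^\infty(TM)$. The vector bundle $T\mathbb{E}\to TM$ carries the tangent prolongation of $\mathbb{E}$: a Courant algebroid structure (which exists) with $$\langle\sigma_T,\tau_T\rangle=\langle\sigma,\tau\rangle_T,\quad \langle\sigma_T,\tau_C\rangle=\langle\sigma_C,\tau_T\rangle=\langle\sigma,\tau\rangle_C,\quad \langle\sigma_C,\tau_C\rangle=0,$$ $$[\![\sigma_T,\tau_T]\!]=[\![\sigma,\tau]\!]_T,\quad [\![\sigma_T,\tau_C]\!]=[\![\sigma_C,\tau_T]\!]=[\![\sigma,\tau]\!]_C,\quad [\![\sigma_C,\tau_C]\!]=0,$$ and $\mathbf{a}(\sigma_T)=\mathbf{a}(\sigma)_T$, $\mathbf{a}(\sigma_C)=\mathbf{a}(\sigma)_C$ (complete and vertical lifts of vector fields) for all $\sigma,\tau\in\Gamma(\mathbb{E})$. Let $L\subseteq T\mathbb{E}$ be a $\mathcal{VB}$-Dirac structure with side bundles $TM$ and $W$. This means: $W\subseteq\mathbb{E}$ is a vector subbundle over $M$; $L$ is at the same time a vector subbundle of $T\mathbb{E}\to TM$ over all of $TM$ and a vector subbundle of the tangent bundle $T\mathbb{E}\to\mathbb{E}$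 over the submanifold $W\subseteq\mathbb{E}$; and $L\to TM$ is a Dirac structure (Lagrangian, and with sections closed under the bracket) in the tangent prolongation $T\mathbb{E}\to TM$. Then $L^{flip}$ is an $\mathcal{LA}$-vector bundle. That is, with the restriction of the Courant bracket and of the anchor of $T\mathbb{E}$, the vector bundle $L\to TM$ is a Lie algebroid, and the graph $\{(d_1,d_2,d_3)\in L^3 : d_1=d_2+d_3 \text{ in } L\to W\}$ of the addition of $L\to W$ is a Lie subalgebroid of the product Lie algebroid $L^3\to(TM)^3$. Moreover there is a Lie algebroid structure on $W\to M$ for which the projection $L\to W$ is a Lie algebroid morphism, that is, its graph is a Lie subalgebroid of $W\times L\to M\times TM$. Here a vector subbundle $K$ of a Lie algebroid, over a submanifold $S$ of its base, is a Lie subalgebroid if the bracket of any two sections whose restrictions to $S$ lie in $\Gamma(K)$ again restricts to a section of $K$ over $S$. -/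

import Mathlib

open Bundle Manifold ContDiff Topology

set_option linter.unusedSectionVars false

namespace TangentLift

section Subbundles

variable {V : Type*} [NormedAddCommGroup V] [NormedSpace ℝ V] {H : Type*} [TopologicalSpace H]
  (I : ModelWithCorners ℝ V H) {N : Type*} [TopologicalSpace N] [ChartedSpace H N]

/-- Embedded submanifolds without boundary: near each of its points, `S` is the preimage of a
linear subspace under a smooth chart. -/
def IsEmbeddedSubmanifold (S : Set N) : Prop :=
  ∀ p ∈ S, ∃ e ∈ IsManifold.maximalAtlas I ∞ N, p ∈ e.source ∧
    ∃ U : Submodule ℝ V, ∀ q ∈ e.source, q ∈ S ↔ I (e q) ∈ U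

/-- The base of a subset `K` of a vector bundle: the points over which `K` is nonempty. -/
def baseOf {Q : N → Type*} (K : ∀ p, Set (Q p)) : Set N := {p | (K p).Nonempty}

/-- A subset `K` of the total space of a vector bundle `Q → N`, given fibre by fibre, is a vector
subbundle over its base: the base is an embedded submanifold `S` of `N` and, locally along `S`,
`K` is spanned by linearly independent smooth sections of `Q`. Here `Γ` is the set
of smooth sections of `Q` over `N`. -/
structure IsVectorSubbundle {Q : N → Type*} [∀ p, AddCommGroup (Q p)] [∀ p, Module ℝ (Q p)]
    (Γ : Set (∀ p, Q p)) (K : ∀ p, Set (Q p)) : Prop where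
  embedded : IsEmbeddedSubmanifold I (baseOf K)
  frame : ∀ p ∈ baseOf K, ∃ (n : ℕ) (s : Fin n → ∀ q, Q q), (∀ i, s i ∈ Γ) ∧
    ∀ᶠ q in 𝓝 p, q ∈ baseOf K → LinearIndependent ℝ (fun i => s i q) ∧
      (Submodule.span ℝ (Set.range fun i => s i q) : Set (Q q)) = K q

/-- A vector subbundle `K`, over a submanifold `S`, of a Lie algebroid over `N` with smooth
sections `Γ` and bracket `br` is a Lie subalgebroid if the bracket of any two sections that
restrict over `S` to sections of `K` restricts over `S` to a section of `K`. -/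
structure IsLieSubalgebroid {Q : N → Type*} [∀ p, AddCommGroup (Q p)] [∀ p, Module ℝ (Q p)]
    (Γ : Set (∀ p, Q p)) (br : (∀ p, Q p) → (∀ p, Q p) → ∀ p, Q p) (K : ∀ p, Set (Q p)) :
    Prop where
  subbundle : IsVectorSubbundle I Γ K
  bracket_mem : ∀ σ ∈ Γ, ∀ τ ∈ Γ, (∀ p ∈ baseOf K, σ p ∈ K p) → (∀ p ∈ baseOf K, τ p ∈ K p) →
    ∀ p ∈ baseOf K, br σ τ p ∈ K p

end Subbundles

section Algebroids

variable {V : Type*} [NormedAddCommGroup V] [NormedSpace ℝ V] {H : Type*} [TopologicalSpace H]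
  (I : ModelWithCorners ℝ V H) {N : Type*} [TopologicalSpace N] [ChartedSpace H N]
  [IsManifold I ∞ N]
  (F : Type*) [NormedAddCommGroup F] [NormedSpace ℝ F] {E : N → Type*}
  [∀ x, AddCommGroup (E x)] [∀ x, Module ℝ (E x)] [∀ x, TopologicalSpace (E x)]
  [TopologicalSpace (TotalSpace F E)] [FiberBundle F E]

/-- The derivative of a real function in the direction of a tangent vector. -/
noncomputable def derivAlong (f : N → ℝ) (x : N) (v : TangentSpace I x) : ℝ :=
  mfderiv I 𝓘(ℝ, ℝ) f x v

/-- The smooth sections of `E` over `N`. -/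
def smoothSections (E : N → Type*) [∀ x, TopologicalSpace (E x)]
    [TopologicalSpace (TotalSpace F E)] [FiberBundle F E] : Set (∀ x, E x) :=
  {σ | ContMDiff I (I.prod 𝓘(ℝ, F)) ∞ (fun x => TotalSpace.mk' F x (σ x))}

/-- The smooth sections of `E` with values in the subbundle `A`. -/
def sectionsOf (A : ∀ x, Submodule ℝ (E x)) : Set (∀ x, E x) :=
  {σ | σ ∈ smoothSections I F E ∧ ∀ x, σ x ∈ A x}

/-- A Courant algebroid structure on the vector bundle `E → N`. The bracket is a bracket on
smooth sections; its values on other arguments are irrelevant. -/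
structure CourantAlgebroid (E : N → Type*)
    [∀ x, AddCommGroup (E x)] [∀ x, Module ℝ (E x)] [∀ x, TopologicalSpace (E x)]
    [TopologicalSpace (TotalSpace F E)] [FiberBundle F E] where
  anchor : ∀ x, E x →ₗ[ℝ] TangentSpace I x
  anchor_smooth : ∀ σ ∈ smoothSections I F E,
    (fun x => anchor x (σ x)) ∈ smoothSections I V (TangentSpace I (M := N))
  pairing : ∀ x, E x →ₗ[ℝ] E x →ₗ[ℝ] ℝ
  pairing_smooth : ∀ σ ∈ smoothSections I F E, ∀ τ ∈ smoothSections I F E,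
    ContMDiff I 𝓘(ℝ, ℝ) ∞ (fun x => pairing x (σ x) (τ x))
  pairing_symm : ∀ x u v, pairing x u v = pairing x v u
  pairing_nondegenerate : ∀ x u, (∀ v, pairing x u v = 0) → u = 0
  bracket : (∀ x, E x) → (∀ x, E x) → ∀ x, E x
  bracket_smooth : ∀ σ ∈ smoothSections I F E, ∀ τ ∈ smoothSections I F E,
    bracket σ τ ∈ smoothSections I F E
  bracket_add_left : ∀ σ ∈ smoothSections I F E, ∀ σ' ∈ smoothSections I F E,
    ∀ τ ∈ smoothSections I F E, bracket (σ + σ') τ = bracket σ τ + bracket σ' τ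
  bracket_add_right : ∀ σ ∈ smoothSections I F E, ∀ τ ∈ smoothSections I F E,
    ∀ τ' ∈ smoothSections I F E, bracket σ (τ + τ') = bracket σ τ + bracket σ τ'
  bracket_smul_left : ∀ c : ℝ, ∀ σ ∈ smoothSections I F E, ∀ τ ∈ smoothSections I F E,
    bracket (c • σ) τ = c • bracket σ τ
  bracket_smul_right : ∀ c : ℝ, ∀ σ ∈ smoothSections I F E, ∀ τ ∈ smoothSections I F E,
    bracket σ (c • τ) = c • bracket σ τ
  jacobi : ∀ σ₁ ∈ smoothSections I F E, ∀ σ₂ ∈ smoothSections I F E,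
    ∀ σ₃ ∈ smoothSections I F E,
    bracket σ₁ (bracket σ₂ σ₃) = bracket (bracket σ₁ σ₂) σ₃ + bracket σ₂ (bracket σ₁ σ₃)
  invariance : ∀ σ₁ ∈ smoothSections I F E, ∀ σ₂ ∈ smoothSections I F E,
    ∀ σ₃ ∈ smoothSections I F E, ∀ x,
    derivAlong I (fun y => pairing y (σ₂ y) (σ₃ y)) x (anchor x (σ₁ x)) =
      pairing x (bracket σ₁ σ₂ x) (σ₃ x) + pairing x (σ₂ x) (bracket σ₁ σ₃ x)
  /-- The identity `⟦σ₁, σ₂⟧ + ⟦σ₂, σ₁⟧ = a^* d⟨σ₁, σ₂⟩`, paired with an arbitrary `u`. -/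
  symmetric_part : ∀ σ₁ ∈ smoothSections I F E, ∀ σ₂ ∈ smoothSections I F E, ∀ x, ∀ u : E x,
    pairing x (bracket σ₁ σ₂ x + bracket σ₂ σ₁ x) u =
      derivAlong I (fun y => pairing y (σ₁ y) (σ₂ y)) x (anchor x u)

/-- Dirac structures: Lagrangian subbundles over all of `N` whose sections are closed under the
Courant bracket. -/
structure IsDirac (C : CourantAlgebroid I F E) (L : ∀ x, Submodule ℝ (E x)) : Prop where
  subbundle : IsVectorSubbundle I (smoothSections I F E) (fun x => (L x : Set (E x)))
  lagrangian : ∀ x u, u ∈ L x ↔ ∀ v ∈ L x, C.pairing x u v = 0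
  involutive : ∀ σ ∈ sectionsOf I F L, ∀ τ ∈ sectionsOf I F L, ∀ x, C.bracket σ τ x ∈ L x

/-- A Lie algebroid structure on the vector bundle `A → N`, where `A` is a subbundle (over all
of `N`) of some vector bundle `E → N`. Only the restriction of the anchor to `A` and the
values of the bracket on smooth sections of `A` are relevant. -/
structure LieAlgebroid (A : ∀ x, Submodule ℝ (E x)) where
  subbundle : IsVectorSubbundle I (smoothSections I F E) (fun x => (A x : Set (E x)))
  anchor : ∀ x, E x →ₗ[ℝ] TangentSpace I x
  anchor_smooth : ∀ σ ∈ sectionsOf I F A,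
    (fun x => anchor x (σ x)) ∈ smoothSections I V (TangentSpace I (M := N))
  bracket : (∀ x, E x) → (∀ x, E x) → ∀ x, E x
  bracket_mem : ∀ σ ∈ sectionsOf I F A, ∀ τ ∈ sectionsOf I F A, bracket σ τ ∈ sectionsOf I F A
  bracket_add : ∀ σ ∈ sectionsOf I F A, ∀ τ ∈ sectionsOf I F A, ∀ τ' ∈ sectionsOf I F A,
    bracket σ (τ + τ') = bracket σ τ + bracket σ τ'
  bracket_smul : ∀ c : ℝ, ∀ σ ∈ sectionsOf I F A, ∀ τ ∈ sectionsOf I F A,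
    bracket σ (c • τ) = c • bracket σ τ
  bracket_skew : ∀ σ ∈ sectionsOf I F A, ∀ τ ∈ sectionsOf I F A, bracket σ τ = -bracket τ σ
  jacobi : ∀ σ₁ ∈ sectionsOf I F A, ∀ σ₂ ∈ sectionsOf I F A, ∀ σ₃ ∈ sectionsOf I F A,
    bracket σ₁ (bracket σ₂ σ₃) + bracket σ₂ (bracket σ₃ σ₁) + bracket σ₃ (bracket σ₁ σ₂) = 0
  leibniz : ∀ σ ∈ sectionsOf I F A, ∀ τ ∈ sectionsOf I F A, ∀ f : N → ℝ,
    ContMDiff I 𝓘(ℝ, ℝ) ∞ f → ∀ x, bracket σ (fun y => f y • τ y) x =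
      derivAlong I f x (anchor x (σ x)) • τ x + f x • bracket σ τ x

end Algebroids

section Products

variable {V₁ : Type*} [NormedAddCommGroup V₁] [NormedSpace ℝ V₁] {H₁ : Type*}
  [TopologicalSpace H₁] {I₁ : ModelWithCorners ℝ V₁ H₁} {N₁ : Type*} [TopologicalSpace N₁]
  [ChartedSpace H₁ N₁] [IsManifold I₁ ∞ N₁]
  {F₁ : Type*} [NormedAddCommGroup F₁] [NormedSpace ℝ F₁] {E₁ : N₁ → Type*}
  [∀ x, AddCommGroup (E₁ x)] [∀ x, Module ℝ (E₁ x)] [∀ x, TopologicalSpace (E₁ x)]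
  [TopologicalSpace (TotalSpace F₁ E₁)] [FiberBundle F₁ E₁] [VectorBundle ℝ F₁ E₁]
  {V₂ : Type*} [NormedAddCommGroup V₂] [NormedSpace ℝ V₂] {H₂ : Type*}
  [TopologicalSpace H₂] {I₂ : ModelWithCorners ℝ V₂ H₂} {N₂ : Type*} [TopologicalSpace N₂]
  [ChartedSpace H₂ N₂] [IsManifold I₂ ∞ N₂]
  {F₂ : Type*} [NormedAddCommGroup F₂] [NormedSpace ℝ F₂] {E₂ : N₂ → Type*}
  [∀ x, AddCommGroup (E₂ x)] [∀ x, Module ℝ (E₂ x)] [∀ x, TopologicalSpace (E₂ x)]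
  [TopologicalSpace (TotalSpace F₂ E₂)] [FiberBundle F₂ E₂] [VectorBundle ℝ F₂ E₂]

/-- The derivative at `p`, in the direction `v`, of a function on a manifold `P` with values in
one fixed fibre `E₁ n` of a vector bundle. The trivialization only serves to identify
the vector space `E₁ n` with the normed space `F₁`. -/
noncomputable def fibreDeriv {V' : Type*} [NormedAddCommGroup V'] [NormedSpace ℝ V'] {H' : Type*}
    [TopologicalSpace H'] (J : ModelWithCorners ℝ V' H') {P : Type*} [TopologicalSpace P]
    [ChartedSpace H' P] (F₁ : Type*) [NormedAddCommGroup F₁] [NormedSpace ℝ F₁]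
    [TopologicalSpace (TotalSpace F₁ E₁)] [FiberBundle F₁ E₁] [VectorBundle ℝ F₁ E₁]
    {n : N₁} (g : P → E₁ n) (p : P) (v : TangentSpace J p) : E₁ n :=
  (trivializationAt F₁ E₁ n).symmL ℝ n
    (mfderiv J 𝓘(ℝ, F₁) (fun q => (trivializationAt F₁ E₁ n ⟨n, g q⟩).2) p v)

/-- One component of the bracket of a product of Lie algebroids. The sections `σ`, `τ` of the
factor depend on a parameter in the base `P` of the remaining factors, and `v`, `w` are the
anchors of the remaining components of the two sections that are being bracketed. -/
noncomputable def LieAlgebroid.paramBracket {A₁ : ∀ x, Submodule ℝ (E₁ x)}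
    (𝓐 : LieAlgebroid I₁ F₁ A₁) {V' : Type*} [NormedAddCommGroup V'] [NormedSpace ℝ V']
    {H' : Type*} [TopologicalSpace H'] (J : ModelWithCorners ℝ V' H') {P : Type*}
    [TopologicalSpace P] [ChartedSpace H' P] (σ τ : ∀ n, P → E₁ n) (n : N₁) (p : P)
    (v w : TangentSpace J p) : E₁ n :=
  𝓐.bracket (fun m => σ m p) (fun m => τ m p) n +
    fibreDeriv J F₁ (τ n) p v - fibreDeriv J F₁ (σ n) p w

variable (I₁ F₁ I₂ F₂) in
/-- The smooth sections of the exterior product `A₁ × A₂ → N₁ × N₂`. -/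
def prodSections (A₁ : ∀ x, Submodule ℝ (E₁ x)) (A₂ : ∀ x, Submodule ℝ (E₂ x)) :
    Set (∀ p : N₁ × N₂, E₁ p.1 × E₂ p.2) :=
  {σ | ContMDiff (I₁.prod I₂) (I₁.prod 𝓘(ℝ, F₁)) ∞ (fun p => TotalSpace.mk' F₁ p.1 (σ p).1) ∧
    ContMDiff (I₁.prod I₂) (I₂.prod 𝓘(ℝ, F₂)) ∞ (fun p => TotalSpace.mk' F₂ p.2 (σ p).2) ∧
    ∀ p, (σ p).1 ∈ A₁ p.1 ∧ (σ p).2 ∈ A₂ p.2}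

/-- The bracket of the product Lie algebroid `A₁ × A₂ → N₁ × N₂`. -/
noncomputable def prodBracket {A₁ : ∀ x, Submodule ℝ (E₁ x)} {A₂ : ∀ x, Submodule ℝ (E₂ x)}
    (𝓐₁ : LieAlgebroid I₁ F₁ A₁) (𝓐₂ : LieAlgebroid I₂ F₂ A₂)
    (σ τ : ∀ p : N₁ × N₂, E₁ p.1 × E₂ p.2) (p : N₁ × N₂) : E₁ p.1 × E₂ p.2 :=
  (𝓐₁.paramBracket I₂ (fun n q => (σ (n, q)).1) (fun n q => (τ (n, q)).1) p.1 p.2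
      (𝓐₂.anchor p.2 (σ p).2) (𝓐₂.anchor p.2 (τ p).2),
    𝓐₂.paramBracket I₁ (fun n q => (σ (q, n)).2) (fun n q => (τ (q, n)).2) p.2 p.1
      (𝓐₁.anchor p.1 (σ p).1) (𝓐₁.anchor p.1 (τ p).1))

variable (I₁ F₁) in
/-- The smooth sections of the exterior cube `A³ → N³`. -/
def cubeSections (A : ∀ x, Submodule ℝ (E₁ x)) :
    Set (∀ p : N₁ × N₁ × N₁, E₁ p.1 × E₁ p.2.1 × E₁ p.2.2) :=
  {σ | ContMDiff (I₁.prod (I₁.prod I₁)) (I₁.prod 𝓘(ℝ, F₁)) ∞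
      (fun p => TotalSpace.mk' F₁ p.1 (σ p).1) ∧
    ContMDiff (I₁.prod (I₁.prod I₁)) (I₁.prod 𝓘(ℝ, F₁)) ∞
      (fun p => TotalSpace.mk' F₁ p.2.1 (σ p).2.1) ∧
    ContMDiff (I₁.prod (I₁.prod I₁)) (I₁.prod 𝓘(ℝ, F₁)) ∞
      (fun p => TotalSpace.mk' F₁ p.2.2 (σ p).2.2) ∧
    ∀ p, (σ p).1 ∈ A p.1 ∧ (σ p).2.1 ∈ A p.2.1 ∧ (σ p).2.2 ∈ A p.2.2}

/-- The bracket of the product Lie algebroid `A³ → N³`. -/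
noncomputable def cubeBracket {A : ∀ x, Submodule ℝ (E₁ x)} (𝓐 : LieAlgebroid I₁ F₁ A)
    (σ τ : ∀ p : N₁ × N₁ × N₁, E₁ p.1 × E₁ p.2.1 × E₁ p.2.2) (p : N₁ × N₁ × N₁) :
    E₁ p.1 × E₁ p.2.1 × E₁ p.2.2 :=
  (𝓐.paramBracket (I₁.prod I₁) (P := N₁ × N₁)
      (fun n q => (σ (n, q.1, q.2)).1) (fun n q => (τ (n, q.1, q.2)).1) p.1 (p.2.1, p.2.2)
      (𝓐.anchor p.2.1 (σ p).2.1, 𝓐.anchor p.2.2 (σ p).2.2)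
      (𝓐.anchor p.2.1 (τ p).2.1, 𝓐.anchor p.2.2 (τ p).2.2),
    𝓐.paramBracket (I₁.prod I₁) (P := N₁ × N₁)
      (fun n q => (σ (q.1, n, q.2)).2.1) (fun n q => (τ (q.1, n, q.2)).2.1) p.2.1 (p.1, p.2.2)
      (𝓐.anchor p.1 (σ p).1, 𝓐.anchor p.2.2 (σ p).2.2)
      (𝓐.anchor p.1 (τ p).1, 𝓐.anchor p.2.2 (τ p).2.2),
    𝓐.paramBracket (I₁.prod I₁) (P := N₁ × N₁)
      (fun n q => (σ (q.1, q.2, n)).2.2) (fun n q => (τ (q.1, q.2, n)).2.2) p.2.2 (p.1, p.2.1)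
      (𝓐.anchor p.1 (σ p).1, 𝓐.anchor p.2.1 (σ p).2.1)
      (𝓐.anchor p.1 (τ p).1, 𝓐.anchor p.2.1 (τ p).2.1))

end Products

section TangentCore

variable {V : Type*} [NormedAddCommGroup V] [NormedSpace ℝ V] {H : Type*} [TopologicalSpace H]
  (I : ModelWithCorners ℝ V H) {M : Type*} [TopologicalSpace M] [ChartedSpace H M]
  [IsManifold I ∞ M]
  (F : Type*) [NormedAddCommGroup F] [NormedSpace ℝ F] (E : M → Type*)
  [∀ x, AddCommGroup (E x)] [∀ x, Module ℝ (E x)] [∀ x, TopologicalSpace (E x)]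
  [TopologicalSpace (TotalSpace F E)] [FiberBundle F E] [VectorBundle ℝ F E]
  [ContMDiffVectorBundle ∞ F E I]

/-- The transition function `g_ij` of the vector bundle `E → M`, from the preferred trivialization at
`i` to the one at `j`, as a function with values in the endomorphisms of the model fibre. -/
noncomputable def transition (i j y : M) : F →L[ℝ] F :=
  ((trivializationAt F E i).coordChangeL ℝ (trivializationAt F E j) y : F →L[ℝ] F)

/-- The derivative `dg_ij(X)` of the transition function in the direction of a tangent vector `X`. -/
noncomputable def dTransition (i j : M) (X : TangentBundle I M) : F →L[ℝ] F :=
  mfderiv I 𝓘(ℝ, F →L[ℝ] F) (transition F E i j) X.proj X.2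

/-- The transition function of `T𝔼 → TM` at `X ∈ TM` obtained by differentiating
`(x, u) ↦ (x, g_ij(x) u)`, namely `(u, u') ↦ (g_ij u, dg_ij(X) u + g_ij u')`. -/
noncomputable def tangentTransition (i j : M) (X : TangentBundle I M) : F × F →L[ℝ] F × F :=
  (transition F E i j X.proj ∘L ContinuousLinearMap.fst ℝ F F).prod
    (dTransition I F E i j X ∘L
        ContinuousLinearMap.fst ℝ F F +
      transition F E i j X.proj ∘L ContinuousLinearMap.snd ℝ F F)

/-- The open set of `TM` lying over the domain of a trivialization of `E`. -/
def tangentBaseSet (i : M) : Set (TangentBundle I M) :=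
  TotalSpace.proj ⁻¹' (trivializationAt F E i).baseSet

lemma contMDiffOn_transition (i j : M) :
    ContMDiffOn I 𝓘(ℝ, F →L[ℝ] F) ∞ (transition F E i j)
      ((trivializationAt F E i).baseSet ∩ (trivializationAt F E j).baseSet) :=
  contMDiffOn_coordChangeL _ _

lemma contMDiffOn_tangentTransition (i j : M) :
    ContMDiffOn I.tangent 𝓘(ℝ, F × F →L[ℝ] F × F) ∞ (tangentTransition I F E i j)
      (tangentBaseSet I F E i ∩ tangentBaseSet I F E j) := by
  set U := (trivializationAt F E i).baseSet ∩ (trivializationAt F E j).baseSet with hU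
  have hUo : IsOpen U := (trivializationAt F E i).open_baseSet.inter
    (trivializationAt F E j).open_baseSet
  have hg := contMDiffOn_transition I F E i j
  have h1 : ContMDiffOn I.tangent 𝓘(ℝ, F →L[ℝ] F) ∞
      (fun X : TangentBundle I M => transition F E i j X.proj)
      (tangentBaseSet I F E i ∩ tangentBaseSet I F E j) :=
    hg.comp (Bundle.contMDiffOn_proj _) (fun X hX => hX)
  have h2 : ContMDiffOn I.tangent 𝓘(ℝ, F →L[ℝ] F) ∞
      (dTransition I F E i j)
      (tangentBaseSet I F E i ∩ tangentBaseSet I F E j) := by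
    have h3 := hg.contMDiffOn_tangentMapWithin (m := ∞) (by simp) hUo.uniqueMDiffOn
    have h4 := (contMDiff_snd_tangentBundle_modelSpace (F →L[ℝ] F) 𝓘(ℝ, F →L[ℝ] F) (n := ∞)).comp_contMDiffOn h3
    refine h4.congr fun X hX => ?_
    have : mfderivWithin I 𝓘(ℝ, F →L[ℝ] F) (transition F E i j) U X.proj
      = mfderiv I 𝓘(ℝ, F →L[ℝ] F) (transition F E i j) X.proj :=
      mfderivWithin_of_isOpen hUo hX
    simp only [Function.comp, tangentMapWithin, dTransition]
    rw [this]
  have hf : ContMDiffOn I.tangent 𝓘(ℝ, F × F →L[ℝ] F) ∞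
      (fun _ : TangentBundle I M => ContinuousLinearMap.fst ℝ F F)
      (tangentBaseSet I F E i ∩ tangentBaseSet I F E j) := contMDiffOn_const
  have hs : ContMDiffOn I.tangent 𝓘(ℝ, F × F →L[ℝ] F) ∞
      (fun _ : TangentBundle I M => ContinuousLinearMap.snd ℝ F F)
      (tangentBaseSet I F E i ∩ tangentBaseSet I F E j) := contMDiffOn_const
  have hl : ContMDiffOn I.tangent 𝓘(ℝ, F →L[ℝ] F × F) ∞
      (fun _ : TangentBundle I M => ContinuousLinearMap.inl ℝ F F)
      (tangentBaseSet I F E i ∩ tangentBaseSet I F E j) := contMDiffOn_const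
  have hr : ContMDiffOn I.tangent 𝓘(ℝ, F →L[ℝ] F × F) ∞
      (fun _ : TangentBundle I M => ContinuousLinearMap.inr ℝ F F)
      (tangentBaseSet I F E i ∩ tangentBaseSet I F E j) := contMDiffOn_const
  have := (hl.clm_comp (h1.clm_comp hf)).add (hr.clm_comp ((h2.clm_comp hf).add (h1.clm_comp hs)))
  refine this.congr fun X _ => ?_
  ext v <;> simp [tangentTransition]


lemma mdifferentiableAt_transition {i j x : M} (hi : x ∈ (trivializationAt F E i).baseSet)
    (hj : x ∈ (trivializationAt F E j).baseSet) :
    MDifferentiableAt I 𝓘(ℝ, F →L[ℝ] F) (transition F E i j) x :=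
  ((contMDiffOn_transition I F E i j).contMDiffAt
    (((trivializationAt F E i).open_baseSet.inter (trivializationAt F E j).open_baseSet).mem_nhds
      ⟨hi, hj⟩)).mdifferentiableAt (by simp)

lemma transition_apply {M : Type*} [TopologicalSpace M] 
  (F : Type*) [NormedAddCommGroup F] [NormedSpace ℝ F] (E : M → Type*)
  [∀ x, AddCommGroup (E x)] [∀ x, Module ℝ (E x)] [∀ x, TopologicalSpace (E x)]
  [TopologicalSpace (TotalSpace F E)] [FiberBundle F E] [VectorBundle ℝ F E] 
  {i j x : M} (hi : x ∈ (trivializationAt F E i).baseSet)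
    (hj : x ∈ (trivializationAt F E j).baseSet) (u : E x) :
    transition F E i j x (trivializationAt F E i ⟨x, u⟩).2 = (trivializationAt F E j ⟨x, u⟩).2 := by
  have := (trivializationAt F E i).coordChangeL_apply (R := ℝ) (trivializationAt F E j) ⟨hi, hj⟩
    (trivializationAt F E i ⟨x, u⟩).2
  rw [Trivialization.symm_apply_apply_mk _ hi] at this
  exact this

/-- The product rule for `y ↦ c(y) (f y)`. -/
lemma hasMFDerivAt_clm_apply {G₁ G₂ : Type*} [NormedAddCommGroup G₁] [NormedSpace ℝ G₁]
    [NormedAddCommGroup G₂] [NormedSpace ℝ G₂] {c : M → G₁ →L[ℝ] G₂} {f : M → G₁} {x : M}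
    {c' : V →L[ℝ] (G₁ →L[ℝ] G₂)} {f' : V →L[ℝ] G₁}
    (hc : HasMFDerivAt I 𝓘(ℝ, G₁ →L[ℝ] G₂) c x c') (hf : HasMFDerivAt I 𝓘(ℝ, G₁) f x f') :
    HasMFDerivAt I 𝓘(ℝ, G₂) (fun y => c y (f y)) x
      (c x ∘L f' + ContinuousLinearMap.flip c' (f x) : V →L[ℝ] G₂) :=
  ⟨hc.1.clm_apply hf.1, by simpa only [mfld_simps] using! hc.2.clm_apply hf.2⟩


lemma transition_self {M : Type*} [TopologicalSpace M]
    (F : Type*) [NormedAddCommGroup F] [NormedSpace ℝ F] (E : M → Type*)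
    [∀ x, AddCommGroup (E x)] [∀ x, Module ℝ (E x)] [∀ x, TopologicalSpace (E x)]
    [TopologicalSpace (TotalSpace F E)] [FiberBundle F E] [VectorBundle ℝ F E]
    {i x : M} (hi : x ∈ (trivializationAt F E i).baseSet) (u : F) :
    transition F E i i x u = u := by
  have := transition_apply F E hi hi ((trivializationAt F E i).symm x u)
  rwa [Trivialization.apply_mk_symm _ hi] at this

lemma transition_comp {M : Type*} [TopologicalSpace M]
    (F : Type*) [NormedAddCommGroup F] [NormedSpace ℝ F] (E : M → Type*)
    [∀ x, AddCommGroup (E x)] [∀ x, Module ℝ (E x)] [∀ x, TopologicalSpace (E x)]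
    [TopologicalSpace (TotalSpace F E)] [FiberBundle F E] [VectorBundle ℝ F E]
    {i j k x : M} (hi : x ∈ (trivializationAt F E i).baseSet)
    (hj : x ∈ (trivializationAt F E j).baseSet) (hk : x ∈ (trivializationAt F E k).baseSet)
    (u : F) : transition F E j k x (transition F E i j x u) = transition F E i k x u := by
  have h1 := transition_apply F E hi hj ((trivializationAt F E i).symm x u)
  have h2 := transition_apply F E hi hk ((trivializationAt F E i).symm x u)
  have h3 := transition_apply F E hj hk ((trivializationAt F E i).symm x u)
  rw [Trivialization.apply_mk_symm _ hi] at h1 h2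
  simp only at h1 h2
  rw [h1, h2, h3]

lemma hasMFDerivAt_transition_apply {i j x : M} (hi : x ∈ (trivializationAt F E i).baseSet)
    (hj : x ∈ (trivializationAt F E j).baseSet) {f : M → F} {f' : V →L[ℝ] F}
    (hf : HasMFDerivAt I 𝓘(ℝ, F) f x f') :
    ∃ D : V →L[ℝ] F, HasMFDerivAt I 𝓘(ℝ, F) (fun y => transition F E i j y (f y)) x D ∧
      ∀ v : V, D v = transition F E i j x (f' v) + dTransition I F E i j ⟨x, v⟩ (f x) := by
  obtain ⟨c', hc⟩ : ∃ c' : V →L[ℝ] F →L[ℝ] F,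
      c' = mfderiv I 𝓘(ℝ, F →L[ℝ] F) (transition F E i j) x := ⟨_, rfl⟩
  have h : HasMFDerivAt I 𝓘(ℝ, F →L[ℝ] F) (transition F E i j) x c' := by
    rw [hc]
    exact (mdifferentiableAt_transition I F E hi hj).hasMFDerivAt
  refine ⟨_, hasMFDerivAt_clm_apply I h hf, fun v => ?_⟩
  simp [dTransition, ← hc]
  rfl

/-- The vector bundle `T𝔼 → TM`, given by its transition functions. -/
noncomputable def tangentCore : VectorBundleCore ℝ (TangentBundle I M) (F × F) M where
  baseSet := tangentBaseSet I F E
  isOpen_baseSet i := (trivializationAt F E i).open_baseSet.preimage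
    (FiberBundle.continuous_proj V (TangentSpace I (M := M)))
  indexAt X := X.proj
  mem_baseSet_at X := mem_baseSet_trivializationAt F E X.proj
  coordChange := tangentTransition I F E
  coordChange_self := by
    rintro i X hi ⟨u, u'⟩
    have hi' : X.proj ∈ (trivializationAt F E i).baseSet := hi
    obtain ⟨D, h1, hD⟩ := hasMFDerivAt_transition_apply I F E hi' hi'
      (hasMFDerivAt_const u X.proj)
    have h2 : HasMFDerivAt I 𝓘(ℝ, F) (fun y => transition F E i i y u) X.proj (0 : V →L[ℝ] F) :=
      (hasMFDerivAt_const u X.proj).congr_of_eventuallyEq <| by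
        filter_upwards [(trivializationAt F E i).open_baseSet.mem_nhds hi'] with y hy
        exact transition_self F E hy u
    have h4 : dTransition I F E i i X u = 0 := by
      obtain ⟨v, hv⟩ : ∃ v : V, v = X.2 := ⟨_, rfl⟩
      have h3 : D v = transition F E i i X.proj 0 + dTransition I F E i i X u := by
        rw [hD, hv]; rfl
      rw [show D = 0 from hasMFDerivAt_unique h1 h2] at h3
      simpa using h3.symm
    refine Prod.ext (transition_self F E hi' u) ?_
    change dTransition I F E i i X u +
      transition F E i i X.proj u' = u'
    rw [h4, transition_self F E hi', zero_add]
  continuousOn_coordChange i j := (contMDiffOn_tangentTransition I F E i j).continuousOn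
  coordChange_comp := by
    rintro i j k X ⟨⟨hi, hj⟩, hk⟩ ⟨u, u'⟩
    have hi' : X.proj ∈ (trivializationAt F E i).baseSet := hi
    have hj' : X.proj ∈ (trivializationAt F E j).baseSet := hj
    have hk' : X.proj ∈ (trivializationAt F E k).baseSet := hk
    obtain ⟨D₁, h1, hD₁⟩ := hasMFDerivAt_transition_apply I F E hi' hj'
      (hasMFDerivAt_const u X.proj)
    obtain ⟨D₂, h2, hD₂⟩ := hasMFDerivAt_transition_apply I F E hj' hk' h1
    obtain ⟨D₃, h3, hD₃⟩ := hasMFDerivAt_transition_apply I F E hi' hk'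
      (hasMFDerivAt_const u X.proj)
    have h4 := h3.congr_of_eventuallyEq
        (f₁ := fun y => transition F E j k y (transition F E i j y u)) <| by
      filter_upwards [(trivializationAt F E i).open_baseSet.mem_nhds hi',
        (trivializationAt F E j).open_baseSet.mem_nhds hj',
        (trivializationAt F E k).open_baseSet.mem_nhds hk'] with y h1 h2 h3
      exact transition_comp F E h1 h2 h3 u
    obtain ⟨v, hv⟩ : ∃ v : V, v = X.2 := ⟨_, rfl⟩
    have h5 : D₂ v = D₃ v := by rw [show D₂ = D₃ from hasMFDerivAt_unique h2 h4]
    rw [hD₂, hD₃, hD₁, hv] at h5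
    replace h5 : transition F E j k X.proj (transition F E i j X.proj 0 +
        dTransition I F E i j X u) + dTransition I F E j k X (transition F E i j X.proj u) =
        transition F E i k X.proj 0 + dTransition I F E i k X u := h5
    refine Prod.ext (transition_comp F E hi' hj' hk' u) ?_
    change dTransition I F E j k X
          (transition F E i j X.proj u) + transition F E j k X.proj
          (dTransition I F E i j X u +
            transition F E i j X.proj u') =
        dTransition I F E i k X u +
          transition F E i k X.proj u'
    simp only [map_zero, zero_add] at h5
    rw [map_add, transition_comp F E hi' hj' hk', ← h5]
    abel

instance : (tangentCore I F E).IsContMDiff I.tangent ∞ where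
  contMDiffOn_coordChange i j := contMDiffOn_tangentTransition I F E i j

/-- The fibre over `X ∈ TM` of the smooth vector bundle `T𝔼 → TM`, where `𝔼` is the total space
of `E → M`. Its elements are pairs `(u, u')` in the model fibre `F × F`, standing for the tangent
vector to `𝔼` over `X` whose components along the fibre, in the preferred trivialization of `E` at
the base point of `X`, are: base point `u`, velocity `u'`. See `tangentIdent`. -/
abbrev TangentProlongation (X : TangentBundle I M) : Type _ := (tangentCore I F E).Fiber X

/-- The identification of the tangent bundle of the total space `𝔼` with the total space
of `T𝔼 → TM`: a tangent vector `v` to `𝔼` goes to the point over `dπ(v) ∈ TM` given by the base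
point of `v` and the fibre component of `v` in a trivialization. -/
noncomputable def tangentIdent (v : TangentBundle (I.prod 𝓘(ℝ, F)) (TotalSpace F E)) :
    TotalSpace (F × F) (TangentProlongation I F E) :=
  ⟨tangentMap (I.prod 𝓘(ℝ, F)) I TotalSpace.proj v,
    ((trivializationAt F E v.proj.proj v.proj).2,
      (mfderiv (I.prod 𝓘(ℝ, F)) 𝓘(ℝ, F) (fun w => (trivializationAt F E v.proj.proj w).2)
        v.proj v.2 : F))⟩

/-- The tangent lift `σ_T = dσ : TM → T𝔼` of a section `σ` of `E`. -/
noncomputable def tangentLift (σ : ∀ x, E x) (X : TangentBundle I M) :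
    TangentProlongation I F E X :=
  ((trivializationAt F E X.proj ⟨X.proj, σ X.proj⟩).2,
    (mfderiv I 𝓘(ℝ, F) (fun y => (trivializationAt F E X.proj ⟨y, σ y⟩).2) X.proj X.2 : F))

/-- The core lift `σ_C : TM → T𝔼` of a section `σ` of `E`: the tangent vector over `X` at the
zero of the fibre of `E` with velocity `σ` along the fibre. -/
noncomputable def coreLift (σ : ∀ x, E x) (X : TangentBundle I M) :
    TangentProlongation I F E X :=
  ((0 : F), (trivializationAt F E X.proj ⟨X.proj, σ X.proj⟩).2)


lemma mdifferentiableAt_triv (w : TotalSpace F E) :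
    MDifferentiableAt (I.prod 𝓘(ℝ, F)) 𝓘(ℝ, F)
      (fun w' => (trivializationAt F E w.proj w').2) w := by
  have := (Trivialization.contMDiffOn (IB := I) (n := ∞) (trivializationAt F E w.proj)).contMDiffAt
    ((trivializationAt F E w.proj).open_source.mem_nhds (FiberBundle.mem_trivializationAt_proj_source))
  exact (contMDiffAt_snd.comp w this).mdifferentiableAt (by simp)

/-- Under the identification, the tangent lift of a section is its differential. -/
lemma tangentIdent_tangentMap {σ : ∀ x, E x}
    (hσ : ContMDiff I (I.prod 𝓘(ℝ, F)) ∞ (fun x => TotalSpace.mk' F x (σ x)))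
    (X : TangentBundle I M) :
    tangentIdent I F E (tangentMap I (I.prod 𝓘(ℝ, F)) (fun x => TotalSpace.mk' F x (σ x)) X) =
      ⟨X, tangentLift I F E σ X⟩ := by
  obtain ⟨x, v⟩ := X
  have hd := hσ.mdifferentiable (by simp) x
  have h1 : mfderiv (I.prod 𝓘(ℝ, F)) I (TotalSpace.proj : TotalSpace F E → M) (TotalSpace.mk' F x (σ x))
     (mfderiv I (I.prod 𝓘(ℝ, F)) (fun x => TotalSpace.mk' F x (σ x)) x v) = v := by
    rw [← mfderiv_comp_apply x (I' := I.prod 𝓘(ℝ, F)) (g := (TotalSpace.proj : TotalSpace F E → M)) (f := fun x => TotalSpace.mk' F x (σ x)) (Bundle.contMDiff_proj E (n := 1) |>.mdifferentiable (by simp) _) hd]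
    exact congrFun (congrArg DFunLike.coe (mfderiv_id (I := I) (x := x))) v
  have h2 : mfderiv (I.prod 𝓘(ℝ, F)) 𝓘(ℝ, F) (fun w => (trivializationAt F E x w).2) (TotalSpace.mk' F x (σ x))
     (mfderiv I (I.prod 𝓘(ℝ, F)) (fun x => TotalSpace.mk' F x (σ x)) x v) = mfderiv I 𝓘(ℝ, F) (fun y => (trivializationAt F E x ⟨y, σ y⟩).2) x v := by
    rw [← mfderiv_comp_apply x (I' := I.prod 𝓘(ℝ, F)) (g := (fun w => (trivializationAt F E x w).2)) (f := fun x => TotalSpace.mk' F x (σ x)) (mdifferentiableAt_triv I F E (TotalSpace.mk' F x (σ x))) hd]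
    rfl
  refine TotalSpace.ext (congrArg (TotalSpace.mk x) h1) (heq_of_eq ?_)
  exact Prod.ext rfl h2


/-- The identification of `T𝔼` with the total space of `T𝔼 → TM` is bijective. -/
lemma tangentIdent_bijective : Function.Bijective (tangentIdent I F E) := by
  have key : ∀ w : TotalSpace F E, Function.Bijective (fun v : TangentSpace (I.prod 𝓘(ℝ, F)) w =>
      ((mfderiv (I.prod 𝓘(ℝ, F)) I (TotalSpace.proj : TotalSpace F E → M) w v : V),
        (mfderiv (I.prod 𝓘(ℝ, F)) 𝓘(ℝ, F) (fun w' => (trivializationAt F E w.proj w').2) w v : F))) := by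
    intro w
    set e := trivializationAt F E w.proj
    have hw : w ∈ e.source := FiberBundle.mem_trivializationAt_proj_source
    have he : e.toOpenPartialHomeomorph.MDifferentiable (I.prod 𝓘(ℝ, F)) (I.prod 𝓘(ℝ, F)) :=
      ⟨(Trivialization.contMDiffOn (IB := I) (n := ∞) e).mdifferentiableOn (by simp),
        (Trivialization.contMDiffOn_symm (IB := I) (n := ∞) e).mdifferentiableOn (by simp)⟩
    have h1 := (he.mfderiv hw).bijective
    have h2 : mfderiv (I.prod 𝓘(ℝ, F)) (I.prod 𝓘(ℝ, F)) e.toOpenPartialHomeomorph w =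
        (mfderiv (I.prod 𝓘(ℝ, F)) I (TotalSpace.proj : TotalSpace F E → M) w).prod
        (mfderiv (I.prod 𝓘(ℝ, F)) 𝓘(ℝ, F) (fun w' => (e w').2) w) := by
      have h3 := ((Bundle.contMDiff_proj E (n := 1) (IB := I) (F := F)).mdifferentiable (by simp) w).hasMFDerivAt.prodMk
        (mdifferentiableAt_triv I F E w).hasMFDerivAt
      refine (h3.congr_of_eventuallyEq ?_).mfderiv
      filter_upwards [e.open_source.mem_nhds hw] with w' hw'
      exact Prod.ext (e.coe_fst hw') rfl
    change Function.Bijective (mfderiv (I.prod 𝓘(ℝ, F)) (I.prod 𝓘(ℝ, F)) e.toOpenPartialHomeomorph w) at h1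
    rw [h2] at h1
    exact h1
  constructor
  · rintro ⟨⟨x, u⟩, v⟩ ⟨⟨x', u'⟩, v'⟩ h
    have h1 := congrArg (fun z => TotalSpace.proj (TotalSpace.proj z)) h
    obtain rfl : x = x' := h1
    let f : TotalSpace (F × F) (TangentProlongation I F E) → V × F × F := fun z => (z.1.2, z.2)
    have h2 := congrArg f h
    have h3 : (trivializationAt F E x ⟨x, u⟩).2 = (trivializationAt F E x ⟨x, u'⟩).2 :=
      congrArg (fun z => z.2.1) h2
    obtain rfl : u = u' := by
      have hx := mem_baseSet_trivializationAt F E x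
      rw [← Trivialization.symm_apply_apply_mk _ hx u, h3, Trivialization.symm_apply_apply_mk _ hx]
    obtain rfl : v = v' := (key ⟨x, u⟩).1 <|
      Prod.ext (congrArg (fun z => z.1) h2) (congrArg (fun z => z.2.2) h2)
    rfl
  · rintro ⟨⟨x, v⟩, d⟩
    obtain ⟨a, b, rfl⟩ : ∃ a b : F, d = ((a, b) : F × F) := ⟨d.1, d.2, rfl⟩
    have hx := mem_baseSet_trivializationAt F E x
    obtain ⟨ξ, hξ⟩ := (key ⟨x, (trivializationAt F E x).symm x a⟩).2 (v, b)
    refine ⟨⟨_, ξ⟩, ?_⟩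
    refine TotalSpace.ext (congrArg (TotalSpace.mk x) (congrArg Prod.fst hξ)) (heq_of_eq ?_)
    have hb := congrArg Prod.snd hξ
    exact Prod.ext (congrArg Prod.snd (Trivialization.apply_mk_symm _ hx a)) hb

end TangentCore

section TangentProlongation

variable {V : Type*} [NormedAddCommGroup V] [NormedSpace ℝ V] {H : Type*} [TopologicalSpace H]
  {I : ModelWithCorners ℝ V H} {M : Type*} [TopologicalSpace M] [ChartedSpace H M]
  [IsManifold I ∞ M]
  {F : Type*} [NormedAddCommGroup F] [NormedSpace ℝ F] {E : M → Type*}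
  [∀ x, AddCommGroup (E x)] [∀ x, Module ℝ (E x)] [∀ x, TopologicalSpace (E x)]
  [TopologicalSpace (TotalSpace F E)] [FiberBundle F E] [VectorBundle ℝ F E]
  [ContMDiffVectorBundle ∞ F E I]

variable (I) in
/-- The tangent lift `f_T = df ∈ C^∞(TM)` of `f ∈ C^∞(M)`. -/
noncomputable def tangentLiftFun (f : M → ℝ) (X : TangentBundle I M) : ℝ :=
  derivAlong I f X.proj X.2

variable (I) in
/-- The core lift `f_C ∈ C^∞(TM)` of `f ∈ C^∞(M)`, its pullback to `TM`. -/
def coreLiftFun (f : M → ℝ) (X : TangentBundle I M) : ℝ := f X.proj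

/-- The Courant algebroid structure `C'` on `T𝔼 → TM` is the tangent prolongation of the Courant
algebroid structure `C` on `𝔼 → M`. In the last four conditions, the tangent lift `Y_T` and
the core lift `Y_C` of a vector field `Y` on `M` are expressed as vector fields on `TM`: they are
determined by `Y_T f_T = (Y f)_T`, `Y_T f_C = (Y f)_C`, `Y_C f_T = (Y f)_C`, `Y_C f_C = 0`. -/
structure IsTangentProlongation (C : CourantAlgebroid I F E)
    (C' : CourantAlgebroid I.tangent (F × F) (TangentProlongation I F E)) : Prop where
  pairing_TT : ∀ σ ∈ smoothSections I F E, ∀ τ ∈ smoothSections I F E, ∀ X,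
    C'.pairing X (tangentLift I F E σ X) (tangentLift I F E τ X) =
      tangentLiftFun I (fun x => C.pairing x (σ x) (τ x)) X
  pairing_TC : ∀ σ ∈ smoothSections I F E, ∀ τ ∈ smoothSections I F E, ∀ X,
    C'.pairing X (tangentLift I F E σ X) (coreLift I F E τ X) =
      coreLiftFun I (fun x => C.pairing x (σ x) (τ x)) X
  pairing_CT : ∀ σ ∈ smoothSections I F E, ∀ τ ∈ smoothSections I F E, ∀ X,
    C'.pairing X (coreLift I F E σ X) (tangentLift I F E τ X) =
      coreLiftFun I (fun x => C.pairing x (σ x) (τ x)) X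
  pairing_CC : ∀ σ ∈ smoothSections I F E, ∀ τ ∈ smoothSections I F E, ∀ X,
    C'.pairing X (coreLift I F E σ X) (coreLift I F E τ X) = 0
  bracket_TT : ∀ σ ∈ smoothSections I F E, ∀ τ ∈ smoothSections I F E,
    C'.bracket (tangentLift I F E σ) (tangentLift I F E τ) = tangentLift I F E (C.bracket σ τ)
  bracket_TC : ∀ σ ∈ smoothSections I F E, ∀ τ ∈ smoothSections I F E,
    C'.bracket (tangentLift I F E σ) (coreLift I F E τ) = coreLift I F E (C.bracket σ τ)
  bracket_CT : ∀ σ ∈ smoothSections I F E, ∀ τ ∈ smoothSections I F E,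
    C'.bracket (coreLift I F E σ) (tangentLift I F E τ) = coreLift I F E (C.bracket σ τ)
  bracket_CC : ∀ σ ∈ smoothSections I F E, ∀ τ ∈ smoothSections I F E,
    C'.bracket (coreLift I F E σ) (coreLift I F E τ) = 0
  anchor_TT : ∀ σ ∈ smoothSections I F E, ∀ f : M → ℝ, ContMDiff I 𝓘(ℝ, ℝ) ∞ f → ∀ X,
    derivAlong I.tangent (tangentLiftFun I f) X (C'.anchor X (tangentLift I F E σ X)) =
      tangentLiftFun I (fun x => derivAlong I f x (C.anchor x (σ x))) X
  anchor_TC : ∀ σ ∈ smoothSections I F E, ∀ f : M → ℝ, ContMDiff I 𝓘(ℝ, ℝ) ∞ f → ∀ X,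
    derivAlong I.tangent (coreLiftFun I f) X (C'.anchor X (tangentLift I F E σ X)) =
      coreLiftFun I (fun x => derivAlong I f x (C.anchor x (σ x))) X
  anchor_CT : ∀ σ ∈ smoothSections I F E, ∀ f : M → ℝ, ContMDiff I 𝓘(ℝ, ℝ) ∞ f → ∀ X,
    derivAlong I.tangent (tangentLiftFun I f) X (C'.anchor X (coreLift I F E σ X)) =
      coreLiftFun I (fun x => derivAlong I f x (C.anchor x (σ x))) X
  anchor_CC : ∀ σ ∈ smoothSections I F E, ∀ f : M → ℝ, ContMDiff I 𝓘(ℝ, ℝ) ∞ f → ∀ X,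
    derivAlong I.tangent (coreLiftFun I f) X (C'.anchor X (coreLift I F E σ X)) = 0

/-- The part of `L ⊆ T𝔼` in the tangent space to `𝔼` at `w`, that is, the fibre of `L → W`
over `w`. -/
def fibreOver (L : ∀ X, Submodule ℝ (TangentProlongation I F E X)) (w : TotalSpace F E) :
    Set (TangentSpace (I.prod 𝓘(ℝ, F)) w) :=
  {v | (tangentIdent I F E ⟨w, v⟩).2 ∈ L (tangentIdent I F E ⟨w, v⟩).1}

/-- `L` is a double vector subbundle of `T𝔼` with side bundles `TM` and `W ⊆ 𝔼`: it is a vector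
subbundle of `T𝔼 → TM` over `TM`, and a vector subbundle of the tangent bundle `T𝔼 → 𝔼`
over `W`, where `W` is a vector subbundle of `𝔼` over `M`. The interchange laws for the two
additions and scalar multiplications of `L` are inherited from `T𝔼`. -/
structure IsDoubleVectorSubbundle (W : ∀ x, Submodule ℝ (E x))
    (L : ∀ X, Submodule ℝ (TangentProlongation I F E X)) : Prop where
  side : IsVectorSubbundle I (smoothSections I F E) (fun x => (W x : Set (E x)))
  over_tangent : IsVectorSubbundle I.tangent
    (smoothSections I.tangent (F × F) (TangentProlongation I F E))
    (fun X => (L X : Set (TangentProlongation I F E X)))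
  over_side : IsVectorSubbundle (I.prod 𝓘(ℝ, F))
    (smoothSections (I.prod 𝓘(ℝ, F)) (V × F)
      (TangentSpace (I.prod 𝓘(ℝ, F)) (M := TotalSpace F E))) (fibreOver L)
  base_eq : ∀ w : TotalSpace F E, w ∈ baseOf (fibreOver L) ↔ w.2 ∈ W w.1

/-- `L` is a `𝒱ℬ`-Dirac structure with side bundles `TM` and `W`, where `T𝔼 → TM` carries the
Courant algebroid structure `C'`. -/
structure IsVBDirac (C' : CourantAlgebroid I.tangent (F × F) (TangentProlongation I F E))
    (W : ∀ x, Submodule ℝ (E x)) (L : ∀ X, Submodule ℝ (TangentProlongation I F E X)) :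
    Prop where
  double : IsDoubleVectorSubbundle W L
  dirac : IsDirac I.tangent (F × F) C' L

/-- The graph `{(d₁, d₂, d₃) ∈ L³ | d₁ = d₂ + d₃}` of the addition of the vector bundle `L → W`,
as a subset of `L³ → (TM)³`: `d₂` and `d₃` are tangent vectors to `𝔼` at the same point `w`,
and the sum is taken in the tangent space at `w`. -/
def graphAdd (L : ∀ X, Submodule ℝ (TangentProlongation I F E X))
    (p : TangentBundle I M × TangentBundle I M × TangentBundle I M) :
    Set (TangentProlongation I F E p.1 × TangentProlongation I F E p.2.1 ×
      TangentProlongation I F E p.2.2) :=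
  {d | d.1 ∈ L p.1 ∧ d.2.1 ∈ L p.2.1 ∧ d.2.2 ∈ L p.2.2 ∧
    ∃ (w : TotalSpace F E) (v₂ v₃ : TangentSpace (I.prod 𝓘(ℝ, F)) w),
      tangentIdent I F E ⟨w, v₂⟩ = ⟨p.2.1, d.2.1⟩ ∧ tangentIdent I F E ⟨w, v₃⟩ = ⟨p.2.2, d.2.2⟩ ∧
      tangentIdent I F E ⟨w, v₂ + v₃⟩ = ⟨p.1, d.1⟩}

/-- The graph `{(w, d) ∈ W × L | d is tangent to 𝔼 at w}` of the projection `L → W`, as a subset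
of `W × L → M × TM`. -/
def graphProj (W : ∀ x, Submodule ℝ (E x))
    (L : ∀ X, Submodule ℝ (TangentProlongation I F E X)) (p : M × TangentBundle I M) :
    Set (E p.1 × TangentProlongation I F E p.2) :=
  {d | d.1 ∈ W p.1 ∧ d.2 ∈ L p.2 ∧
    ∃ v : TangentSpace (I.prod 𝓘(ℝ, F)) (TotalSpace.mk' F p.1 d.1),
      tangentIdent I F E ⟨TotalSpace.mk' F p.1 d.1, v⟩ = ⟨p.2, d.2⟩}

/-- `L^flip` is an `ℒ𝒜`-vector bundle for the Lie algebroid structure `𝓛` on `L → TM`: `L` is a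
double vector bundle, and the graph of the addition of `L → W` is a Lie subalgebroid
of `L³ → (TM)³`. -/
structure IsFlipLAVectorBundle (W : ∀ x, Submodule ℝ (E x))
    {L : ∀ X, Submodule ℝ (TangentProlongation I F E X)}
    (𝓛 : LieAlgebroid I.tangent (F × F) L) : Prop where
  double : IsDoubleVectorSubbundle W L
  addition : IsLieSubalgebroid (I.tangent.prod (I.tangent.prod I.tangent))
    (cubeSections I.tangent (F × F) L) (cubeBracket 𝓛) (graphAdd L)

/-- The projection `L → W`, over `TM → M`, is a morphism of Lie algebroids: its graph is a Lie
subalgebroid of `W × L → M × TM`. -/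
def ProjIsLieAlgebroidMorphism {W : ∀ x, Submodule ℝ (E x)}
    {L : ∀ X, Submodule ℝ (TangentProlongation I F E X)} (𝓦 : LieAlgebroid I F W)
    (𝓛 : LieAlgebroid I.tangent (F × F) L) : Prop :=
  IsLieSubalgebroid (I.prod I.tangent) (prodSections I F I.tangent (F × F) W L)
    (prodBracket 𝓦 𝓛) (graphProj W L)

end TangentProlongation

end TangentLift

open TangentLift

/-! The proof has two halves: the tangent prolongation exists and is unique, and the linear
structure of a `𝒱ℬ`-Dirac structure is compatible with it.

Existence and uniqueness rest on the sections σ_T + τ_C. Near a point X of TM they realise every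
section of T𝔼 that is constant ("flat") in the preferred trivialization at X (`flatLift_isFlatAt`).
An operation that is tensorial at X, that is, scales by f(X) when its argument is multiplied by f,
is therefore determined by its values on lifts (`tensorial_eq_zero`). So the pairing and the anchor
are forced, and defined, by their values on lifts. The bracket is not tensorial, but the axioms
impose Leibniz rules in both arguments. Hence its value at X is the sum of universal first-order
terms and of the bracket of flat sections with the same values at X
(`PreCourant.pairing_bracket_eq`). Read as a definition, this formula gives existence
(`prolongBracket`); read as a theorem, it gives uniqueness (`IsTangentProlongation.bracket_eq`). An
axiom asserts that some expression vanishes; the expression is tensorial and reduces on lifts to the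
same axiom over M. The Jacobi identity needs two facts about brackets satisfying all the other
axioms: the failure of the anchor to preserve brackets is tensorial in its second argument and, once
the anchor kills gradients, skew; and the Jacobiator is tensorial once that failure vanishes.

Let L be a `𝒱ℬ`-Dirac structure and X = (x, v). The base point projection maps L_X onto W_x, and its
kernel, the core, is the annihilator of W_x (`IsVBDirac.exists_basePt_eq`,
`IsVBDirac.vert_mem_iff`). Indeed a core element can be moved from one v to another by adding, in L
→ W, a zero of L → TM; so the core does not depend on v. As L is Lagrangian, the image of L_X is the
orthogonal complement of the core, hence independent of v as well, and for v = 0 it contains W_x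
because L → W has zero vectors. Consequently frames of W lift to sections of L that are linear in v
(`IsVBDirac.exists_linear_lifts`); together with a frame of the core they give frames of both
graphs.

For the addition, the triples with d₁ = d₂ + d₃ form their own orthogonal complement for the form
⟨d₁, e₁⟩ - ⟨d₂, e₂⟩ - ⟨d₃, e₃⟩ (`IsAddTriple.pairing_eq`, `isAddTriple_of_pairing`). The anchor, the
bracket of flat sections and derivatives along the base of the graph all preserve such triples.
Hence the bracket of two sections with values in the graph is orthogonal to all such triples, so it
is again an additive triple. Its components lie in L by involutivity.

For the algebroid on W, the base point of ⟦s, t⟧ is detected by pairing with vertical vectors c. The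
only term that sees more than base points is the derivative of s in the vertical direction a(c),
paired with t. Isotropy of L along the line u + t·a(c) turns it into an expression in base points
alone (`IsVBDirac.pairing_flatDeriv_vertical`). So brackets of projectable sections of L are
projectable, the bracket on W is defined by lifting, and its axioms are projected from L. The same
comparison (`IsVBDirac.basePt_bracket_compare`), applied to arbitrary sections with values in the
graph of the projection, shows that the projection is a morphism. -/

namespace TangentLift

/-! ### Sections in trivializations, cutoffs and tensoriality. -/

section SmoothSections

variable {V : Type*} [NormedAddCommGroup V] [NormedSpace ℝ V] {H : Type*} [TopologicalSpace H]
  {I : ModelWithCorners ℝ V H} {N : Type*} [TopologicalSpace N] [ChartedSpace H N]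
  {F : Type*} [NormedAddCommGroup F] [NormedSpace ℝ F] {E : N → Type*}
  [∀ x, AddCommGroup (E x)] [∀ x, Module ℝ (E x)] [∀ x, TopologicalSpace (E x)]
  [TopologicalSpace (TotalSpace F E)] [FiberBundle F E] [VectorBundle ℝ F E]

lemma smoothSections_zero : (0 : ∀ x, E x) ∈ smoothSections I F E :=
  contMDiff_zeroSection ℝ E

lemma smoothSections_add {σ τ : ∀ x, E x} (hσ : σ ∈ smoothSections I F E)
    (hτ : τ ∈ smoothSections I F E) : σ + τ ∈ smoothSections I F E :=
  ContMDiff.add_section hσ hτ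

lemma smoothSections_smul {f : N → ℝ} (hf : ContMDiff I 𝓘(ℝ, ℝ) ∞ f) {σ : ∀ x, E x}
    (hσ : σ ∈ smoothSections I F E) : f • σ ∈ smoothSections I F E :=
  ContMDiff.smul_section hf hσ

lemma smoothSections_const_smul (c : ℝ) {σ : ∀ x, E x}
    (hσ : σ ∈ smoothSections I F E) : c • σ ∈ smoothSections I F E :=
  ContMDiff.const_smul_section hσ

lemma smoothSections_sub {σ τ : ∀ x, E x} (hσ : σ ∈ smoothSections I F E)
    (hτ : τ ∈ smoothSections I F E) : σ - τ ∈ smoothSections I F E :=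
  ContMDiff.sub_section hσ hτ

lemma smoothSections_sum {ι : Type*} {s : Finset ι} {σ : ι → ∀ x, E x}
    (hσ : ∀ i ∈ s, σ i ∈ smoothSections I F E) : ∑ i ∈ s, σ i ∈ smoothSections I F E := by
  classical
  induction s using Finset.induction_on with
  | empty => simpa using smoothSections_zero
  | insert i s hi h =>
    rw [Finset.sum_insert hi]
    exact smoothSections_add (hσ _ (s.mem_insert_self i))
      (h fun j hj => hσ j (Finset.mem_insert_of_mem hj))

/-- The coordinates of a section in the preferred trivialization at `x`. -/
noncomputable def coordRep (F : Type*) [NormedAddCommGroup F] [NormedSpace ℝ F]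
    [TopologicalSpace (TotalSpace F E)] [FiberBundle F E] (x : N) (σ : ∀ y, E y) (y : N) : F :=
  (trivializationAt F E x ⟨y, σ y⟩).2

lemma coordRep_add (x : N) (σ τ : ∀ y, E y) {y : N} (hy : y ∈ (trivializationAt F E x).baseSet) :
    coordRep F x (σ + τ) y = coordRep F x σ y + coordRep F x τ y :=
  ((trivializationAt F E x).linear ℝ hy).map_add _ _

lemma coordRep_smul (x : N) (f : N → ℝ) (σ : ∀ y, E y) {y : N}
    (hy : y ∈ (trivializationAt F E x).baseSet) :
    coordRep F x (f • σ) y = f y • coordRep F x σ y :=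
  ((trivializationAt F E x).linear ℝ hy).map_smul _ _

lemma coordRep_zero (x : N) {y : N}
    (hy : y ∈ (trivializationAt F E x).baseSet) :
    coordRep F x (0 : ∀ y, E y) y = 0 :=
  ((trivializationAt F E x).linear ℝ hy).map_zero

lemma symmL_coordRep (x : N) (σ : ∀ y, E y) {y : N}
    (hy : y ∈ (trivializationAt F E x).baseSet) :
    (trivializationAt F E x).symmL ℝ y (coordRep F x σ y) = σ y := by
  exact (Trivialization.symmL_apply _ hy _).trans
    ((trivializationAt F E x).symm_apply_apply_mk hy (σ y))

lemma coordRep_eq_iff (x : N) (σ τ : ∀ y, E y) {y : N}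
    (hy : y ∈ (trivializationAt F E x).baseSet) :
    coordRep F x σ y = coordRep F x τ y ↔ σ y = τ y := by
  refine ⟨fun h => ?_, fun h => by rw [coordRep, coordRep, h]⟩
  have h' := congrArg ((trivializationAt F E x).symmL ℝ y) h
  rwa [symmL_coordRep x σ hy, symmL_coordRep x τ hy] at h'

lemma baseSet_mem_nhds (F : Type*) [NormedAddCommGroup F] [NormedSpace ℝ F]
    (E : N → Type*) [∀ x, TopologicalSpace (E x)]
    [TopologicalSpace (TotalSpace F E)] [FiberBundle F E] (x : N) :
    ∀ᶠ y in 𝓝 x, y ∈ (trivializationAt F E x).baseSet :=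
  (trivializationAt F E x).open_baseSet.mem_nhds (mem_baseSet_trivializationAt F E x)

variable [IsManifold I ∞ N] [ContMDiffVectorBundle ∞ F E I]

lemma contMDiffAt_coordRep {x y : N} {σ : ∀ y, E y}
    (hσ : ContMDiffAt I (I.prod 𝓘(ℝ, F)) ∞ (fun x => TotalSpace.mk' F x (σ x)) y)
    (hy : y ∈ (trivializationAt F E x).baseSet) :
    ContMDiffAt I 𝓘(ℝ, F) ∞ (coordRep F x σ) y :=
  ((trivializationAt F E x).contMDiffAt_section_iff hy).1 hσ

lemma contMDiffAt_section_of_coordRep {x y : N} {σ : ∀ y, E y}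
    (hσ : ContMDiffAt I 𝓘(ℝ, F) ∞ (coordRep F x σ) y)
    (hy : y ∈ (trivializationAt F E x).baseSet) :
    ContMDiffAt I (I.prod 𝓘(ℝ, F)) ∞ (fun x => TotalSpace.mk' F x (σ x)) y :=
  ((trivializationAt F E x).contMDiffAt_section_iff hy).2 hσ


omit [IsManifold I ∞ N] in
lemma hasMFDerivAt_smul {G : Type*} [NormedAddCommGroup G] [NormedSpace ℝ G] {f : N → ℝ}
    {g : N → G} {x : N} {f' : V →L[ℝ] ℝ} {g' : V →L[ℝ] G}
    (hf : HasMFDerivAt I 𝓘(ℝ, ℝ) f x f') (hg : HasMFDerivAt I 𝓘(ℝ, G) g x g') :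
    HasMFDerivAt I 𝓘(ℝ, G) (fun y => f y • g y) x
      (f x • g' + f'.smulRight (g x) : V →L[ℝ] G) :=
  ⟨hf.1.smul hg.1, by simpa only [mfld_simps] using! hf.2.smul hg.2⟩

/-- The derivative at `x`, in the direction `v`, of a function with values in a normed space. -/
noncomputable def vderiv (I : ModelWithCorners ℝ V H) {G : Type*} [NormedAddCommGroup G]
    [NormedSpace ℝ G] (f : N → G) (x : N) (v : TangentSpace I x) : G :=
  mfderiv I 𝓘(ℝ, G) f x v

section VDeriv

variable {G : Type*} [NormedAddCommGroup G] [NormedSpace ℝ G] {x : N}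

omit [IsManifold I ∞ N] in
lemma vderiv_eq {f : N → G} {f' : V →L[ℝ] G} (h : HasMFDerivAt I 𝓘(ℝ, G) f x f')
    (v : TangentSpace I x) : vderiv I f x v = f' v := by
  simp only [vderiv]
  rw [h.mfderiv]
  rfl

omit [IsManifold I ∞ N] in
lemma vderiv_fun_smul {f : N → ℝ}
    {g : N → G} (hf : MDifferentiableAt I 𝓘(ℝ, ℝ) f x)
    (hg : MDifferentiableAt I 𝓘(ℝ, G) g x) (v : TangentSpace I x) :
    vderiv I (fun y => f y • g y) x v = f x • vderiv I g x v + derivAlong I f x v • g x :=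
  vderiv_eq (hasMFDerivAt_smul hf.hasMFDerivAt hg.hasMFDerivAt) v

omit [IsManifold I ∞ N] in
lemma vderiv_fun_add {f g : N → G} (hf : MDifferentiableAt I 𝓘(ℝ, G) f x)
    (hg : MDifferentiableAt I 𝓘(ℝ, G) g x) (v : TangentSpace I x) :
    vderiv I (fun y => f y + g y) x v = vderiv I f x v + vderiv I g x v :=
  vderiv_eq (hf.hasMFDerivAt.add hg.hasMFDerivAt) v

omit [IsManifold I ∞ N] in
lemma vderiv_congr {f g : N → G} (h : ∀ᶠ y in 𝓝 x, f y = g y) (v : TangentSpace I x) :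
    vderiv I f x v = vderiv I g x v := by
  have h' : f =ᶠ[𝓝 x] g := h
  simp only [vderiv]
  rw [h'.mfderiv_eq]
  rfl

omit [IsManifold I ∞ N] in
@[simp] lemma vderiv_const (c : G) (v : TangentSpace I x) :
    vderiv I (fun _ => c) x v = 0 := by
  simp only [vderiv]
  rw [mfderiv_const]
  rfl

omit [IsManifold I ∞ N] in
lemma vderiv_add (f : N → G) (v w : TangentSpace I x) :
    vderiv I f x (v + w) = vderiv I f x v + vderiv I f x w :=
  (mfderiv I 𝓘(ℝ, G) f x).map_add v w

omit [IsManifold I ∞ N] in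
lemma vderiv_smul (f : N → G) (c : ℝ) (v : TangentSpace I x) :
    vderiv I f x (c • v) = c • vderiv I f x v :=
  (mfderiv I 𝓘(ℝ, G) f x).map_smul c v

end VDeriv

section DerivAlong

variable {f g : N → ℝ} {x : N}

omit [IsManifold I ∞ N] in
lemma derivAlong_add (v w : TangentSpace I x) :
    derivAlong I f x (v + w) = derivAlong I f x v + derivAlong I f x w :=
  (mfderiv I 𝓘(ℝ, ℝ) f x).map_add v w

omit [IsManifold I ∞ N] in
lemma derivAlong_sub (v w : TangentSpace I x) :
    derivAlong I f x (v - w) = derivAlong I f x v - derivAlong I f x w :=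
  (mfderiv I 𝓘(ℝ, ℝ) f x).map_sub v w

omit [IsManifold I ∞ N] in
lemma derivAlong_smul (c : ℝ) (v : TangentSpace I x) :
    derivAlong I f x (c • v) = c * derivAlong I f x v :=
  (mfderiv I 𝓘(ℝ, ℝ) f x).map_smul c v

omit [IsManifold I ∞ N] in
@[simp] lemma derivAlong_zero : derivAlong I f x 0 = 0 :=
  (mfderiv I 𝓘(ℝ, ℝ) f x).map_zero

omit [IsManifold I ∞ N] in
lemma derivAlong_congr (h : ∀ᶠ y in 𝓝 x, f y = g y) (v : TangentSpace I x) :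
    derivAlong I f x v = derivAlong I g x v :=
  vderiv_congr h v

omit [IsManifold I ∞ N] in
@[simp] lemma derivAlong_const (c : ℝ) (v : TangentSpace I x) :
    derivAlong I (fun _ => c) x v = 0 :=
  vderiv_const c v

omit [IsManifold I ∞ N] in
lemma derivAlong_fun_add (hf : MDifferentiableAt I 𝓘(ℝ, ℝ) f x)
    (hg : MDifferentiableAt I 𝓘(ℝ, ℝ) g x) (v : TangentSpace I x) :
    derivAlong I (fun y => f y + g y) x v = derivAlong I f x v + derivAlong I g x v :=
  vderiv_fun_add hf hg v

omit [IsManifold I ∞ N] in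
lemma derivAlong_fun_mul (hf : MDifferentiableAt I 𝓘(ℝ, ℝ) f x)
    (hg : MDifferentiableAt I 𝓘(ℝ, ℝ) g x) (v : TangentSpace I x) :
    derivAlong I (fun y => f y * g y) x v = f x * derivAlong I g x v + derivAlong I f x v * g x :=
  vderiv_fun_smul hf hg v

omit [IsManifold I ∞ N] in
lemma derivAlong_const_mul (c : ℝ) (hg : MDifferentiableAt I 𝓘(ℝ, ℝ) g x)
    (v : TangentSpace I x) :
    derivAlong I (fun y => c * g y) x v = c * derivAlong I g x v := by
  rw [derivAlong_fun_mul mdifferentiableAt_const hg, derivAlong_const]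
  simp

omit [IsManifold I ∞ N] in
lemma derivAlong_fun_sub (hf : MDifferentiableAt I 𝓘(ℝ, ℝ) f x)
    (hg : MDifferentiableAt I 𝓘(ℝ, ℝ) g x) (v : TangentSpace I x) :
    derivAlong I (fun y => f y - g y) x v = derivAlong I f x v - derivAlong I g x v := by
  have := derivAlong_fun_add (f := f) (g := fun y => -1 * g y) hf
    ((mdifferentiableAt_const (c := (-1 : ℝ))).smul hg) v
  rw [derivAlong_const_mul (-1) hg v] at this
  simpa [sub_eq_add_neg] using this

end DerivAlong

/-- The tangent vector `v`-derivative of a section in the preferred trivialization at `x`. -/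
noncomputable def flatDeriv (I : ModelWithCorners ℝ V H) (F : Type*) [NormedAddCommGroup F]
    [NormedSpace ℝ F] [TopologicalSpace (TotalSpace F E)] [FiberBundle F E] [VectorBundle ℝ F E]
    (x : N) (σ : ∀ y, E y) (v : TangentSpace I x) : E x :=
  (trivializationAt F E x).symmL ℝ x (vderiv I (coordRep F x σ) x v)

/-- The section `σ` is constant with value `u` in the preferred trivialization at `x`, near `x`. -/
def IsFlatAt (x : N) (σ : ∀ y, E y) (u : F) : Prop :=
  ∀ᶠ y in 𝓝 x, coordRep F x σ y = u

lemma mdifferentiableAt_coordRep {x : N} {σ : ∀ y, E y} (hσ : σ ∈ smoothSections I F E) :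
    MDifferentiableAt I 𝓘(ℝ, F) (coordRep F x σ) x :=
  (contMDiffAt_coordRep (hσ x) (mem_baseSet_trivializationAt F E x)).mdifferentiableAt (by simp)

lemma flatDeriv_add_section {x : N} {σ τ : ∀ y, E y} (hσ : σ ∈ smoothSections I F E)
    (hτ : τ ∈ smoothSections I F E) (v : TangentSpace I x) :
    flatDeriv I F x (σ + τ) v = flatDeriv I F x σ v + flatDeriv I F x τ v := by
  have h : coordRep F x (σ + τ) =ᶠ[𝓝 x] fun y => coordRep F x σ y + coordRep F x τ y := by
    filter_upwards [baseSet_mem_nhds F E x] with y hy using coordRep_add x σ τ hy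
  rw [flatDeriv, vderiv_congr h, vderiv_fun_add (mdifferentiableAt_coordRep hσ)
    (mdifferentiableAt_coordRep hτ), map_add]
  rfl

lemma flatDeriv_smul_section {x : N} {f : N → ℝ} (hf : ContMDiff I 𝓘(ℝ, ℝ) ∞ f) {σ : ∀ y, E y}
    (hσ : σ ∈ smoothSections I F E) (v : TangentSpace I x) :
    flatDeriv I F x (f • σ) v = f x • flatDeriv I F x σ v + derivAlong I f x v • σ x := by
  have h : coordRep F x (f • σ) =ᶠ[𝓝 x] fun y => f y • coordRep F x σ y := by
    filter_upwards [baseSet_mem_nhds F E x] with y hy using coordRep_smul x f σ hy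
  rw [flatDeriv, vderiv_congr h, vderiv_fun_smul (hf.mdifferentiableAt (by simp))
    (mdifferentiableAt_coordRep hσ), map_add, map_smul, map_smul,
    symmL_coordRep x σ (mem_baseSet_trivializationAt F E x)]
  rfl

omit [VectorBundle ℝ F E] [IsManifold I ∞ N] [ContMDiffVectorBundle ∞ F E I] in
lemma flatDeriv_congr [VectorBundle ℝ F E] {x : N} {σ τ : ∀ y, E y}
    (h : ∀ᶠ y in 𝓝 x, σ y = τ y) (v : TangentSpace I x) :
    flatDeriv I F x σ v = flatDeriv I F x τ v := by
  have h : coordRep F x σ =ᶠ[𝓝 x] coordRep F x τ := by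
    filter_upwards [h] with y hy
    rw [coordRep, coordRep, hy]
  rw [flatDeriv, vderiv_congr h]
  rfl

omit [IsManifold I ∞ N] [ContMDiffVectorBundle ∞ F E I] in
lemma IsFlatAt.flatDeriv_eq_zero {x : N} {σ : ∀ y, E y} {u : F} (h : IsFlatAt x σ u)
    (v : TangentSpace I x) : flatDeriv I F x σ v = 0 := by
  have h : coordRep F x σ =ᶠ[𝓝 x] fun _ => u := h
  rw [flatDeriv, vderiv_congr h, vderiv_const, map_zero]

omit [IsManifold I ∞ N] [ContMDiffVectorBundle ∞ F E I] in
lemma flatDeriv_add (x : N) (σ : ∀ y, E y) (v w : TangentSpace I x) :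
    flatDeriv I F x σ (v + w) = flatDeriv I F x σ v + flatDeriv I F x σ w := by
  simp only [flatDeriv, vderiv_add, map_add]

omit [IsManifold I ∞ N] [ContMDiffVectorBundle ∞ F E I] in
lemma flatDeriv_smul (x : N) (σ : ∀ y, E y) (c : ℝ) (v : TangentSpace I x) :
    flatDeriv I F x σ (c • v) = c • flatDeriv I F x σ v := by
  simp only [flatDeriv, vderiv_smul, map_smul]

section Cutoff

variable [FiniteDimensional ℝ V] [T2Space N]

omit [ContMDiffVectorBundle ∞ F E I] in
variable (I) in
lemma exists_cutoff {x : N} {U : Set N} (hU : U ∈ 𝓝 x) :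
    ∃ χ : N → ℝ, ContMDiff I 𝓘(ℝ, ℝ) ∞ χ ∧ (∀ᶠ y in 𝓝 x, χ y = 1) ∧ tsupport χ ⊆ U := by
  obtain ⟨f, -, hf⟩ := (SmoothBumpFunction.nhds_basis_tsupport (I := I) x).mem_iff.1 hU
  exact ⟨f, f.contMDiff, f.eventuallyEq_one, hf⟩

omit [IsManifold I ∞ N] [ContMDiffVectorBundle ∞ F E I] [FiniteDimensional ℝ V] [T2Space N] in
lemma cutoff_smul_mem {χ : N → ℝ} (hχ : ContMDiff I 𝓘(ℝ, ℝ) ∞ χ) {σ : ∀ y, E y}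
    (hσ : ∀ y ∈ tsupport χ,
      ContMDiffAt I (I.prod 𝓘(ℝ, F)) ∞ (fun x => TotalSpace.mk' F x (σ x)) y) :
    χ • σ ∈ smoothSections I F E := by
  intro y
  by_cases hy : y ∈ tsupport χ
  · exact ContMDiffAt.smul_section (hχ y) (hσ y hy)
  · refine (contMDiff_zeroSection ℝ E y).congr_of_eventuallyEq ?_
    filter_upwards [(isClosed_tsupport χ).isOpen_compl.mem_nhds hy] with z hz
    simp [image_eq_zero_of_notMem_tsupport hz, zeroSection]

omit [IsManifold I ∞ N] [FiniteDimensional ℝ V] [T2Space N] in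
lemma cutoff_mul_contMDiff {χ : N → ℝ} (hχ : ContMDiff I 𝓘(ℝ, ℝ) ∞ χ) {f : N → ℝ}
    (hf : ∀ y ∈ tsupport χ, ContMDiffAt I 𝓘(ℝ, ℝ) ∞ f y) :
    ContMDiff I 𝓘(ℝ, ℝ) ∞ (fun y => χ y * f y) := by
  intro y
  by_cases hy : y ∈ tsupport χ
  · exact (hχ y).mul (hf y hy)
  · refine (contMDiffAt_const (c := (0 : ℝ))).congr_of_eventuallyEq ?_
    filter_upwards [(isClosed_tsupport χ).isOpen_compl.mem_nhds hy] with z hz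
    simp [image_eq_zero_of_notMem_tsupport hz]

lemma exists_contMDiff_eventuallyEq {x : N} {f : N → ℝ}
    (hf : ∀ᶠ y in 𝓝 x, ContMDiffAt I 𝓘(ℝ, ℝ) ∞ f y) :
    ∃ g : N → ℝ, ContMDiff I 𝓘(ℝ, ℝ) ∞ g ∧ ∀ᶠ y in 𝓝 x, g y = f y := by
  obtain ⟨χ, hχ, h1, hs⟩ := exists_cutoff I hf
  refine ⟨_, cutoff_mul_contMDiff hχ fun y hy => hs hy, ?_⟩
  filter_upwards [h1] with y hy
  simp [hy]

variable (I F E) in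
/-- A smooth function, equal to one near `x`, with support in the domain of the preferred
trivialization at `x`. -/
noncomputable def cutoff (x : N) : N → ℝ :=
  (exists_cutoff I (baseSet_mem_nhds F E x)).choose

lemma cutoff_contMDiff (x : N) : ContMDiff I 𝓘(ℝ, ℝ) ∞ (cutoff I F E x) :=
  (exists_cutoff I (baseSet_mem_nhds F E x)).choose_spec.1

lemma cutoff_eventually (x : N) : ∀ᶠ y in 𝓝 x, cutoff I F E x y = 1 :=
  (exists_cutoff I (baseSet_mem_nhds F E x)).choose_spec.2.1

lemma tsupport_cutoff (x : N) :
    tsupport (cutoff I F E x) ⊆ (trivializationAt F E x).baseSet :=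
  (exists_cutoff I (baseSet_mem_nhds F E x)).choose_spec.2.2

variable (I E) in
/-- A global section which near `x` is constant in the preferred trivialization at `x`. -/
noncomputable def constSection (x : N) (u : F) (y : N) : E y :=
  cutoff I F E x y • (trivializationAt F E x).symmL ℝ y u

lemma coordRep_symmL {x y : N} (hy : y ∈ (trivializationAt F E x).baseSet) (u : F) :
    coordRep F x (fun z => (trivializationAt F E x).symmL ℝ z u) y = u := by
  have := (trivializationAt F E x).apply_mk_symm hy u
  rw [coordRep, Trivialization.symmL_apply _ hy, this]

lemma constSection_mem (x : N) (u : F) : constSection I E x u ∈ smoothSections I F E := by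
  refine cutoff_smul_mem (cutoff_contMDiff x) fun y hy => ?_
  have hy := tsupport_cutoff x hy
  refine contMDiffAt_section_of_coordRep (x := x) ?_ hy
  refine (contMDiffAt_const (c := u)).congr_of_eventuallyEq ?_
  filter_upwards [(trivializationAt F E x).open_baseSet.mem_nhds hy] with z hz
  exact coordRep_symmL hz u

lemma constSection_isFlatAt (x : N) (u : F) : IsFlatAt x (constSection I E x u) u := by
  filter_upwards [cutoff_eventually (I := I) (F := F) (E := E) x, baseSet_mem_nhds F E x]
    with y hy hy'
  have : constSection I E x u y = (trivializationAt F E x).symmL ℝ y u := by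
    simp [constSection, hy]
  rw [coordRep, this]
  exact coordRep_symmL hy' u

lemma constSection_self (x : N) (u : F) :
    constSection I E x u x = (trivializationAt F E x).symmL ℝ x u := by
  simp [constSection, (cutoff_eventually (I := I) (F := F) (E := E) x).self_of_nhds]

lemma constSection_coordRep (x : N) (σ : ∀ y, E y) :
    constSection I E x (coordRep F x σ x) x = σ x := by
  rw [constSection_self, symmL_coordRep x σ (mem_baseSet_trivializationAt F E x)]

lemma constSection_add (x : N) (u v : F) :
    constSection I E x (u + v) = constSection I E x u + constSection I E x v := by
  ext y; simp [constSection]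

lemma constSection_smul (x : N) (c : ℝ) (u : F) :
    constSection I E x (c • u) = c • constSection I E x u := by
  ext y; simp only [constSection, map_smul, Pi.smul_apply]; exact smul_comm _ _ _

variable (I F) in
lemma exists_section_eq (x : N) (u : E x) : ∃ σ ∈ smoothSections I F E, σ x = u := by
  classical
  refine ⟨_, constSection_mem x (coordRep F x (Function.update 0 x u) x), ?_⟩
  rw [constSection_coordRep]
  simp

lemma IsFlatAt.symmL_eq {x : N} {σ : ∀ y, E y} {u : F} (h : IsFlatAt x σ u) :
    σ x = (trivializationAt F E x).symmL ℝ x u := by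
  rw [← h.self_of_nhds, symmL_coordRep x σ (mem_baseSet_trivializationAt F E x)]

variable [FiniteDimensional ℝ F]

/-- A property of smooth sections that is local at `x` and stable under addition and
multiplication by smooth functions holds for all sections as soon as it holds for sections that
are constant near `x` in the preferred trivialization. -/
theorem section_induction {x : N} {Q : (∀ y, E y) → Prop}
    (hadd : ∀ σ ∈ smoothSections I F E, ∀ τ ∈ smoothSections I F E, Q σ → Q τ → Q (σ + τ))
    (hsmul : ∀ f : N → ℝ, ContMDiff I 𝓘(ℝ, ℝ) ∞ f → ∀ σ ∈ smoothSections I F E, Q σ → Q (f • σ))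
    (hgerm : ∀ σ ∈ smoothSections I F E, ∀ τ ∈ smoothSections I F E,
      (∀ᶠ y in 𝓝 x, σ y = τ y) → Q σ → Q τ)
    (h0 : ∀ u : F, ∃ τ ∈ smoothSections I F E, IsFlatAt x τ u ∧ Q τ) :
    ∀ σ ∈ smoothSections I F E, Q σ := by
  classical
  intro σ hσ
  choose e he hflat hQ using h0
  let b := Module.finBasis ℝ F
  -- The coordinates of `σ` in a basis of the model fibre; the cutoff makes them smooth on all of
  -- `N` without changing them near `x`.
  let f : Fin (Module.finrank ℝ F) → N → ℝ :=
    fun i y => cutoff I F E x y * b.repr (coordRep F x σ y) i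
  have hf : ∀ i, ContMDiff I 𝓘(ℝ, ℝ) ∞ (f i) := fun i => by
    refine cutoff_mul_contMDiff (cutoff_contMDiff x) fun y hy => ?_
    exact (LinearMap.toContinuousLinearMap (b.coord i)).contMDiff.contMDiffAt.comp y
      (contMDiffAt_coordRep (hσ y) (tsupport_cutoff x hy))
  have key : ∀ s : Finset (Fin (Module.finrank ℝ F)), Q (∑ i ∈ s, f i • e (b i)) := by
    intro s
    induction s using Finset.induction_on with
    | empty =>
      -- `Q` is not assumed for the zero section, but the flat section with value zero has the same
      -- germ.
      rw [Finset.sum_empty]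
      refine hgerm _ (he 0) _ smoothSections_zero ?_ (hQ 0)
      filter_upwards [hflat 0, baseSet_mem_nhds F E x] with y hy hy'
      rw [← coordRep_eq_iff (F := F) x _ _ hy', hy, coordRep_zero x hy']
    | insert i s hi h =>
      rw [Finset.sum_insert hi]
      exact hadd _ (smoothSections_smul (hf i) (he _)) _
        (smoothSections_sum fun j _ => smoothSections_smul (hf j) (he _))
        (hsmul _ (hf i) _ (he _) (hQ _)) h
  refine hgerm _ (smoothSections_sum fun j _ => smoothSections_smul (hf j) (he _)) _ hσ ?_
    (key Finset.univ)
  have hall : ∀ᶠ y in 𝓝 x, ∀ i, coordRep F x (e (b i)) y = b i :=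
    Filter.eventually_all.2 fun i => hflat (b i)
  filter_upwards [hall, baseSet_mem_nhds F E x, cutoff_eventually (I := I) (F := F) (E := E) x]
    with y hy hy' hc
  rw [Finset.sum_apply]
  have h1 : ∀ i, (f i • e (b i)) y =
      b.repr (coordRep F x σ y) i • (trivializationAt F E x).symmL ℝ y (b i) := fun i => by
    have := symmL_coordRep (F := F) x (e (b i)) hy'
    rw [hy i] at this
    simp only [Pi.smul_apply', f, hc, one_mul, this]
  simp only [h1, ← map_smul, ← map_sum, b.sum_repr]
  exact symmL_coordRep x σ hy'

omit [FiniteDimensional ℝ F] in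
-- Multiplication by a cutoff that is one at `x` and supported where the sections agree makes them
-- equal globally, and does not change the value of `P`. So locality need not be assumed for
-- tensorial operations.
lemma tensorial_congr {G : Type*} [AddCommGroup G] [Module ℝ G] {x : N} {P : (∀ y, E y) → G}
    (hsmul : ∀ f : N → ℝ, ContMDiff I 𝓘(ℝ, ℝ) ∞ f → ∀ σ ∈ smoothSections I F E,
      P (f • σ) = f x • P σ)
    {σ τ : ∀ y, E y} (hσ : σ ∈ smoothSections I F E) (hτ : τ ∈ smoothSections I F E)
    (h : ∀ᶠ y in 𝓝 x, σ y = τ y) : P σ = P τ := by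
  obtain ⟨χ, hχ, h1, hs⟩ := exists_cutoff I h
  have h2 : χ • σ = χ • τ := by
    ext y
    by_cases hy : y ∈ tsupport χ
    · simp only [Pi.smul_apply', show σ y = τ y from hs hy]
    · simp [image_eq_zero_of_notMem_tsupport hy]
  have h3 := hsmul χ hχ σ hσ
  rw [h2, hsmul χ hχ τ hτ, h1.self_of_nhds, one_smul, one_smul] at h3
  exact h3.symm

/-- An operation on sections that is tensorial at `x` vanishes if it does so on sections that are
constant near `x` in the preferred trivialization. -/
theorem tensorial_eq_zero {G : Type*} [AddCommGroup G] [Module ℝ G] {x : N} {P : (∀ y, E y) → G}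
    (hadd : ∀ σ ∈ smoothSections I F E, ∀ τ ∈ smoothSections I F E, P (σ + τ) = P σ + P τ)
    (hsmul : ∀ f : N → ℝ, ContMDiff I 𝓘(ℝ, ℝ) ∞ f → ∀ σ ∈ smoothSections I F E,
      P (f • σ) = f x • P σ)
    (h0 : ∀ u : F, ∃ τ ∈ smoothSections I F E, IsFlatAt x τ u ∧ P τ = 0) :
    ∀ σ ∈ smoothSections I F E, P σ = 0 := by
  refine section_induction (x := x) (fun σ hσ τ hτ h1 h2 => ?_) (fun f hf σ hσ h => ?_)
    (fun σ hσ τ hτ h h1 => ?_) h0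
  · rw [hadd σ hσ τ hτ, h1, h2, add_zero]
  · rw [hsmul f hf σ hσ, h, smul_zero]
  · rw [← tensorial_congr hsmul hσ hτ h, h1]

end Cutoff

end SmoothSections

/-! ### Smoothness of the inverse matrix. -/

section Matrices

variable {ι : Type*} [Fintype ι] [DecidableEq ι]

lemma two_le_infty : (2 : WithTop ℕ∞) ≤ ∞ := WithTop.coe_le_coe.2 le_top

lemma contDiff_det :
    ContDiff ℝ ∞ (fun A : ι → ι → ℝ => (Matrix.of A).det) := by
  simp only [Matrix.det_apply', Matrix.of_apply]
  refine ContDiff.sum fun σ _ => contDiff_const.mul (contDiff_prod fun i _ => ?_)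
  exact contDiff_apply_apply ℝ ℝ _ _

/-- Cramer's rule: an entry of the inverse is a quotient of determinants, the numerator being the
determinant of the matrix with one row replaced by a unit vector. -/
lemma contDiffAt_matrix_inv {A : ι → ι → ℝ} (hA : (Matrix.of A).det ≠ 0) (i j : ι) :
    ContDiffAt ℝ ∞ (fun B : ι → ι → ℝ => (Matrix.of B)⁻¹ i j) A := by
  simp only [Matrix.inv_def, Ring.inverse_eq_inv', Matrix.smul_apply, smul_eq_mul,
    Matrix.adjugate_apply]
  refine (contDiff_det.contDiffAt.inv hA).mul ?_
  have h : (fun B : ι → ι → ℝ => ((Matrix.of B).updateRow j (Pi.single i 1)).det) =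
      (fun A : ι → ι → ℝ => (Matrix.of A).det) ∘
        (fun B => Function.update B j (Pi.single i 1)) := by
    ext B; rfl
  rw [h]
  refine contDiff_det.contDiffAt.comp _ (contDiff_pi.2 fun k => ?_).contDiffAt
  by_cases hk : k = j
  · subst hk; simp only [Function.update_self]; exact contDiff_const
  · simp only [Function.update_of_ne hk]; exact contDiff_apply ℝ (ι → ℝ) k

variable {V : Type*} [NormedAddCommGroup V] [NormedSpace ℝ V] {H : Type*} [TopologicalSpace H]
  {I : ModelWithCorners ℝ V H} {N : Type*} [TopologicalSpace N] [ChartedSpace H N]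

omit [DecidableEq ι] in
lemma contMDiffAt_sum_smul {G : Type*} [NormedAddCommGroup G] [NormedSpace ℝ G] {c : ι → N → ℝ}
    {b : ι → G} {x : N} (hc : ∀ i, ContMDiffAt I 𝓘(ℝ, ℝ) ∞ (c i) x) :
    ContMDiffAt I 𝓘(ℝ, G) ∞ (fun y => ∑ i, c i y • b i) x := by
  have h : ∀ i, ContMDiffAt I 𝓘(ℝ, G) ∞ (fun y => c i y • b i) x :=
    fun i => (hc i).smul contMDiffAt_const
  exact contMDiffAt_finsetSum fun i _ => h i

lemma contMDiffAt_matrix_inv {A : N → Matrix ι ι ℝ} {x : N}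
    (hA : ∀ i j, ContMDiffAt I 𝓘(ℝ, ℝ) ∞ (fun y => A y i j) x) (h0 : (A x).det ≠ 0) (i j : ι) :
    ContMDiffAt I 𝓘(ℝ, ℝ) ∞ (fun y => (A y)⁻¹ i j) x := by
  have h1 : ContMDiffAt I 𝓘(ℝ, ι → ι → ℝ) ∞ (fun y => (fun i j => A y i j)) x :=
    contMDiffAt_pi_space.2 fun i => contMDiffAt_pi_space.2 fun j => hA i j
  exact (contDiffAt_matrix_inv (A := fun i j => A x i j) h0 i j).contMDiffAt.comp x h1

lemma eventually_det_ne_zero {A : N → Matrix ι ι ℝ} {x : N}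
    (hA : ∀ i j, ContMDiffAt I 𝓘(ℝ, ℝ) ∞ (fun y => A y i j) x) (h0 : (A x).det ≠ 0) :
    ∀ᶠ y in 𝓝 x, (A y).det ≠ 0 := by
  have h1 : ContMDiffAt I 𝓘(ℝ, ι → ι → ℝ) ∞ (fun y => (fun i j => A y i j)) x :=
    contMDiffAt_pi_space.2 fun i => contMDiffAt_pi_space.2 fun j => hA i j
  have h2 := (contDiff_det (ι := ι)).contMDiff.contMDiffAt.comp x h1
  exact h2.continuousAt.eventually_ne h0

end Matrices

/-! ### Nondegenerate pairings and smoothness tested by pairing. -/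

section Pairings

lemma exists_pairing_eq {W : Type*} [AddCommGroup W] [Module ℝ W] [FiniteDimensional ℝ W]
    {p : W →ₗ[ℝ] W →ₗ[ℝ] ℝ} (hp : ∀ u, (∀ v, p u v = 0) → u = 0) (φ : W →ₗ[ℝ] ℝ) :
    ∃ u, ∀ v, p u v = φ v := by
  have hinj : Function.Injective p := by
    refine (injective_iff_map_eq_zero p).2 fun u hu => hp u fun v => ?_
    rw [hu]; rfl
  obtain ⟨u, hu⟩ := (LinearMap.injective_iff_surjective_of_finrank_eq_finrank
    (Subspace.dual_finrank_eq (K := ℝ) (V := W)).symm).1 hinj φ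
  exact ⟨u, fun v => by rw [hu]⟩

lemma eq_of_pairing {W : Type*} [AddCommGroup W] [Module ℝ W]
    {p : W →ₗ[ℝ] W →ₗ[ℝ] ℝ} (hp : ∀ u, (∀ v, p u v = 0) → u = 0) {u u' : W}
    (h : ∀ v, p u v = p u' v) : u = u' := by
  refine sub_eq_zero.1 (hp _ fun v => ?_)
  rw [map_sub, LinearMap.sub_apply, h, sub_self]

variable {V : Type*} [NormedAddCommGroup V] [NormedSpace ℝ V] {H : Type*} [TopologicalSpace H]
  {I : ModelWithCorners ℝ V H} {N : Type*} [TopologicalSpace N] [ChartedSpace H N]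
  {F : Type*} [NormedAddCommGroup F] [NormedSpace ℝ F] {E : N → Type*}
  [∀ x, AddCommGroup (E x)] [∀ x, Module ℝ (E x)] [∀ x, TopologicalSpace (E x)]
  [TopologicalSpace (TotalSpace F E)] [FiberBundle F E] [VectorBundle ℝ F E]
  [IsManifold I ∞ N] [ContMDiffVectorBundle ∞ F E I]
  [FiniteDimensional ℝ V] [T2Space N] [FiniteDimensional ℝ F]

/-- A section is smooth at `x` if its pairings with all smooth sections are, for a smooth pairing
that is nondegenerate at `x`. -/
theorem contMDiffAt_of_pairing {p : ∀ x, E x →ₗ[ℝ] E x →ₗ[ℝ] ℝ}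
    (hp : ∀ σ ∈ smoothSections I F E, ∀ τ ∈ smoothSections I F E,
      ContMDiff I 𝓘(ℝ, ℝ) ∞ (fun x => p x (σ x) (τ x)))
    {x : N} (hn : ∀ u, (∀ v, p x u v = 0) → u = 0) {w : ∀ y, E y}
    (hw : ∀ σ ∈ smoothSections I F E, ContMDiffAt I 𝓘(ℝ, ℝ) ∞ (fun y => p y (w y) (σ y)) x) :
    ContMDiffAt I (I.prod 𝓘(ℝ, F)) ∞ (fun y => TotalSpace.mk' F y (w y)) x := by
  classical
  have hx := mem_baseSet_trivializationAt F E x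
  let b := Module.finBasis ℝ F
  let e := fun i => constSection I E x (b i)
  have he : ∀ i, e i ∈ smoothSections I F E := fun i => constSection_mem x (b i)
  have hflat : ∀ᶠ y in 𝓝 x, ∀ i, coordRep F x (e i) y = b i :=
    Filter.eventually_all.2 fun i => constSection_isFlatAt x (b i)
  -- The Gram matrix of a local frame. Nondegeneracy makes it invertible at `x`, hence nearby, and
  -- the coefficients of `w` in the frame are the pairings of `w` with the frame times the inverse
  -- of `G`.
  let G : N → Matrix _ _ ℝ := fun y => Matrix.of fun i j => p y (e i y) (e j y)
  have hG : ∀ i j, ContMDiffAt I 𝓘(ℝ, ℝ) ∞ (fun y => G y i j) x :=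
    fun i j => hp _ (he i) _ (he j) x
  have hexp : ∀ y, (∀ i, coordRep F x (e i) y = b i) → y ∈ (trivializationAt F E x).baseSet →
      ∀ u : E y, u = ∑ i, b.repr (coordRep F x (Function.update 0 y u) y) i • e i y := by
    intro y hy hy' u
    have h1 : ∀ i, e i y = (trivializationAt F E x).symmL ℝ y (b i) := fun i => by
      rw [← hy i, symmL_coordRep x _ hy']
    simp only [h1, ← map_smul, ← map_sum, b.sum_repr]
    rw [symmL_coordRep x _ hy', Function.update_self]
  have hdet : (G x).det ≠ 0 := by
    intro h0
    obtain ⟨c, hc, hc'⟩ := Matrix.exists_vecMul_eq_zero_iff.2 h0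
    have h1 : ∑ i, c i • e i x = 0 := by
      refine hn _ fun v => ?_
      rw [hexp x hflat.self_of_nhds hx v, map_sum]
      refine Finset.sum_eq_zero fun j _ => ?_
      have h2 := congrFun hc' j
      simp only [Matrix.vecMul, dotProduct, Pi.zero_apply] at h2
      rw [map_smul, map_sum, LinearMap.sum_apply]
      simp only [map_smul, LinearMap.smul_apply, smul_eq_mul]
      rw [show ∑ i, c i * p x (e i x) (e j x) = 0 from h2, mul_zero]
    have h2 : ∀ i, e i x = (trivializationAt F E x).symmL ℝ x (b i) := fun i => by
      rw [← hflat.self_of_nhds i, symmL_coordRep x _ hx]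
    simp only [h2, ← map_smul, ← map_sum] at h1
    have h3 := coordRep_symmL hx (∑ i, c i • b i)
    rw [coordRep, h1] at h3
    have h4 : ∑ i, c i • b i = 0 := by
      rw [← h3]; exact coordRep_zero x hx
    exact hc (funext fun i => Fintype.linearIndependent_iff.1 b.linearIndependent c h4 i)
  refine contMDiffAt_section_of_coordRep (x := x) ?_ hx
  have hsm : ContMDiffAt I 𝓘(ℝ, F) ∞
      (fun y => ∑ i, (∑ j, p y (w y) (e j y) * (G y)⁻¹ j i) • b i) x := by
    refine contMDiffAt_sum_smul fun i => ?_
    refine contMDiffAt_finsetSum fun j _ => (hw _ (he j)).mul ?_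
    exact contMDiffAt_matrix_inv hG hdet j i
  refine hsm.congr_of_eventuallyEq ?_
  filter_upwards [hflat, baseSet_mem_nhds F E x, eventually_det_ne_zero hG hdet]
    with y hy hy' hd
  set c := b.repr (coordRep F x w y) with hc
  have h1 : w y = ∑ i, c i • e i y := by
    have := hexp y hy hy' (w y)
    rw [coordRep, Function.update_self] at this
    exact this
  have h2 : (fun j => p y (w y) (e j y)) = Matrix.vecMul c (G y) := by
    ext j
    simp only [Matrix.vecMul, dotProduct]
    conv_lhs => rw [h1, map_sum, LinearMap.sum_apply]
    simp [G]
  have h3 : ∀ i, ∑ j, p y (w y) (e j y) * (G y)⁻¹ j i = c i := fun i => by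
    have h4 : Matrix.vecMul (fun j => p y (w y) (e j y)) (G y)⁻¹ i = c i := by
      rw [h2, Matrix.vecMul_vecMul, Matrix.mul_nonsing_inv _ (isUnit_iff_ne_zero.2 hd),
        Matrix.vecMul_one]
    exact h4
  simp only [h3]
  exact (b.sum_repr _).symm

end Pairings

/-! ### Tangent vectors and second derivatives in a chart. -/

section Hessian

variable {V : Type*} [NormedAddCommGroup V] [NormedSpace ℝ V] {H : Type*} [TopologicalSpace H]
  {I : ModelWithCorners ℝ V H} {N : Type*} [TopologicalSpace N] [ChartedSpace H N]
  [IsManifold I ∞ N]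

/-- The tangent space at `x` is modelled on `V` through the chart at `x` itself, whose coordinate
change at `x` is the identity. Formulas in the preferred chart therefore need no conversion at the
base point. -/
lemma tangent_symmL_self (x : N) (v : V) :
    (trivializationAt V (TangentSpace I (M := N)) x).symmL ℝ x v = v := by
  rw [TangentBundle.symmL_trivializationAt (mem_chart_source H x),
    mfderivWithin_range_extChartAt_symm]
  rfl

lemma coordRep_tangent (x : N) (Y : ∀ y : N, TangentSpace I y) {y : N}
    (hy : y ∈ (chartAt H x).source) :
    coordRep V x Y y = vderiv I (extChartAt I x) y (Y y) := by
  rw [vderiv, ← TangentBundle.continuousLinearMapAt_trivializationAt hy]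
  exact ((trivializationAt V (TangentSpace I (M := N)) x).continuousLinearMapAt_apply_of_mem ℝ
    (by simpa using hy) (Y y)).symm

lemma coordRep_tangent_self (x : N) (Y : ∀ y : N, TangentSpace I y) :
    coordRep V x Y x = Y x := by
  rw [coordRep_tangent x Y (mem_chart_source H x), vderiv, mfderiv_extChartAt_self]
  rfl

lemma flatDeriv_tangent (x : N) (Y : ∀ y : N, TangentSpace I y) (v : TangentSpace I x) :
    flatDeriv I V x Y v = vderiv I (coordRep V x Y) x v :=
  tangent_symmL_self x _

lemma vderiv_extChartAt_self (x : N) (v : TangentSpace I x) :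
    vderiv I (extChartAt I x) x v = v := by
  rw [vderiv, mfderiv_extChartAt_self]
  rfl

/-- The second derivative of a function at `x` in the preferred chart at `x`. -/
noncomputable def hessAt (I : ModelWithCorners ℝ V H) (f : N → ℝ) (x : N)
    (v w : TangentSpace I x) : ℝ :=
  fderiv ℝ (fderiv ℝ (f ∘ (extChartAt I x).symm)) (extChartAt I x x) v w

variable [I.Boundaryless]

lemma contDiffAt_comp_extChartAt_symm {G : Type*} [NormedAddCommGroup G] [NormedSpace ℝ G]
    {f : N → G} (hf : ContMDiff I 𝓘(ℝ, G) ∞ f) {x : N} {z : V}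
    (hz : z ∈ (extChartAt I x).target) :
    ContDiffAt ℝ ∞ (f ∘ (extChartAt I x).symm) z := by
  have h1 : ContMDiffAt 𝓘(ℝ, V) I ∞ (extChartAt I x).symm z :=
    (contMDiffOn_extChartAt_symm x z hz).contMDiffAt (extChartAt_target_mem_nhds' hz)
  exact (hf.contMDiffAt.comp z h1).contDiffAt

lemma hessAt_symm {f : N → ℝ} (hf : ContMDiff I 𝓘(ℝ, ℝ) ∞ f) (x : N)
    (v w : TangentSpace I x) :
    hessAt I f x v w = hessAt I f x w v := by
  have h := contDiffAt_comp_extChartAt_symm (x := x) hf (mem_extChartAt_target (I := I) x)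
  have h2 := h.isSymmSndFDerivAt (by simpa using two_le_infty)
  exact h2 v w

lemma derivAlong_eq_fderiv {f : N → ℝ} (hf : ContMDiff I 𝓘(ℝ, ℝ) ∞ f) {x y : N}
    (hy : y ∈ (chartAt H x).source) (v : TangentSpace I y) :
    derivAlong I f y v =
      fderiv ℝ (f ∘ (extChartAt I x).symm) (extChartAt I x y) (vderiv I (extChartAt I x) y v) := by
  have hz : extChartAt I x y ∈ (extChartAt I x).target :=
    (extChartAt I x).map_source (by simpa using hy)
  have h1 := (contDiffAt_comp_extChartAt_symm (x := x) hf hz).differentiableAt (by simp)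
  have h2 := (mdifferentiableAt_extChartAt (I := I) hy).hasMFDerivAt
  have h3 := HasMFDerivAt.comp y h1.hasFDerivAt.hasMFDerivAt h2
  have h4 : ((f ∘ (extChartAt I x).symm) ∘ extChartAt I x) =ᶠ[𝓝 y] f := by
    filter_upwards [(chartAt H x).open_source.mem_nhds hy] with z hz
    simp only [Function.comp]
    rw [(extChartAt I x).left_inv (by simpa using hz)]
  exact vderiv_eq (h3.congr_of_eventuallyEq h4.symm) v

/-- The derivative of `Y f` along `v`, in terms of the Hessian of `f` in a chart. -/
lemma derivAlong_derivAlong {f : N → ℝ} (hf : ContMDiff I 𝓘(ℝ, ℝ) ∞ f) {x : N}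
    {Y : ∀ y : N, TangentSpace I y} (hY : Y ∈ smoothSections I V (TangentSpace I (M := N)))
    (v : TangentSpace I x) :
    derivAlong I (fun y => derivAlong I f y (Y y)) x v =
      hessAt I f x v (Y x) + derivAlong I f x (flatDeriv I V x Y v) := by
  have hx := mem_chart_source H x
  have h1 := contDiffAt_comp_extChartAt_symm (x := x) hf (mem_extChartAt_target (I := I) x)
  have h2 : DifferentiableAt ℝ (fderiv ℝ (f ∘ (extChartAt I x).symm)) (extChartAt I x x) :=
    (h1.fderiv_right (m := 1) (by simpa [one_add_one_eq_two] using two_le_infty)).differentiableAt (by simp)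
  have h3 : HasMFDerivAt I 𝓘(ℝ, V →L[ℝ] ℝ)
      (fderiv ℝ (f ∘ (extChartAt I x).symm) ∘ extChartAt I x) x
      (fderiv ℝ (fderiv ℝ (f ∘ (extChartAt I x).symm)) (extChartAt I x x)) := by
    have := HasMFDerivAt.comp x h2.hasFDerivAt.hasMFDerivAt
      (mdifferentiableAt_extChartAt (I := I) hx).hasMFDerivAt
    rw [mfderiv_extChartAt_self] at this
    exact this
  have h4 := (mdifferentiableAt_coordRep (x := x) hY).hasMFDerivAt
  have h5 := hasMFDerivAt_clm_apply I h3 h4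
  have h6 : (fun y => (fderiv ℝ (f ∘ (extChartAt I x).symm) ∘ extChartAt I x) y (coordRep V x Y y))
      =ᶠ[𝓝 x] fun y => derivAlong I f y (Y y) := by
    filter_upwards [(chartAt H x).open_source.mem_nhds hx] with y hy
    rw [derivAlong_eq_fderiv hf hy, coordRep_tangent x Y hy]
    rfl
  refine (vderiv_eq (h5.congr_of_eventuallyEq h6.symm) v).trans ?_
  rw [derivAlong_eq_fderiv hf hx, vderiv_extChartAt_self, flatDeriv_tangent, add_comm]
  change fderiv ℝ (fderiv ℝ (f ∘ (extChartAt I x).symm)) (extChartAt I x x) v (coordRep V x Y x) +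
    _ = _
  rw [coordRep_tangent_self]
  rfl

variable [FiniteDimensional ℝ V] [T2Space N]

omit [I.Boundaryless] in
variable (I) in
lemma exists_function_eq_chart (x : N) (ℓ : V →L[ℝ] ℝ) :
    ∃ f : N → ℝ, ContMDiff I 𝓘(ℝ, ℝ) ∞ f ∧ ∀ᶠ y in 𝓝 x, f y = ℓ (extChartAt I x y) := by
  refine exists_contMDiff_eventuallyEq (f := fun y => ℓ (extChartAt I x y)) ?_
  filter_upwards [(chartAt H x).open_source.mem_nhds (mem_chart_source H x)] with y hy
  exact ℓ.contMDiff.contMDiffAt.comp y (contMDiffAt_extChartAt' hy)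

omit [I.Boundaryless] [FiniteDimensional ℝ V] [T2Space N] in
lemma derivAlong_of_eq_chart {x y : N} {f : N → ℝ} {ℓ : V →L[ℝ] ℝ}
    (hf : ∀ᶠ z in 𝓝 y, f z = ℓ (extChartAt I x z)) (hy : y ∈ (chartAt H x).source)
    (v : TangentSpace I y) :
    derivAlong I f y v = ℓ (vderiv I (extChartAt I x) y v) := by
  rw [derivAlong_congr hf]
  have h1 := HasMFDerivAt.comp y (ℓ.hasFDerivAt.hasMFDerivAt (x := extChartAt I x y))
    (mdifferentiableAt_extChartAt (I := I) hy).hasMFDerivAt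
  exact vderiv_eq h1 v

omit [I.Boundaryless] in
-- Linear functionals of the chart, extended to global functions by cutoffs, already separate
-- tangent vectors.
lemma tangent_eq_zero {x : N} {v : TangentSpace I x}
    (h : ∀ f : N → ℝ, ContMDiff I 𝓘(ℝ, ℝ) ∞ f → derivAlong I f x v = 0) : v = 0 := by
  refine (SeparatingDual.eq_zero_of_forall_dual_eq_zero (R := ℝ) (V := V) (x := v)) fun ℓ => ?_
  obtain ⟨f, hf, hfe⟩ := exists_function_eq_chart I x ℓ
  have := h f hf
  rwa [derivAlong_of_eq_chart hfe (mem_chart_source H x), vderiv_extChartAt_self] at this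

omit [I.Boundaryless] in
lemma tangent_ext {x : N} {v w : TangentSpace I x}
    (h : ∀ f : N → ℝ, ContMDiff I 𝓘(ℝ, ℝ) ∞ f → derivAlong I f x v = derivAlong I f x w) :
    v = w :=
  sub_eq_zero.1 <| tangent_eq_zero fun f hf => by rw [derivAlong_sub, h f hf, sub_self]

omit [FiniteDimensional ℝ V] [T2Space N] in
lemma contMDiff_derivAlong {f : N → ℝ} (hf : ContMDiff I 𝓘(ℝ, ℝ) ∞ f)
    {Y : ∀ y : N, TangentSpace I y} (hY : Y ∈ smoothSections I V (TangentSpace I (M := N))) :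
    ContMDiff I 𝓘(ℝ, ℝ) ∞ (fun y => derivAlong I f y (Y y)) := by
  intro x
  have hx := mem_chart_source H x
  have h1 := contDiffAt_comp_extChartAt_symm (x := x) hf (mem_extChartAt_target (I := I) x)
  have h2 : ContDiffAt ℝ ∞ (fderiv ℝ (f ∘ (extChartAt I x).symm)) (extChartAt I x x) :=
    h1.fderiv_right (by simp)
  have h3 := h2.contMDiffAt.comp x (contMDiffAt_extChartAt (I := I) (x := x) (n := ∞))
  have h4 := contMDiffAt_coordRep (hY x) (mem_baseSet_trivializationAt V (TangentSpace I) x)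
  refine (h3.clm_apply h4).congr_of_eventuallyEq ?_
  filter_upwards [(chartAt H x).open_source.mem_nhds hx] with y hy
  rw [derivAlong_eq_fderiv hf hy, coordRep_tangent x Y hy]
  rfl

/-- A vector field is smooth at `x` if the derivatives along it of the coordinate functions of the
chart at `x` are. -/
lemma contMDiffAt_vectorField {x : N} {Y : ∀ y : N, TangentSpace I y}
    (h : ∀ ℓ : V →L[ℝ] ℝ,
      ContMDiffAt I 𝓘(ℝ, ℝ) ∞ (fun y => ℓ (vderiv I (extChartAt I x) y (Y y))) x) :
    ContMDiffAt I (I.prod 𝓘(ℝ, V)) ∞ (fun y => TotalSpace.mk' V y (Y y)) x := by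
  refine contMDiffAt_section_of_coordRep (x := x) ?_ (mem_baseSet_trivializationAt _ _ x)
  let b := Module.finBasis ℝ V
  have h1 : ContMDiffAt I 𝓘(ℝ, V) ∞ (fun y => ∑ i,
      (LinearMap.toContinuousLinearMap (b.coord i)) (vderiv I (extChartAt I x) y (Y y)) • b i) x :=
    contMDiffAt_sum_smul fun i => h _
  refine h1.congr_of_eventuallyEq ?_
  filter_upwards [(chartAt H x).open_source.mem_nhds (mem_chart_source H x)] with y hy
  rw [coordRep_tangent x Y hy]
  exact (b.sum_repr _).symm

end Hessian

/-! ### The Lie bracket of vector fields. -/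

section LieVec

variable {V : Type*} [NormedAddCommGroup V] [NormedSpace ℝ V] {H : Type*} [TopologicalSpace H]
  {I : ModelWithCorners ℝ V H} {N : Type*} [TopologicalSpace N] [ChartedSpace H N]
  [IsManifold I ∞ N]

variable (I) in
/-- The Lie bracket of two vector fields at `x`, computed in the preferred chart at `x`. -/
noncomputable def lieVec (Y Z : ∀ y : N, TangentSpace I y) (x : N) : TangentSpace I x :=
  flatDeriv I V x Z (Y x) - flatDeriv I V x Y (Z x)

/-- The Hessian contributions to the two iterated derivatives cancel by symmetry. In particular the
definition in a chart gives the usual commutator of derivations. -/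
lemma derivAlong_lieVec [I.Boundaryless] {f : N → ℝ} (hf : ContMDiff I 𝓘(ℝ, ℝ) ∞ f)
    {Y Z : ∀ y : N, TangentSpace I y} (hY : Y ∈ smoothSections I V (TangentSpace I (M := N)))
    (hZ : Z ∈ smoothSections I V (TangentSpace I (M := N))) (x : N) :
    derivAlong I f x (lieVec I Y Z x) =
      derivAlong I (fun y => derivAlong I f y (Z y)) x (Y x) -
        derivAlong I (fun y => derivAlong I f y (Y y)) x (Z x) := by
  rw [derivAlong_derivAlong hf hZ, derivAlong_derivAlong hf hY, hessAt_symm hf, lieVec,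
    derivAlong_sub]
  ring

lemma lieVec_add_right {Y Z Z' : ∀ y : N, TangentSpace I y}
    (hZ : Z ∈ smoothSections I V (TangentSpace I (M := N)))
    (hZ' : Z' ∈ smoothSections I V (TangentSpace I (M := N))) (x : N) :
    lieVec I Y (Z + Z') x = lieVec I Y Z x + lieVec I Y Z' x := by
  simp only [lieVec, flatDeriv_add_section hZ hZ', Pi.add_apply, flatDeriv_add]
  abel

lemma lieVec_smul_right {f : N → ℝ} (hf : ContMDiff I 𝓘(ℝ, ℝ) ∞ f)
    {Y Z : ∀ y : N, TangentSpace I y}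
    (hZ : Z ∈ smoothSections I V (TangentSpace I (M := N))) (x : N) :
    lieVec I Y (f • Z) x = f x • lieVec I Y Z x + derivAlong I f x (Y x) • Z x := by
  simp only [lieVec, flatDeriv_smul_section hf hZ, Pi.smul_apply', flatDeriv_smul, smul_sub]
  abel

lemma lieVec_symm (Y Z : ∀ y : N, TangentSpace I y) (x : N) :
    lieVec I Y Z x = -lieVec I Z Y x := by
  simp only [lieVec]; abel

end LieVec

/-! ### Consequences of the Courant axioms other than the Jacobi identity. -/

section PreCourant

variable {V : Type*} [NormedAddCommGroup V] [NormedSpace ℝ V] {H : Type*} [TopologicalSpace H]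
  (I : ModelWithCorners ℝ V H) {N : Type*} [TopologicalSpace N] [ChartedSpace H N]
  [IsManifold I ∞ N]
  (F : Type*) [NormedAddCommGroup F] [NormedSpace ℝ F]

/-- A Courant algebroid structure whose bracket need not satisfy the Jacobi identity. -/
structure PreCourant (E : N → Type*)
    [∀ x, AddCommGroup (E x)] [∀ x, Module ℝ (E x)] [∀ x, TopologicalSpace (E x)]
    [TopologicalSpace (TotalSpace F E)] [FiberBundle F E] where
  anchor : ∀ x, E x →ₗ[ℝ] TangentSpace I x
  anchor_smooth : ∀ σ ∈ smoothSections I F E,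
    (fun x => anchor x (σ x)) ∈ smoothSections I V (TangentSpace I (M := N))
  pairing : ∀ x, E x →ₗ[ℝ] E x →ₗ[ℝ] ℝ
  pairing_smooth : ∀ σ ∈ smoothSections I F E, ∀ τ ∈ smoothSections I F E,
    ContMDiff I 𝓘(ℝ, ℝ) ∞ (fun x => pairing x (σ x) (τ x))
  pairing_symm : ∀ x u v, pairing x u v = pairing x v u
  pairing_nondegenerate : ∀ x u, (∀ v, pairing x u v = 0) → u = 0
  bracket : (∀ x, E x) → (∀ x, E x) → ∀ x, E x
  bracket_smooth : ∀ σ ∈ smoothSections I F E, ∀ τ ∈ smoothSections I F E,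
    bracket σ τ ∈ smoothSections I F E
  bracket_add_left : ∀ σ ∈ smoothSections I F E, ∀ σ' ∈ smoothSections I F E,
    ∀ τ ∈ smoothSections I F E, bracket (σ + σ') τ = bracket σ τ + bracket σ' τ
  bracket_add_right : ∀ σ ∈ smoothSections I F E, ∀ τ ∈ smoothSections I F E,
    ∀ τ' ∈ smoothSections I F E, bracket σ (τ + τ') = bracket σ τ + bracket σ τ'
  bracket_smul_left : ∀ c : ℝ, ∀ σ ∈ smoothSections I F E, ∀ τ ∈ smoothSections I F E,
    bracket (c • σ) τ = c • bracket σ τ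
  bracket_smul_right : ∀ c : ℝ, ∀ σ ∈ smoothSections I F E, ∀ τ ∈ smoothSections I F E,
    bracket σ (c • τ) = c • bracket σ τ
  invariance : ∀ σ₁ ∈ smoothSections I F E, ∀ σ₂ ∈ smoothSections I F E,
    ∀ σ₃ ∈ smoothSections I F E, ∀ x,
    derivAlong I (fun y => pairing y (σ₂ y) (σ₃ y)) x (anchor x (σ₁ x)) =
      pairing x (bracket σ₁ σ₂ x) (σ₃ x) + pairing x (σ₂ x) (bracket σ₁ σ₃ x)
  symmetric_part : ∀ σ₁ ∈ smoothSections I F E, ∀ σ₂ ∈ smoothSections I F E, ∀ x, ∀ u : E x,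
    pairing x (bracket σ₁ σ₂ x + bracket σ₂ σ₁ x) u =
      derivAlong I (fun y => pairing y (σ₁ y) (σ₂ y)) x (anchor x u)

variable {I F} {E : N → Type*}
  [∀ x, AddCommGroup (E x)] [∀ x, Module ℝ (E x)] [∀ x, TopologicalSpace (E x)]
  [TopologicalSpace (TotalSpace F E)] [FiberBundle F E]

/-- Forget the Jacobi identity. -/
def CourantAlgebroid.toPre (C : CourantAlgebroid I F E) : PreCourant I F E where
  anchor := C.anchor
  anchor_smooth := C.anchor_smooth
  pairing := C.pairing
  pairing_smooth := C.pairing_smooth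
  pairing_symm := C.pairing_symm
  pairing_nondegenerate := C.pairing_nondegenerate
  bracket := C.bracket
  bracket_smooth := C.bracket_smooth
  bracket_add_left := C.bracket_add_left
  bracket_add_right := C.bracket_add_right
  bracket_smul_left := C.bracket_smul_left
  bracket_smul_right := C.bracket_smul_right
  invariance := C.invariance
  symmetric_part := C.symmetric_part

namespace PreCourant

variable [VectorBundle ℝ F E] [ContMDiffVectorBundle ∞ F E I] [I.Boundaryless]
  [FiniteDimensional ℝ V] [T2Space N] [FiniteDimensional ℝ F] (C : PreCourant I F E)

lemma ext_pairing {x : N} {u v : E x} (h : ∀ w, C.pairing x u w = C.pairing x v w) : u = v :=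
  eq_of_pairing (C.pairing_nondegenerate x) h

variable {σ τ ρ : ∀ x, E x} (hσ : σ ∈ smoothSections I F E) (hτ : τ ∈ smoothSections I F E)
  (hρ : ρ ∈ smoothSections I F E) {f : N → ℝ} (hf : ContMDiff I 𝓘(ℝ, ℝ) ∞ f)

/-- The derivative of `f` along the anchor of `σ`. -/
noncomputable def anchorDeriv (σ : ∀ x, E x) (f : N → ℝ) (x : N) : ℝ :=
  derivAlong I f x (C.anchor x (σ x))

include hσ hf in
lemma contMDiff_anchorDeriv : ContMDiff I 𝓘(ℝ, ℝ) ∞ (C.anchorDeriv σ f) :=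
  contMDiff_derivAlong hf (C.anchor_smooth σ hσ)

include hσ hτ in
lemma mdifferentiableAt_pairing (x : N) :
    MDifferentiableAt I 𝓘(ℝ, ℝ) (fun y => C.pairing y (σ y) (τ y)) x :=
  (C.pairing_smooth σ hσ τ hτ).mdifferentiableAt (by simp)

include hσ hτ hf in
-- The Leibniz rule is not among the axioms. It follows from `invariance` for `f • τ` and for `τ`,
-- tested against an arbitrary section, by nondegeneracy.
lemma leibniz_right (x : N) :
    C.bracket σ (f • τ) x = f x • C.bracket σ τ x + C.anchorDeriv σ f x • τ x := by
  refine C.ext_pairing fun w => ?_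
  obtain ⟨ρ, hρ, rfl⟩ := exists_section_eq I F x w
  have h1 := C.invariance σ hσ (f • τ) (smoothSections_smul hf hτ) ρ hρ x
  have h2 := C.invariance σ hσ τ hτ ρ hρ x
  have h3 : (fun y => C.pairing y ((f • τ) y) (ρ y)) =
      fun y => f y * C.pairing y (τ y) (ρ y) := by
    ext y; simp
  rw [h3, derivAlong_fun_mul (hf.mdifferentiableAt (by simp))
    (C.mdifferentiableAt_pairing hτ hρ x), h2] at h1
  simp only [Pi.smul_apply', map_smul, LinearMap.smul_apply, smul_eq_mul, map_add,
    LinearMap.add_apply, anchorDeriv] at h1 ⊢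
  linarith

include hσ hτ hf in
lemma bracket_fun_smul_right :
    C.bracket σ (f • τ) = f • C.bracket σ τ + C.anchorDeriv σ f • τ :=
  funext fun x => C.leibniz_right hσ hτ hf x

include hσ hτ hf in
-- Exchange the arguments by `symmetric_part` and use `leibniz_right`. The last term, absent for Lie
-- algebroids, comes from differentiating the factor `f` in the pairing of `f • σ` with `τ`.
lemma leibniz_left_pairing (x : N) (u : E x) :
    C.pairing x (C.bracket (f • σ) τ x) u =
      f x * C.pairing x (C.bracket σ τ x) u - C.anchorDeriv τ f x * C.pairing x (σ x) u +
        C.pairing x (σ x) (τ x) * derivAlong I f x (C.anchor x u) := by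
  have h1 := C.symmetric_part (f • σ) (smoothSections_smul hf hσ) τ hτ x u
  have h2 := C.symmetric_part σ hσ τ hτ x u
  have h3 : (fun y => C.pairing y ((f • σ) y) (τ y)) =
      fun y => f y * C.pairing y (σ y) (τ y) := by
    ext y; simp
  rw [h3, derivAlong_fun_mul (hf.mdifferentiableAt (by simp))
    (C.mdifferentiableAt_pairing hσ hτ x), ← h2, C.leibniz_right hτ hσ hf] at h1
  simp only [map_smul, LinearMap.smul_apply, smul_eq_mul, map_add,
    LinearMap.add_apply] at h1 ⊢
  linarith

lemma exists_grad (f : N → ℝ) (x : N) :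
    ∃ u, ∀ v, C.pairing x u v = derivAlong I f x (C.anchor x v) := by
  have := VectorBundle.finiteDimensional ℝ F E x
  exact exists_pairing_eq (C.pairing_nondegenerate x)
    (φ := { toFun := fun v => derivAlong I f x (C.anchor x v)
            map_add' := fun u v => by rw [map_add, derivAlong_add]
            map_smul' := fun c v => by rw [map_smul, derivAlong_smul]; rfl })

/-- The section `a^* df`. -/
noncomputable def grad (f : N → ℝ) (x : N) : E x := (C.exists_grad f x).choose

lemma pairing_grad (f : N → ℝ) (x : N) (u : E x) :
    C.pairing x (C.grad f x) u = derivAlong I f x (C.anchor x u) :=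
  (C.exists_grad f x).choose_spec u

include hf in
lemma grad_mem : C.grad f ∈ smoothSections I F E := fun x =>
  contMDiffAt_of_pairing C.pairing_smooth (C.pairing_nondegenerate x) fun σ hσ => by
    simp only [pairing_grad]
    exact contMDiff_derivAlong hf (C.anchor_smooth σ hσ) x

include hσ hτ in
lemma bracket_add_bracket_symm :
    C.bracket σ τ + C.bracket τ σ = C.grad (fun y => C.pairing y (σ y) (τ y)) := by
  ext x
  refine C.ext_pairing fun w => ?_
  rw [pairing_grad, Pi.add_apply, C.symmetric_part σ hσ τ hτ]

/-- The failure of the anchor to preserve brackets. -/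
noncomputable def anchorDefect (σ τ : ∀ x, E x) (x : N) : TangentSpace I x :=
  C.anchor x (C.bracket σ τ x) -
    lieVec I (fun y => C.anchor y (σ y)) (fun y => C.anchor y (τ y)) x

include hσ hτ hρ in
lemma anchorDefect_add_right (x : N) :
    C.anchorDefect σ (τ + ρ) x = C.anchorDefect σ τ x + C.anchorDefect σ ρ x := by
  have h : (fun y => C.anchor y ((τ + ρ) y)) =
      (fun y => C.anchor y (τ y)) + fun y => C.anchor y (ρ y) := by
    ext y : 1; simp
  rw [anchorDefect, h, lieVec_add_right (C.anchor_smooth τ hτ) (C.anchor_smooth ρ hρ),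
    C.bracket_add_right σ hσ τ hτ ρ hρ, Pi.add_apply, map_add, anchorDefect, anchorDefect]
  abel

include hσ hτ hf in
-- The bracket on `E` and the Lie bracket of vector fields contribute the same derivative of `f`,
-- and these cancel.
lemma anchorDefect_smul_right (x : N) :
    C.anchorDefect σ (f • τ) x = f x • C.anchorDefect σ τ x := by
  have h : (fun y => C.anchor y ((f • τ) y)) =
      f • (fun y => C.anchor y (τ y)) := by
    ext y : 1; simp
  rw [anchorDefect, h, lieVec_smul_right hf (C.anchor_smooth τ hτ),
    C.leibniz_right hσ hτ hf, map_add, map_smul, map_smul, anchorDefect, anchorDeriv, smul_sub]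
  abel

include hσ hτ in
-- Lie brackets of vector fields are skew, so only the symmetric part of the bracket on `E`
-- survives. This transfers tensoriality to the first argument as soon as the anchor kills
-- gradients.
lemma anchorDefect_add_symm (x : N) :
    C.anchorDefect σ τ x + C.anchorDefect τ σ x =
      C.anchor x (C.grad (fun y => C.pairing y (σ y) (τ y)) x) := by
  rw [← C.bracket_add_bracket_symm hσ hτ, Pi.add_apply, map_add, anchorDefect, anchorDefect,
    lieVec_symm]
  abel

/-- The anchor preserves brackets if this holds for sections that are constant near `x`, and if
the anchor vanishes on gradients. -/
theorem anchorDefect_eq_zero {S : Set (∀ x, E x)} (hS : S ⊆ smoothSections I F E)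
    {x : N} (hgrad : ∀ f : N → ℝ, ContMDiff I 𝓘(ℝ, ℝ) ∞ f → C.anchor x (C.grad f x) = 0)
    (hflat : ∀ u : F, ∃ σ ∈ S, IsFlatAt x σ u)
    (h0 : ∀ σ ∈ S, ∀ τ ∈ S, C.anchorDefect σ τ x = 0)
    (hσ : σ ∈ smoothSections I F E) (hτ : τ ∈ smoothSections I F E) :
    C.anchorDefect σ τ x = 0 := by
  -- Tensoriality is directly available only in the second argument; vanishing passes to the
  -- exchanged arguments by `hgrad`.
  have hsymm : ∀ σ ∈ smoothSections I F E, ∀ τ ∈ smoothSections I F E,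
      C.anchorDefect σ τ x = 0 → C.anchorDefect τ σ x = 0 := fun σ hσ τ hτ h => by
    have := C.anchorDefect_add_symm hσ hτ x
    rwa [h, hgrad _ (C.pairing_smooth σ hσ τ hτ), zero_add] at this
  have hext : ∀ σ ∈ smoothSections I F E, (∀ τ ∈ S, C.anchorDefect σ τ x = 0) →
      ∀ τ ∈ smoothSections I F E, C.anchorDefect σ τ x = 0 := fun σ hσ h =>
    tensorial_eq_zero (fun τ hτ ρ hρ => C.anchorDefect_add_right hσ hτ hρ x)
      (fun f hf τ hτ => C.anchorDefect_smul_right hσ hτ hf x)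
      fun u => by
        obtain ⟨τ, hτ, hu⟩ := hflat u
        exact ⟨τ, hS hτ, hu, h τ hτ⟩
  exact hext σ hσ (fun τ hτ => hsymm _ (hS hτ) _ hσ
    (hext τ (hS hτ) (fun ρ hρ => h0 τ hτ ρ hρ) σ hσ)) τ hτ

/-- The Jacobiator of the bracket. -/
def jacobiator (σ τ ρ : ∀ x, E x) (x : N) : E x :=
  C.bracket σ (C.bracket τ ρ) x - C.bracket (C.bracket σ τ) ρ x - C.bracket τ (C.bracket σ ρ) x

include hσ hτ hρ in
lemma jacobiator_add_right {ρ' : ∀ x, E x} (hρ' : ρ' ∈ smoothSections I F E) (x : N) :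
    C.jacobiator σ τ (ρ + ρ') x = C.jacobiator σ τ ρ x + C.jacobiator σ τ ρ' x := by
  simp only [jacobiator]
  rw [C.bracket_add_right τ hτ ρ hρ ρ' hρ', C.bracket_add_right σ hσ ρ hρ ρ' hρ',
    C.bracket_add_right _ (C.bracket_smooth σ hσ τ hτ) ρ hρ ρ' hρ',
    C.bracket_add_right σ hσ _ (C.bracket_smooth _ hτ _ hρ) _ (C.bracket_smooth _ hτ _ hρ'),
    C.bracket_add_right τ hτ _ (C.bracket_smooth _ hσ _ hρ) _ (C.bracket_smooth _ hσ _ hρ')]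
  simp only [Pi.add_apply]
  abel

include hσ hτ hρ hf in
-- Terms with one derivative of `f` multiplying a bracket cancel; the second derivatives combine
-- into the commutator of the anchors acting on `f`, to be compared with the anchor of the bracket.
-- The formula serves in both directions: the Jacobi identity forces the defect to vanish, and a
-- vanishing defect makes the Jacobiator tensorial.
lemma jacobiator_smul_right (x : N) :
    C.jacobiator σ τ (f • ρ) x =
      f x • C.jacobiator σ τ ρ x - derivAlong I f x (C.anchorDefect σ τ x) • ρ x := by
  have hgen : ∀ σ ∈ smoothSections I F E, ∀ τ ∈ smoothSections I F E,
      C.bracket σ (C.bracket τ (f • ρ)) x = f x • C.bracket σ (C.bracket τ ρ) x +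
        C.anchorDeriv σ f x • C.bracket τ ρ x + (C.anchorDeriv τ f x • C.bracket σ ρ x +
        C.anchorDeriv σ (C.anchorDeriv τ f) x • ρ x) := fun σ hσ τ hτ => by
    have h1 := C.contMDiff_anchorDeriv hτ hf
    have h2 := C.bracket_smooth τ hτ ρ hρ
    rw [C.bracket_fun_smul_right hτ hρ hf,
      C.bracket_add_right σ hσ _ (smoothSections_smul hf h2) _ (smoothSections_smul h1 hρ),
      Pi.add_apply, C.leibniz_right hσ h2 hf, C.leibniz_right hσ hρ h1]
  have h3 : derivAlong I f x (C.anchorDefect σ τ x) = C.anchorDeriv (C.bracket σ τ) f x -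
      (C.anchorDeriv σ (C.anchorDeriv τ f) x - C.anchorDeriv τ (C.anchorDeriv σ f) x) := by
    rw [anchorDefect, derivAlong_sub,
      derivAlong_lieVec hf (C.anchor_smooth σ hσ) (C.anchor_smooth τ hτ)]
    rfl
  rw [h3, jacobiator, hgen σ hσ τ hτ, hgen τ hτ σ hσ,
    C.leibniz_right (C.bracket_smooth σ hσ τ hτ) hρ hf, jacobiator]
  module

section Hom

variable (hhom : ∀ σ ∈ smoothSections I F E, ∀ τ ∈ smoothSections I F E, ∀ x,
  C.anchorDefect σ τ x = 0)

include hhom hσ hτ hf in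
lemma anchorDeriv_bracket (x : N) : C.anchorDeriv (C.bracket σ τ) f x =
      C.anchorDeriv σ (C.anchorDeriv τ f) x - C.anchorDeriv τ (C.anchorDeriv σ f) x := by
  have := hhom σ hσ τ hτ x
  rw [anchorDefect, sub_eq_zero] at this
  rw [anchorDeriv, this, derivAlong_lieVec hf (C.anchor_smooth σ hσ) (C.anchor_smooth τ hτ)]
  rfl

include hhom hσ hf in
-- Test against `ρ` by `invariance`. The term in which the anchor of the bracket of `σ` and `ρ` acts
-- on `f` expands into a commutator because the anchor preserves brackets.
lemma bracket_grad : C.bracket σ (C.grad f) = C.grad (C.anchorDeriv σ f) := by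
  ext x
  refine C.ext_pairing fun w => ?_
  obtain ⟨ρ, hρ, rfl⟩ := exists_section_eq I F x w
  have h1 := C.invariance σ hσ _ (C.grad_mem hf) ρ hρ x
  simp only [pairing_grad] at h1 ⊢
  have h2 : derivAlong I f x (C.anchor x (C.bracket σ ρ x)) =
      derivAlong I (fun y => derivAlong I f y (C.anchor y (ρ y))) x (C.anchor x (σ x)) -
        derivAlong I (C.anchorDeriv σ f) x (C.anchor x (ρ x)) :=
    C.anchorDeriv_bracket hσ hρ hf hhom x
  linarith

include hhom hσ hf in
-- The symmetrised bracket of a gradient with `σ` is the gradient of `C.anchorDeriv σ f`, and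
-- `bracket_grad` already accounts for all of it.
lemma grad_bracket : C.bracket (C.grad f) σ = 0 := by
  have h1 := C.bracket_add_bracket_symm (C.grad_mem hf) hσ
  rw [C.bracket_grad hσ hf hhom] at h1
  simp only [pairing_grad] at h1
  exact add_eq_right.1 h1

include hhom hσ hτ hρ in
-- After symmetrising in the last two arguments, each inner or outer symmetrised bracket is a
-- gradient. These gradients add up to zero by `bracket_grad` and by `invariance`, differentiated
-- once more.
lemma jacobiator_symm_right (x : N) :
    C.jacobiator σ τ ρ x = -C.jacobiator σ ρ τ x := by
  have hb := C.bracket_smooth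
  have h1 : C.bracket σ (C.bracket τ ρ) + C.bracket σ (C.bracket ρ τ) =
      C.grad (C.anchorDeriv σ fun y => C.pairing y (τ y) (ρ y)) := by
    rw [← C.bracket_add_right σ hσ _ (hb τ hτ ρ hρ) _ (hb ρ hρ τ hτ),
      C.bracket_add_bracket_symm hτ hρ, C.bracket_grad hσ (C.pairing_smooth τ hτ ρ hρ) hhom]
  have h2 := congrFun (C.bracket_add_bracket_symm (hb σ hσ τ hτ) hρ) x
  have h3 := congrFun (C.bracket_add_bracket_symm hτ (hb σ hσ ρ hρ)) x
  have h4 : C.grad (C.anchorDeriv σ fun y => C.pairing y (τ y) (ρ y)) x =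
      C.grad (fun y => C.pairing y (C.bracket σ τ y) (ρ y)) x +
        C.grad (fun y => C.pairing y (τ y) (C.bracket σ ρ y)) x := by
    refine C.ext_pairing fun w => ?_
    simp only [map_add, LinearMap.add_apply, pairing_grad]
    rw [← derivAlong_fun_add (C.mdifferentiableAt_pairing (hb σ hσ τ hτ) hρ x)
      (C.mdifferentiableAt_pairing hτ (hb σ hσ ρ hρ) x)]
    refine congrArg (fun g => derivAlong I g x _) (funext fun y => ?_)
    exact C.invariance σ hσ τ hτ ρ hρ y
  have h5 := congrFun h1 x
  rw [h4, ← h2, ← h3] at h5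
  simp only [Pi.add_apply] at h5
  simp only [jacobiator]
  rw [eq_neg_iff_add_eq_zero]
  calc _ = (C.bracket σ (C.bracket τ ρ) x + C.bracket σ (C.bracket ρ τ) x) -
        (C.bracket (C.bracket σ τ) ρ x + C.bracket ρ (C.bracket σ τ) x +
        (C.bracket τ (C.bracket σ ρ) x + C.bracket (C.bracket σ ρ) τ x)) := by abel
    _ = 0 := by rw [h5, sub_self]

include hhom hσ hτ hρ in
-- Symmetrising in the first two arguments leaves only the left bracket with a gradient, which
-- vanishes by `grad_bracket`.
lemma jacobiator_symm_left (x : N) :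
    C.jacobiator σ τ ρ x = -C.jacobiator τ σ ρ x := by
  have hb := C.bracket_smooth
  have h1 : C.bracket (C.bracket σ τ) ρ x + C.bracket (C.bracket τ σ) ρ x = 0 := by
    rw [← Pi.add_apply, ← C.bracket_add_left _ (hb σ hσ τ hτ) _ (hb τ hτ σ hσ) ρ hρ,
      C.bracket_add_bracket_symm hσ hτ, C.grad_bracket hρ (C.pairing_smooth σ hσ τ hτ) hhom]
    rfl
  simp only [jacobiator]
  rw [eq_neg_iff_add_eq_zero]
  calc _ = -(C.bracket (C.bracket σ τ) ρ x + C.bracket (C.bracket τ σ) ρ x) := by abel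
    _ = 0 := by rw [h1, neg_zero]

include hhom in
/-- The Jacobi identity holds if it holds for sections that are constant near `x`. -/
theorem jacobiator_eq_zero {S : Set (∀ x, E x)} (hS : S ⊆ smoothSections I F E)
    {x : N} (hflat : ∀ u : F, ∃ σ ∈ S, IsFlatAt x σ u)
    (h0 : ∀ σ ∈ S, ∀ τ ∈ S, ∀ ρ ∈ S, C.jacobiator σ τ ρ x = 0)
    (hσ : σ ∈ smoothSections I F E) (hτ : τ ∈ smoothSections I F E)
    (hρ : ρ ∈ smoothSections I F E) :
    C.jacobiator σ τ ρ x = 0 := by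
  have hext : ∀ σ ∈ smoothSections I F E, ∀ τ ∈ smoothSections I F E,
      (∀ ρ ∈ S, C.jacobiator σ τ ρ x = 0) →
      ∀ ρ ∈ smoothSections I F E, C.jacobiator σ τ ρ x = 0 := fun σ hσ τ hτ h =>
    tensorial_eq_zero (fun ρ hρ ρ' hρ' => C.jacobiator_add_right hσ hτ hρ hρ' x)
      (fun f hf ρ hρ => by
        rw [C.jacobiator_smul_right hσ hτ hρ hf, hhom σ hσ τ hτ, derivAlong_zero, zero_smul,
          sub_zero])
      fun u => by
        obtain ⟨ρ, hρ, hu⟩ := hflat u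
        exact ⟨ρ, hS hρ, hu, h ρ hρ⟩
  -- Tensoriality in the last slot frees the last argument from `S`. Symmetry in the last two slots
  -- then frees the second argument, and moving an element of `S` to the first slot frees the
  -- remaining one.
  have h1 : ∀ σ ∈ S, ∀ τ ∈ smoothSections I F E, ∀ ρ ∈ smoothSections I F E,
      C.jacobiator σ τ ρ x = 0 := fun σ hσ τ hτ => by
    refine hext σ (hS hσ) τ hτ fun ρ hρ => ?_
    rw [C.jacobiator_symm_right (hS hσ) hτ (hS hρ) hhom,
      hext σ (hS hσ) ρ (hS hρ) (fun ρ' hρ' => h0 σ hσ ρ hρ ρ' hρ') τ hτ, neg_zero]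
  refine hext σ hσ τ hτ (fun κ hκ => ?_) ρ hρ
  rw [C.jacobiator_symm_right hσ hτ (hS hκ) hhom, C.jacobiator_symm_left hσ (hS hκ) hτ hhom,
    h1 κ hκ σ hσ τ hτ, neg_zero, neg_zero]

end Hom

/-- The bracket of two sections at `x`, in terms of their derivatives in the preferred
trivialization at `x`, and of the bracket of sections with the same value at `x` that are constant
near `x`. -/
theorem pairing_bracket_eq {x : N} {σ₀ τ₀ : ∀ x, E x} {u v : F}
    (hσ : σ ∈ smoothSections I F E) (hτ : τ ∈ smoothSections I F E)
    (hσ₀ : σ₀ ∈ smoothSections I F E) (hτ₀ : τ₀ ∈ smoothSections I F E)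
    (hu : IsFlatAt x σ₀ u) (hv : IsFlatAt x τ₀ v) (h1 : σ₀ x = σ x) (h2 : τ₀ x = τ x) (w : E x) :
    C.pairing x (C.bracket σ τ x) w =
      C.pairing x (flatDeriv I F x τ (C.anchor x (σ x))) w -
        C.pairing x (flatDeriv I F x σ (C.anchor x (τ x))) w +
        C.pairing x (flatDeriv I F x σ (C.anchor x w)) (τ x) +
        C.pairing x (C.bracket σ₀ τ₀ x) w := by
  let T : (∀ x, E x) → (∀ x, E x) → ℝ := fun σ τ =>
    C.pairing x (C.bracket (constSection I E x (coordRep F x σ x))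
      (constSection I E x (coordRep F x τ x)) x) w
  -- The three derivative terms reproduce the Leibniz rules of the bracket, so that `P` is tensorial
  -- in `τ` and, for `τ` flat at `x`, also in `σ`.
  let P : (∀ x, E x) → (∀ x, E x) → ℝ := fun σ τ => C.pairing x (C.bracket σ τ x) w -
      (C.pairing x (flatDeriv I F x τ (C.anchor x (σ x))) w -
        C.pairing x (flatDeriv I F x σ (C.anchor x (τ x))) w +
        C.pairing x (flatDeriv I F x σ (C.anchor x w)) (τ x) + T σ τ)
  have hx := mem_baseSet_trivializationAt F E x
  have hc : ∀ u : F, constSection I E x u ∈ smoothSections I F E := constSection_mem x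
  have key : ∀ σ ∈ smoothSections I F E, ∀ τ ∈ smoothSections I F E, P σ τ = 0 := by
    intro σ hσ
    refine tensorial_eq_zero (x := x) (fun τ hτ ρ hρ => ?_) (fun f hf τ hτ => ?_) fun v =>
      ⟨_, hc v, constSection_isFlatAt x v, ?_⟩
    · simp only [P, T]
      rw [C.bracket_add_right σ hσ τ hτ ρ hρ, flatDeriv_add_section hτ hρ, coordRep_add x _ _ hx,
        constSection_add, C.bracket_add_right _ (hc _) _ (hc _) _ (hc _)]
      simp only [Pi.add_apply, map_add, LinearMap.add_apply, flatDeriv_add]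
      ring
    · simp only [P, T]
      rw [C.leibniz_right hσ hτ hf, flatDeriv_smul_section hf hτ, coordRep_smul x _ _ hx,
        constSection_smul, C.bracket_smul_right _ _ (hc _) _ (hc _)]
      simp only [Pi.smul_apply', Pi.smul_apply, map_add, map_smul, LinearMap.add_apply,
        LinearMap.smul_apply, flatDeriv_smul, smul_eq_mul, anchorDeriv]
      ring
    revert σ
    refine tensorial_eq_zero (x := x) (fun σ hσ ρ hρ => ?_) (fun f hf σ hσ => ?_) fun u =>
      ⟨_, hc u, constSection_isFlatAt x u, ?_⟩
    · simp only [P, T]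
      rw [C.bracket_add_left σ hσ ρ hρ _ (hc v), flatDeriv_add_section hσ hρ,
        flatDeriv_add_section hσ hρ, coordRep_add x _ _ hx,
        constSection_add, C.bracket_add_left _ (hc _) _ (hc _) _ (hc _)]
      simp only [Pi.add_apply, map_add, LinearMap.add_apply, flatDeriv_add]
      ring
    · simp only [P, T]
      rw [C.leibniz_left_pairing hσ (hc v) hf, flatDeriv_smul_section hf hσ,
        flatDeriv_smul_section hf hσ, coordRep_smul x _ _ hx,
        constSection_smul, C.bracket_smul_left _ _ (hc _) _ (hc _)]
      simp only [Pi.smul_apply', Pi.smul_apply, map_add, map_smul, LinearMap.add_apply,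
        LinearMap.smul_apply, flatDeriv_smul, smul_eq_mul, anchorDeriv]
      ring
    · have hcr : ∀ u : F, coordRep F x (constSection I E x u) x = u := fun u =>
        (constSection_isFlatAt (I := I) (E := E) x u).self_of_nhds
      simp only [P, T]
      simp only [(constSection_isFlatAt x _).flatDeriv_eq_zero, hcr, map_zero,
        LinearMap.zero_apply]
      ring
  -- Both pairs of sections have the same values at `x`, hence the same `T`; for `σ₀`, `τ₀` the
  -- derivative terms vanish, which identifies `T` with the bracket of the given flat sections.
  have e1 := key σ hσ τ hτ
  have e2 := key σ₀ hσ₀ τ₀ hτ₀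
  have e3 : T σ₀ τ₀ = T σ τ := by
    simp only [T]
    rw [(coordRep_eq_iff x σ₀ σ hx).2 h1, (coordRep_eq_iff x τ₀ τ hx).2 h2]
  simp only [P, e3, hu.flatDeriv_eq_zero, hv.flatDeriv_eq_zero, map_zero,
    LinearMap.zero_apply] at e2
  simp only [P] at e1
  linarith

end PreCourant

namespace CourantAlgebroid

variable [VectorBundle ℝ F E] [ContMDiffVectorBundle ∞ F E I] [I.Boundaryless]
  [FiniteDimensional ℝ V] [T2Space N] [FiniteDimensional ℝ F] (C : CourantAlgebroid I F E)

/-- By the Jacobi identity both Jacobiators in `jacobiator_smul_right` vanish, so the defect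
annihilates every function times a section `ρ`; choose `ρ` nonzero at `x`. -/
lemma anchorDefect_eq_zero {σ τ : ∀ x, E x} (hσ : σ ∈ smoothSections I F E)
    (hτ : τ ∈ smoothSections I F E) (x : N) : C.toPre.anchorDefect σ τ x = 0 := by
  have hj : ∀ ρ ∈ smoothSections I F E, ∀ x, C.toPre.jacobiator σ τ ρ x = 0 := fun ρ hρ x => by
    have := congrFun (C.jacobi σ hσ τ hτ ρ hρ) x
    simp only [Pi.add_apply] at this
    simp only [PreCourant.jacobiator, toPre]
    rw [this]
    abel
  -- In rank zero there is no nonzero section to test with. There `τ` equals zero times itself, and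
  -- tensoriality gives the claim.
  rcases subsingleton_or_nontrivial (E x) with h | h
  · have hE : ∀ y, Subsingleton (E y) := fun y =>
      ((VectorBundle.continuousLinearEquivAt ℝ F E y).toEquiv.trans
        (VectorBundle.continuousLinearEquivAt ℝ F E x).symm.toEquiv).subsingleton
    have h0 : ∀ σ : ∀ x, E x, (fun y => C.anchor y (σ y)) = 0 := fun σ => by
      ext y : 1
      rw [Subsingleton.elim (σ y) 0, map_zero]
      rfl
    have h1 := C.toPre.anchorDefect_smul_right hσ hτ (contMDiff_const (c := (0 : ℝ))) x
    have h2 : ((fun _ : N => (0 : ℝ)) • τ) = τ := by ext y; exact Subsingleton.elim _ _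
    rwa [h2, zero_smul] at h1
  · obtain ⟨u, hu⟩ := exists_ne (0 : E x)
    obtain ⟨ρ, hρ, rfl⟩ := exists_section_eq I F x u
    refine tangent_eq_zero fun f hf => ?_
    have h1 := C.toPre.jacobiator_smul_right hσ hτ hρ hf x
    rw [hj _ (smoothSections_smul hf hρ), hj ρ hρ, smul_zero, zero_sub, eq_comm, neg_eq_zero,
      smul_eq_zero] at h1
    exact h1.resolve_right hu

/-- Since the defect vanishes, the anchor kills gradients of functions of the form ⟨σ, τ⟩. Replacing
`σ` by `f • σ` and applying the product rule isolates the gradient of `f` with coefficient ⟨σ, τ⟩ at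
`x`. If the gradient of `f` is nonzero at `x`, take it as the value of `σ` and choose `τ` so that
this coefficient is nonzero. -/
lemma anchor_grad {f : N → ℝ} (hf : ContMDiff I 𝓘(ℝ, ℝ) ∞ f) (x : N) :
    C.anchor x (C.toPre.grad f x) = 0 := by
  by_cases h : ∀ v, C.pairing x (C.toPre.grad f x) v = 0
  · rw [C.pairing_nondegenerate x _ h, map_zero]
  push Not at h
  obtain ⟨v, hv⟩ := h
  obtain ⟨σ, hσ, h1⟩ := exists_section_eq I F x (C.toPre.grad f x)
  obtain ⟨τ, hτ, rfl⟩ := exists_section_eq I F x v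
  rw [← h1] at hv
  have h0 : ∀ σ ∈ smoothSections I F E,
      C.anchor x (C.toPre.grad (fun y => C.toPre.pairing y (σ y) (τ y)) x) = 0 := fun σ hσ => by
    have := C.toPre.anchorDefect_add_symm hσ hτ x
    rw [C.anchorDefect_eq_zero hσ hτ, C.anchorDefect_eq_zero hτ hσ, add_zero] at this
    exact this.symm
  have h2 : C.toPre.grad (fun y => C.toPre.pairing y ((f • σ) y) (τ y)) x =
      f x • C.toPre.grad (fun y => C.toPre.pairing y (σ y) (τ y)) x +
        C.toPre.pairing x (σ x) (τ x) • C.toPre.grad f x := by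
    refine C.toPre.ext_pairing fun w => ?_
    have h3 : (fun y => C.toPre.pairing y ((f • σ) y) (τ y)) =
        fun y => f y * C.toPre.pairing y (σ y) (τ y) := by
      ext y; simp
    rw [PreCourant.pairing_grad, h3, derivAlong_fun_mul (hf.mdifferentiableAt (by simp))
      (C.toPre.mdifferentiableAt_pairing hσ hτ x), map_add, map_smul, map_smul,
      LinearMap.add_apply, LinearMap.smul_apply, LinearMap.smul_apply, PreCourant.pairing_grad,
      PreCourant.pairing_grad, smul_eq_mul, smul_eq_mul, mul_comm (derivAlong I f x _)]
  have h4 := h0 _ (smoothSections_smul hf hσ)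
  rw [h2, map_add, map_smul, map_smul, h0 σ hσ, smul_zero, zero_add, smul_eq_zero] at h4
  exact h4.resolve_left hv

end CourantAlgebroid

end PreCourant

/-! ### Functions and vector fields on `TM`. -/

section TangentBundleFunctions

variable {V : Type*} [NormedAddCommGroup V] [NormedSpace ℝ V] {H : Type*} [TopologicalSpace H]
  {I : ModelWithCorners ℝ V H} {M : Type*} [TopologicalSpace M] [ChartedSpace H M]
  [IsManifold I ∞ M]

instance instT2SpaceTangentBundle [T2Space M] : T2Space (TangentBundle I M) := by
  refine ⟨fun X Y hXY => ?_⟩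
  by_cases h : X.proj = Y.proj
  · let e := trivializationAt V (TangentSpace I (M := M)) X.proj
    have hX : X ∈ e.source := FiberBundle.mem_trivializationAt_proj_source
    have hY : Y ∈ e.source := by
      rw [e.mem_source, ← h]; exact mem_baseSet_trivializationAt V _ X.proj
    have hne : e X ≠ e Y := fun h' => hXY (e.injOn hX hY h')
    obtain ⟨u, v, hu, hv, hXu, hYv, huv⟩ := t2_separation hne
    have hc := e.continuousOn
    exact ⟨_, _, hc.isOpen_inter_preimage e.open_source hu,
      hc.isOpen_inter_preimage e.open_source hv, ⟨hX, hXu⟩, ⟨hY, hYv⟩,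
      Set.disjoint_left.2 fun Z hZ hZ' => Set.disjoint_left.1 huv hZ.2 hZ'.2⟩
  · obtain ⟨u, v, hu, hv, hXu, hYv, huv⟩ := t2_separation h
    have hc := FiberBundle.continuous_proj V (TangentSpace I (M := M))
    exact ⟨_, _, hu.preimage hc, hv.preimage hc, hXu, hYv, huv.preimage _⟩

instance instBoundarylessTangent [I.Boundaryless] : I.tangent.Boundaryless :=
  inferInstanceAs (I.prod 𝓘(ℝ, V)).Boundaryless

lemma tendsto_proj (X : TangentBundle I M) :
    Filter.Tendsto (TotalSpace.proj : TangentBundle I M → M) (𝓝 X) (𝓝 X.proj) :=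
  (FiberBundle.continuous_proj V (TangentSpace I (M := M))).tendsto X

lemma contMDiff_proj_tangent :
    ContMDiff I.tangent I ∞ (TotalSpace.proj : TangentBundle I M → M) :=
  Bundle.contMDiff_proj (TangentSpace I)

lemma contMDiffAt_vderiv {G : Type*} [NormedAddCommGroup G] [NormedSpace ℝ G] {f : M → G}
    {X : TangentBundle I M} (hf : ∀ᶠ y in 𝓝 X.proj, ContMDiffAt I 𝓘(ℝ, G) ∞ f y) :
    ContMDiffAt I.tangent 𝓘(ℝ, G) ∞
      (fun Z : TangentBundle I M => vderiv I f Z.proj Z.2) X := by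
  obtain ⟨U, hU, hUo, hXU⟩ := eventually_nhds_iff.1 hf
  have h3 := ContMDiffOn.contMDiffOn_tangentMapWithin (m := ∞)
    (fun y hy => (hU y hy).contMDiffWithinAt) (by simp) hUo.uniqueMDiffOn
  have h4 := (contMDiff_snd_tangentBundle_modelSpace G 𝓘(ℝ, G) (n := ∞)).comp_contMDiffOn h3
  have hUo' := hUo.preimage (FiberBundle.continuous_proj V (TangentSpace I (M := M)))
  refine (h4.contMDiffAt (hUo'.mem_nhds hXU)).congr_of_eventuallyEq ?_
  filter_upwards [hUo'.mem_nhds hXU] with Z hZ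
  simp only [Function.comp, tangentMapWithin, vderiv]
  rw [mfderivWithin_of_isOpen hUo hZ]

lemma contMDiff_tangentLiftFun {f : M → ℝ} (hf : ContMDiff I 𝓘(ℝ, ℝ) ∞ f) :
    ContMDiff I.tangent 𝓘(ℝ, ℝ) ∞ (tangentLiftFun I f) := fun _ =>
  contMDiffAt_vderiv (Filter.Eventually.of_forall fun y => hf y)

lemma contMDiff_coreLiftFun {f : M → ℝ} (hf : ContMDiff I 𝓘(ℝ, ℝ) ∞ f) :
    ContMDiff I.tangent 𝓘(ℝ, ℝ) ∞ (coreLiftFun I f) :=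
  hf.comp contMDiff_proj_tangent

lemma mem_chartAt_tangent {X Z : TangentBundle I M} (h : Z.proj ∈ (chartAt H X.proj).source) :
    Z ∈ (chartAt (ModelProd H V) X).source :=
  (TangentBundle.mem_chart_source_iff Z X).2 h

/-- The preferred chart of `TM` at `X` is the differential of the chart of `M` at the base point of
`X`. In particular it depends only on that base point, so vectors over one point share a chart. -/
lemma extChartAt_tangent {X Z : TangentBundle I M} (h : Z.proj ∈ (chartAt H X.proj).source) :
    extChartAt I.tangent X Z =
      (extChartAt I X.proj Z.proj, vderiv I (extChartAt I X.proj) Z.proj Z.2) := by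
  rw [FiberBundle.extChartAt]
  have h1 : Z.proj ∈ (trivializationAt V (TangentSpace I (M := M)) X.proj).baseSet := by
    simpa using h
  simp only [PartialEquiv.coe_trans, Function.comp, PartialEquiv.prod_coe, PartialEquiv.refl_coe,
    id]
  refine Prod.ext ?_ ?_
  · exact congrArg (extChartAt I X.proj) (Trivialization.coe_fst' _ h1)
  · rw [vderiv, ← TangentBundle.continuousLinearMapAt_trivializationAt h]
    exact ((trivializationAt V (TangentSpace I (M := M)) X.proj).continuousLinearMapAt_apply_of_mem
      ℝ h1 Z.2).symm

variable [I.Boundaryless]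

lemma derivAlong_eq_fderiv_self {f : M → ℝ} (hf : ContMDiff I 𝓘(ℝ, ℝ) ∞ f) (x : M)
    (v : TangentSpace I x) :
    derivAlong I f x v = fderiv ℝ (f ∘ (extChartAt I x).symm) (extChartAt I x x) v := by
  rw [derivAlong_eq_fderiv hf (mem_chart_source H x), vderiv_extChartAt_self]

/-- The derivative of the function `f_C` on `TM`. -/
lemma derivAlong_coreLiftFun {f : M → ℝ} (hf : ContMDiff I 𝓘(ℝ, ℝ) ∞ f)
    (X : TangentBundle I M) (d : V × V) :
    derivAlong I.tangent (coreLiftFun I f) X d = derivAlong I f X.proj d.1 := by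
  have hx := mem_chart_source H X.proj
  have h1 := (contDiffAt_comp_extChartAt_symm (x := X.proj) hf
    (mem_extChartAt_target (I := I) X.proj)).differentiableAt (by simp)
  have hX := mem_chart_source (ModelProd H V) X
  have h2 := (mdifferentiableAt_extChartAt (I := I.tangent) hX).hasMFDerivAt
  rw [mfderiv_extChartAt_self] at h2
  have h3 : HasFDerivAt (fun p : V × V => (f ∘ (extChartAt I X.proj).symm) p.1)
      ((fderiv ℝ (f ∘ (extChartAt I X.proj).symm) (extChartAt I X.proj X.proj)).comp
        (ContinuousLinearMap.fst ℝ V V)) (extChartAt I.tangent X X) := by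
    rw [extChartAt_tangent hx]
    exact HasFDerivAt.comp (g := f ∘ (extChartAt I X.proj).symm)
      (extChartAt I X.proj X.proj, vderiv I (extChartAt I X.proj) X.proj X.2)
      h1.hasFDerivAt hasFDerivAt_fst
  have h4 := HasMFDerivAt.comp X h3.hasMFDerivAt h2
  have h5 : ((fun p : V × V => (f ∘ (extChartAt I X.proj).symm) p.1) ∘ extChartAt I.tangent X)
      =ᶠ[𝓝 X] coreLiftFun I f := by
    filter_upwards [tendsto_proj X ((chartAt H X.proj).open_source.mem_nhds hx)] with Z hZ
    have hZ : Z.proj ∈ (chartAt H X.proj).source := hZ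
    simp only [Function.comp]
    rw [extChartAt_tangent hZ, (extChartAt I X.proj).left_inv (by simpa using hZ), coreLiftFun]
  refine (vderiv_eq (h4.congr_of_eventuallyEq h5.symm) d).trans ?_
  exact (derivAlong_eq_fderiv_self hf X.proj d.1).symm

/-- The derivative of the function `f_T` on `TM`. -/
lemma derivAlong_tangentLiftFun {f : M → ℝ} (hf : ContMDiff I 𝓘(ℝ, ℝ) ∞ f)
    (X : TangentBundle I M) (d : V × V) :
    derivAlong I.tangent (tangentLiftFun I f) X d =
      hessAt I f X.proj d.1 X.2 + derivAlong I f X.proj d.2 := by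
  have hx := mem_chart_source H X.proj
  have h1 := contDiffAt_comp_extChartAt_symm (x := X.proj) hf
    (mem_extChartAt_target (I := I) X.proj)
  have h1' : DifferentiableAt ℝ (fderiv ℝ (f ∘ (extChartAt I X.proj).symm))
      (extChartAt I X.proj X.proj) :=
    (h1.fderiv_right (m := 1)
      (by simpa [one_add_one_eq_two] using two_le_infty)).differentiableAt (by simp)
  have hX := mem_chart_source (ModelProd H V) X
  have h2 := (mdifferentiableAt_extChartAt (I := I.tangent) hX).hasMFDerivAt
  rw [mfderiv_extChartAt_self] at h2
  obtain ⟨q, hq⟩ : ∃ q : V, q = X.2 := ⟨_, rfl⟩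
  have he : extChartAt I.tangent X X = (extChartAt I X.proj X.proj, q) := by
    rw [extChartAt_tangent hx, vderiv_extChartAt_self, hq]
  obtain ⟨D, h3, hD⟩ : ∃ D : V × V →L[ℝ] ℝ, HasFDerivAt
      (fun p : V × V => fderiv ℝ (f ∘ (extChartAt I X.proj).symm) p.1 p.2) D
      (extChartAt I.tangent X X) ∧ ∀ e : V × V, D e =
        fderiv ℝ (f ∘ (extChartAt I X.proj).symm) (extChartAt I X.proj X.proj) e.2 +
        fderiv ℝ (fderiv ℝ (f ∘ (extChartAt I X.proj).symm))
          (extChartAt I X.proj X.proj) e.1 q := by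
    rw [he]
    exact ⟨_, (HasFDerivAt.comp (g := fderiv ℝ (f ∘ (extChartAt I X.proj).symm))
      (extChartAt I X.proj X.proj, q)
      h1'.hasFDerivAt hasFDerivAt_fst).clm_apply hasFDerivAt_snd, fun e => rfl⟩
  have h4 := HasMFDerivAt.comp X h3.hasMFDerivAt h2
  have h5 : ((fun p : V × V => fderiv ℝ (f ∘ (extChartAt I X.proj).symm) p.1 p.2) ∘
      extChartAt I.tangent X) =ᶠ[𝓝 X] tangentLiftFun I f := by
    filter_upwards [tendsto_proj X ((chartAt H X.proj).open_source.mem_nhds hx)] with Z hZ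
    have hZ : Z.proj ∈ (chartAt H X.proj).source := hZ
    simp only [Function.comp]
    rw [extChartAt_tangent hZ, tangentLiftFun, derivAlong_eq_fderiv hf hZ]
  refine (vderiv_eq (h4.congr_of_eventuallyEq h5.symm) d).trans ?_
  have h6 := derivAlong_eq_fderiv_self hf X.proj d.2
  refine (hD d).trans ?_
  rw [h6, add_comm, hq]
  rfl

variable [FiniteDimensional ℝ V] [T2Space M]

/-- Tangent vectors to `TM` are separated by the functions `f_C` and `f_T`. -/
lemma tangent_lift_ext {X : TangentBundle I M} {d d' : TangentSpace I.tangent X}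
    (hC : ∀ f : M → ℝ, ContMDiff I 𝓘(ℝ, ℝ) ∞ f →
      derivAlong I.tangent (coreLiftFun I f) X d = derivAlong I.tangent (coreLiftFun I f) X d')
    (hT : ∀ f : M → ℝ, ContMDiff I 𝓘(ℝ, ℝ) ∞ f →
      derivAlong I.tangent (tangentLiftFun I f) X d =
        derivAlong I.tangent (tangentLiftFun I f) X d') : d = d' := by
  obtain ⟨a, b⟩ : V × V := d
  obtain ⟨a', b'⟩ : V × V := d'
  have h1 : a = a' := tangent_ext (I := I) (x := X.proj) fun f hf => by
    have := hC f hf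
    rwa [derivAlong_coreLiftFun hf, derivAlong_coreLiftFun hf] at this
  subst h1
  have h2 : b = b' := tangent_ext (I := I) (x := X.proj) fun f hf => by
    have := hT f hf
    rw [derivAlong_tangentLiftFun hf, derivAlong_tangentLiftFun hf] at this
    exact add_left_cancel this
  rw [h2]

/-- A linear functional on `V × V`, composed with the chart of `TM`, is near `X` of the form f_C +
g_T, with f and g linear functionals of the chart of `M`. So derivatives of lifted functions include
all derivatives of chart coordinates. -/
lemma contMDiffAt_tangentField {X : TangentBundle I M}
    {Y : ∀ Z : TangentBundle I M, TangentSpace I.tangent Z}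
    (hC : ∀ f : M → ℝ, ContMDiff I 𝓘(ℝ, ℝ) ∞ f →
      ContMDiffAt I.tangent 𝓘(ℝ, ℝ) ∞
        (fun Z => derivAlong I.tangent (coreLiftFun I f) Z (Y Z)) X)
    (hT : ∀ f : M → ℝ, ContMDiff I 𝓘(ℝ, ℝ) ∞ f →
      ContMDiffAt I.tangent 𝓘(ℝ, ℝ) ∞
        (fun Z => derivAlong I.tangent (tangentLiftFun I f) Z (Y Z)) X) :
    ContMDiffAt I.tangent (I.tangent.prod 𝓘(ℝ, V × V)) ∞
      (fun Z => TotalSpace.mk' (V × V) Z (Y Z)) X := by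
  refine contMDiffAt_vectorField fun ℓ => ?_
  obtain ⟨f, hf, hfe⟩ := exists_function_eq_chart I X.proj
    (ℓ.comp (ContinuousLinearMap.inl ℝ V V))
  obtain ⟨g, hg, hge⟩ := exists_function_eq_chart I X.proj
    (ℓ.comp (ContinuousLinearMap.inr ℝ V V))
  refine ((hC f hf).add (hT g hg)).congr_of_eventuallyEq ?_
  have hx := (chartAt H X.proj).open_source.mem_nhds (mem_chart_source H X.proj)
  have hev : ∀ᶠ y in 𝓝 X.proj, (∀ᶠ z in 𝓝 y, f z = ℓ (extChartAt I X.proj z, 0) ∧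
      (∀ᶠ z' in 𝓝 z, g z' = ℓ (0, extChartAt I X.proj z')) ∧ z ∈ (chartAt H X.proj).source) :=
    (hfe.and (hge.eventually_nhds.and hx)).eventually_nhds
  filter_upwards [tendsto_proj X hev] with Z hZ
  have hZ : ∀ᶠ z in 𝓝 Z.proj, f z = ℓ (extChartAt I X.proj z, 0) ∧
      (∀ᶠ z' in 𝓝 z, g z' = ℓ (0, extChartAt I X.proj z')) ∧ z ∈ (chartAt H X.proj).source := hZ
  have hZ0 := hZ.self_of_nhds.2.2
  change _ = derivAlong I.tangent (coreLiftFun I f) Z (Y Z) +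
    derivAlong I.tangent (tangentLiftFun I g) Z (Y Z)
  rw [← derivAlong_fun_add ((contMDiff_coreLiftFun hf).mdifferentiableAt (by simp))
    ((contMDiff_tangentLiftFun hg).mdifferentiableAt (by simp))]
  refine (derivAlong_of_eq_chart (x := X) ?_ (mem_chartAt_tangent hZ0) (Y Z)).symm
  filter_upwards [tendsto_proj Z hZ] with Z' hZ'
  obtain ⟨h1, h2, h3⟩ : f Z'.proj = ℓ (extChartAt I X.proj Z'.proj, 0) ∧
      (∀ᶠ z' in 𝓝 Z'.proj, g z' = ℓ (0, extChartAt I X.proj z')) ∧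
        Z'.proj ∈ (chartAt H X.proj).source := hZ'
  rw [extChartAt_tangent h3, coreLiftFun, h1, tangentLiftFun,
    derivAlong_of_eq_chart (x := X.proj) (ℓ := ℓ.comp (ContinuousLinearMap.inr ℝ V V)) h2 h3,
    ContinuousLinearMap.comp_apply, ContinuousLinearMap.inr_apply, ← map_add, Prod.mk_add_mk,
    add_zero, zero_add]

end TangentBundleFunctions

/-! ### Tangent and core lifts of sections. -/

section Lifts

variable {V : Type*} [NormedAddCommGroup V] [NormedSpace ℝ V] {H : Type*} [TopologicalSpace H]
  {I : ModelWithCorners ℝ V H} {M : Type*} [TopologicalSpace M] [ChartedSpace H M]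
  [IsManifold I ∞ M]
  {F : Type*} [NormedAddCommGroup F] [NormedSpace ℝ F] {E : M → Type*}
  [∀ x, AddCommGroup (E x)] [∀ x, Module ℝ (E x)] [∀ x, TopologicalSpace (E x)]
  [TopologicalSpace (TotalSpace F E)] [FiberBundle F E] [VectorBundle ℝ F E]
  [ContMDiffVectorBundle ∞ F E I]

/-- Elements of the fibre over `X` are stored in the preferred trivialization at `X` itself; passing
to the one at `X₀` is a transition function by definition. -/
lemma coordRep_prolongation (X₀ : TangentBundle I M) (s : ∀ X, TangentProlongation I F E X)
    (X : TangentBundle I M) :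
    coordRep (F × F) X₀ s X = tangentTransition I F E X.proj X₀.proj X (s X) := rfl

lemma mem_baseSet_prolongation {X₀ X : TangentBundle I M} :
    X ∈ (trivializationAt (F × F) (TangentProlongation I F E) X₀).baseSet ↔
      X.proj ∈ (trivializationAt F E X₀.proj).baseSet := Iff.rfl

lemma coordRep_prolongation_self (X : TangentBundle I M)
    (s : ∀ X, TangentProlongation I F E X) : coordRep (F × F) X s X = s X :=
  (tangentCore I F E).coordChange_self X.proj X (mem_baseSet_trivializationAt F E X.proj) (s X)

lemma symmL_prolongation_self [FiniteDimensional ℝ V] [T2Space M] (X : TangentBundle I M) (p : F × F) :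
    (trivializationAt (F × F) (TangentProlongation I F E) X).symmL ℝ X p = p := by
  have hX := mem_baseSet_trivializationAt (F × F) (TangentProlongation I F E) X
  have h := coordRep_symmL (F := F × F) hX p
  rwa [coordRep_prolongation_self] at h

lemma coordRep_coreLift (σ : ∀ x, E x) {X₀ X : TangentBundle I M}
    (hX : X.proj ∈ (trivializationAt F E X₀.proj).baseSet) :
    coordRep (F × F) X₀ (coreLift I F E σ) X = (0, coordRep F X₀.proj σ X.proj) := by
  rw [coordRep_prolongation]
  have h := transition_apply F E (mem_baseSet_trivializationAt F E X.proj) hX (σ X.proj)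
  refine Prod.ext ?_ ?_
  · exact map_zero (transition F E X.proj X₀.proj X.proj)
  · change dTransition I F E X.proj X₀.proj X 0 + transition F E X.proj X₀.proj X.proj _ = _
    rw [map_zero, zero_add]
    exact h

/-- The transition functions of T𝔼 are differentiated transition functions of 𝔼. By the product
rule, the components of a tangent lift are value and derivative in every trivialization, not just in
the one used in its definition. -/
lemma coordRep_tangentLift {σ : ∀ x, E x} (hσ : σ ∈ smoothSections I F E)
    {X₀ X : TangentBundle I M} (hX : X.proj ∈ (trivializationAt F E X₀.proj).baseSet) :
    coordRep (F × F) X₀ (tangentLift I F E σ) X =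
      (coordRep F X₀.proj σ X.proj, vderiv I (coordRep F X₀.proj σ) X.proj X.2) := by
  rw [coordRep_prolongation]
  have hx := mem_baseSet_trivializationAt F E X.proj
  have h := transition_apply F E hx hX (σ X.proj)
  obtain ⟨D, hD, hD'⟩ := hasMFDerivAt_transition_apply I F E hx hX
    (mdifferentiableAt_coordRep (x := X.proj) hσ).hasMFDerivAt
  have h2 : (fun y => transition F E X.proj X₀.proj y (coordRep F X.proj σ y)) =ᶠ[𝓝 X.proj]
      coordRep F X₀.proj σ := by
    filter_upwards [baseSet_mem_nhds F E X.proj,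
      (trivializationAt F E X₀.proj).open_baseSet.mem_nhds hX] with y hy hy'
    exact transition_apply F E hy hy' (σ y)
  refine Prod.ext h ?_
  refine Eq.trans ?_ (vderiv_eq (hD.congr_of_eventuallyEq h2.symm) X.2).symm
  refine Eq.trans ?_ (hD' X.2).symm
  exact add_comm _ _

lemma tangentLift_mem {σ : ∀ x, E x} (hσ : σ ∈ smoothSections I F E) :
    tangentLift I F E σ ∈ smoothSections I.tangent (F × F) (TangentProlongation I F E) := by
  intro X
  refine contMDiffAt_section_of_coordRep (x := X) ?_ (mem_baseSet_trivializationAt _ _ X)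
  have h0 : ∀ᶠ y in 𝓝 X.proj, ContMDiffAt I 𝓘(ℝ, F) ∞ (coordRep F X.proj σ) y := by
    filter_upwards [baseSet_mem_nhds F E X.proj] with y hy using contMDiffAt_coordRep (hσ y) hy
  have h1 : ContMDiffAt I.tangent 𝓘(ℝ, F) ∞
      (fun Z : TangentBundle I M => coordRep F X.proj σ Z.proj) X :=
    h0.self_of_nhds.comp X contMDiff_proj_tangent.contMDiffAt
  refine (h1.prodMk_space (contMDiffAt_vderiv h0)).congr_of_eventuallyEq ?_
  filter_upwards [tendsto_proj X (baseSet_mem_nhds F E X.proj)] with Z hZ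
  exact coordRep_tangentLift hσ hZ

lemma coreLift_mem {σ : ∀ x, E x} (hσ : σ ∈ smoothSections I F E) :
    coreLift I F E σ ∈ smoothSections I.tangent (F × F) (TangentProlongation I F E) := by
  intro X
  refine contMDiffAt_section_of_coordRep (x := X) ?_ (mem_baseSet_trivializationAt _ _ X)
  have h1 : ContMDiffAt I.tangent 𝓘(ℝ, F) ∞
      (fun Z : TangentBundle I M => coordRep F X.proj σ Z.proj) X :=
    (contMDiffAt_coordRep (hσ X.proj) (mem_baseSet_trivializationAt F E X.proj)).comp X
      contMDiff_proj_tangent.contMDiffAt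
  refine ((contMDiffAt_const (c := (0 : F))).prodMk_space h1).congr_of_eventuallyEq ?_
  filter_upwards [tendsto_proj X (baseSet_mem_nhds F E X.proj)] with Z hZ
  exact coordRep_coreLift σ hZ

lemma coreLift_add (σ τ : ∀ x, E x) :
    coreLift I F E (σ + τ) = coreLift I F E σ + coreLift I F E τ := by
  ext X : 1
  refine Prod.ext (add_zero (0 : F)).symm ?_
  exact coordRep_add X.proj σ τ (mem_baseSet_trivializationAt F E X.proj)

lemma coreLift_smul (f : M → ℝ) (σ : ∀ x, E x) :
    coreLift I F E (f • σ) = coreLiftFun I f • coreLift I F E σ := by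
  ext X : 1
  refine Prod.ext (smul_zero (f X.proj)).symm ?_
  exact coordRep_smul X.proj f σ (mem_baseSet_trivializationAt F E X.proj)

lemma coreLift_const_smul (c : ℝ) (σ : ∀ x, E x) :
    coreLift I F E (c • σ) = c • coreLift I F E σ :=
  coreLift_smul (fun _ => c) σ

lemma tangentLift_add {σ τ : ∀ x, E x} (hσ : σ ∈ smoothSections I F E)
    (hτ : τ ∈ smoothSections I F E) :
    tangentLift I F E (σ + τ) = tangentLift I F E σ + tangentLift I F E τ := by
  ext X : 1
  refine Prod.ext (coordRep_add X.proj σ τ (mem_baseSet_trivializationAt F E X.proj)) ?_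
  have h : ∀ᶠ y in 𝓝 X.proj, coordRep F X.proj (σ + τ) y =
      coordRep F X.proj σ y + coordRep F X.proj τ y := by
    filter_upwards [baseSet_mem_nhds F E X.proj] with y hy using coordRep_add X.proj σ τ hy
  exact (vderiv_congr h X.2).trans
    (vderiv_fun_add (mdifferentiableAt_coordRep hσ) (mdifferentiableAt_coordRep hτ) X.2)

lemma tangentLift_smul {f : M → ℝ} (hf : ContMDiff I 𝓘(ℝ, ℝ) ∞ f) {σ : ∀ x, E x}
    (hσ : σ ∈ smoothSections I F E) :
    tangentLift I F E (f • σ) =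
      coreLiftFun I f • tangentLift I F E σ + tangentLiftFun I f • coreLift I F E σ := by
  ext X : 1
  have h : ∀ᶠ y in 𝓝 X.proj, coordRep F X.proj (f • σ) y = f y • coordRep F X.proj σ y := by
    filter_upwards [baseSet_mem_nhds F E X.proj] with y hy using coordRep_smul X.proj f σ hy
  refine Prod.ext (h.self_of_nhds.trans ?_) ((vderiv_congr h X.2).trans
    (vderiv_fun_smul (hf.mdifferentiableAt (by simp)) (mdifferentiableAt_coordRep hσ) X.2))
  change _ = f X.proj • coordRep F X.proj σ X.proj + tangentLiftFun I f X • (0 : F)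
  rw [smul_zero, add_zero]

lemma tangentLift_const_smul (c : ℝ) {σ : ∀ x, E x} (hσ : σ ∈ smoothSections I F E) :
    tangentLift I F E (c • σ) = c • tangentLift I F E σ := by
  have h := tangentLift_smul (contMDiff_const (c := c)) hσ
  have h1 : tangentLiftFun I (fun _ : M => c) = fun _ => 0 := by
    ext X; exact derivAlong_const c X.2
  rw [h1] at h
  ext X : 1
  refine (congrFun h X).trans ?_
  simp only [Pi.add_apply, Pi.smul_apply', zero_smul, add_zero, coreLiftFun, Pi.smul_apply]

/-- This makes lifts sufficient for all tensorial arguments on `TM`: every flat germ is the germ of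
a lift. -/
lemma IsFlatAt.lift {X : TangentBundle I M} {σ τ : ∀ x, E x} (hσ : σ ∈ smoothSections I F E)
    {u v : F} (h : IsFlatAt X.proj σ u) (h' : IsFlatAt X.proj τ v) :
    IsFlatAt X (tangentLift I F E σ + coreLift I F E τ) (u, v) := by
  have h1 : ∀ᶠ y in 𝓝 X.proj, (∀ᶠ z in 𝓝 y, coordRep F X.proj σ z = u) ∧
      coordRep F X.proj τ y = v ∧ y ∈ (trivializationAt F E X.proj).baseSet :=
    h.eventually_nhds.and (h'.and (baseSet_mem_nhds F E X.proj))
  filter_upwards [tendsto_proj X h1] with Z hZ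
  obtain ⟨h2, h3, h4⟩ : (∀ᶠ z in 𝓝 Z.proj, coordRep F X.proj σ z = u) ∧
      coordRep F X.proj τ Z.proj = v ∧ Z.proj ∈ (trivializationAt F E X.proj).baseSet := hZ
  rw [coordRep_add X _ _ (mem_baseSet_prolongation.2 h4), coordRep_tangentLift hσ h4,
    coordRep_coreLift τ h4, vderiv_congr h2, vderiv_const, h2.self_of_nhds, h3, Prod.mk_add_mk,
    add_zero, zero_add]

variable [FiniteDimensional ℝ V] [T2Space M]

variable (I E) in
/-- A section of `T𝔼` which near `X` is constant with value `p` in the preferred trivialization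
at `X`. -/
noncomputable def flatLift (X : TangentBundle I M) (p : F × F) :
    ∀ X, TangentProlongation I F E X :=
  tangentLift I F E (constSection I E X.proj p.1) + coreLift I F E (constSection I E X.proj p.2)

lemma flatLift_mem (X : TangentBundle I M) (p : F × F) :
    flatLift I E X p ∈ smoothSections I.tangent (F × F) (TangentProlongation I F E) :=
  smoothSections_add (tangentLift_mem (constSection_mem _ _)) (coreLift_mem (constSection_mem _ _))

lemma flatLift_isFlatAt (X : TangentBundle I M) (p : F × F) :
    IsFlatAt X (flatLift I E X p) p :=
  (constSection_isFlatAt X.proj p.1).lift (constSection_mem _ _) (constSection_isFlatAt X.proj p.2)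

lemma flatLift_self (X : TangentBundle I M) (p : TangentProlongation I F E X) :
    flatLift I E X p X = p := by
  have := (flatLift_isFlatAt (E := E) X p).symmL_eq
  rw [this]
  exact symmL_prolongation_self X p

end Lifts

/-! ### Complete and vertical lifts of vector fields. -/

section LiftVectorFields

variable {V : Type*} [NormedAddCommGroup V] [NormedSpace ℝ V] {H : Type*} [TopologicalSpace H]
  {I : ModelWithCorners ℝ V H} {M : Type*} [TopologicalSpace M] [ChartedSpace H M]
  [IsManifold I ∞ M]

variable (I) in
/-- The tangent (complete) lift of a vector field. -/
noncomputable def tangentLiftField (Y : ∀ x : M, TangentSpace I x) (X : TangentBundle I M) :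
    TangentSpace I.tangent X :=
  ((Y X.proj : V), (flatDeriv I V X.proj Y X.2 : V))

variable (I) in
/-- The core (vertical) lift of a vector field. -/
def coreLiftField (Y : ∀ x : M, TangentSpace I x) (X : TangentBundle I M) :
    TangentSpace I.tangent X :=
  ((0 : V), (Y X.proj : V))

variable [I.Boundaryless] {Y : ∀ x : M, TangentSpace I x}
  (hY : Y ∈ smoothSections I V (TangentSpace I (M := M))) {f : M → ℝ}
  (hf : ContMDiff I 𝓘(ℝ, ℝ) ∞ f) (X : TangentBundle I M)

include hY hf in
-- The Hessian of `f` appears with its arguments `Y` and `X` in opposite orders on the two sides,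
-- and is symmetric; the first-order terms agree by definition of the lift.
lemma tangentLiftField_T : derivAlong I.tangent (tangentLiftFun I f) X (tangentLiftField I Y X) =
    tangentLiftFun I (fun x => derivAlong I f x (Y x)) X := by
  refine (derivAlong_tangentLiftFun hf X _).trans ?_
  rw [tangentLiftFun, derivAlong_derivAlong hf hY, hessAt_symm hf]
  rfl

include hf in
lemma tangentLiftField_C : derivAlong I.tangent (coreLiftFun I f) X (tangentLiftField I Y X) =
    coreLiftFun I (fun x => derivAlong I f x (Y x)) X :=
  derivAlong_coreLiftFun hf X _

include hf in
lemma coreLiftField_T : derivAlong I.tangent (tangentLiftFun I f) X (coreLiftField I Y X) =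
    coreLiftFun I (fun x => derivAlong I f x (Y x)) X := by
  refine (derivAlong_tangentLiftFun hf X _).trans ?_
  have : hessAt I f X.proj (0 : V) X.2 = 0 := by
    have := (fderiv ℝ (fderiv ℝ (f ∘ (extChartAt I X.proj).symm)) (extChartAt I X.proj X.proj)).map_zero
    exact congrArg (fun A : V →L[ℝ] ℝ => A X.2) this
  refine (congrArg (· + _) this).trans (zero_add _)

include hf in
lemma coreLiftField_C : derivAlong I.tangent (coreLiftFun I f) X (coreLiftField I Y X) = 0 :=
  (derivAlong_coreLiftFun hf X _).trans derivAlong_zero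

end LiftVectorFields

/-! ### Algebraic rules for lifts of vector fields and functions. -/

section LiftAlgebra

variable {V : Type*} [NormedAddCommGroup V] [NormedSpace ℝ V] {H : Type*} [TopologicalSpace H]
  {I : ModelWithCorners ℝ V H} {M : Type*} [TopologicalSpace M] [ChartedSpace H M]
  [IsManifold I ∞ M]

lemma tangentLiftField_add {Y Z : ∀ x : M, TangentSpace I x}
    (hY : Y ∈ smoothSections I V (TangentSpace I (M := M)))
    (hZ : Z ∈ smoothSections I V (TangentSpace I (M := M))) (X : TangentBundle I M) :
    tangentLiftField I (Y + Z) X = tangentLiftField I Y X + tangentLiftField I Z X :=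
  Prod.ext rfl (flatDeriv_add_section hY hZ X.2)

lemma tangentLiftField_smul {f : M → ℝ} (hf : ContMDiff I 𝓘(ℝ, ℝ) ∞ f)
    {Y : ∀ x : M, TangentSpace I x}
    (hY : Y ∈ smoothSections I V (TangentSpace I (M := M))) (X : TangentBundle I M) :
    tangentLiftField I (f • Y) X =
      f X.proj • tangentLiftField I Y X + tangentLiftFun I f X • coreLiftField I Y X := by
  refine Prod.ext ?_ (flatDeriv_smul_section hf hY X.2)
  have h : ∀ (a : V) (c : ℝ), a = a + c • (0 : V) := by simp
  exact h _ _

lemma tangentLiftField_zero (X : TangentBundle I M) :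
    tangentLiftField I (0 : ∀ x : M, TangentSpace I x) X = 0 := by
  have h := tangentLiftField_add (I := I) (M := M) smoothSections_zero smoothSections_zero X
  rw [add_zero] at h
  exact left_eq_add.1 h

lemma coreLiftField_add (Y Z : ∀ x : M, TangentSpace I x) (X : TangentBundle I M) :
    coreLiftField I (Y + Z) X = coreLiftField I Y X + coreLiftField I Z X :=
  Prod.ext (add_zero (0 : V)).symm rfl

lemma coreLiftField_smul (f : M → ℝ) (Y : ∀ x : M, TangentSpace I x) (X : TangentBundle I M) :
    coreLiftField I (f • Y) X = f X.proj • coreLiftField I Y X :=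
  Prod.ext (smul_zero (f X.proj)).symm rfl

lemma coreLiftField_zero (X : TangentBundle I M) :
    coreLiftField I (0 : ∀ x : M, TangentSpace I x) X = 0 := rfl

lemma tangentLiftField_const_smul (c : ℝ) {Y : ∀ x : M, TangentSpace I x}
    (hY : Y ∈ smoothSections I V (TangentSpace I (M := M))) (X : TangentBundle I M) :
    tangentLiftField I (c • Y) X = c • tangentLiftField I Y X := by
  refine (tangentLiftField_smul (contMDiff_const (c := c)) hY X).trans ?_
  have h1 : tangentLiftFun I (fun _ : M => c) X = 0 := derivAlong_const c X.2
  rw [h1, zero_smul, add_zero]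

lemma tangentLiftFun_add {f g : M → ℝ} (hf : ContMDiff I 𝓘(ℝ, ℝ) ∞ f)
    (hg : ContMDiff I 𝓘(ℝ, ℝ) ∞ g) (X : TangentBundle I M) :
    tangentLiftFun I (fun y => f y + g y) X = tangentLiftFun I f X + tangentLiftFun I g X :=
  derivAlong_fun_add (hf.mdifferentiableAt (by simp)) (hg.mdifferentiableAt (by simp)) X.2

lemma tangentLiftFun_sub {f g : M → ℝ} (hf : ContMDiff I 𝓘(ℝ, ℝ) ∞ f)
    (hg : ContMDiff I 𝓘(ℝ, ℝ) ∞ g) (X : TangentBundle I M) :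
    tangentLiftFun I (fun y => f y - g y) X = tangentLiftFun I f X - tangentLiftFun I g X :=
  derivAlong_fun_sub (hf.mdifferentiableAt (by simp)) (hg.mdifferentiableAt (by simp)) X.2

lemma tangentLiftFun_mul {f g : M → ℝ} (hf : ContMDiff I 𝓘(ℝ, ℝ) ∞ f)
    (hg : ContMDiff I 𝓘(ℝ, ℝ) ∞ g) (X : TangentBundle I M) :
    tangentLiftFun I (fun y => f y * g y) X =
      f X.proj * tangentLiftFun I g X + tangentLiftFun I f X * g X.proj :=
  derivAlong_fun_mul (hf.mdifferentiableAt (by simp)) (hg.mdifferentiableAt (by simp)) X.2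

lemma tangentLiftFun_const_mul (c : ℝ) {g : M → ℝ}
    (hg : ContMDiff I 𝓘(ℝ, ℝ) ∞ g) (X : TangentBundle I M) :
    tangentLiftFun I (fun y => c * g y) X = c * tangentLiftFun I g X :=
  derivAlong_const_mul c (hg.mdifferentiableAt (by simp)) X.2

end LiftAlgebra

/-! ### The anchor and the pairing of the prolongation. -/

section ProlongTensors

variable {V : Type*} [NormedAddCommGroup V] [NormedSpace ℝ V] {H : Type*} [TopologicalSpace H]
  {I : ModelWithCorners ℝ V H} {M : Type*} [TopologicalSpace M] [ChartedSpace H M]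
  [IsManifold I ∞ M]
  {F : Type*} [NormedAddCommGroup F] [NormedSpace ℝ F] {E : M → Type*}
  [∀ x, AddCommGroup (E x)] [∀ x, Module ℝ (E x)] [∀ x, TopologicalSpace (E x)]
  [TopologicalSpace (TotalSpace F E)] [FiberBundle F E] [VectorBundle ℝ F E]
  [ContMDiffVectorBundle ∞ F E I]

variable (I E) in
/-- The base point of an element of `T𝔼`, in the fibre of `𝔼`. -/
def fibFst (X : TangentBundle I M) : TangentProlongation I F E X →ₗ[ℝ] F := LinearMap.fst ℝ F F

variable (I E) in
/-- The velocity along the fibre of an element of `T𝔼`. -/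
def fibSnd (X : TangentBundle I M) : TangentProlongation I F E X →ₗ[ℝ] F := LinearMap.snd ℝ F F

lemma fibFst_tangentLift (σ : ∀ x, E x) (X : TangentBundle I M) :
    fibFst I E X (tangentLift I F E σ X) = coordRep F X.proj σ X.proj := rfl

lemma fibFst_coreLift (σ : ∀ x, E x) (X : TangentBundle I M) :
    fibFst I E X (coreLift I F E σ X) = 0 := rfl

lemma fibSnd_coreLift (σ : ∀ x, E x) (X : TangentBundle I M) :
    fibSnd I E X (coreLift I F E σ X) = coordRep F X.proj σ X.proj := rfl

lemma IsFlatAt.fibSnd_tangentLift {σ : ∀ x, E x} {X : TangentBundle I M} {u : F}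
    (h : IsFlatAt X.proj σ u) : fibSnd I E X (tangentLift I F E σ X) = 0 := by
  have h : ∀ᶠ y in 𝓝 X.proj, coordRep F X.proj σ y = u := h
  exact (vderiv_congr h X.2).trans (vderiv_const _ _)

variable [FiniteDimensional ℝ V] [T2Space M] [FiniteDimensional ℝ F] [I.Boundaryless]

lemma constSection_zero (x : M) : constSection I E x (0 : F) = 0 := by
  have := constSection_add (I := I) (E := E) x (0 : F) 0
  rw [add_zero] at this
  exact left_eq_add.1 this

namespace CourantAlgebroid

variable (C : CourantAlgebroid I F E)

lemma anchor_add_section (σ τ : ∀ x, E x) : (fun y => C.anchor y ((σ + τ) y)) =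
    (fun y => C.anchor y (σ y)) + fun y => C.anchor y (τ y) := by
  ext y : 1; simp

lemma anchor_smul_section (f : M → ℝ) (σ : ∀ x, E x) : (fun y => C.anchor y ((f • σ) y)) =
    f • fun y => C.anchor y (σ y) := by
  ext y : 1; simp

lemma anchor_const_smul_section (c : ℝ) (σ : ∀ x, E x) : (fun y => C.anchor y ((c • σ) y)) =
    c • fun y => C.anchor y (σ y) := by
  ext y : 1; simp

/-- The anchor of the tangent prolongation. -/
noncomputable def prolongAnchor (X : TangentBundle I M) :
    TangentProlongation I F E X →ₗ[ℝ] TangentSpace I.tangent X where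
  -- `d` is the value at `X` of the sum of a tangent lift and a core lift of flat sections, and the
  -- anchors of these lifts are prescribed.
  toFun d :=
    tangentLiftField I (fun y => C.anchor y (constSection I E X.proj (fibFst I E X d) y)) X +
    coreLiftField I (fun y => C.anchor y (constSection I E X.proj (fibSnd I E X d) y)) X
  map_add' d d' := by
    have h := fun u => C.anchor_smooth _ (constSection_mem (I := I) (E := E) X.proj u)
    simp only [map_add, constSection_add, anchor_add_section, tangentLiftField_add (h _) (h _),
      coreLiftField_add]
    abel
  map_smul' c d := by
    have h := fun u => C.anchor_smooth _ (constSection_mem (I := I) (E := E) X.proj u)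
    have h2 : ∀ Y : ∀ x : M, TangentSpace I x, coreLiftField I (c • Y) X =
      c • coreLiftField I Y X := fun Y => coreLiftField_smul (fun _ => c) Y X
    simp only [map_smul, constSection_smul, anchor_const_smul_section,
      tangentLiftField_const_smul _ (h _), h2, RingHom.id_apply, smul_add]

lemma prolongAnchor_apply (X : TangentBundle I M) (d : TangentProlongation I F E X) :
    C.prolongAnchor X d =
    tangentLiftField I (fun y => C.anchor y (constSection I E X.proj (fibFst I E X d) y)) X +
    coreLiftField I (fun y => C.anchor y (constSection I E X.proj (fibSnd I E X d) y)) X := rfl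

/-- The pairing of the tangent prolongation. -/
noncomputable def prolongPairing (X : TangentBundle I M) :
    TangentProlongation I F E X →ₗ[ℝ] TangentProlongation I F E X →ₗ[ℝ] ℝ :=
  -- `T` is the pairing of tangent lifts of flat sections and `B` the pairing of a tangent lift with
  -- a core lift. There is no third form, since core lifts are to be orthogonal to each other.
  let T : F →ₗ[ℝ] F →ₗ[ℝ] ℝ := LinearMap.mk₂ ℝ
    (fun u v => tangentLiftFun I
      (fun y => C.pairing y (constSection I E X.proj u y) (constSection I E X.proj v y)) X)
    (fun u u' v => by
      simp only [constSection_add, Pi.add_apply, map_add, LinearMap.add_apply]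
      exact tangentLiftFun_add (C.pairing_smooth _ (constSection_mem _ _) _ (constSection_mem _ _))
        (C.pairing_smooth _ (constSection_mem _ _) _ (constSection_mem _ _)) X)
    (fun c u v => by
      simp only [constSection_smul, Pi.smul_apply, map_smul, LinearMap.smul_apply, smul_eq_mul]
      exact tangentLiftFun_const_mul c
        (C.pairing_smooth _ (constSection_mem _ _) _ (constSection_mem _ _)) X)
    (fun u v v' => by
      simp only [constSection_add, Pi.add_apply, map_add]
      exact tangentLiftFun_add (C.pairing_smooth _ (constSection_mem _ _) _ (constSection_mem _ _))
        (C.pairing_smooth _ (constSection_mem _ _) _ (constSection_mem _ _)) X)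
    (fun c u v => by
      simp only [constSection_smul, Pi.smul_apply, map_smul, smul_eq_mul]
      exact tangentLiftFun_const_mul c
        (C.pairing_smooth _ (constSection_mem _ _) _ (constSection_mem _ _)) X)
  let B : F →ₗ[ℝ] F →ₗ[ℝ] ℝ := LinearMap.compl₁₂ (C.pairing X.proj)
    ((trivializationAt F E X.proj).symmL ℝ X.proj : F →ₗ[ℝ] E X.proj)
    ((trivializationAt F E X.proj).symmL ℝ X.proj : F →ₗ[ℝ] E X.proj)
  T.compl₁₂ (fibFst I E X) (fibFst I E X) + B.compl₁₂ (fibFst I E X) (fibSnd I E X) +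
    B.compl₁₂ (fibSnd I E X) (fibFst I E X)

lemma prolongPairing_apply (X : TangentBundle I M) (d d' : TangentProlongation I F E X) :
    C.prolongPairing X d d' =
      tangentLiftFun I (fun y => C.pairing y (constSection I E X.proj (fibFst I E X d) y)
        (constSection I E X.proj (fibFst I E X d') y)) X +
      C.pairing X.proj (constSection I E X.proj (fibFst I E X d) X.proj)
        (constSection I E X.proj (fibSnd I E X d') X.proj) +
      C.pairing X.proj (constSection I E X.proj (fibSnd I E X d) X.proj)
        (constSection I E X.proj (fibFst I E X d') X.proj) := by
  simp only [constSection_self]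
  rfl

lemma prolongPairing_symm (X : TangentBundle I M) (d d' : TangentProlongation I F E X) :
    C.prolongPairing X d d' = C.prolongPairing X d' d := by
  rw [prolongPairing_apply, prolongPairing_apply]
  simp only [C.pairing_symm _ (constSection I E X.proj (fibFst I E X d') _),
    C.pairing_symm _ (constSection I E X.proj (fibSnd I E X d') _)]
  ring

lemma prolongAnchor_coreLift (σ : ∀ x, E x) (X : TangentBundle I M) :
    C.prolongAnchor X (coreLift I F E σ X) =
      coreLiftField I (fun y => C.anchor y (σ y)) X := by
  rw [prolongAnchor_apply, fibFst_coreLift, fibSnd_coreLift, constSection_zero]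
  simp only [Pi.zero_apply, map_zero]
  refine (congrArg (· + _) (tangentLiftField_zero X)).trans ?_
  rw [zero_add]
  simp only [coreLiftField, constSection_coordRep]
  rfl

/-- The definition gives this only for `σ` flat at the base point. When `σ` is multiplied by `f`,
both sides acquire the same core term, so their difference is tensorial in `σ`. -/
lemma prolongAnchor_tangentLift {σ : ∀ x, E x} (hσ : σ ∈ smoothSections I F E)
    (X : TangentBundle I M) :
    C.prolongAnchor X (tangentLift I F E σ X) =
      tangentLiftField I (fun y => C.anchor y (σ y)) X := by
  rw [← sub_eq_zero]
  revert hσ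
  revert σ
  refine @(tensorial_eq_zero (x := X.proj) (fun σ hσ τ hτ => ?_) (fun f hf σ hσ => ?_)
    fun u => ⟨_, constSection_mem _ u, constSection_isFlatAt _ u, ?_⟩)
  · rw [tangentLift_add hσ hτ, Pi.add_apply, map_add, anchor_add_section,
      tangentLiftField_add (C.anchor_smooth _ hσ) (C.anchor_smooth _ hτ)]
    abel
  · rw [tangentLift_smul hf hσ, Pi.add_apply, map_add, Pi.smul_apply', Pi.smul_apply', map_smul,
      map_smul, anchor_smul_section, tangentLiftField_smul hf (C.anchor_smooth _ hσ),
      prolongAnchor_coreLift, smul_sub, coreLiftFun]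
    abel
  · have hu := constSection_isFlatAt (I := I) (E := E) X.proj u
    rw [sub_eq_zero, prolongAnchor_apply, fibFst_tangentLift, hu.fibSnd_tangentLift,
      hu.self_of_nhds, constSection_zero]
    simp only [Pi.zero_apply, map_zero]
    exact (congrArg (_ + ·) (coreLiftField_zero X)).trans (add_zero _)

lemma prolongPairing_coreLift_left (σ : ∀ x, E x) (X : TangentBundle I M)
    (d : TangentProlongation I F E X) :
    C.prolongPairing X (coreLift I F E σ X) d =
      C.pairing X.proj (σ X.proj) (constSection I E X.proj (fibFst I E X d) X.proj) := by
  rw [prolongPairing_apply, fibFst_coreLift, fibSnd_coreLift, constSection_zero,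
    constSection_coordRep]
  simp only [Pi.zero_apply, map_zero, LinearMap.zero_apply, add_zero, tangentLiftFun,
    derivAlong_const, zero_add]

lemma prolongPairing_CT (σ τ : ∀ x, E x) (X : TangentBundle I M) :
    C.prolongPairing X (coreLift I F E σ X) (tangentLift I F E τ X) =
      C.pairing X.proj (σ X.proj) (τ X.proj) := by
  rw [prolongPairing_coreLift_left, fibFst_tangentLift, constSection_coordRep]

lemma prolongPairing_TC (σ τ : ∀ x, E x) (X : TangentBundle I M) :
    C.prolongPairing X (tangentLift I F E σ X) (coreLift I F E τ X) =
      C.pairing X.proj (σ X.proj) (τ X.proj) := by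
  rw [prolongPairing_symm, prolongPairing_CT, C.pairing_symm]

lemma prolongPairing_CC (σ τ : ∀ x, E x) (X : TangentBundle I M) :
    C.prolongPairing X (coreLift I F E σ X) (coreLift I F E τ X) = 0 := by
  rw [prolongPairing_coreLift_left, fibFst_coreLift, constSection_zero, Pi.zero_apply, map_zero]

lemma prolongPairing_TT {σ τ : ∀ x, E x} (hσ : σ ∈ smoothSections I F E)
    (hτ : τ ∈ smoothSections I F E) (X : TangentBundle I M) :
    C.prolongPairing X (tangentLift I F E σ X) (tangentLift I F E τ X) =
      tangentLiftFun I (fun y => C.pairing y (σ y) (τ y)) X := by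
  have hg := C.pairing_smooth
  rw [← sub_eq_zero]
  -- The difference of the two sides is tensorial in `σ`, since the extra term f_T ⟨σ_C, τ_T⟩ also
  -- appears in the product rule. By symmetry `key` applies to each argument in turn.
  have key : ∀ τ ∈ smoothSections I F E, (∀ u : F, C.prolongPairing X
        (tangentLift I F E (constSection I E X.proj u) X) (tangentLift I F E τ X) -
        tangentLiftFun I (fun y => C.pairing y (constSection I E X.proj u y) (τ y)) X = 0) →
      ∀ σ ∈ smoothSections I F E, C.prolongPairing X (tangentLift I F E σ X)
        (tangentLift I F E τ X) - tangentLiftFun I (fun y => C.pairing y (σ y) (τ y)) X = 0 := by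
    intro τ hτ h0
    refine tensorial_eq_zero (I := I) (F := F) (E := E) (x := X.proj) (fun σ hσ σ' hσ' => ?_) (fun f hf σ hσ => ?_)
      fun u => ⟨_, constSection_mem _ u, constSection_isFlatAt _ u, h0 u⟩
    · simp only [tangentLift_add hσ hσ', Pi.add_apply, map_add, LinearMap.add_apply]
      rw [tangentLiftFun_add (hg σ hσ τ hτ) (hg σ' hσ' τ hτ)]
      ring
    · simp only [tangentLift_smul hf hσ, Pi.add_apply, Pi.smul_apply', map_add, map_smul,
        LinearMap.add_apply, LinearMap.smul_apply, smul_eq_mul, prolongPairing_CT]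
      rw [tangentLiftFun_mul hf (hg σ hσ τ hτ), coreLiftFun]
      ring
  refine key τ hτ (fun u => ?_) σ hσ
  simp only [C.pairing_symm _ (constSection I E X.proj u _), prolongPairing_symm _ _
    (tangentLift I F E (constSection I E X.proj u) X)]
  refine key _ (constSection_mem _ _) (fun v => ?_) τ hτ
  have hu := constSection_isFlatAt (I := I) (E := E) X.proj u
  have hv := constSection_isFlatAt (I := I) (E := E) X.proj v
  rw [prolongPairing_apply, fibFst_tangentLift, fibFst_tangentLift, hu.fibSnd_tangentLift,
    hv.fibSnd_tangentLift, hu.self_of_nhds, hv.self_of_nhds, constSection_zero]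
  simp

/-- Pairing with core lifts sees only the base point of `d` and forces it to vanish; pairing with
tangent lifts then sees only the fibre velocity. -/
lemma prolongPairing_nondegenerate (X : TangentBundle I M) (d : TangentProlongation I F E X)
    (h : ∀ d', C.prolongPairing X d d' = 0) : d = 0 := by
  have hinj : ∀ u : F, (∀ v : F, C.pairing X.proj (constSection I E X.proj u X.proj)
      (constSection I E X.proj v X.proj) = 0) → u = 0 := fun u hu => by
    have h1 : constSection I E X.proj u X.proj = 0 := by
      refine C.pairing_nondegenerate _ _ fun w => ?_
      obtain ⟨ρ, hρ, rfl⟩ := exists_section_eq I F X.proj w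
      have := hu (coordRep F X.proj ρ X.proj)
      rwa [constSection_coordRep] at this
    have h2 := (constSection_isFlatAt (I := I) (E := E) X.proj u).self_of_nhds
    rw [← h2]
    have h3 := (coordRep_eq_iff (F := F) X.proj (constSection I E X.proj u) 0
      (mem_baseSet_trivializationAt F E X.proj)).2 h1
    rw [h3, coordRep_zero X.proj (mem_baseSet_trivializationAt F E X.proj)]
  have hF : fibFst I E X d = 0 := hinj _ fun v => by
    have h1 := h (coreLift I F E (constSection I E X.proj v) X)
    rw [prolongPairing_symm, prolongPairing_coreLift_left, C.pairing_symm] at h1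
    exact h1
  have hS : fibSnd I E X d = 0 := hinj _ fun v => by
    have h1 := h (tangentLift I F E (constSection I E X.proj v) X)
    have hv := constSection_isFlatAt (I := I) (E := E) X.proj v
    rw [prolongPairing_apply, hF, fibFst_tangentLift, hv.self_of_nhds, constSection_zero] at h1
    simpa [tangentLiftFun] using h1
  exact Prod.ext hF hS

end CourantAlgebroid

end ProlongTensors

/-! ### Definition and Leibniz rules of the prolonged bracket. -/

section ProlongBracket

variable {V : Type*} [NormedAddCommGroup V] [NormedSpace ℝ V] {H : Type*} [TopologicalSpace H]
  {I : ModelWithCorners ℝ V H} {M : Type*} [TopologicalSpace M] [ChartedSpace H M]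
  [IsManifold I ∞ M]
  {F : Type*} [NormedAddCommGroup F] [NormedSpace ℝ F] {E : M → Type*}
  [∀ x, AddCommGroup (E x)] [∀ x, Module ℝ (E x)] [∀ x, TopologicalSpace (E x)]
  [TopologicalSpace (TotalSpace F E)] [FiberBundle F E] [VectorBundle ℝ F E]
  [ContMDiffVectorBundle ∞ F E I]
  [FiniteDimensional ℝ V] [T2Space M] [FiniteDimensional ℝ F] [I.Boundaryless]

variable (I F E) in
/-- The smooth sections of `T𝔼 → TM`. -/
abbrev prolongSections : Set (∀ X, TangentProlongation I F E X) :=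
  smoothSections I.tangent (F × F) (TangentProlongation I F E)

/-- A local property of sections of `T𝔼`, stable under addition and multiplication by smooth
functions, holds for all sections if it holds for tangent lifts and core lifts. -/
theorem section_lift_induction {X : TangentBundle I M}
    {Q : (∀ X, TangentProlongation I F E X) → Prop}
    (hadd : ∀ s ∈ prolongSections I F E,
      ∀ t ∈ prolongSections I F E, Q s → Q t → Q (s + t))
    (hsmul : ∀ f : TangentBundle I M → ℝ, ContMDiff I.tangent 𝓘(ℝ, ℝ) ∞ f →
      ∀ s ∈ prolongSections I F E, Q s → Q (f • s))
    (hgerm : ∀ s ∈ prolongSections I F E,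
      ∀ t ∈ prolongSections I F E,
      (∀ᶠ Z in 𝓝 X, s Z = t Z) → Q s → Q t)
    (hT : ∀ σ ∈ smoothSections I F E, Q (tangentLift I F E σ))
    (hC : ∀ σ ∈ smoothSections I F E, Q (coreLift I F E σ)) :
    ∀ s ∈ prolongSections I F E, Q s :=
  section_induction hadd hsmul hgerm fun p => ⟨_, flatLift_mem X p, flatLift_isFlatAt X p,
    hadd _ (tangentLift_mem (constSection_mem _ _)) _ (coreLift_mem (constSection_mem _ _))
      (hT _ (constSection_mem _ _)) (hC _ (constSection_mem _ _))⟩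

namespace CourantAlgebroid

variable (C : CourantAlgebroid I F E)

lemma contMDiff_prolongPairing (s : ∀ X, TangentProlongation I F E X) (hs : s ∈ prolongSections I F E)
    (t : ∀ X, TangentProlongation I F E X) (ht : t ∈ prolongSections I F E) :
    ContMDiff I.tangent 𝓘(ℝ, ℝ) ∞ (fun X => C.prolongPairing X (s X) (t X)) := by
  intro X
  -- Reduction to lifts is carried out in one argument at a time, exchanging them by symmetry;
  -- pairings of lifts are lifts of smooth functions, or zero.
  have key : ∀ t ∈ prolongSections I F E,
      (∀ σ ∈ smoothSections I F E, ContMDiffAt I.tangent 𝓘(ℝ, ℝ) ∞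
        (fun X => C.prolongPairing X (tangentLift I F E σ X) (t X)) X) →
      (∀ σ ∈ smoothSections I F E, ContMDiffAt I.tangent 𝓘(ℝ, ℝ) ∞
        (fun X => C.prolongPairing X (coreLift I F E σ X) (t X)) X) →
      ∀ s ∈ prolongSections I F E, ContMDiffAt I.tangent 𝓘(ℝ, ℝ) ∞ (fun X => C.prolongPairing X (s X) (t X)) X := by
    intro t ht hT hC
    refine section_lift_induction (X := X) (fun s hs s' hs' h h' => ?_) (fun f hf s hs h => ?_)
      (fun s hs s' hs' h h' => ?_) hT hC
    · simp only [Pi.add_apply, map_add, LinearMap.add_apply]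
      exact h.add h'
    · simp only [Pi.smul_apply', map_smul, LinearMap.smul_apply]
      exact (hf X).mul h
    · refine h'.congr_of_eventuallyEq ?_
      filter_upwards [h] with Z hZ
      rw [hZ]
  have key2 : ∀ t ∈ prolongSections I F E,
      (∀ σ ∈ smoothSections I F E, ContMDiffAt I.tangent 𝓘(ℝ, ℝ) ∞
        (fun X => C.prolongPairing X (t X) (tangentLift I F E σ X)) X) →
      (∀ σ ∈ smoothSections I F E, ContMDiffAt I.tangent 𝓘(ℝ, ℝ) ∞
        (fun X => C.prolongPairing X (t X) (coreLift I F E σ X)) X) →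
      ∀ s ∈ prolongSections I F E, ContMDiffAt I.tangent 𝓘(ℝ, ℝ) ∞ (fun X => C.prolongPairing X (t X) (s X)) X := by
    intro t ht
    simp only [C.prolongPairing_symm _ (t _)]
    exact key t ht
  refine key t ht (fun σ hσ => ?_) (fun σ hσ => ?_) s hs
  · refine key2 _ (tangentLift_mem hσ) (fun τ hτ => ?_) (fun τ hτ => ?_) t ht
    · simp only [C.prolongPairing_TT hσ hτ]
      exact contMDiff_tangentLiftFun (C.pairing_smooth _ hσ _ hτ) X
    · simp only [C.prolongPairing_TC]
      exact contMDiff_coreLiftFun (C.pairing_smooth _ hσ _ hτ) X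
  · refine key2 _ (coreLift_mem hσ) (fun τ hτ => ?_) (fun τ hτ => ?_) t ht
    · simp only [C.prolongPairing_CT]
      exact contMDiff_coreLiftFun (C.pairing_smooth _ hσ _ hτ) X
    · simp only [C.prolongPairing_CC]
      exact contMDiffAt_const

lemma prolongAnchor_T_T {σ : ∀ x, E x} (hσ : σ ∈ smoothSections I F E) {f : M → ℝ}
    (hf : ContMDiff I 𝓘(ℝ, ℝ) ∞ f) (X : TangentBundle I M) :
    derivAlong I.tangent (tangentLiftFun I f) X (C.prolongAnchor X (tangentLift I F E σ X)) =
      tangentLiftFun I (fun x => derivAlong I f x (C.anchor x (σ x))) X := by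
  rw [C.prolongAnchor_tangentLift hσ, tangentLiftField_T (C.anchor_smooth _ hσ) hf]

lemma prolongAnchor_T_C {σ : ∀ x, E x} (hσ : σ ∈ smoothSections I F E) {f : M → ℝ}
    (hf : ContMDiff I 𝓘(ℝ, ℝ) ∞ f) (X : TangentBundle I M) :
    derivAlong I.tangent (coreLiftFun I f) X (C.prolongAnchor X (tangentLift I F E σ X)) =
      coreLiftFun I (fun x => derivAlong I f x (C.anchor x (σ x))) X := by
  rw [C.prolongAnchor_tangentLift hσ, tangentLiftField_C hf]

lemma prolongAnchor_C_T (σ : ∀ x, E x) {f : M → ℝ}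
    (hf : ContMDiff I 𝓘(ℝ, ℝ) ∞ f) (X : TangentBundle I M) :
    derivAlong I.tangent (tangentLiftFun I f) X (C.prolongAnchor X (coreLift I F E σ X)) =
      coreLiftFun I (fun x => derivAlong I f x (C.anchor x (σ x))) X := by
  rw [C.prolongAnchor_coreLift, coreLiftField_T hf]

lemma prolongAnchor_C_C (σ : ∀ x, E x) {f : M → ℝ}
    (hf : ContMDiff I 𝓘(ℝ, ℝ) ∞ f) (X : TangentBundle I M) :
    derivAlong I.tangent (coreLiftFun I f) X (C.prolongAnchor X (coreLift I F E σ X)) = 0 := by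
  rw [C.prolongAnchor_coreLift, coreLiftField_C hf]

lemma contMDiff_anchorDeriv {σ : ∀ x, E x} (hσ : σ ∈ smoothSections I F E) {f : M → ℝ}
    (hf : ContMDiff I 𝓘(ℝ, ℝ) ∞ f) :
    ContMDiff I 𝓘(ℝ, ℝ) ∞ (fun x => derivAlong I f x (C.anchor x (σ x))) :=
  contMDiff_derivAlong hf (C.anchor_smooth _ hσ)

lemma prolongAnchor_smooth (s : ∀ X, TangentProlongation I F E X) (hs : s ∈ prolongSections I F E) :
    (fun X => C.prolongAnchor X (s X)) ∈
      smoothSections I.tangent (V × V) (TangentSpace I.tangent (M := TangentBundle I M)) := by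
  intro X
  have key : ∀ g : TangentBundle I M → ℝ,
      (∀ σ ∈ smoothSections I F E, ContMDiffAt I.tangent 𝓘(ℝ, ℝ) ∞
        (fun Z => derivAlong I.tangent g Z (C.prolongAnchor Z (tangentLift I F E σ Z))) X) →
      (∀ σ ∈ smoothSections I F E, ContMDiffAt I.tangent 𝓘(ℝ, ℝ) ∞
        (fun Z => derivAlong I.tangent g Z (C.prolongAnchor Z (coreLift I F E σ Z))) X) →
      ContMDiffAt I.tangent 𝓘(ℝ, ℝ) ∞
        (fun Z => derivAlong I.tangent g Z (C.prolongAnchor Z (s Z))) X := by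
    intro g hT hC
    revert hs
    revert s
    refine section_lift_induction (X := X) (fun s hs s' hs' h h' => ?_) (fun f hf s hs h => ?_)
      (fun s hs s' hs' h h' => ?_) hT hC
    · simp only [Pi.add_apply, map_add, derivAlong_add]
      exact h.add h'
    · simp only [Pi.smul_apply', map_smul, derivAlong_smul]
      exact (hf X).mul h
    · refine h'.congr_of_eventuallyEq ?_
      filter_upwards [h] with Z hZ
      rw [hZ]
  refine contMDiffAt_tangentField (fun f hf => key _ (fun σ hσ => ?_) (fun σ hσ => ?_))
    (fun f hf => key _ (fun σ hσ => ?_) (fun σ hσ => ?_))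
  · simp only [C.prolongAnchor_T_C hσ hf]
    exact contMDiff_coreLiftFun (C.contMDiff_anchorDeriv hσ hf) X
  · simp only [C.prolongAnchor_C_C _ hf]
    exact contMDiffAt_const
  · simp only [C.prolongAnchor_T_T hσ hf]
    exact contMDiff_tangentLiftFun (C.contMDiff_anchorDeriv hσ hf) X
  · simp only [C.prolongAnchor_C_T _ hf]
    exact contMDiff_coreLiftFun (C.contMDiff_anchorDeriv hσ hf) X

/-- The value at `X` of the bracket of two sections of `T𝔼` that are constant near `X` in
the preferred trivialization. -/
noncomputable def prolongTensor (X : TangentBundle I M) (d d' : TangentProlongation I F E X) :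
    TangentProlongation I F E X :=
  let e : F → ∀ x, E x := constSection I E X.proj
  tangentLift I F E (C.bracket (e (fibFst I E X d)) (e (fibFst I E X d'))) X +
    coreLift I F E (C.bracket (e (fibFst I E X d)) (e (fibSnd I E X d')) +
      C.bracket (e (fibSnd I E X d)) (e (fibFst I E X d'))) X

lemma prolongTensor_add_right (X : TangentBundle I M) (d d' d'' : TangentProlongation I F E X) :
    C.prolongTensor X d (d' + d'') = C.prolongTensor X d d' + C.prolongTensor X d d'' := by
  have hc : ∀ u : F, constSection I E X.proj u ∈ smoothSections I F E := constSection_mem X.proj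
  simp only [prolongTensor, map_add, constSection_add, C.bracket_add_right _ (hc _) _ (hc _) _
    (hc _), tangentLift_add (C.bracket_smooth _ (hc _) _ (hc _)) (C.bracket_smooth _ (hc _) _ (hc _)),
    coreLift_add, Pi.add_apply]
  abel

lemma prolongTensor_add_left (X : TangentBundle I M) (d d' d'' : TangentProlongation I F E X) :
    C.prolongTensor X (d + d') d'' = C.prolongTensor X d d'' + C.prolongTensor X d' d'' := by
  have hc : ∀ u : F, constSection I E X.proj u ∈ smoothSections I F E := constSection_mem X.proj
  simp only [prolongTensor, map_add, constSection_add, C.bracket_add_left _ (hc _) _ (hc _) _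
    (hc _), tangentLift_add (C.bracket_smooth _ (hc _) _ (hc _)) (C.bracket_smooth _ (hc _) _ (hc _)),
    coreLift_add, Pi.add_apply]
  abel

lemma prolongTensor_smul_right (X : TangentBundle I M) (c : ℝ)
    (d d' : TangentProlongation I F E X) :
    C.prolongTensor X d (c • d') = c • C.prolongTensor X d d' := by
  have hc : ∀ u : F, constSection I E X.proj u ∈ smoothSections I F E := constSection_mem X.proj
  simp only [prolongTensor, map_smul, constSection_smul, C.bracket_smul_right _ _ (hc _) _ (hc _),
    tangentLift_const_smul _ (C.bracket_smooth _ (hc _) _ (hc _)),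
    coreLift_const_smul, coreLift_add, Pi.add_apply, Pi.smul_apply, smul_add]

lemma prolongTensor_smul_left (X : TangentBundle I M) (c : ℝ)
    (d d' : TangentProlongation I F E X) :
    C.prolongTensor X (c • d) d' = c • C.prolongTensor X d d' := by
  have hc : ∀ u : F, constSection I E X.proj u ∈ smoothSections I F E := constSection_mem X.proj
  simp only [prolongTensor, map_smul, constSection_smul, C.bracket_smul_left _ _ (hc _) _ (hc _),
    tangentLift_const_smul _ (C.bracket_smooth _ (hc _) _ (hc _)),
    coreLift_const_smul, coreLift_add, Pi.add_apply, Pi.smul_apply, smul_add]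

/-- The right-hand side is the formula of `PreCourant.pairing_bracket_eq`, which any bracket with
the required properties must satisfy, with `prolongTensor` as the bracket of flat sections. It is
linear in `w`, hence represented by a unique vector. -/
lemma exists_prolongBracket (s t : ∀ X, TangentProlongation I F E X) (X : TangentBundle I M) :
    ∃ d, ∀ w, C.prolongPairing X d w =
      C.prolongPairing X (flatDeriv I.tangent (F × F) X t (C.prolongAnchor X (s X)) -
        flatDeriv I.tangent (F × F) X s (C.prolongAnchor X (t X)) +
        C.prolongTensor X (s X) (t X)) w +
      C.prolongPairing X (flatDeriv I.tangent (F × F) X s (C.prolongAnchor X w)) (t X) := by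
  have : FiniteDimensional ℝ (TangentProlongation I F E X) :=
    inferInstanceAs (FiniteDimensional ℝ (F × F))
  exact exists_pairing_eq (C.prolongPairing_nondegenerate X)
    (φ := C.prolongPairing X (flatDeriv I.tangent (F × F) X t (C.prolongAnchor X (s X)) -
        flatDeriv I.tangent (F × F) X s (C.prolongAnchor X (t X)) +
        C.prolongTensor X (s X) (t X)) +
      { toFun := fun w => C.prolongPairing X
          (flatDeriv I.tangent (F × F) X s (C.prolongAnchor X w)) (t X)
        map_add' := fun u v => by
          rw [map_add, flatDeriv_add, map_add, LinearMap.add_apply]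
        map_smul' := fun c v => by
          rw [map_smul, flatDeriv_smul, map_smul, LinearMap.smul_apply]; rfl })

/-- The bracket of the tangent prolongation. -/
noncomputable def prolongBracket (s t : ∀ X, TangentProlongation I F E X)
    (X : TangentBundle I M) : TangentProlongation I F E X :=
  (C.exists_prolongBracket s t X).choose

lemma pairing_prolongBracket (s t : ∀ X, TangentProlongation I F E X) (X : TangentBundle I M)
    (w : TangentProlongation I F E X) :
    C.prolongPairing X (C.prolongBracket s t X) w =
      C.prolongPairing X (flatDeriv I.tangent (F × F) X t (C.prolongAnchor X (s X))) w -
        C.prolongPairing X (flatDeriv I.tangent (F × F) X s (C.prolongAnchor X (t X))) w +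
        C.prolongPairing X (C.prolongTensor X (s X) (t X)) w +
      C.prolongPairing X (flatDeriv I.tangent (F × F) X s (C.prolongAnchor X w)) (t X) := by
  refine ((C.exists_prolongBracket s t X).choose_spec w).trans ?_
  simp only [map_add, map_sub, LinearMap.add_apply, LinearMap.sub_apply]

lemma prolong_ext {X : TangentBundle I M} {d d' : TangentProlongation I F E X}
    (h : ∀ w, C.prolongPairing X d w = C.prolongPairing X d' w) : d = d' :=
  eq_of_pairing (C.prolongPairing_nondegenerate X) h

variable {s t r : ∀ X, TangentProlongation I F E X} (hs : s ∈ prolongSections I F E) (ht : t ∈ prolongSections I F E) (hr : r ∈ prolongSections I F E)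
  {f : TangentBundle I M → ℝ} (hf : ContMDiff I.tangent 𝓘(ℝ, ℝ) ∞ f) (X : TangentBundle I M)

lemma prolongBracket_congr {s t s' t' : ∀ X, TangentProlongation I F E X}
    (hs : ∀ᶠ Z in 𝓝 X, s Z = s' Z) (ht : ∀ᶠ Z in 𝓝 X, t Z = t' Z) :
    C.prolongBracket s t X = C.prolongBracket s' t' X := by
  refine C.prolong_ext fun w => ?_
  rw [pairing_prolongBracket, pairing_prolongBracket, hs.self_of_nhds, ht.self_of_nhds,
    flatDeriv_congr hs, flatDeriv_congr hs, flatDeriv_congr ht]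

include ht hr in
lemma prolongBracket_add_right :
    C.prolongBracket s (t + r) X = C.prolongBracket s t X + C.prolongBracket s r X := by
  refine C.prolong_ext fun w => ?_
  simp only [map_add, LinearMap.add_apply, pairing_prolongBracket, Pi.add_apply,
    flatDeriv_add_section ht hr, flatDeriv_add, prolongTensor_add_right]
  ring

include hs ht in
lemma prolongBracket_add_left :
    C.prolongBracket (s + t) r X = C.prolongBracket s r X + C.prolongBracket t r X := by
  refine C.prolong_ext fun w => ?_
  simp only [map_add, LinearMap.add_apply, pairing_prolongBracket, Pi.add_apply,
    flatDeriv_add_section hs ht, flatDeriv_add, prolongTensor_add_left]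
  ring

include ht hf in
lemma prolongBracket_smul_right :
    C.prolongBracket s (f • t) X = f X • C.prolongBracket s t X +
      derivAlong I.tangent f X (C.prolongAnchor X (s X)) • t X := by
  refine C.prolong_ext fun w => ?_
  simp only [map_add, map_smul, LinearMap.add_apply, LinearMap.smul_apply, smul_eq_mul,
    pairing_prolongBracket, Pi.smul_apply', flatDeriv_smul_section hf ht, flatDeriv_smul,
    prolongTensor_smul_right]
  ring

include hs hf in
lemma pairing_prolongBracket_smul_left (w : TangentProlongation I F E X) :
    C.prolongPairing X (C.prolongBracket (f • s) t X) w =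
      f X * C.prolongPairing X (C.prolongBracket s t X) w -
      derivAlong I.tangent f X (C.prolongAnchor X (t X)) * C.prolongPairing X (s X) w +
      derivAlong I.tangent f X (C.prolongAnchor X w) * C.prolongPairing X (s X) (t X) := by
  simp only [map_add, map_smul, LinearMap.add_apply, LinearMap.smul_apply, smul_eq_mul,
    pairing_prolongBracket, Pi.smul_apply', flatDeriv_smul_section hf hs, flatDeriv_smul,
    prolongTensor_smul_left]
  ring

lemma prolongBracket_flatLift (d d' : TangentProlongation I F E X) :
    C.prolongBracket (flatLift I E X d) (flatLift I E X d') X = C.prolongTensor X d d' := by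
  refine C.prolong_ext fun w => ?_
  have h : ∀ (d : TangentProlongation I F E X) v,
      flatDeriv I.tangent (F × F) X (flatLift I E X d) v = 0 := fun d v =>
    (flatLift_isFlatAt (E := E) X d).flatDeriv_eq_zero v
  simp only [pairing_prolongBracket, h, map_zero, LinearMap.zero_apply, flatLift_self]
  ring

include hs ht in
lemma mdifferentiableAt_prolongPairing :
    MDifferentiableAt I.tangent 𝓘(ℝ, ℝ) (fun Z => C.prolongPairing Z (s Z) (t Z)) X :=
  (C.contMDiff_prolongPairing s hs t ht).mdifferentiableAt (by simp)

end CourantAlgebroid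

end ProlongBracket

/-! ### Lifted gradients and the symmetric part of the prolonged bracket. -/

section ProlongLifts

variable {V : Type*} [NormedAddCommGroup V] [NormedSpace ℝ V] {H : Type*} [TopologicalSpace H]
  {I : ModelWithCorners ℝ V H} {M : Type*} [TopologicalSpace M] [ChartedSpace H M]
  [IsManifold I ∞ M]
  {F : Type*} [NormedAddCommGroup F] [NormedSpace ℝ F] {E : M → Type*}
  [∀ x, AddCommGroup (E x)] [∀ x, Module ℝ (E x)] [∀ x, TopologicalSpace (E x)]
  [TopologicalSpace (TotalSpace F E)] [FiberBundle F E] [VectorBundle ℝ F E]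
  [ContMDiffVectorBundle ∞ F E I]
  [FiniteDimensional ℝ V] [T2Space M] [FiniteDimensional ℝ F] [I.Boundaryless]

lemma exists_lift_eq {X : TangentBundle I M} (d : TangentProlongation I F E X) :
    ∃ σ ∈ smoothSections I F E, ∃ τ ∈ smoothSections I F E,
      d = tangentLift I F E σ X + coreLift I F E τ X :=
  ⟨_, constSection_mem X.proj _, _, constSection_mem X.proj _, (flatLift_self X d).symm⟩

omit [FiniteDimensional ℝ V] [T2Space M] [I.Boundaryless] in
lemma derivAlong_lift_add {f g h : M → ℝ} (hf : ContMDiff I 𝓘(ℝ, ℝ) ∞ f)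
    (hg : ContMDiff I 𝓘(ℝ, ℝ) ∞ g) (hh : ContMDiff I 𝓘(ℝ, ℝ) ∞ h) {X : TangentBundle I M}
    (d : TangentSpace I.tangent X) :
    derivAlong I.tangent
        (fun Z => tangentLiftFun I f Z + (coreLiftFun I g Z + coreLiftFun I h Z)) X d =
      derivAlong I.tangent (tangentLiftFun I f) X d +
        (derivAlong I.tangent (coreLiftFun I g) X d +
          derivAlong I.tangent (coreLiftFun I h) X d) := by
  have h1 := (contMDiff_coreLiftFun hg).mdifferentiableAt (x := X) (by simp)
  have h2 := (contMDiff_coreLiftFun hh).mdifferentiableAt (x := X) (by simp)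
  have h3 := (contMDiff_tangentLiftFun hf).mdifferentiableAt (x := X) (by simp)
  exact (derivAlong_fun_add h3 (h1.add h2) d).trans
    (congrArg (_ + ·) (derivAlong_fun_add h1 h2 d))

namespace CourantAlgebroid

variable (C : CourantAlgebroid I F E) {σ τ : ∀ x, E x} (hσ : σ ∈ smoothSections I F E)
  (hτ : τ ∈ smoothSections I F E) {f : M → ℝ} (hf : ContMDiff I 𝓘(ℝ, ℝ) ∞ f)
  (X : TangentBundle I M)

include hf in
-- Stated through pairings, this says that the gradient of f_T is the tangent lift of the gradient
-- of f. It is checked on lifts, which exhaust each fibre.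
lemma pairing_tangentLift_grad (w : TangentProlongation I F E X) :
    C.prolongPairing X (tangentLift I F E (C.toPre.grad f) X) w =
      derivAlong I.tangent (tangentLiftFun I f) X (C.prolongAnchor X w) := by
  obtain ⟨κ, hκ, κ', hκ', rfl⟩ := exists_lift_eq w
  rw [map_add, map_add, derivAlong_add, C.prolongPairing_TT (C.toPre.grad_mem hf) hκ,
    prolongPairing_TC, C.prolongAnchor_T_T hκ hf, C.prolongAnchor_C_T _ hf]
  exact congrArg₂ (· + ·)
    (congrArg (tangentLiftFun I · X) (funext fun y => C.toPre.pairing_grad f y (κ y)))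
    (C.toPre.pairing_grad f X.proj (κ' X.proj))

include hf in
lemma pairing_coreLift_grad (w : TangentProlongation I F E X) :
    C.prolongPairing X (coreLift I F E (C.toPre.grad f) X) w =
      derivAlong I.tangent (coreLiftFun I f) X (C.prolongAnchor X w) := by
  obtain ⟨κ, hκ, κ', hκ', rfl⟩ := exists_lift_eq w
  rw [map_add, map_add, derivAlong_add, prolongPairing_CT,
    prolongPairing_CC, C.prolongAnchor_T_C hκ hf, C.prolongAnchor_C_C _ hf]
  exact congrArg (· + 0) (C.toPre.pairing_grad f X.proj (κ X.proj))

lemma prolongPairing_lift {σ' τ' : ∀ x, E x} (hσ : σ ∈ smoothSections I F E)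
    (hτ : τ ∈ smoothSections I F E) (X : TangentBundle I M) :
    C.prolongPairing X ((tangentLift I F E σ + coreLift I F E σ') X)
        ((tangentLift I F E τ + coreLift I F E τ') X) =
      tangentLiftFun I (fun y => C.pairing y (σ y) (τ y)) X +
      (coreLiftFun I (fun y => C.pairing y (σ y) (τ' y)) X +
        coreLiftFun I (fun y => C.pairing y (σ' y) (τ y)) X) := by
  simp only [Pi.add_apply, map_add, LinearMap.add_apply, C.prolongPairing_TT hσ hτ,
    prolongPairing_CT, prolongPairing_TC, prolongPairing_CC, coreLiftFun]
  ring

variable {s t r : ∀ X, TangentProlongation I F E X} (hs : s ∈ prolongSections I F E)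
  (ht : t ∈ prolongSections I F E) (hr : r ∈ prolongSections I F E)

lemma prolongTensor_mk (p q : F × F) : C.prolongTensor X p q = tangentLift I F E
      (C.bracket (constSection I E X.proj p.1) (constSection I E X.proj q.1)) X +
    (coreLift I F E (C.bracket (constSection I E X.proj p.1) (constSection I E X.proj q.2)) X +
      coreLift I F E (C.bracket (constSection I E X.proj p.2) (constSection I E X.proj q.1)) X) :=
  congrArg (_ + ·) (congrFun (coreLift_add _ _) X)

include hs ht in
/-- The symmetric part of the bracket of the tangent prolongation. -/
lemma prolongBracket_symmetric (w : TangentProlongation I F E X) :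
    C.prolongPairing X (C.prolongBracket s t X + C.prolongBracket t s X) w =
      derivAlong I.tangent (fun Z => C.prolongPairing Z (s Z) (t Z)) X (C.prolongAnchor X w) := by
  -- The claim with both brackets expanded: the derivatives along the anchors of `s` and `t` have
  -- cancelled. What remains is symmetric and tensorial, so flat lifts suffice.
  let Ψ : (∀ X, TangentProlongation I F E X) → (∀ X, TangentProlongation I F E X) → ℝ :=
    fun s t => derivAlong I.tangent (fun Z => C.prolongPairing Z (s Z) (t Z)) X
        (C.prolongAnchor X w) -
      C.prolongPairing X (flatDeriv I.tangent (F × F) X s (C.prolongAnchor X w)) (t X) -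
      C.prolongPairing X (flatDeriv I.tangent (F × F) X t (C.prolongAnchor X w)) (s X) -
      C.prolongPairing X (C.prolongTensor X (s X) (t X)) w -
      C.prolongPairing X (C.prolongTensor X (t X) (s X)) w
  have hsymm : ∀ s t, Ψ s t = Ψ t s := fun s t => by
    simp only [Ψ, C.prolongPairing_symm _ (s _) (t _)]
    ring
  have key : ∀ t ∈ prolongSections I F E, (∀ p : F × F, Ψ (flatLift I E X p) t = 0) →
      ∀ s ∈ prolongSections I F E, Ψ s t = 0 := by
    intro t ht h0
    refine tensorial_eq_zero (x := X) (fun s hs r hr => ?_) (fun f hf s hs => ?_)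
      fun p => ⟨_, flatLift_mem X p, flatLift_isFlatAt X p, h0 p⟩
    · simp only [Ψ, Pi.add_apply, map_add, LinearMap.add_apply, flatDeriv_add_section hs hr,
        prolongTensor_add_left, prolongTensor_add_right]
      rw [derivAlong_fun_add (C.mdifferentiableAt_prolongPairing hs ht X)
        (C.mdifferentiableAt_prolongPairing hr ht X)]
      ring
    · simp only [Ψ, Pi.smul_apply', map_add, map_smul, LinearMap.add_apply, LinearMap.smul_apply,
        flatDeriv_smul_section hf hs, prolongTensor_smul_left, prolongTensor_smul_right,
        smul_eq_mul]
      rw [derivAlong_fun_mul (hf.mdifferentiableAt (by simp))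
        (C.mdifferentiableAt_prolongPairing hs ht X)]
      ring
  -- The pairing of two flat lifts is a sum of one tangent lift and two core lifts of functions. Its
  -- derivative along an anchor is a pairing with lifted gradients, and these gradients are
  -- symmetrised brackets over `M`.
  have h0 : ∀ p q : F × F, Ψ (flatLift I E X p) (flatLift I E X q) = 0 := by
    intro p q
    have hf : ∀ (p : F × F) v,
        flatDeriv I.tangent (F × F) X (flatLift I E X p) v = 0 := fun p v =>
      (flatLift_isFlatAt (E := E) X p).flatDeriv_eq_zero v
    have hc : ∀ u : F, constSection I E X.proj u ∈ smoothSections I F E := constSection_mem X.proj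
    have hg := fun u v : F => C.pairing_smooth _ (hc u) _ (hc v)
    have hfun : (fun Z => C.prolongPairing Z (flatLift I E X p Z) (flatLift I E X q Z)) = fun Z =>
        tangentLiftFun I (fun y => C.pairing y (constSection I E X.proj p.1 y)
          (constSection I E X.proj q.1 y)) Z +
        (coreLiftFun I (fun y => C.pairing y (constSection I E X.proj p.1 y)
          (constSection I E X.proj q.2 y)) Z +
          coreLiftFun I (fun y => C.pairing y (constSection I E X.proj p.2 y)
          (constSection I E X.proj q.1 y)) Z) :=
      funext fun Z => C.prolongPairing_lift (hc _) (hc _) Z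
    have hgr := fun u v : F => C.toPre.bracket_add_bracket_symm (hc u) (hc v)
    simp only [Ψ]
    rw [hfun, derivAlong_lift_add (hg _ _) (hg _ _) (hg _ _),
      ← pairing_tangentLift_grad C (hg _ _), ← pairing_coreLift_grad C (hg _ _),
      ← pairing_coreLift_grad C (hg _ _), hf, hf, map_zero, LinearMap.zero_apply,
      LinearMap.zero_apply, show flatLift I E X p X = _ from flatLift_self X p,
      show flatLift I E X q X = _ from flatLift_self X q]
    have e1 := hgr p.1 q.1
    have e2 := hgr p.1 q.2
    have e3 := hgr p.2 q.1
    change _ = C.toPre.grad (fun y => C.pairing y _ _) at e1 e2 e3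
    rw [← e1, ← e2, ← e3]
    have hb : ∀ u v : F, C.bracket (constSection I E X.proj u) (constSection I E X.proj v) ∈
      smoothSections I F E := fun u v => C.bracket_smooth _ (hc u) _ (hc v)
    rw [prolongTensor_mk, prolongTensor_mk]
    change C.prolongPairing X (tangentLift I F E (C.bracket _ _ + C.bracket _ _) X) w +
      (C.prolongPairing X (coreLift I F E (C.bracket _ _ + C.bracket _ _) X) w +
      C.prolongPairing X (coreLift I F E (C.bracket _ _ + C.bracket _ _) X) w) - 0 - 0 - _ - _ = _
    rw [tangentLift_add (hb _ _) (hb _ _)]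
    simp only [coreLift_add, Pi.add_apply, map_add, LinearMap.add_apply]
    abel
  have h := key t ht (fun p => by
    rw [hsymm]
    exact key _ (flatLift_mem X p) (fun q => h0 q p) t ht) s hs
  simp only [Ψ] at h
  rw [map_add, LinearMap.add_apply, pairing_prolongBracket, pairing_prolongBracket]
  linarith

end CourantAlgebroid

end ProlongLifts

/-! ### Brackets of lifts. -/

section BracketLifts

variable {V : Type*} [NormedAddCommGroup V] [NormedSpace ℝ V] {H : Type*} [TopologicalSpace H]
  {I : ModelWithCorners ℝ V H} {M : Type*} [TopologicalSpace M] [ChartedSpace H M]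
  [IsManifold I ∞ M]
  {F : Type*} [NormedAddCommGroup F] [NormedSpace ℝ F] {E : M → Type*}
  [∀ x, AddCommGroup (E x)] [∀ x, Module ℝ (E x)] [∀ x, TopologicalSpace (E x)]
  [TopologicalSpace (TotalSpace F E)] [FiberBundle F E] [VectorBundle ℝ F E]
  [ContMDiffVectorBundle ∞ F E I]

lemma tangentLift_zero : tangentLift I F E (0 : ∀ x, E x) = 0 := by
  have h := tangentLift_add (I := I) (F := F) (E := E) smoothSections_zero smoothSections_zero
  rw [add_zero] at h
  exact left_eq_add.1 h

lemma coreLift_zero : coreLift I F E (0 : ∀ x, E x) = 0 := by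
  have h := coreLift_add (I := I) (F := F) (0 : ∀ x, E x) 0
  rw [add_zero] at h
  exact left_eq_add.1 h

variable [FiniteDimensional ℝ V] [T2Space M] [FiniteDimensional ℝ F] [I.Boundaryless]

lemma flatLift_inl (X : TangentBundle I M) (u : F) :
    flatLift I E X (u, 0) = tangentLift I F E (constSection I E X.proj u) := by
  rw [flatLift, constSection_zero, coreLift_zero, add_zero]

lemma flatLift_inr (X : TangentBundle I M) (u : F) :
    flatLift I E X (0, u) = coreLift I F E (constSection I E X.proj u) := by
  rw [flatLift, constSection_zero, tangentLift_zero, zero_add]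

omit [I.Boundaryless] in
-- Tensoriality is needed only in second arguments, the first argument being reached by exchange.
-- Two operations are allowed because exchanging the arguments turns the bracket of a tangent and a
-- core lift into that of a core and a tangent lift.
lemma tensorial_pair_eq_zero {G : Type*} [AddCommGroup G] [Module ℝ G] {x : M}
    {P Q : (∀ y, E y) → (∀ y, E y) → G}
    (hadd : ∀ σ ∈ smoothSections I F E, ∀ τ ∈ smoothSections I F E, ∀ τ' ∈ smoothSections I F E,
      P σ (τ + τ') = P σ τ + P σ τ')
    (hsmul : ∀ σ ∈ smoothSections I F E, ∀ f : M → ℝ, ContMDiff I 𝓘(ℝ, ℝ) ∞ f →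
      ∀ τ ∈ smoothSections I F E, P σ (f • τ) = f x • P σ τ)
    (hadd' : ∀ σ ∈ smoothSections I F E, ∀ τ ∈ smoothSections I F E,
      ∀ τ' ∈ smoothSections I F E, Q σ (τ + τ') = Q σ τ + Q σ τ')
    (hsmul' : ∀ σ ∈ smoothSections I F E, ∀ f : M → ℝ, ContMDiff I 𝓘(ℝ, ℝ) ∞ f →
      ∀ τ ∈ smoothSections I F E, Q σ (f • τ) = f x • Q σ τ)
    (hsymm : ∀ σ ∈ smoothSections I F E, ∀ τ ∈ smoothSections I F E, P σ τ = -Q τ σ)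
    (h0 : ∀ u v : F, P (constSection I E x u) (constSection I E x v) = 0)
    {σ τ : ∀ y, E y} (hσ : σ ∈ smoothSections I F E) (hτ : τ ∈ smoothSections I F E) :
    P σ τ = 0 := by
  rw [hsymm σ hσ τ hτ, neg_eq_zero]
  refine tensorial_eq_zero (hadd' τ hτ) (hsmul' τ hτ)
    (fun u => ⟨_, constSection_mem x u, constSection_isFlatAt x u, ?_⟩) σ hσ
  rw [← neg_eq_zero, ← hsymm _ (constSection_mem x u) τ hτ]
  exact tensorial_eq_zero (hadd _ (constSection_mem x u)) (hsmul _ (constSection_mem x u))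
    (fun v => ⟨_, constSection_mem x v, constSection_isFlatAt x v, h0 u v⟩) τ hτ

namespace CourantAlgebroid

variable (C : CourantAlgebroid I F E) {σ τ : ∀ x, E x} (hσ : σ ∈ smoothSections I F E)
  (hτ : τ ∈ smoothSections I F E) (X : TangentBundle I M)

include hσ in
lemma bracket_zero_right : C.bracket σ 0 = 0 := by
  have h := C.bracket_add_right σ hσ 0 smoothSections_zero 0 smoothSections_zero
  rw [add_zero] at h
  exact left_eq_add.1 h

include hσ in
lemma bracket_zero_left : C.bracket 0 σ = 0 := by
  have h := C.bracket_add_left 0 smoothSections_zero 0 smoothSections_zero σ hσ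
  rw [add_zero] at h
  exact left_eq_add.1 h

include hσ hτ in
-- Core lifts are mutually orthogonal and their anchors kill core functions, so the bracket is skew
-- and tensorial on them; on flat sections it is zero because every term contains a bracket with the
-- zero section.
lemma prolongBracket_CC : C.prolongBracket (coreLift I F E σ) (coreLift I F E τ) X = 0 := by
  have hc : ∀ u : F, constSection I E X.proj u ∈ smoothSections I F E := constSection_mem X.proj
  refine tensorial_pair_eq_zero (x := X.proj)
    (P := fun σ τ => C.prolongBracket (coreLift I F E σ) (coreLift I F E τ) X)
    (Q := fun σ τ => C.prolongBracket (coreLift I F E σ) (coreLift I F E τ) X)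
    ?hadd ?hsmul ?hadd ?hsmul ?_ ?_ hσ hτ
  case hadd =>
    intro σ hσ τ hτ τ' hτ'
    rw [coreLift_add, C.prolongBracket_add_right (coreLift_mem hτ) (coreLift_mem hτ')]
  case hsmul =>
    intro σ hσ f hf τ hτ
    rw [coreLift_smul, C.prolongBracket_smul_right (coreLift_mem hτ) (contMDiff_coreLiftFun hf),
      C.prolongAnchor_C_C _ hf, zero_smul, add_zero, coreLiftFun]
  · intro σ hσ τ hτ
    refine eq_neg_of_add_eq_zero_left (C.prolong_ext fun w => ?_)
    rw [C.prolongBracket_symmetric X (coreLift_mem hσ) (coreLift_mem hτ)]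
    simp only [prolongPairing_CC, derivAlong_const, map_zero, LinearMap.zero_apply]
  · intro u v
    rw [← flatLift_inr, ← flatLift_inr]
    refine (C.prolongBracket_flatLift X _ _).trans ((C.prolongTensor_mk X _ _).trans ?_)
    simp only [constSection_zero, C.bracket_zero_right (hc _), C.bracket_zero_left (hc _),
      C.bracket_zero_left smoothSections_zero, tangentLift_zero, coreLift_zero, Pi.zero_apply,
      add_zero]

lemma bracket_fun_smul {f : M → ℝ} (hf : ContMDiff I 𝓘(ℝ, ℝ) ∞ f)
    (hσ : σ ∈ smoothSections I F E) (hτ : τ ∈ smoothSections I F E) :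
    C.bracket σ (f • τ) =
      f • C.bracket σ τ + (fun x => derivAlong I f x (C.anchor x (σ x))) • τ :=
  C.toPre.bracket_fun_smul_right hσ hτ hf

/-- The two identities are proved together because the symmetric part exchanges them. Multiplying a
tangent lift by `f` produces a core lift with coefficient f_T, whose bracket with a core lift is
zero by `prolongBracket_CC`. -/
lemma prolongBracket_TC_and_CT (hσ : σ ∈ smoothSections I F E) (hτ : τ ∈ smoothSections I F E) :
    C.prolongBracket (tangentLift I F E σ) (coreLift I F E τ) X =
      coreLift I F E (C.bracket σ τ) X ∧
    C.prolongBracket (coreLift I F E τ) (tangentLift I F E σ) X =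
      coreLift I F E (C.bracket τ σ) X := by
  have hc : ∀ u : F, constSection I E X.proj u ∈ smoothSections I F E := constSection_mem X.proj
  let P : (∀ y, E y) → (∀ y, E y) → TangentProlongation I F E X := fun σ τ =>
    C.prolongBracket (tangentLift I F E σ) (coreLift I F E τ) X - coreLift I F E (C.bracket σ τ) X
  let Q : (∀ y, E y) → (∀ y, E y) → TangentProlongation I F E X := fun σ τ =>
    C.prolongBracket (coreLift I F E σ) (tangentLift I F E τ) X - coreLift I F E (C.bracket σ τ) X
  have hsymm : ∀ σ ∈ smoothSections I F E, ∀ τ ∈ smoothSections I F E, P σ τ = -Q τ σ := by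
    intro σ hσ τ hτ
    have hg := C.pairing_smooth σ hσ τ hτ
    refine eq_neg_of_add_eq_zero_left (C.prolong_ext fun w => ?_)
    have h1 := C.prolongBracket_symmetric X (tangentLift_mem hσ) (coreLift_mem hτ) w
    simp only [prolongPairing_TC] at h1
    have h2 := C.pairing_coreLift_grad hg X w
    have h3 : C.toPre.grad (fun y => C.pairing y (σ y) (τ y)) = C.bracket σ τ + C.bracket τ σ :=
      (C.toPre.bracket_add_bracket_symm hσ hτ).symm
    rw [h3, coreLift_add] at h2
    have h4 := h1.trans h2.symm
    simp only [Pi.add_apply, map_add, LinearMap.add_apply] at h4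
    simp only [P, Q, map_add, map_sub, LinearMap.add_apply, LinearMap.sub_apply, map_zero,
      LinearMap.zero_apply]
    linarith
  have hP : ∀ σ ∈ smoothSections I F E, ∀ τ ∈ smoothSections I F E, P σ τ = 0 := by
    intro σ hσ τ hτ
    refine tensorial_pair_eq_zero (x := X.proj) (P := P) (Q := Q)
      ?_ ?_ ?_ ?_ hsymm ?_ hσ hτ
    · intro σ hσ τ hτ τ' hτ'
      simp only [P]
      rw [coreLift_add, C.prolongBracket_add_right (coreLift_mem hτ) (coreLift_mem hτ'),
        C.bracket_add_right σ hσ τ hτ τ' hτ', coreLift_add, Pi.add_apply]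
      abel
    · intro σ hσ f hf τ hτ
      simp only [P]
      rw [coreLift_smul, C.prolongBracket_smul_right (coreLift_mem hτ) (contMDiff_coreLiftFun hf),
        C.prolongAnchor_T_C hσ hf, C.bracket_fun_smul hf hσ hτ, coreLift_add, coreLift_smul,
        coreLift_smul]
      simp only [Pi.add_apply, Pi.smul_apply', coreLiftFun, smul_sub]
      abel
    · intro σ hσ τ hτ τ' hτ'
      simp only [Q]
      rw [tangentLift_add hτ hτ', C.prolongBracket_add_right (tangentLift_mem hτ)
        (tangentLift_mem hτ'), C.bracket_add_right σ hσ τ hτ τ' hτ', coreLift_add, Pi.add_apply]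
      abel
    · intro σ hσ f hf τ hτ
      simp only [Q]
      rw [tangentLift_smul hf hτ, C.prolongBracket_add_right
        (smoothSections_smul (contMDiff_coreLiftFun hf) (tangentLift_mem hτ))
        (smoothSections_smul (contMDiff_tangentLiftFun hf) (coreLift_mem hτ)),
        C.prolongBracket_smul_right (tangentLift_mem hτ) (contMDiff_coreLiftFun hf),
        C.prolongBracket_smul_right (coreLift_mem hτ) (contMDiff_tangentLiftFun hf),
        C.prolongAnchor_C_C _ hf, C.prolongAnchor_C_T _ hf, C.prolongBracket_CC hσ hτ,
        C.bracket_fun_smul hf hσ hτ, coreLift_add, coreLift_smul, coreLift_smul]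
      simp only [Pi.add_apply, Pi.smul_apply', coreLiftFun, smul_sub, smul_zero, zero_smul,
        zero_add, add_zero]
      abel
    · intro u v
      simp only [P]
      rw [← flatLift_inr, ← flatLift_inl, sub_eq_zero]
      refine (C.prolongBracket_flatLift X _ _).trans ((C.prolongTensor_mk X _ _).trans ?_)
      simp only [constSection_zero, C.bracket_zero_right (hc _),
        C.bracket_zero_left smoothSections_zero, tangentLift_zero, coreLift_zero, Pi.zero_apply,
        add_zero, zero_add]
  have h := hP σ hσ τ hτ
  refine ⟨sub_eq_zero.1 h, sub_eq_zero.1 ?_⟩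
  rw [hsymm σ hσ τ hτ, neg_eq_zero] at h
  exact h

include hσ hτ in
lemma prolongBracket_TC : C.prolongBracket (tangentLift I F E σ) (coreLift I F E τ) X =
    coreLift I F E (C.bracket σ τ) X := (C.prolongBracket_TC_and_CT X hσ hτ).1

include hσ hτ in
lemma prolongBracket_CT : C.prolongBracket (coreLift I F E σ) (tangentLift I F E τ) X =
    coreLift I F E (C.bracket σ τ) X := (C.prolongBracket_TC_and_CT X hτ hσ).2

include hσ hτ in
-- The deviation is skew and tensorial: the core terms created by (fτ)_T on one side match those
-- created by the tangent lift of the Leibniz rule on the other, by `prolongBracket_TC`.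
lemma prolongBracket_TT : C.prolongBracket (tangentLift I F E σ) (tangentLift I F E τ) X =
    tangentLift I F E (C.bracket σ τ) X := by
  have hc : ∀ u : F, constSection I E X.proj u ∈ smoothSections I F E := constSection_mem X.proj
  have hb := C.bracket_smooth
  let P : (∀ y, E y) → (∀ y, E y) → TangentProlongation I F E X := fun σ τ =>
    C.prolongBracket (tangentLift I F E σ) (tangentLift I F E τ) X -
      tangentLift I F E (C.bracket σ τ) X
  have hP : P σ τ = 0 := by
    refine tensorial_pair_eq_zero (x := X.proj) (P := P) (Q := P)
      ?hadd ?hsmul ?hadd ?hsmul ?_ ?_ hσ hτ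
    case hadd =>
      intro σ hσ τ hτ τ' hτ'
      simp only [P]
      rw [tangentLift_add hτ hτ', C.prolongBracket_add_right (tangentLift_mem hτ)
        (tangentLift_mem hτ'), C.bracket_add_right σ hσ τ hτ τ' hτ',
        tangentLift_add (hb _ hσ _ hτ) (hb _ hσ _ hτ'), Pi.add_apply]
      abel
    case hsmul =>
      intro σ hσ f hf τ hτ
      have ha := C.contMDiff_anchorDeriv hσ hf
      simp only [P]
      rw [tangentLift_smul hf hτ, C.prolongBracket_add_right
        (smoothSections_smul (contMDiff_coreLiftFun hf) (tangentLift_mem hτ))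
        (smoothSections_smul (contMDiff_tangentLiftFun hf) (coreLift_mem hτ)),
        C.prolongBracket_smul_right (tangentLift_mem hτ) (contMDiff_coreLiftFun hf),
        C.prolongBracket_smul_right (coreLift_mem hτ) (contMDiff_tangentLiftFun hf),
        C.prolongAnchor_T_C hσ hf, C.prolongAnchor_T_T hσ hf, C.prolongBracket_TC hσ hτ,
        C.bracket_fun_smul hf hσ hτ,
        tangentLift_add (smoothSections_smul hf (hb _ hσ _ hτ)) (smoothSections_smul ha hτ),
        tangentLift_smul hf (hb _ hσ _ hτ), tangentLift_smul ha hτ]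
      simp only [Pi.add_apply, Pi.smul_apply', coreLiftFun, smul_sub]
      abel
    · intro σ hσ τ hτ
      have hg := C.pairing_smooth σ hσ τ hτ
      refine eq_neg_of_add_eq_zero_left (C.prolong_ext fun w => ?_)
      have h1 := C.prolongBracket_symmetric X (tangentLift_mem hσ) (tangentLift_mem hτ) w
      simp only [C.prolongPairing_TT hσ hτ] at h1
      have h2 := C.pairing_tangentLift_grad hg X w
      have h3 : C.toPre.grad (fun y => C.pairing y (σ y) (τ y)) = C.bracket σ τ + C.bracket τ σ :=
        (C.toPre.bracket_add_bracket_symm hσ hτ).symm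
      rw [h3, tangentLift_add (hb _ hσ _ hτ) (hb _ hτ _ hσ)] at h2
      have h4 := h1.trans h2.symm
      simp only [Pi.add_apply, map_add, LinearMap.add_apply] at h4
      simp only [P, map_add, map_sub, LinearMap.add_apply, LinearMap.sub_apply, map_zero,
        LinearMap.zero_apply]
      linarith
    · intro u v
      simp only [P]
      rw [← flatLift_inl, ← flatLift_inl, sub_eq_zero]
      refine (C.prolongBracket_flatLift X _ _).trans ((C.prolongTensor_mk X _ _).trans ?_)
      simp only [constSection_zero, C.bracket_zero_right (hc _), C.bracket_zero_left (hc _),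
        coreLift_zero, Pi.zero_apply,
        add_zero]
  exact sub_eq_zero.1 hP

end CourantAlgebroid

end BracketLifts

/-! ### Invariance and smoothness of the prolonged bracket. -/

section Prolongation

variable {V : Type*} [NormedAddCommGroup V] [NormedSpace ℝ V] {H : Type*} [TopologicalSpace H]
  {I : ModelWithCorners ℝ V H} {M : Type*} [TopologicalSpace M] [ChartedSpace H M]
  [IsManifold I ∞ M]
  {F : Type*} [NormedAddCommGroup F] [NormedSpace ℝ F] {E : M → Type*}
  [∀ x, AddCommGroup (E x)] [∀ x, Module ℝ (E x)] [∀ x, TopologicalSpace (E x)]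
  [TopologicalSpace (TotalSpace F E)] [FiberBundle F E] [VectorBundle ℝ F E]
  [ContMDiffVectorBundle ∞ F E I]
  [FiniteDimensional ℝ V] [T2Space M] [FiniteDimensional ℝ F] [I.Boundaryless]

namespace CourantAlgebroid

variable (C : CourantAlgebroid I F E) {σ τ σ' τ' : ∀ x, E x} (hσ : σ ∈ smoothSections I F E)
  (hσ' : σ' ∈ smoothSections I F E) (hτ : τ ∈ smoothSections I F E)
  (hτ' : τ' ∈ smoothSections I F E)
  {s t r : ∀ X, TangentProlongation I F E X} (hs : s ∈ prolongSections I F E)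
  (ht : t ∈ prolongSections I F E) (hr : r ∈ prolongSections I F E)

include hσ hσ' hτ hτ' in
lemma prolongBracket_lift :
    C.prolongBracket (tangentLift I F E σ + coreLift I F E σ')
        (tangentLift I F E τ + coreLift I F E τ') =
      tangentLift I F E (C.bracket σ τ) + coreLift I F E (C.bracket σ τ' + C.bracket σ' τ) := by
  ext X : 1
  have h1 := tangentLift_mem hσ
  have h2 := tangentLift_mem hτ
  have h3 := coreLift_mem hσ'
  have h4 := coreLift_mem hτ'
  rw [C.prolongBracket_add_left h1 h3, C.prolongBracket_add_right h2 h4,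
    C.prolongBracket_add_right h2 h4, C.prolongBracket_TT hσ hτ, C.prolongBracket_TC hσ hτ',
    C.prolongBracket_CT hσ' hτ, C.prolongBracket_CC hσ' hτ', coreLift_add]
  simp only [Pi.add_apply, add_zero]
  abel

include hσ in
lemma prolongAnchor_lift_T (σ' : ∀ x, E x) {f : M → ℝ} (hf : ContMDiff I 𝓘(ℝ, ℝ) ∞ f)
    (X : TangentBundle I M) :
    derivAlong I.tangent (tangentLiftFun I f) X
        (C.prolongAnchor X ((tangentLift I F E σ + coreLift I F E σ') X)) =
      tangentLiftFun I (fun x => derivAlong I f x (C.anchor x (σ x))) X +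
        coreLiftFun I (fun x => derivAlong I f x (C.anchor x (σ' x))) X := by
  rw [Pi.add_apply, map_add, derivAlong_add, C.prolongAnchor_T_T hσ hf, C.prolongAnchor_C_T _ hf]

include hσ in
lemma prolongAnchor_lift_C (σ' : ∀ x, E x) {f : M → ℝ} (hf : ContMDiff I 𝓘(ℝ, ℝ) ∞ f)
    (X : TangentBundle I M) :
    derivAlong I.tangent (coreLiftFun I f) X
        (C.prolongAnchor X ((tangentLift I F E σ + coreLift I F E σ') X)) =
      coreLiftFun I (fun x => derivAlong I f x (C.anchor x (σ x))) X := by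
  rw [Pi.add_apply, map_add, derivAlong_add, C.prolongAnchor_T_C hσ hf, C.prolongAnchor_C_C _ hf,
    add_zero]

include hs ht hr in
lemma prolongBracket_invariance (X : TangentBundle I M) :
    derivAlong I.tangent (fun Z => C.prolongPairing Z (t Z) (r Z)) X (C.prolongAnchor X (s X)) =
      C.prolongPairing X (C.prolongBracket s t X) (r X) +
        C.prolongPairing X (t X) (C.prolongBracket s r X) := by
  -- Derivatives of `s` cancel between the two brackets on the right, so only its value at `X`
  -- matters. With that value fixed, the claim becomes tensorial in `t` and `r`.
  obtain ⟨d, hd⟩ : ∃ d, d = s X := ⟨_, rfl⟩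
  let Ψ : (∀ X, TangentProlongation I F E X) → (∀ X, TangentProlongation I F E X) → ℝ :=
    fun t r => derivAlong I.tangent (fun Z => C.prolongPairing Z (t Z) (r Z)) X
        (C.prolongAnchor X d) -
      C.prolongPairing X (flatDeriv I.tangent (F × F) X t (C.prolongAnchor X d)) (r X) -
      C.prolongPairing X (flatDeriv I.tangent (F × F) X r (C.prolongAnchor X d)) (t X) -
      C.prolongPairing X (C.prolongTensor X d (t X)) (r X) -
      C.prolongPairing X (C.prolongTensor X d (r X)) (t X)
  have hsymm : ∀ t r, Ψ t r = Ψ r t := fun t r => by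
    simp only [Ψ, C.prolongPairing_symm _ (t _) (r _)]
    ring
  have key : ∀ t ∈ prolongSections I F E, (∀ p : F × F, Ψ (flatLift I E X p) t = 0) →
      ∀ s ∈ prolongSections I F E, Ψ s t = 0 := by
    intro t ht h0
    refine tensorial_eq_zero (x := X) (fun s hs r hr => ?_) (fun f hf s hs => ?_)
      fun p => ⟨_, flatLift_mem X p, flatLift_isFlatAt X p, h0 p⟩
    · simp only [Ψ, Pi.add_apply, map_add, LinearMap.add_apply, flatDeriv_add_section hs hr,
        prolongTensor_add_right]
      rw [derivAlong_fun_add (C.mdifferentiableAt_prolongPairing hs ht X)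
        (C.mdifferentiableAt_prolongPairing hr ht X)]
      ring
    · simp only [Ψ, Pi.smul_apply', map_add, map_smul, LinearMap.add_apply, LinearMap.smul_apply,
        flatDeriv_smul_section hf hs, prolongTensor_smul_right, smul_eq_mul]
      rw [derivAlong_fun_mul (hf.mdifferentiableAt (by simp))
        (C.mdifferentiableAt_prolongPairing hs ht X)]
      ring
  -- Expanding `d` and the flat lifts into tangent and core parts, the claim reduces to the
  -- invariance identity over `M` and its derivative along `X`.
  have h0 : ∀ p q : F × F, Ψ (flatLift I E X p) (flatLift I E X q) = 0 := by
    intro p q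
    have hf : ∀ (p : F × F) v,
        flatDeriv I.tangent (F × F) X (flatLift I E X p) v = 0 := fun p v =>
      (flatLift_isFlatAt (E := E) X p).flatDeriv_eq_zero v
    have hc : ∀ u : F, constSection I E X.proj u ∈ smoothSections I F E := constSection_mem X.proj
    have hg := fun u v : F => C.pairing_smooth _ (hc u) _ (hc v)
    have hb : ∀ u v : F, C.bracket (constSection I E X.proj u) (constSection I E X.proj v) ∈
      smoothSections I F E := fun u v => C.bracket_smooth _ (hc u) _ (hc v)
    have hfun : (fun Z => C.prolongPairing Z (flatLift I E X p Z) (flatLift I E X q Z)) = fun Z =>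
        tangentLiftFun I (fun y => C.pairing y (constSection I E X.proj p.1 y)
          (constSection I E X.proj q.1 y)) Z +
        (coreLiftFun I (fun y => C.pairing y (constSection I E X.proj p.1 y)
          (constSection I E X.proj q.2 y)) Z +
          coreLiftFun I (fun y => C.pairing y (constSection I E X.proj p.2 y)
          (constSection I E X.proj q.1 y)) Z) :=
      funext fun Z => C.prolongPairing_lift (hc _) (hc _) Z
    have hT : ∀ p q : F × F, C.prolongPairing X
        (C.prolongTensor X d (flatLift I E X p X)) (flatLift I E X q X) =
        tangentLiftFun I (fun y => C.pairing y (C.bracket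
          (constSection I E X.proj (fibFst I E X d)) (constSection I E X.proj p.1) y)
          (constSection I E X.proj q.1 y)) X +
        (coreLiftFun I (fun y => C.pairing y (C.bracket
          (constSection I E X.proj (fibFst I E X d)) (constSection I E X.proj p.1) y)
          (constSection I E X.proj q.2 y)) X +
        coreLiftFun I (fun y => C.pairing y ((C.bracket (constSection I E X.proj (fibFst I E X d))
          (constSection I E X.proj p.2) + C.bracket (constSection I E X.proj (fibSnd I E X d))
          (constSection I E X.proj p.1)) y) (constSection I E X.proj q.1 y)) X) := fun p q => by
      rw [show flatLift I E X p X = _ from flatLift_self X p]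
      exact C.prolongPairing_lift (hb _ _) (hc _) X
    have hinv := fun u v w : F => C.invariance _ (hc u) _ (hc v) _ (hc w)
    simp only [Ψ]
    rw [hf, hf, map_zero, LinearMap.zero_apply, LinearMap.zero_apply, hT, hT]
    rw [hfun, derivAlong_lift_add (hg _ _) (hg _ _) (hg _ _)]
    have hd' : d = (tangentLift I F E (constSection I E X.proj (fibFst I E X d)) +
      coreLift I F E (constSection I E X.proj (fibSnd I E X d))) X := (flatLift_self X d).symm
    have e1 := C.prolongAnchor_lift_T (hc (fibFst I E X d))
      (constSection I E X.proj (fibSnd I E X d)) (hg p.1 q.1) X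
    have e2 := C.prolongAnchor_lift_C (hc (fibFst I E X d))
      (constSection I E X.proj (fibSnd I E X d)) (hg p.1 q.2) X
    have e3 := C.prolongAnchor_lift_C (hc (fibFst I E X d))
      (constSection I E X.proj (fibSnd I E X d)) (hg p.2 q.1) X
    rw [← hd'] at e1 e2 e3
    rw [e1, e2, e3]
    simp only [hinv, coreLiftFun, Pi.add_apply, map_add, LinearMap.add_apply]
    have hg' : ∀ u v w : F, ContMDiff I 𝓘(ℝ, ℝ) ∞ (fun y => C.pairing y (C.bracket
      (constSection I E X.proj u) (constSection I E X.proj v) y) (constSection I E X.proj w y)) :=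
      fun u v w => C.pairing_smooth _ (hb u v) _ (hc w)
    simp only [C.pairing_symm _ (constSection I E X.proj p.1 _) (C.bracket _ _ _),
      C.pairing_symm _ (constSection I E X.proj p.2 _) (C.bracket _ _ _)]
    rw [tangentLiftFun_add (hg' _ _ _) (hg' _ _ _)]
    ring
  have h := key r hr (fun p => by
    rw [hsymm]
    exact key _ (flatLift_mem X p) (fun q => h0 q p) r hr) t ht
  simp only [Ψ, hd] at h
  rw [C.prolongPairing_symm X (t X), pairing_prolongBracket, pairing_prolongBracket]
  linarith

lemma prolongBracket_smooth (s : ∀ X, TangentProlongation I F E X)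
    (hs : s ∈ prolongSections I F E) (t : ∀ X, TangentProlongation I F E X)
    (ht : t ∈ prolongSections I F E) : C.prolongBracket s t ∈ prolongSections I F E := by
  intro X
  refine contMDiffAt_of_pairing C.contMDiff_prolongPairing (C.prolongPairing_nondegenerate X) ?_
  -- By `contMDiffAt_of_pairing` smoothness may be tested by pairings. The property `S` is symmetric
  -- up to the smooth symmetric part, and stable under the Leibniz rule in its second argument, so
  -- it reduces to brackets of lifts, which are lifts or zero.
  let S : (∀ X, TangentProlongation I F E X) → (∀ X, TangentProlongation I F E X) → Prop :=
    fun s t => ∀ r ∈ prolongSections I F E, ContMDiffAt I.tangent 𝓘(ℝ, ℝ) ∞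
      (fun Z => C.prolongPairing Z (C.prolongBracket s t Z) (r Z)) X
  have hsymm : ∀ s ∈ prolongSections I F E, ∀ t ∈ prolongSections I F E, S s t → S t s := by
    intro s hs t ht h r hr
    have h1 : (fun Z => C.prolongPairing Z (C.prolongBracket t s Z) (r Z)) = fun Z =>
        derivAlong I.tangent (fun Z => C.prolongPairing Z (s Z) (t Z)) Z
          (C.prolongAnchor Z (r Z)) -
        C.prolongPairing Z (C.prolongBracket s t Z) (r Z) := by
      ext Z
      rw [← C.prolongBracket_symmetric Z hs ht, map_add, LinearMap.add_apply]
      ring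
    rw [h1]
    exact (contMDiff_derivAlong (C.contMDiff_prolongPairing s hs t ht)
      (C.prolongAnchor_smooth r hr) X).sub (h r hr)
  have key : ∀ s ∈ prolongSections I F E, (∀ σ ∈ smoothSections I F E, S s (tangentLift I F E σ)) →
      (∀ σ ∈ smoothSections I F E, S s (coreLift I F E σ)) →
      ∀ t ∈ prolongSections I F E, S s t := by
    intro s hs hT hC
    refine section_lift_induction (X := X) (fun t ht t' ht' h h' r hr => ?_)
      (fun f hf t ht h r hr => ?_) (fun t ht t' ht' h h' r hr => ?_) hT hC
    · simp only [C.prolongBracket_add_right ht ht', map_add, LinearMap.add_apply]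
      exact (h r hr).add (h' r hr)
    · simp only [C.prolongBracket_smul_right ht hf, map_add, map_smul, LinearMap.add_apply,
        LinearMap.smul_apply]
      exact ((hf X).mul (h r hr)).add
        ((contMDiff_derivAlong hf (C.prolongAnchor_smooth s hs) X).mul
          (C.contMDiff_prolongPairing t ht r hr X))
    · refine (h' r hr).congr_of_eventuallyEq ?_
      filter_upwards [h.eventually_nhds] with Z hZ
      rw [C.prolongBracket_congr Z (Filter.Eventually.of_forall fun _ => rfl) hZ]
  have hlift : ∀ s t b, s ∈ prolongSections I F E → t ∈ prolongSections I F E →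
      b ∈ prolongSections I F E → (∀ Z, C.prolongBracket s t Z = b Z) → S s t := by
    intro s t b hs ht hb h r hr
    simp only [h]
    exact C.contMDiff_prolongPairing b hb r hr X
  refine key s hs (fun σ hσ => ?_) (fun σ hσ => ?_) t ht
  · refine hsymm _ (tangentLift_mem hσ) _ hs
      (key _ (tangentLift_mem hσ) (fun τ hτ => ?_) (fun τ hτ => ?_) s hs)
    · exact hlift _ _ _ (tangentLift_mem hσ) (tangentLift_mem hτ)
        (tangentLift_mem (C.bracket_smooth _ hσ _ hτ)) fun Z => C.prolongBracket_TT hσ hτ Z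
    · exact hlift _ _ _ (tangentLift_mem hσ) (coreLift_mem hτ)
        (coreLift_mem (C.bracket_smooth _ hσ _ hτ)) fun Z => C.prolongBracket_TC hσ hτ Z
  · refine hsymm _ (coreLift_mem hσ) _ hs
      (key _ (coreLift_mem hσ) (fun τ hτ => ?_) (fun τ hτ => ?_) s hs)
    · exact hlift _ _ _ (coreLift_mem hσ) (tangentLift_mem hτ)
        (coreLift_mem (C.bracket_smooth _ hσ _ hτ)) fun Z => C.prolongBracket_CT hσ hτ Z
    · exact hlift _ _ _ (coreLift_mem hσ) (coreLift_mem hτ)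
        smoothSections_zero fun Z => C.prolongBracket_CC hσ hτ Z

/-- The tangent prolongation, before the verification of the Jacobi identity. -/
noncomputable def prolongPre :
    PreCourant I.tangent (F × F) (TangentProlongation I F E) where
  anchor := C.prolongAnchor
  anchor_smooth := C.prolongAnchor_smooth
  pairing := C.prolongPairing
  pairing_smooth := C.contMDiff_prolongPairing
  pairing_symm := C.prolongPairing_symm
  pairing_nondegenerate := C.prolongPairing_nondegenerate
  bracket := C.prolongBracket
  bracket_smooth := C.prolongBracket_smooth
  bracket_add_left _ hs _ ht _ _ := funext fun X => C.prolongBracket_add_left hs ht X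
  bracket_add_right _ _ _ ht _ hr := funext fun X => C.prolongBracket_add_right ht hr X
  bracket_smul_left c s hs t ht := funext fun X => C.prolong_ext fun w => by
    have h := C.pairing_prolongBracket_smul_left (t := t) hs (contMDiff_const (c := c)) X w
    simp only [derivAlong_const, zero_mul, sub_zero, add_zero] at h
    rw [Pi.smul_apply, map_smul, LinearMap.smul_apply, smul_eq_mul]
    exact h
  bracket_smul_right c s hs t ht := funext fun X => by
    have h := C.prolongBracket_smul_right (s := s) ht (contMDiff_const (c := c)) X
    simp only [derivAlong_const, zero_smul, add_zero] at h
    exact h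
  invariance _ hs _ ht _ hr X := C.prolongBracket_invariance hs ht hr X
  symmetric_part _ hs _ ht X u := C.prolongBracket_symmetric X hs ht u

end CourantAlgebroid

end Prolongation

/-! ### The Jacobi identity and the existence of the prolongation. -/

section ProlongationExists

variable {V : Type*} [NormedAddCommGroup V] [NormedSpace ℝ V] {H : Type*} [TopologicalSpace H]
  {I : ModelWithCorners ℝ V H} {M : Type*} [TopologicalSpace M] [ChartedSpace H M]
  [IsManifold I ∞ M]
  {F : Type*} [NormedAddCommGroup F] [NormedSpace ℝ F] {E : M → Type*}
  [∀ x, AddCommGroup (E x)] [∀ x, Module ℝ (E x)] [∀ x, TopologicalSpace (E x)]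
  [TopologicalSpace (TotalSpace F E)] [FiberBundle F E] [VectorBundle ℝ F E]
  [ContMDiffVectorBundle ∞ F E I]
  [FiniteDimensional ℝ V] [T2Space M] [FiniteDimensional ℝ F] [I.Boundaryless]

namespace CourantAlgebroid

variable (C : CourantAlgebroid I F E) {σ τ σ' τ' : ∀ x, E x} (hσ : σ ∈ smoothSections I F E)
  (hσ' : σ' ∈ smoothSections I F E) (hτ : τ ∈ smoothSections I F E)
  (hτ' : τ' ∈ smoothSections I F E)

lemma anchorDeriv_bracket (hσ : σ ∈ smoothSections I F E) (hτ : τ ∈ smoothSections I F E)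
    {f : M → ℝ} (hf : ContMDiff I 𝓘(ℝ, ℝ) ∞ f) (x : M) :
    derivAlong I f x (C.anchor x (C.bracket σ τ x)) =
      derivAlong I (fun y => derivAlong I f y (C.anchor y (τ y))) x (C.anchor x (σ x)) -
        derivAlong I (fun y => derivAlong I f y (C.anchor y (σ y))) x (C.anchor x (τ x)) :=
  C.toPre.anchorDeriv_bracket hσ hτ hf (fun _ hσ _ hτ x => C.anchorDefect_eq_zero hσ hτ x) x

variable (I F E) in
/-- Sums of a tangent lift and a core lift. -/
def liftSections : Set (∀ X, TangentProlongation I F E X) :=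
  {s | ∃ σ ∈ smoothSections I F E, ∃ σ' ∈ smoothSections I F E,
    s = tangentLift I F E σ + coreLift I F E σ'}

omit [FiniteDimensional ℝ V] [T2Space M] [FiniteDimensional ℝ F] [I.Boundaryless] in
lemma liftSections_subset : liftSections I F E ⊆ prolongSections I F E := by
  rintro _ ⟨σ, hσ, σ', hσ', rfl⟩
  exact smoothSections_add (tangentLift_mem hσ) (coreLift_mem hσ')

omit [FiniteDimensional ℝ F] [I.Boundaryless] in
lemma liftSections_flat (X : TangentBundle I M) (p : F × F) :
    ∃ s ∈ liftSections I F E, IsFlatAt X s p :=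
  ⟨_, ⟨_, constSection_mem X.proj p.1, _, constSection_mem X.proj p.2, rfl⟩,
    flatLift_isFlatAt (E := E) X p⟩

/-- It suffices to differentiate lifted functions k. By symmetry of the pairing, the derivative of k
along the anchor of the gradient of h is that of h along the anchor of the gradient of k. The latter
gradient is a lift of a gradient on `M`, so its anchor vanishes by `anchor_grad`. No regularity of
`h` enters. -/
lemma prolongPre_anchor_grad (h : TangentBundle I M → ℝ) (X : TangentBundle I M) :
    C.prolongPre.anchor X (C.prolongPre.grad h X) = 0 := by
  have key : ∀ k : TangentBundle I M → ℝ, C.prolongAnchor X (C.prolongPre.grad k X) = 0 →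
      derivAlong I.tangent k X (C.prolongPre.anchor X (C.prolongPre.grad h X)) = 0 := by
    intro k hk
    rw [← C.prolongPre.pairing_grad, C.prolongPre.pairing_symm, C.prolongPre.pairing_grad]
    exact (congrArg (derivAlong I.tangent h X) hk).trans derivAlong_zero
  have hz : ∀ f : M → ℝ, ContMDiff I 𝓘(ℝ, ℝ) ∞ f →
      (fun y => C.anchor y (C.toPre.grad f y)) = 0 := fun f hf => funext fun y => C.anchor_grad hf y
  refine tangent_lift_ext (fun f hf => ?_) fun f hf => ?_
  · rw [derivAlong_zero]
    refine key _ ?_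
    have h1 : C.prolongPre.grad (coreLiftFun I f) X = coreLift I F E (C.toPre.grad f) X :=
      C.prolong_ext fun w => (C.prolongPre.pairing_grad _ X w).trans
        (C.pairing_coreLift_grad hf X w).symm
    rw [h1, prolongAnchor_coreLift, hz f hf]
    rfl
  · rw [derivAlong_zero]
    refine key _ ?_
    have h1 : C.prolongPre.grad (tangentLiftFun I f) X = tangentLift I F E (C.toPre.grad f) X :=
      C.prolong_ext fun w => (C.prolongPre.pairing_grad _ X w).trans
        (C.pairing_tangentLift_grad hf X w).symm
    rw [h1, C.prolongAnchor_tangentLift (C.toPre.grad_mem hf), hz f hf, tangentLiftField_zero]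

/-- Vector fields on `TM` are compared through their action on f_C and f_T, where both sides reduce
to the anchor of brackets over `M`. -/
lemma prolongPre_anchorDefect_lift : ∀ s ∈ liftSections I F E, ∀ t ∈ liftSections I F E,
    ∀ X, C.prolongPre.anchorDefect s t X = 0 := by
  rintro _ ⟨σ, hσ, σ', hσ', rfl⟩ _ ⟨τ, hτ, τ', hτ', rfl⟩ X
  have hs := smoothSections_add (tangentLift_mem hσ) (coreLift_mem hσ')
  have ht := smoothSections_add (tangentLift_mem hτ) (coreLift_mem hτ')
  have hY := C.prolongAnchor_smooth _ hs
  have hZ := C.prolongAnchor_smooth _ ht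
  have hb := C.bracket_smooth
  have ha := fun {f : M → ℝ} (hf : ContMDiff I 𝓘(ℝ, ℝ) ∞ f) {σ : ∀ x, E x}
    (hσ : σ ∈ smoothSections I F E) => C.contMDiff_anchorDeriv hσ hf
  refine sub_eq_zero.2 (tangent_lift_ext (fun f hf => ?_) fun f hf => ?_)
  · refine Eq.trans ?_ (derivAlong_lieVec (contMDiff_coreLiftFun hf) hY hZ X).symm
    simp only [C.prolongAnchor_lift_C hσ _ hf, C.prolongAnchor_lift_C hτ _ hf]
    change derivAlong I.tangent (coreLiftFun I f) X (C.prolongAnchor X (C.prolongBracket _ _ X)) =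
      derivAlong I.tangent (coreLiftFun I _) X _ - derivAlong I.tangent (coreLiftFun I _) X _
    rw [C.prolongBracket_lift hσ hσ' hτ hτ', C.prolongAnchor_lift_C (hb _ hσ _ hτ) _ hf,
      C.prolongAnchor_lift_C hσ _ (ha hf hτ), C.prolongAnchor_lift_C hτ _ (ha hf hσ)]
    exact C.anchorDeriv_bracket hσ hτ hf X.proj
  · refine Eq.trans ?_ (derivAlong_lieVec (contMDiff_tangentLiftFun hf) hY hZ X).symm
    simp only [C.prolongAnchor_lift_T hσ _ hf, C.prolongAnchor_lift_T hτ _ hf]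
    change derivAlong I.tangent (tangentLiftFun I f) X
      (C.prolongAnchor X (C.prolongBracket _ _ X)) = _
    rw [derivAlong_fun_add
        ((contMDiff_tangentLiftFun (ha hf hτ)).mdifferentiableAt (by simp))
        ((contMDiff_coreLiftFun (ha hf hτ')).mdifferentiableAt (by simp)),
      derivAlong_fun_add
        ((contMDiff_tangentLiftFun (ha hf hσ)).mdifferentiableAt (by simp))
        ((contMDiff_coreLiftFun (ha hf hσ')).mdifferentiableAt (by simp))]
    rw [C.prolongBracket_lift hσ hσ' hτ hτ', C.prolongAnchor_lift_T (hb _ hσ _ hτ) _ hf,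
      C.prolongAnchor_lift_T hσ _ (ha hf hτ), C.prolongAnchor_lift_T hτ _ (ha hf hσ),
      C.prolongAnchor_lift_C hσ _ (ha hf hτ'), C.prolongAnchor_lift_C hτ _ (ha hf hσ')]
    simp only [Pi.add_apply, map_add, derivAlong_add, C.anchorDeriv_bracket hσ hτ hf,
      C.anchorDeriv_bracket hσ' hτ hf, C.anchorDeriv_bracket hσ hτ' hf, coreLiftFun]
    rw [tangentLiftFun_sub (C.contMDiff_anchorDeriv hσ (ha hf hτ))
      (C.contMDiff_anchorDeriv hτ (ha hf hσ))]
    ring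

lemma prolongPre_anchorDefect (s : ∀ X, TangentProlongation I F E X)
    (hs : s ∈ prolongSections I F E) (t : ∀ X, TangentProlongation I F E X)
    (ht : t ∈ prolongSections I F E) (X : TangentBundle I M) :
    C.prolongPre.anchorDefect s t X = 0 :=
  C.prolongPre.anchorDefect_eq_zero liftSections_subset
    (fun h _ => C.prolongPre_anchor_grad h X) (liftSections_flat X)
    (fun s hs t ht => C.prolongPre_anchorDefect_lift s hs t ht X) hs ht

/-- The tangent part is the Jacobi identity of the three tangent entries. The core part is the sum
of the three Jacobi identities with exactly one core entry, because two core entries bracket to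
zero. -/
lemma prolongPre_jacobiator_lift : ∀ s ∈ liftSections I F E, ∀ t ∈ liftSections I F E,
    ∀ r ∈ liftSections I F E, ∀ X, C.prolongPre.jacobiator s t r X = 0 := by
  rintro _ ⟨σ, hσ, σ', hσ', rfl⟩ _ ⟨τ, hτ, τ', hτ', rfl⟩ _ ⟨ρ, hρ, ρ', hρ', rfl⟩ X
  have hb := C.bracket_smooth
  have ha := fun {σ τ : ∀ x, E x} (hσ : σ ∈ smoothSections I F E)
    (hτ : τ ∈ smoothSections I F E) => smoothSections_add (I := I) hσ hτ
  change C.prolongBracket _ (C.prolongBracket _ _) X - C.prolongBracket (C.prolongBracket _ _) _ X -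
    C.prolongBracket _ (C.prolongBracket _ _) X = 0
  rw [C.prolongBracket_lift hσ hσ' hτ hτ', C.prolongBracket_lift hσ hσ' hρ hρ',
    C.prolongBracket_lift hτ hτ' hρ hρ',
    C.prolongBracket_lift hσ hσ' (hb _ hτ _ hρ) (ha (hb _ hτ _ hρ') (hb _ hτ' _ hρ)),
    C.prolongBracket_lift (hb _ hσ _ hτ) (ha (hb _ hσ _ hτ') (hb _ hσ' _ hτ)) hρ hρ',
    C.prolongBracket_lift hτ hτ' (hb _ hσ _ hρ) (ha (hb _ hσ _ hρ') (hb _ hσ' _ hρ)),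
    C.jacobi _ hσ _ hτ _ hρ,
    tangentLift_add (hb _ (hb _ hσ _ hτ) _ hρ) (hb _ hτ _ (hb _ hσ _ hρ)),
    C.bracket_add_right _ hσ _ (hb _ hτ _ hρ') _ (hb _ hτ' _ hρ),
    C.bracket_add_right _ hτ _ (hb _ hσ _ hρ') _ (hb _ hσ' _ hρ),
    C.bracket_add_left _ (hb _ hσ _ hτ') _ (hb _ hσ' _ hτ) _ hρ,
    C.jacobi _ hσ' _ hτ _ hρ, C.jacobi _ hσ _ hτ' _ hρ, C.jacobi _ hσ _ hτ _ hρ']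
  simp only [coreLift_add, Pi.add_apply]
  abel

lemma prolongPre_jacobiator (s : ∀ X, TangentProlongation I F E X)
    (hs : s ∈ prolongSections I F E) (t : ∀ X, TangentProlongation I F E X)
    (ht : t ∈ prolongSections I F E) (r : ∀ X, TangentProlongation I F E X)
    (hr : r ∈ prolongSections I F E) (X : TangentBundle I M) :
    C.prolongPre.jacobiator s t r X = 0 :=
  C.prolongPre.jacobiator_eq_zero C.prolongPre_anchorDefect liftSections_subset
    (liftSections_flat X) (fun s hs t ht r hr => C.prolongPre_jacobiator_lift s hs t ht r hr X)
    hs ht hr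

/-- The tangent prolongation of a Courant algebroid. -/
noncomputable def prolong : CourantAlgebroid I.tangent (F × F) (TangentProlongation I F E) where
  anchor := C.prolongPre.anchor
  anchor_smooth := C.prolongPre.anchor_smooth
  pairing := C.prolongPre.pairing
  pairing_smooth := C.prolongPre.pairing_smooth
  pairing_symm := C.prolongPre.pairing_symm
  pairing_nondegenerate := C.prolongPre.pairing_nondegenerate
  bracket := C.prolongPre.bracket
  bracket_smooth := C.prolongPre.bracket_smooth
  bracket_add_left := C.prolongPre.bracket_add_left
  bracket_add_right := C.prolongPre.bracket_add_right
  bracket_smul_left := C.prolongPre.bracket_smul_left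
  bracket_smul_right := C.prolongPre.bracket_smul_right
  invariance := C.prolongPre.invariance
  symmetric_part := C.prolongPre.symmetric_part
  jacobi s hs t ht r hr := funext fun X => by
    have h := C.prolongPre_jacobiator s hs t ht r hr X
    rw [PreCourant.jacobiator, sub_sub, sub_eq_zero] at h
    exact h

theorem isTangentProlongation_prolong : IsTangentProlongation C C.prolong where
  pairing_TT _ hσ _ hτ X := C.prolongPairing_TT hσ hτ X
  pairing_TC σ _ τ _ X := C.prolongPairing_TC σ τ X
  pairing_CT σ _ τ _ X := C.prolongPairing_CT σ τ X
  pairing_CC σ _ τ _ X := C.prolongPairing_CC σ τ X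
  bracket_TT _ hσ _ hτ := funext fun X => C.prolongBracket_TT hσ hτ X
  bracket_TC _ hσ _ hτ := funext fun X => C.prolongBracket_TC hσ hτ X
  bracket_CT _ hσ _ hτ := funext fun X => C.prolongBracket_CT hσ hτ X
  bracket_CC _ hσ _ hτ := funext fun X => C.prolongBracket_CC hσ hτ X
  anchor_TT _ hσ _ hf X := C.prolongAnchor_T_T hσ hf X
  anchor_TC _ hσ _ hf X := C.prolongAnchor_T_C hσ hf X
  anchor_CT σ _ _ hf X := C.prolongAnchor_C_T σ hf X
  anchor_CC σ _ _ hf X := C.prolongAnchor_C_C σ hf X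

end CourantAlgebroid

end ProlongationExists

/-! ### Dirac structures are Lie algebroids. -/

section DiracLieAlgebroid

variable {V : Type*} [NormedAddCommGroup V] [NormedSpace ℝ V] {H : Type*} [TopologicalSpace H]
  {I : ModelWithCorners ℝ V H} {N : Type*} [TopologicalSpace N] [ChartedSpace H N]
  [IsManifold I ∞ N]
  {F : Type*} [NormedAddCommGroup F] [NormedSpace ℝ F] {E : N → Type*}
  [∀ x, AddCommGroup (E x)] [∀ x, Module ℝ (E x)] [∀ x, TopologicalSpace (E x)]
  [TopologicalSpace (TotalSpace F E)] [FiberBundle F E] [VectorBundle ℝ F E]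
  [ContMDiffVectorBundle ∞ F E I]
  [FiniteDimensional ℝ V] [T2Space N] [FiniteDimensional ℝ F] [I.Boundaryless]
  {C : CourantAlgebroid I F E} {L : ∀ x, Submodule ℝ (E x)}

namespace IsDirac

lemma pairing_eq_zero (h : IsDirac I F C L) {x : N} {u v : E x} (hu : u ∈ L x) (hv : v ∈ L x) :
    C.pairing x u v = 0 := (h.lagrangian x u).1 hu v hv

/-- Isotropy makes the pairing of two sections identically zero, hence the symmetric part of their
bracket vanishes. -/
lemma bracket_skew (h : IsDirac I F C L) {σ τ : ∀ x, E x} (hσ : σ ∈ sectionsOf I F L)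
    (hτ : τ ∈ sectionsOf I F L) : C.bracket σ τ = -C.bracket τ σ := by
  refine eq_neg_of_add_eq_zero_left (funext fun x => ?_)
  refine C.pairing_nondegenerate x _ fun u => ?_
  rw [Pi.add_apply, C.symmetric_part σ hσ.1 τ hτ.1]
  have h0 : (fun y => C.pairing y (σ y) (τ y)) = fun _ => 0 :=
    funext fun y => h.pairing_eq_zero (hσ.2 y) (hτ.2 y)
  rw [h0]
  exact derivAlong_const 0 _

/-- A Dirac structure is a Lie algebroid with the restrictions of the anchor and of the bracket. -/
noncomputable def lieAlgebroid (h : IsDirac I F C L) : LieAlgebroid I F L where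
  subbundle := h.subbundle
  anchor := C.anchor
  anchor_smooth σ hσ := C.anchor_smooth σ hσ.1
  bracket := C.bracket
  bracket_mem σ hσ τ hτ := ⟨C.bracket_smooth σ hσ.1 τ hτ.1, h.involutive σ hσ τ hτ⟩
  bracket_add σ hσ τ hτ τ' hτ' := C.bracket_add_right σ hσ.1 τ hτ.1 τ' hτ'.1
  bracket_smul c σ hσ τ hτ := C.bracket_smul_right c σ hσ.1 τ hτ.1
  bracket_skew σ hσ τ hτ := h.bracket_skew hσ hτ
  jacobi σ hσ τ hτ ρ hρ := by
    have hb : ∀ σ ∈ sectionsOf I F L, ∀ τ ∈ sectionsOf I F L, C.bracket σ τ ∈ sectionsOf I F L :=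
      fun σ hσ τ hτ => ⟨C.bracket_smooth σ hσ.1 τ hτ.1, h.involutive σ hσ τ hτ⟩
    have h1 : C.bracket τ (C.bracket ρ σ) = -C.bracket τ (C.bracket σ ρ) := by
      have h2 := C.bracket_smul_right (-1) τ hτ.1 _ (hb σ hσ ρ hρ).1
      rwa [neg_one_smul, neg_one_smul, ← h.bracket_skew hρ hσ] at h2
    rw [C.jacobi σ hσ.1 τ hτ.1 ρ hρ.1, h1, h.bracket_skew hρ (hb σ hσ τ hτ)]
    abel
  leibniz σ hσ τ hτ f hf x := by
    have h1 := congrFun (C.bracket_fun_smul hf hσ.1 hτ.1) x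
    refine h1.trans (add_comm _ _)

end IsDirac

end DiracLieAlgebroid

/-! ### Uniqueness of the tangent prolongation. -/

section Uniqueness

variable {V : Type*} [NormedAddCommGroup V] [NormedSpace ℝ V] {H : Type*} [TopologicalSpace H]
  {I : ModelWithCorners ℝ V H} {M : Type*} [TopologicalSpace M] [ChartedSpace H M]
  [IsManifold I ∞ M]
  {F : Type*} [NormedAddCommGroup F] [NormedSpace ℝ F] {E : M → Type*}
  [∀ x, AddCommGroup (E x)] [∀ x, Module ℝ (E x)] [∀ x, TopologicalSpace (E x)]
  [TopologicalSpace (TotalSpace F E)] [FiberBundle F E] [VectorBundle ℝ F E]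
  [ContMDiffVectorBundle ∞ F E I]
  [FiniteDimensional ℝ V] [T2Space M] [FiniteDimensional ℝ F] [I.Boundaryless]
  {C : CourantAlgebroid I F E}
  {C' : CourantAlgebroid I.tangent (F × F) (TangentProlongation I F E)}

namespace IsTangentProlongation

lemma anchor_eq (h : IsTangentProlongation C C') : C'.anchor = C.prolong.anchor := by
  have h' := C.isTangentProlongation_prolong
  ext X d : 2
  obtain ⟨σ, hσ, τ, hτ, rfl⟩ := exists_lift_eq d
  rw [map_add, map_add]
  congr 1
  · refine tangent_lift_ext (fun f hf => ?_) fun f hf => ?_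
    · rw [h.anchor_TC σ hσ f hf, h'.anchor_TC σ hσ f hf]
    · rw [h.anchor_TT σ hσ f hf, h'.anchor_TT σ hσ f hf]
  · refine tangent_lift_ext (fun f hf => ?_) fun f hf => ?_
    · rw [h.anchor_CC τ hτ f hf, h'.anchor_CC τ hτ f hf]
    · rw [h.anchor_CT τ hτ f hf, h'.anchor_CT τ hτ f hf]

lemma pairing_eq (h : IsTangentProlongation C C') : C'.pairing = C.prolong.pairing := by
  have h' := C.isTangentProlongation_prolong
  ext X d e : 3
  obtain ⟨σ, hσ, τ, hτ, rfl⟩ := exists_lift_eq d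
  obtain ⟨κ, hκ, ρ, hρ, rfl⟩ := exists_lift_eq e
  simp only [map_add, LinearMap.add_apply, h.pairing_TT σ hσ κ hκ, h.pairing_TC σ hσ ρ hρ,
    h.pairing_CT τ hτ κ hκ, h.pairing_CC τ hτ ρ hρ, h'.pairing_TT σ hσ κ hκ,
    h'.pairing_TC σ hσ ρ hρ, h'.pairing_CT τ hτ κ hκ, h'.pairing_CC τ hτ ρ hρ]

lemma bracket_lift (h : IsTangentProlongation C C') {σ τ κ ρ : ∀ x, E x}
    (hσ : σ ∈ smoothSections I F E) (hτ : τ ∈ smoothSections I F E)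
    (hκ : κ ∈ smoothSections I F E) (hρ : ρ ∈ smoothSections I F E) :
    C'.bracket (tangentLift I F E σ + coreLift I F E τ)
        (tangentLift I F E κ + coreLift I F E ρ) =
      tangentLift I F E (C.bracket σ κ) + coreLift I F E (C.bracket σ ρ + C.bracket τ κ) := by
  have hκρ := smoothSections_add (tangentLift_mem (I := I) hκ) (coreLift_mem (I := I) hρ)
  rw [C'.bracket_add_left _ (tangentLift_mem hσ) _ (coreLift_mem hτ) _ hκρ,
    C'.bracket_add_right _ (tangentLift_mem hσ) _ (tangentLift_mem hκ) _ (coreLift_mem hρ),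
    C'.bracket_add_right _ (coreLift_mem hτ) _ (tangentLift_mem hκ) _ (coreLift_mem hρ),
    h.bracket_TT σ hσ κ hκ, h.bracket_TC σ hσ ρ hρ, h.bracket_CT τ hτ κ hκ,
    h.bracket_CC τ hτ ρ hρ, coreLift_add]
  abel

/-- The tangent prolongation is unique. -/
theorem bracket_eq (h : IsTangentProlongation C C') {s t : ∀ X, TangentProlongation I F E X}
    (hs : s ∈ prolongSections I F E) (ht : t ∈ prolongSections I F E) :
    C'.bracket s t = C.prolong.bracket s t := by
  have h' := C.isTangentProlongation_prolong
  ext X : 1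
  refine eq_of_pairing (C'.pairing_nondegenerate X) fun w => ?_
  -- One formula expresses the bracket of either structure through its anchor, its pairing and its
  -- bracket of flat lifts; all three ingredients are prescribed on lifts.
  have h1 := fun D : CourantAlgebroid I.tangent (F × F) (TangentProlongation I F E) =>
    D.toPre.pairing_bracket_eq hs ht (flatLift_mem X (s X)) (flatLift_mem X (t X))
      (flatLift_isFlatAt X (s X)) (flatLift_isFlatAt X (t X)) (flatLift_self X (s X))
      (flatLift_self X (t X)) w
  have hc : ∀ u : F, constSection I E X.proj u ∈ smoothSections I F E := constSection_mem X.proj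
  have h2 : C'.bracket (flatLift I E X (s X)) (flatLift I E X (t X)) =
      C.prolong.bracket (flatLift I E X (s X)) (flatLift I E X (t X)) :=
    (h.bracket_lift (hc _) (hc _) (hc _) (hc _)).trans
      (h'.bracket_lift (hc _) (hc _) (hc _) (hc _)).symm
  refine (h1 C').trans (Eq.trans ?_ (Eq.trans (h1 C.prolong).symm ?_))
  · have e1 : C'.toPre.anchor = C.prolong.toPre.anchor := h.anchor_eq
    have e2 : C'.toPre.pairing = C.prolong.toPre.pairing := h.pairing_eq
    have e3 : C'.toPre.bracket (flatLift I E X (s X)) (flatLift I E X (t X)) =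
      C.prolong.toPre.bracket (flatLift I E X (s X)) (flatLift I E X (t X)) := h2
    rw [e1, e2, e3]
  · rw [h.pairing_eq]; rfl

/-- Allows everything below to be proved for the explicit structure `C.prolong`. -/
lemma isVBDirac (h : IsTangentProlongation C C') {W : ∀ x, Submodule ℝ (E x)}
    {L : ∀ X, Submodule ℝ (TangentProlongation I F E X)} (hL : IsVBDirac C' W L) :
    IsVBDirac C.prolong W L where
  double := hL.double
  dirac :=
    { subbundle := hL.dirac.subbundle
      lagrangian := fun X u => by rw [← h.pairing_eq]; exact hL.dirac.lagrangian X u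
      involutive := fun σ hσ τ hτ X => by
        rw [← h.bracket_eq hσ.1 hτ.1]; exact hL.dirac.involutive σ hσ τ hτ X }

end IsTangentProlongation

end Uniqueness

/-! ### The fibres of a `𝒱ℬ`-Dirac structure: side and core. -/

section FibreStructure

variable {V : Type*} [NormedAddCommGroup V] [NormedSpace ℝ V] {H : Type*} [TopologicalSpace H]
  {I : ModelWithCorners ℝ V H} {M : Type*} [TopologicalSpace M] [ChartedSpace H M]
  [IsManifold I ∞ M]
  {F : Type*} [NormedAddCommGroup F] [NormedSpace ℝ F] {E : M → Type*}
  [∀ x, AddCommGroup (E x)] [∀ x, Module ℝ (E x)] [∀ x, TopologicalSpace (E x)]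
  [TopologicalSpace (TotalSpace F E)] [FiberBundle F E] [VectorBundle ℝ F E]
  [ContMDiffVectorBundle ∞ F E I]

variable (I F) in
/-- The fibre coordinate of an element of `E` in the preferred trivialization at its base point. -/
noncomputable def fibCoord (x : M) : E x ≃L[ℝ] F :=
  (trivializationAt F E x).continuousLinearEquivAt ℝ x (mem_baseSet_trivializationAt F E x)

lemma fibCoord_apply (x : M) (u : E x) :
    fibCoord F x u = (trivializationAt F E x ⟨x, u⟩).2 := rfl

variable (I F E) in
/-- The element of `T𝔼` over `X` with given base point and velocity along the fibre. -/
def fibMk (X : TangentBundle I M) (a b : F) : TangentProlongation I F E X := ((a, b) : F × F)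

lemma fibMk_eta (X : TangentBundle I M) (d : TangentProlongation I F E X) :
    fibMk I F E X (fibFst I E X d) (fibSnd I E X d) = d := rfl

lemma fibFst_fibMk (X : TangentBundle I M) (a b : F) : fibFst I E X (fibMk I F E X a b) = a := rfl

lemma fibSnd_fibMk (X : TangentBundle I M) (a b : F) : fibSnd I E X (fibMk I F E X a b) = b := rfl

lemma fib_ext {X : TangentBundle I M} {d d' : TangentProlongation I F E X}
    (h : fibFst I E X d = fibFst I E X d') (h' : fibSnd I E X d = fibSnd I E X d') : d = d' :=
  Prod.ext h h'

variable (I E) in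
/-- The base point of an element of `T𝔼`. -/
noncomputable def basePt (X : TangentBundle I M) : TangentProlongation I F E X →ₗ[ℝ] E X.proj :=
  (fibCoord F X.proj).symm.toLinearMap ∘ₗ fibFst I E X

variable (I F) in
/-- The tangent vector at zero to a fibre of `𝔼`. -/
noncomputable def vert (X : TangentBundle I M) : E X.proj →ₗ[ℝ] TangentProlongation I F E X :=
  LinearMap.inr ℝ F F ∘ₗ (fibCoord F X.proj).toLinearMap

lemma fibCoord_basePt (X : TangentBundle I M) (d : TangentProlongation I F E X) :
    fibCoord F X.proj (basePt I E X d) = fibFst I E X d := by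
  simp [basePt]

lemma basePt_fibMk (X : TangentBundle I M) (a b : F) :
    basePt I E X (fibMk I F E X a b) = (fibCoord F X.proj).symm a := rfl

lemma basePt_eq_iff (X : TangentBundle I M) (d : TangentProlongation I F E X) (u : E X.proj) :
    basePt I E X d = u ↔ fibFst I E X d = fibCoord F X.proj u := by
  rw [← fibCoord_basePt, (fibCoord F X.proj).injective.eq_iff]

lemma fibFst_vert (X : TangentBundle I M) (k : E X.proj) : fibFst I E X (vert I F X k) = 0 := rfl

lemma fibSnd_vert (X : TangentBundle I M) (k : E X.proj) :
    fibSnd I E X (vert I F X k) = fibCoord F X.proj k := rfl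

lemma basePt_vert (X : TangentBundle I M) (k : E X.proj) : basePt I E X (vert I F X k) = 0 :=
  (basePt_eq_iff _ _ _).2 (by rw [fibFst_vert, map_zero])

lemma basePt_tangentLift (σ : ∀ x, E x) (X : TangentBundle I M) :
    basePt I E X (tangentLift I F E σ X) = σ X.proj :=
  (basePt_eq_iff _ _ _).2 rfl

lemma coreLift_eq_vert (σ : ∀ x, E x) (X : TangentBundle I M) :
    coreLift I F E σ X = vert I F X (σ X.proj) := rfl

lemma eq_vert_of_basePt {X : TangentBundle I M} {d : TangentProlongation I F E X}
    (h : basePt I E X d = 0) : ∃ k, d = vert I F X k :=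
  ⟨(fibCoord F X.proj).symm (fibSnd I E X d), fib_ext
    (by rw [fibFst_vert, ← fibCoord_basePt, h, map_zero])
    (by rw [fibSnd_vert, ContinuousLinearEquiv.apply_symm_apply])⟩

/-- The components, along the base and along the fibre, of a tangent vector to `𝔼`. -/
noncomputable def tangentCoord (w : TotalSpace F E) :
    TangentSpace (I.prod 𝓘(ℝ, F)) w →ₗ[ℝ] V × F :=
  LinearMap.prod
    (mfderiv (I.prod 𝓘(ℝ, F)) I (TotalSpace.proj : TotalSpace F E → M) w).toLinearMap
    (mfderiv (I.prod 𝓘(ℝ, F)) 𝓘(ℝ, F)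
      (fun w' => (trivializationAt F E w.proj w').2) w).toLinearMap

lemma tangentIdent_mk (w : TotalSpace F E) (ξ : TangentSpace (I.prod 𝓘(ℝ, F)) w) :
    tangentIdent I F E ⟨w, ξ⟩ =
      ⟨⟨w.proj, (tangentCoord w ξ).1⟩, fibMk I F E _ (trivializationAt F E w.proj w).2
        (tangentCoord w ξ).2⟩ := rfl

lemma exists_tangentCoord_eq (w : TotalSpace F E) (v : V) (b : F) :
    ∃ ξ : TangentSpace (I.prod 𝓘(ℝ, F)) w, tangentCoord w ξ = (v, b) := by
  obtain ⟨x, u⟩ := w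
  obtain ⟨⟨⟨x', u'⟩, ξ⟩, h⟩ := (tangentIdent_bijective I F E).2
    ⟨⟨x, v⟩, fibMk I F E _ (trivializationAt F E x ⟨x, u⟩).2 b⟩
  have h1 := congrArg (fun z => TotalSpace.proj (TotalSpace.proj z)) h
  obtain rfl : x' = x := h1
  let f : TotalSpace (F × F) (TangentProlongation I F E) → V × F × F := fun z => (z.1.2, z.2)
  have h2 := congrArg f h
  have h3 : fibCoord F x' u' = fibCoord F x' u := congrArg (fun z => z.2.1) h2
  obtain rfl : u' = u := (fibCoord F x').injective h3
  exact ⟨ξ, Prod.ext (congrArg (fun z => z.1) h2) (congrArg (fun z => z.2.2) h2)⟩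

variable {W : ∀ x, Submodule ℝ (E x)} {L : ∀ X, Submodule ℝ (TangentProlongation I F E X)}

lemma mem_fibreOver {w : TotalSpace F E} {ξ : TangentSpace (I.prod 𝓘(ℝ, F)) w} :
    ξ ∈ fibreOver L w ↔ fibMk I F E ⟨w.proj, (tangentCoord w ξ).1⟩
      (trivializationAt F E w.proj w).2 (tangentCoord w ξ).2 ∈
        L ⟨w.proj, (tangentCoord w ξ).1⟩ := Iff.rfl

namespace IsDoubleVectorSubbundle

variable (hL : IsDoubleVectorSubbundle W L)
include hL

/-- An element of `L` is a tangent vector to 𝔼 at its base point, so that point belongs to the base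
of `L` as a bundle over `W`. -/
lemma basePt_mem {X : TangentBundle I M} {d : TangentProlongation I F E X} (hd : d ∈ L X) :
    basePt I E X d ∈ W X.proj := by
  obtain ⟨x, v⟩ := X
  obtain ⟨ξ, hξ⟩ := exists_tangentCoord_eq (I := I) (⟨x, basePt I E ⟨x, v⟩ d⟩ : TotalSpace F E) v
    (fibSnd I E ⟨x, v⟩ d)
  refine (hL.base_eq ⟨x, basePt I E ⟨x, v⟩ d⟩).1 ⟨ξ, mem_fibreOver.2 ?_⟩
  rw [hξ]
  have h := fibCoord_basePt _ d
  refine Eq.mp ?_ hd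
  exact congrArg (fun a => fibMk I F E ⟨x, v⟩ a (fibSnd I E ⟨x, v⟩ d) ∈ L ⟨x, v⟩) h.symm

/-- A local frame of `L → W` spans the fibre, which is therefore a subspace of the tangent space at
`u`. This is the source of the closure of `L` under the second addition and scalar multiplication.
-/
lemma exists_fibreOver_eq {x : M} {u : E x} (hu : u ∈ W x) :
    ∃ D : Submodule ℝ (TangentSpace (I.prod 𝓘(ℝ, F)) (⟨x, u⟩ : TotalSpace F E)),
      (D : Set _) = fibreOver L ⟨x, u⟩ := by
  have h : (⟨x, u⟩ : TotalSpace F E) ∈ baseOf (fibreOver L) := (hL.base_eq _).2 hu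
  obtain ⟨n, s, -, hs⟩ := hL.over_side.frame _ h
  exact ⟨_, (hs.self_of_nhds h).2⟩

lemma zero_mem {x : M} {u : E x} (hu : u ∈ W x) :
    fibMk I F E ⟨x, 0⟩ (fibCoord F x u) 0 ∈ L ⟨x, 0⟩ := by
  obtain ⟨D, hD⟩ := hL.exists_fibreOver_eq hu
  have h : (0 : TangentSpace (I.prod 𝓘(ℝ, F)) (⟨x, u⟩ : TotalSpace F E)) ∈ fibreOver L ⟨x, u⟩ :=
    hD ▸ D.zero_mem
  rw [mem_fibreOver, map_zero] at h
  exact h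

lemma add_mem {x : M} {v v' : V} {a b b' : F} (h : fibMk I F E ⟨x, v⟩ a b ∈ L ⟨x, v⟩)
    (h' : fibMk I F E ⟨x, v'⟩ a b' ∈ L ⟨x, v'⟩) :
    fibMk I F E ⟨x, v + v'⟩ a (b + b') ∈ L ⟨x, v + v'⟩ := by
  have hu := hL.basePt_mem h
  obtain ⟨u, rfl⟩ := (fibCoord F (E := E) x).surjective a
  rw [basePt_fibMk] at hu
  change (fibCoord F x).symm _ ∈ W x at hu
  rw [ContinuousLinearEquiv.symm_apply_apply] at hu
  obtain ⟨D, hD⟩ := hL.exists_fibreOver_eq hu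
  obtain ⟨ξ, hξ⟩ := exists_tangentCoord_eq (I := I) (⟨x, u⟩ : TotalSpace F E) v b
  obtain ⟨ξ', hξ'⟩ := exists_tangentCoord_eq (I := I) (⟨x, u⟩ : TotalSpace F E) v' b'
  have h1 : ξ ∈ D := by
    rw [← SetLike.mem_coe, hD, mem_fibreOver, hξ]; exact h
  have h2 : ξ' ∈ D := by
    rw [← SetLike.mem_coe, hD, mem_fibreOver, hξ']; exact h'
  have h3 := D.add_mem h1 h2
  rw [← SetLike.mem_coe, hD, mem_fibreOver, map_add, hξ, hξ'] at h3
  exact h3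

/-- The zero of `L → TM` over `v' - v` has base point zero, like the given element, so the two can
be added in `L → W`. Hence the core does not depend on the tangent vector. -/
lemma vert_mem_iff_aux {x : M} {v v' : V} {k : F} (h : fibMk I F E ⟨x, v⟩ 0 k ∈ L ⟨x, v⟩) :
    fibMk I F E ⟨x, v'⟩ 0 k ∈ L ⟨x, v'⟩ := by
  have h1 := hL.add_mem h (L ⟨x, v' - v⟩).zero_mem
  have h2 : v + (v' - v) = v' := by abel
  rw [h2, add_zero] at h1
  exact h1

end IsDoubleVectorSubbundle

variable [FiniteDimensional ℝ V] [T2Space M] [FiniteDimensional ℝ F] [I.Boundaryless]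
  {C : CourantAlgebroid I F E}


lemma fibCoord_symm_apply (x : M) (a : F) :
    (fibCoord F x).symm a = (trivializationAt F E x).symmL ℝ x a := by
  rw [ContinuousLinearEquiv.symm_apply_eq]
  exact (coordRep_symmL (mem_baseSet_trivializationAt F E x) a).symm

lemma CourantAlgebroid.prolongPairing_vert_left {X : TangentBundle I M} (k : E X.proj)
    (d : TangentProlongation I F E X) :
    C.prolongPairing X (vert I F X k) d = C.pairing X.proj k (basePt I E X d) := by
  obtain ⟨τ, hτ, rfl⟩ := exists_section_eq I F X.proj k
  exact (C.prolongPairing_coreLift_left τ X d).trans (congrArg _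
    ((constSection_self X.proj (fibFst I E X d)).trans (fibCoord_symm_apply _ _).symm))

lemma CourantAlgebroid.prolongPairing_vert_right {X : TangentBundle I M} (k : E X.proj)
    (d : TangentProlongation I F E X) :
    C.prolongPairing X d (vert I F X k) = C.pairing X.proj k (basePt I E X d) := by
  rw [C.prolongPairing_symm, C.prolongPairing_vert_left]

namespace IsVBDirac

variable (hL : IsVBDirac C.prolong W L)
include hL

lemma mem_iff {X : TangentBundle I M} {d : TangentProlongation I F E X} :
    d ∈ L X ↔ ∀ e ∈ L X, C.prolongPairing X d e = 0 := hL.dirac.lagrangian X d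

lemma pairing_eq_zero {X : TangentBundle I M} {d e : TangentProlongation I F E X} (hd : d ∈ L X)
    (he : e ∈ L X) : C.prolongPairing X d e = 0 := hL.mem_iff.1 hd e he

/-- The fibre of `L → TM` over `X` projects onto the fibre of `W`. -/
lemma exists_basePt_eq (X : TangentBundle I M) {u : E X.proj} (hu : u ∈ W X.proj) :
    ∃ d ∈ L X, basePt I E X d = u := by
  obtain ⟨x, v⟩ := X
  change E x at u
  change u ∈ W x at hu
  let B : LinearMap.BilinForm ℝ F := (C.pairing x).compl₁₂ (fibCoord F x).symm.toLinearMap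
    (fibCoord F x).symm.toLinearMap
  have hB : ∀ a b, B a b = C.pairing x ((fibCoord F x).symm a) ((fibCoord F x).symm b) :=
    fun _ _ => rfl
  have hsymm : B.IsSymm := ⟨fun a b => C.pairing_symm x _ _⟩
  have hnd : B.Nondegenerate := by
    have : B.SeparatingLeft := fun a ha => by
      refine (fibCoord F (E := E) x).symm.injective ?_
      rw [map_zero]
      refine C.pairing_nondegenerate x _ fun w => ?_
      have := ha (fibCoord F x w)
      rwa [hB, ContinuousLinearEquiv.symm_apply_apply] at this
    exact hsymm.isRefl.nondegenerate_iff_separatingLeft.2 this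
  -- The image of the fibre of `L` over `v` under the base point map. Its orthogonal complement is
  -- the core, because `L` is Lagrangian; the core is independent of `v`, hence so is `P v`, by
  -- taking complements twice.
  let P : V → Submodule ℝ F := fun v => (L ⟨x, v⟩).map (fibFst I E ⟨x, v⟩)
  have hP : ∀ v k, k ∈ B.orthogonal (P v) ↔ fibMk I F E ⟨x, v⟩ 0 k ∈ L ⟨x, v⟩ := fun v k => by
    rw [hL.mem_iff, LinearMap.BilinForm.mem_orthogonal_iff]
    have h1 : fibMk I F E ⟨x, v⟩ 0 k = vert I F ⟨x, v⟩ ((fibCoord F x).symm k) :=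
      fib_ext rfl (((fibCoord F x).apply_symm_apply k).symm)
    have h2 : ∀ e, C.prolongPairing ⟨x, v⟩ (fibMk I F E ⟨x, v⟩ 0 k) e =
        B (fibFst I E ⟨x, v⟩ e) k := fun e => by
      rw [h1, C.prolongPairing_vert_left, C.pairing_symm]; rfl
    simp only [h2]
    constructor
    · exact fun h e he => h _ ⟨e, he, rfl⟩
    · rintro h _ ⟨e, he, rfl⟩
      exact h e he
  have hPv : ∀ v, P v = P 0 := fun v => by
    have h1 : B.orthogonal (P v) = B.orthogonal (P 0) := by
      ext k
      rw [hP, hP]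
      exact ⟨hL.double.vert_mem_iff_aux, hL.double.vert_mem_iff_aux⟩
    rw [← LinearMap.BilinForm.orthogonal_orthogonal hnd hsymm.isRefl (P v), h1,
      LinearMap.BilinForm.orthogonal_orthogonal hnd hsymm.isRefl (P 0)]
  -- Over the zero tangent vector, the zero of `L → W` at `u` is an element of `L` with base point
  -- `u`.
  have h0 : fibCoord F x u ∈ P 0 := ⟨_, hL.double.zero_mem hu, rfl⟩
  rw [← hPv v] at h0
  obtain ⟨d, hd, h1⟩ := h0
  exact ⟨d, hd, (basePt_eq_iff _ _ _).2 h1⟩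

/-- The core of `L` is the annihilator of `W`. -/
lemma vert_mem_iff {X : TangentBundle I M} {k : E X.proj} :
    vert I F X k ∈ L X ↔ ∀ u ∈ W X.proj, C.pairing X.proj k u = 0 := by
  rw [hL.mem_iff]
  simp only [C.prolongPairing_vert_left]
  refine ⟨fun h u hu => ?_, fun h d hd => h _ (hL.double.basePt_mem hd)⟩
  obtain ⟨d, hd, rfl⟩ := hL.exists_basePt_eq X hu
  exact h d hd

end IsVBDirac

end FibreStructure

/-! ### Frames and dual sections of subbundles. -/

section SubbundleFrames

variable {V : Type*} [NormedAddCommGroup V] [NormedSpace ℝ V] {H : Type*} [TopologicalSpace H]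
  {I : ModelWithCorners ℝ V H} {N : Type*} [TopologicalSpace N] [ChartedSpace H N]
  [IsManifold I ∞ N]
  {F : Type*} [NormedAddCommGroup F] [NormedSpace ℝ F] {E : N → Type*}
  [∀ x, AddCommGroup (E x)] [∀ x, Module ℝ (E x)] [∀ x, TopologicalSpace (E x)]
  [TopologicalSpace (TotalSpace F E)] [FiberBundle F E] [VectorBundle ℝ F E]
  [ContMDiffVectorBundle ∞ F E I]
  [FiniteDimensional ℝ V] [T2Space N]

omit [FiniteDimensional ℝ V] [T2Space N] in
lemma sectionsOf_sum {ι : Type*} [Fintype ι] {A : ∀ x, Submodule ℝ (E x)} {f : ι → N → ℝ}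
    (hf : ∀ i, ContMDiff I 𝓘(ℝ, ℝ) ∞ (f i)) {s : ι → ∀ x, E x}
    (hs : ∀ i, s i ∈ sectionsOf I F A) : ∑ i, f i • s i ∈ sectionsOf I F A := by
  refine ⟨smoothSections_sum fun i _ => smoothSections_smul (hf i) (hs i).1, fun x => ?_⟩
  rw [Finset.sum_apply]
  exact Submodule.sum_mem _ fun i _ => (A x).smul_mem _ ((hs i).2 x)

omit [FiniteDimensional ℝ V] [T2Space N] in
lemma baseOf_submodule (A : ∀ x, Submodule ℝ (E x)) (x : N) :
    x ∈ baseOf (fun x => (A x : Set (E x))) := ⟨0, (A x).zero_mem⟩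

omit [VectorBundle ℝ F E] [ContMDiffVectorBundle ∞ F E I] in
lemma exists_matrix_inverse {ι : Type*} [Fintype ι] [DecidableEq ι] {B : N → Matrix ι ι ℝ} {x : N}
    (hB : ∀ i j, ContMDiff I 𝓘(ℝ, ℝ) ∞ (fun y => B y i j)) (h0 : B x = 1) :
    ∃ D : N → Matrix ι ι ℝ, (∀ i j, ContMDiff I 𝓘(ℝ, ℝ) ∞ (fun y => D y i j)) ∧
      ∀ᶠ y in 𝓝 x, D y * B y = 1 := by
  have hdet : (B x).det ≠ 0 := by rw [h0]; simp
  have hev := eventually_det_ne_zero (fun i j => (hB i j).contMDiffAt) hdet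
  have h1 : ∀ i j, ∃ g : N → ℝ, ContMDiff I 𝓘(ℝ, ℝ) ∞ g ∧ ∀ᶠ y in 𝓝 x, g y = (B y)⁻¹ i j :=
    fun i j => exists_contMDiff_eventuallyEq (by
      filter_upwards [hev] with y hy
      exact contMDiffAt_matrix_inv (fun i j => (hB i j).contMDiffAt) hy i j)
  choose D hD h2 using h1
  refine ⟨fun y => Matrix.of fun i j => D i j y, hD, ?_⟩
  filter_upwards [hev, Filter.eventually_all.2 fun i => Filter.eventually_all.2 (h2 i)] with y hy h3
  have h4 : (Matrix.of fun i j => D i j y) = (B y)⁻¹ := by ext i j; exact h3 i j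
  rw [h4, Matrix.nonsing_inv_mul _ (isUnit_iff_ne_zero.2 hy)]

/-- Local frames of a subbundle, by sections with values in the subbundle. -/
lemma exists_frame_sectionsOf {A : ∀ x, Submodule ℝ (E x)}
    (hA : IsVectorSubbundle I (smoothSections I F E) (fun x => (A x : Set (E x)))) (x : N) :
    ∃ (n : ℕ) (s : Fin n → ∀ y, E y), (∀ i, s i ∈ sectionsOf I F A) ∧
      ∀ᶠ y in 𝓝 x, LinearIndependent ℝ (fun i => s i y) ∧
        Submodule.span ℝ (Set.range fun i => s i y) = A y := by
  obtain ⟨n, s, hs, h⟩ := hA.frame x (baseOf_submodule A x)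
  have h : ∀ᶠ y in 𝓝 x, LinearIndependent ℝ (fun i => s i y) ∧
      Submodule.span ℝ (Set.range fun i => s i y) = A y := by
    filter_upwards [h] with y hy
    exact ⟨(hy (baseOf_submodule A y)).1, SetLike.coe_injective (hy (baseOf_submodule A y)).2⟩
  -- The cutoff is supported where the given frame spans `A`, so the new sections take values in `A`
  -- everywhere.
  obtain ⟨χ, hχ, h1, hsupp⟩ := exists_cutoff I h
  refine ⟨n, fun i => χ • s i, fun i => ⟨smoothSections_smul hχ (hs i), fun y => ?_⟩, ?_⟩
  · by_cases hy : χ y = 0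
    · change χ y • s i y ∈ A y
      rw [hy, zero_smul]; exact (A y).zero_mem
    · have h2 := hsupp (subset_tsupport χ hy)
      have h3 : s i y ∈ A y := by
        rw [← h2.2]
        exact Submodule.subset_span ⟨i, rfl⟩
      exact (A y).smul_mem _ h3
  · filter_upwards [h, h1] with y hy hy1
    simpa [hy1] using hy

lemma exists_sectionsOf_eq {A : ∀ x, Submodule ℝ (E x)}
    (hA : IsVectorSubbundle I (smoothSections I F E) (fun x => (A x : Set (E x)))) {x : N}
    {u : E x} (hu : u ∈ A x) : ∃ s ∈ sectionsOf I F A, s x = u := by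
  obtain ⟨n, s, hs, h⟩ := exists_frame_sectionsOf hA x
  rw [← h.self_of_nhds.2] at hu
  obtain ⟨c, hc⟩ := (Submodule.mem_span_range_iff_exists_fun ℝ).1 hu
  refine ⟨∑ i, (fun _ => c i) • s i, sectionsOf_sum (fun i => contMDiff_const) hs, ?_⟩
  rw [← hc]
  simp

variable [FiniteDimensional ℝ F] (C : CourantAlgebroid I F E)

lemma exists_dual_family {W : Type*} [AddCommGroup W] [Module ℝ W] [FiniteDimensional ℝ W]
    {ι : Type*} [Fintype ι] [DecidableEq ι] {p : W →ₗ[ℝ] W →ₗ[ℝ] ℝ}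
    (hp : ∀ u, (∀ v, p u v = 0) → u = 0) {w : ι → W} (hw : LinearIndependent ℝ w) :
    ∃ e : ι → W, ∀ i j, p (e i) (w j) = (1 : Matrix ι ι ℝ) i j := by
  obtain ⟨g, hg⟩ := (Fintype.linearCombination ℝ w).exists_leftInverse_of_injective
    (LinearMap.ker_eq_bot.2 (linearIndependent_iff_injective_fintypeLinearCombination.1 hw))
  choose e he using fun i => exists_pairing_eq hp (LinearMap.proj i ∘ₗ g)
  refine ⟨e, fun i j => ?_⟩
  have h1 := LinearMap.congr_fun hg (Pi.single j 1)
  simp only [LinearMap.comp_apply, Fintype.linearCombination_apply_single, one_smul,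
    LinearMap.id_apply] at h1
  rw [he, LinearMap.comp_apply, h1, Matrix.one_apply, LinearMap.proj_apply, Pi.single_apply]

/-- Near a point where they are linearly independent, sections have smooth dual sections. -/
lemma CourantAlgebroid.exists_dual_sections {ι : Type*} [Fintype ι] [DecidableEq ι]
    {w : ι → ∀ y, E y} (hw : ∀ i, w i ∈ smoothSections I F E) {x : N}
    (hli : LinearIndependent ℝ fun i => w i x) :
    ∃ θ : ι → ∀ y, E y, (∀ i, θ i ∈ smoothSections I F E) ∧
      ∀ᶠ y in 𝓝 x, ∀ i j, C.pairing y (θ i y) (w j y) = (1 : Matrix ι ι ℝ) i j := by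
  have := (fibCoord F (E := E) x).symm.toLinearEquiv.finiteDimensional
  obtain ⟨e, he⟩ := exists_dual_family (C.pairing_nondegenerate x) hli
  choose η hη h1 using fun i => exists_section_eq I F x (e i)
  -- The sections `η` are dual to `w` only at `x`. The matrix of pairings is the identity there, and
  -- its inverse corrects `η` nearby.
  obtain ⟨D, hD, h2⟩ := exists_matrix_inverse (I := I) (x := x)
    (B := fun y => Matrix.of fun i j => C.pairing y (η i y) (w j y))
    (fun i j => C.pairing_smooth _ (hη i) _ (hw j)) (by ext i j; simp [h1, he])
  refine ⟨fun i => ∑ l, (fun y => D y i l) • η l, fun i => smoothSections_sum fun l _ =>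
    smoothSections_smul (hD i l) (hη l), ?_⟩
  filter_upwards [h2] with y hy i j
  rw [← hy, Matrix.mul_apply]
  simp [Finset.sum_apply]

lemma eq_sum_of_dual {W : Type*} [AddCommGroup W] [Module ℝ W]
    {ι : Type*} [Fintype ι] [DecidableEq ι] {p : W →ₗ[ℝ] W →ₗ[ℝ] ℝ} {w θ : ι → W}
    (h : ∀ i j, p (θ i) (w j) = (1 : Matrix ι ι ℝ) i j) {u : W}
    (hu : u ∈ Submodule.span ℝ (Set.range w)) : u = ∑ i, p (θ i) u • w i := by
  obtain ⟨c, rfl⟩ := (Submodule.mem_span_range_iff_exists_fun ℝ).1 hu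
  refine Finset.sum_congr rfl fun i _ => ?_
  simp [h, Matrix.one_apply]

lemma linearIndependent_of_dual {W : Type*} [AddCommGroup W] [Module ℝ W]
    {ι : Type*} [Fintype ι] [DecidableEq ι] {p : W →ₗ[ℝ] W →ₗ[ℝ] ℝ} {w θ : ι → W}
    (h : ∀ i j, p (θ i) (w j) = (1 : Matrix ι ι ℝ) i j) : LinearIndependent ℝ w := by
  refine Fintype.linearIndependent_iff.2 fun c hc i => ?_
  have := congrArg (p (θ i)) hc
  simpa [h, Matrix.one_apply] using this

end SubbundleFrames

/-! ### Local lifts of sections of `W` to sections of `L`. -/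

section LinearLifts

variable {V : Type*} [NormedAddCommGroup V] [NormedSpace ℝ V] {H : Type*} [TopologicalSpace H]
  {I : ModelWithCorners ℝ V H} {M : Type*} [TopologicalSpace M] [ChartedSpace H M]
  [IsManifold I ∞ M]
  {F : Type*} [NormedAddCommGroup F] [NormedSpace ℝ F] {E : M → Type*}
  [∀ x, AddCommGroup (E x)] [∀ x, Module ℝ (E x)] [∀ x, TopologicalSpace (E x)]
  [TopologicalSpace (TotalSpace F E)] [FiberBundle F E] [VectorBundle ℝ F E]
  [ContMDiffVectorBundle ∞ F E I]
  [FiniteDimensional ℝ V] [T2Space M] [FiniteDimensional ℝ F] [I.Boundaryless]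
  {C : CourantAlgebroid I F E} {W : ∀ x, Submodule ℝ (E x)}
  {L : ∀ X, Submodule ℝ (TangentProlongation I F E X)}

namespace IsVBDirac

variable (hL : IsVBDirac C.prolong W L)
include hL

/-- A local frame of `W`, with dual sections, and a section of `L` over each of its members. -/
lemma exists_frame_lift (X : TangentBundle I M) :
    ∃ (r : ℕ) (w θ : Fin r → ∀ x, E x) (t : Fin r → ∀ X, TangentProlongation I F E X),
      (∀ i, w i ∈ sectionsOf I F W) ∧ (∀ i, θ i ∈ smoothSections I F E) ∧
      (∀ i, t i ∈ sectionsOf I.tangent (F × F) L) ∧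
      (∀ᶠ x in 𝓝 X.proj, (∀ i j, C.pairing x (θ i x) (w j x) = (1 : Matrix (Fin r) (Fin r) ℝ) i j) ∧
        Submodule.span ℝ (Set.range fun i => w i x) = W x) ∧
      ∀ᶠ Z in 𝓝 X, ∀ i, basePt I E Z (t i Z) = w i Z.proj := by
  obtain ⟨r, w, hw, hspan⟩ := exists_frame_sectionsOf hL.double.side X.proj
  obtain ⟨θ, hθ, hdual⟩ := C.exists_dual_sections (fun i => (hw i).1) hspan.self_of_nhds.1
  have h1 : ∀ i, ∃ s ∈ sectionsOf I.tangent (F × F) L, basePt I E X (s X) = w i X.proj := fun i => by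
    obtain ⟨d, hd, h2⟩ := hL.exists_basePt_eq X ((hw i).2 X.proj)
    obtain ⟨s, hs, rfl⟩ := exists_sectionsOf_eq hL.double.over_tangent hd
    exact ⟨s, hs, h2⟩
  choose s hs h2 using h1
  have hB : ∀ Z i j, C.prolongPairing Z (coreLift I F E (θ j) Z) (s i Z) =
      C.pairing Z.proj (θ j Z.proj) (basePt I E Z (s i Z)) := fun Z i j =>
    C.prolongPairing_vert_left _ _
  -- Pairing `s i` with the core lift of `θ j` reads off the `j`-th coordinate of the base point of
  -- `s i` in the frame `w`. This matrix is the identity at `X`; its inverse turns the `s i` into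
  -- lifts of the frame near `X`.
  obtain ⟨D, hD, h3⟩ := exists_matrix_inverse (I := I.tangent) (x := X)
    (B := fun Z => Matrix.of fun i j => C.prolongPairing Z (coreLift I F E (θ j) Z) (s i Z))
    (fun i j => C.prolong.pairing_smooth _ (coreLift_mem (hθ j)) _ (hs i).1)
    (by ext i j; simp only [Matrix.of_apply, hB, h2, hdual.self_of_nhds, Matrix.one_apply, eq_comm])
  have hnear := (hspan.and hdual)
  refine ⟨r, w, θ, fun i => ∑ l, (fun Z => D Z i l) • s l, hw, hθ,
    fun i => sectionsOf_sum (fun l => hD i l) hs, ?_, ?_⟩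
  · filter_upwards [hnear] with x hx using ⟨hx.2, hx.1.2⟩
  · filter_upwards [h3, tendsto_proj X hnear] with Z hZ hx i
    have h4 : ∀ l, basePt I E Z (s l Z) = ∑ j, C.pairing Z.proj (θ j Z.proj)
        (basePt I E Z (s l Z)) • w j Z.proj := fun l => by
      refine eq_sum_of_dual (hx.2) ?_
      rw [show Submodule.span ℝ _ = _ from hx.1.2]
      exact hL.double.basePt_mem ((hs l).2 Z)
    have h5 : basePt I E Z ((∑ l, (fun Z => D Z i l) • s l) Z) =
        ∑ j, (D Z * (Matrix.of fun i j =>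
          C.prolongPairing Z (coreLift I F E (θ j) Z) (s i Z))) i j • w j Z.proj := by
      simp only [Finset.sum_apply, Pi.smul_apply', map_sum, map_smul, Matrix.mul_apply,
        Matrix.of_apply, hB, Finset.sum_smul]
      rw [Finset.sum_comm]
      refine Finset.sum_congr rfl fun l _ => ?_
      conv_lhs => rw [h4 l, Finset.smul_sum]
      simp only [smul_smul]
    rw [h5, hZ]
    simp [Matrix.one_apply]

/-- Sections of `W` lift locally to sections of `L`. -/
lemma exists_lift {w : ∀ x, E x} (hw : w ∈ smoothSections I F E) (X : TangentBundle I M)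
    (hW : ∀ᶠ x in 𝓝 X.proj, w x ∈ W x) :
    ∃ s ∈ sectionsOf I.tangent (F × F) L, ∀ᶠ Z in 𝓝 X, basePt I E Z (s Z) = w Z.proj := by
  obtain ⟨r, w', θ, t, hw', hθ, ht, h1, h2⟩ := hL.exists_frame_lift X
  refine ⟨∑ i, (coreLiftFun I fun x => C.pairing x (θ i x) (w x)) • t i, sectionsOf_sum
    (fun i => contMDiff_coreLiftFun (C.pairing_smooth _ (hθ i) _ hw)) ht, ?_⟩
  filter_upwards [h2, tendsto_proj X (h1.and hW)] with Z hZ hx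
  obtain ⟨⟨hx1, hx2⟩, hx3⟩ := hx
  have hx3 : w Z.proj ∈ W Z.proj := hx3
  rw [← hx2] at hx3
  conv_rhs => rw [eq_sum_of_dual hx1 hx3]
  simp only [Finset.sum_apply, Pi.smul_apply', map_sum, map_smul, hZ, coreLiftFun]

end IsVBDirac

end LinearLifts

/-! ### Lifts to `L` that are linear in the tangent vector. -/

section AdaptedFrames

variable {V : Type*} [NormedAddCommGroup V] [NormedSpace ℝ V] {H : Type*} [TopologicalSpace H]
  {I : ModelWithCorners ℝ V H} {M : Type*} [TopologicalSpace M] [ChartedSpace H M]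
  [IsManifold I ∞ M]
  {F : Type*} [NormedAddCommGroup F] [NormedSpace ℝ F] {E : M → Type*}
  [∀ x, AddCommGroup (E x)] [∀ x, Module ℝ (E x)] [∀ x, TopologicalSpace (E x)]
  [TopologicalSpace (TotalSpace F E)] [FiberBundle F E] [VectorBundle ℝ F E]
  [ContMDiffVectorBundle ∞ F E I]

/-- Sections of `T𝔼 → TM` whose restriction to each tangent space of `M` is linear along the
fibres of `T𝔼 → 𝔼`. -/
def IsAdditiveLift (s : ∀ X, TangentProlongation I F E X) : Prop :=
  ∀ (x : M) (v v' : V), fibSnd I E (⟨x, v + v'⟩ : TangentBundle I M) (s ⟨x, v + v'⟩) =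
    fibSnd I E (⟨x, v⟩ : TangentBundle I M) (s ⟨x, v⟩) +
      fibSnd I E (⟨x, v'⟩ : TangentBundle I M) (s ⟨x, v'⟩)

lemma tangentLift_isAdditiveLift (σ : ∀ x, E x) : IsAdditiveLift (tangentLift I F E σ) :=
  fun x v v' => map_add (mfderiv I 𝓘(ℝ, F) (coordRep F x σ) x) v v'

variable [FiniteDimensional ℝ V] [T2Space M] [FiniteDimensional ℝ F] [I.Boundaryless]
  {C : CourantAlgebroid I F E} {W : ∀ x, Submodule ℝ (E x)}
  {L : ∀ X, Submodule ℝ (TangentProlongation I F E X)}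

variable (C) in
-- The pairing consists of a derivative along the tangent vector, which is linear in that vector,
-- and of terms linear in one of the fibre velocities. So it is additive for the addition of T𝔼 → 𝔼.
lemma CourantAlgebroid.prolongPairing_fibMk_add (x : M) (v v' : V) (a b b' c e e' : F) :
    C.prolongPairing ⟨x, v + v'⟩ (fibMk I F E ⟨x, v + v'⟩ a (b + b'))
        (fibMk I F E ⟨x, v + v'⟩ c (e + e')) =
      C.prolongPairing ⟨x, v⟩ (fibMk I F E ⟨x, v⟩ a b) (fibMk I F E ⟨x, v⟩ c e) +
        C.prolongPairing ⟨x, v'⟩ (fibMk I F E ⟨x, v'⟩ a b') (fibMk I F E ⟨x, v'⟩ c e') := by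
  have h : ∀ f : M → ℝ, tangentLiftFun I f ⟨x, v + v'⟩ =
      tangentLiftFun I f ⟨x, v⟩ + tangentLiftFun I f ⟨x, v'⟩ := fun f =>
    map_add (mfderiv I 𝓘(ℝ, ℝ) f x) v v'
  simp only [C.prolongPairing_apply, fibFst_fibMk, fibSnd_fibMk, h, constSection_add,
    Pi.add_apply, map_add, LinearMap.add_apply]
  ring

namespace IsVBDirac

variable (hL : IsVBDirac C.prolong W L)

section
include hL

/-- Two elements of `L` with the same base point differ by a core element, which annihilates `W`. -/
lemma pairing_congr {X : TangentBundle I M} {d e e' : TangentProlongation I F E X}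
    (hd : basePt I E X d ∈ W X.proj) (he : e ∈ L X) (he' : e' ∈ L X)
    (h : basePt I E X e = basePt I E X e') :
    C.prolongPairing X d e = C.prolongPairing X d e' := by
  rw [← sub_eq_zero, ← map_sub] at h ⊢
  obtain ⟨k, hk⟩ := eq_vert_of_basePt h
  have h1 : vert I F X k ∈ L X := hk ▸ (L X).sub_mem he he'
  rw [hk, C.prolongPairing_vert_right]
  exact hL.vert_mem_iff.1 h1 _ hd

end

/-- An element of `L` over a given element of `W`. -/
noncomputable def liftAt {w : ∀ x, E x} (hw : ∀ x, w x ∈ W x) (X : TangentBundle I M) :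
    TangentProlongation I F E X := (hL.exists_basePt_eq X (hw X.proj)).choose

section

lemma liftAt_mem {w : ∀ x, E x} (hw : ∀ x, w x ∈ W x) (X : TangentBundle I M) :
    hL.liftAt hw X ∈ L X := (hL.exists_basePt_eq X (hw X.proj)).choose_spec.1

lemma basePt_liftAt {w : ∀ x, E x} (hw : ∀ x, w x ∈ W x) (X : TangentBundle I M) :
    basePt I E X (hL.liftAt hw X) = w X.proj := (hL.exists_basePt_eq X (hw X.proj)).choose_spec.2

/-- The choice in `liftAt` is made point by point, with no regularity. The pairing does not depend
on it, by `pairing_congr`, so it may be computed with a smooth local lift. -/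
lemma contMDiff_pairing_liftAt {w w' : ∀ x, E x} (hw : w ∈ sectionsOf I F W)
    (hw' : w' ∈ sectionsOf I F W) : ContMDiff I.tangent 𝓘(ℝ, ℝ) ∞ fun X =>
      C.prolongPairing X (tangentLift I F E w X) (hL.liftAt hw'.2 X) := by
  intro X
  obtain ⟨s, hs, h⟩ := hL.exists_lift hw'.1 X (Filter.Eventually.of_forall hw'.2)
  refine (C.contMDiff_prolongPairing _ (tangentLift_mem hw.1) s hs.1 X).congr_of_eventuallyEq ?_
  filter_upwards [h] with Z hZ
  refine hL.pairing_congr ?_ (hL.liftAt_mem _ Z) (hs.2 Z) ?_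
  · rw [basePt_tangentLift]; exact hw.2 _
  · rw [hZ, hL.basePt_liftAt]

/-- For the same reason, the chosen lift over `v + v'` may be replaced by the sum, in `L → W`, of
the lifts over `v` and `v'`. -/
lemma pairing_liftAt_add {w w' : ∀ x, E x} (hw : w ∈ sectionsOf I F W)
    (hw' : w' ∈ sectionsOf I F W) (x : M) (v v' : V) :
    C.prolongPairing ⟨x, v + v'⟩ (tangentLift I F E w ⟨x, v + v'⟩) (hL.liftAt hw'.2 ⟨x, v + v'⟩) =
    C.prolongPairing ⟨x, v⟩ (tangentLift I F E w ⟨x, v⟩) (hL.liftAt hw'.2 ⟨x, v⟩) +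
      C.prolongPairing ⟨x, v'⟩ (tangentLift I F E w ⟨x, v'⟩) (hL.liftAt hw'.2 ⟨x, v'⟩) := by
  have h1 : ∀ v : V, hL.liftAt hw'.2 ⟨x, v⟩ = fibMk I F E ⟨x, v⟩ (fibCoord F x (w' x))
      (fibSnd I E (⟨x, v⟩ : TangentBundle I M) (hL.liftAt hw'.2 ⟨x, v⟩)) := fun v =>
    fib_ext ((basePt_eq_iff _ _ _).1 (hL.basePt_liftAt hw'.2 ⟨x, v⟩)) rfl
  have h2 : ∀ v : V, tangentLift I F E w ⟨x, v⟩ = fibMk I F E ⟨x, v⟩ (fibCoord F x (w x))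
      (fibSnd I E (⟨x, v⟩ : TangentBundle I M) (tangentLift I F E w ⟨x, v⟩)) := fun v => rfl
  have hm := fun v => hL.liftAt_mem hw'.2 (⟨x, v⟩ : TangentBundle I M)
  have h3 := hL.double.add_mem (h1 v ▸ hm v) (h1 v' ▸ hm v')
  have h4 := C.prolongPairing_fibMk_add x v v' (fibCoord F x (w x))
    (fibSnd I E (⟨x, v⟩ : TangentBundle I M) (tangentLift I F E w ⟨x, v⟩))
    (fibSnd I E (⟨x, v'⟩ : TangentBundle I M) (tangentLift I F E w ⟨x, v'⟩)) (fibCoord F x (w' x))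
    (fibSnd I E (⟨x, v⟩ : TangentBundle I M) (hL.liftAt hw'.2 ⟨x, v⟩))
    (fibSnd I E (⟨x, v'⟩ : TangentBundle I M) (hL.liftAt hw'.2 ⟨x, v'⟩))
  rw [← h1 v, ← h1 v', ← h2 v, ← h2 v'] at h4
  rw [← h4]
  have h5 : fibMk I F E ⟨x, v + v'⟩ (fibCoord F x (w x))
      (fibSnd I E (⟨x, v⟩ : TangentBundle I M) (tangentLift I F E w ⟨x, v⟩) +
        fibSnd I E (⟨x, v'⟩ : TangentBundle I M) (tangentLift I F E w ⟨x, v'⟩)) =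
      tangentLift I F E w ⟨x, v + v'⟩ :=
    fib_ext rfl (tangentLift_isAdditiveLift w x v v').symm
  rw [h5]
  refine hL.pairing_congr ?_ (hm _) h3 ?_
  · rw [basePt_tangentLift]; exact hw.2 x
  · rw [basePt_eq_iff, fibCoord_basePt]
    exact (basePt_eq_iff _ _ _).1 (hL.basePt_liftAt hw'.2 ⟨x, v + v'⟩)

include hL in
/-- Near every point there are a frame of `W`, given by global sections of `W`, with dual sections,
and sections of `L` that lift the frame and are linear on the tangent spaces of `M`. -/
theorem exists_linear_lifts (x₀ : M) :
    ∃ (r : ℕ) (w θ : Fin r → ∀ x, E x) (l : Fin r → ∀ X, TangentProlongation I F E X),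
      (∀ i, w i ∈ sectionsOf I F W) ∧ (∀ i, θ i ∈ smoothSections I F E) ∧
      (∀ i, l i ∈ sectionsOf I.tangent (F × F) L) ∧
      (∀ i X, basePt I E X (l i X) = w i X.proj) ∧ (∀ i, IsAdditiveLift (l i)) ∧
      ∀ᶠ x in 𝓝 x₀, (∀ i j, C.pairing x (θ i x) (w j x) = (1 : Matrix (Fin r) (Fin r) ℝ) i j) ∧
        Submodule.span ℝ (Set.range fun i => w i x) = W x := by
  obtain ⟨r, w, hw, hspan⟩ := exists_frame_sectionsOf hL.double.side x₀
  obtain ⟨θ, hθ, hdual⟩ := C.exists_dual_sections (fun i => (hw i).1) hspan.self_of_nhds.1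
  have hnear := hdual.and hspan
  obtain ⟨χ, hχ, h1, hsupp⟩ := exists_cutoff I hnear
  -- The tangent lift of `w i` has the right base point but need not lie in `L`. Its failure to be
  -- orthogonal to `L` is measured by `Ω`, smooth and linear in the tangent vector.
  let Ω : Fin r → Fin r → TangentBundle I M → ℝ := fun i j X =>
    C.prolongPairing X (tangentLift I F E (w i) X) (hL.liftAt (hw j).2 X)
  have hΩ : ∀ i j, ContMDiff I.tangent 𝓘(ℝ, ℝ) ∞ (Ω i j) := fun i j =>
    hL.contMDiff_pairing_liftAt (hw i) (hw j)
  -- The core correction makes the tangent lift orthogonal to `L`, hence an element of `L`. Core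
  -- terms affect neither the base point nor linearity; the cutoff restricts to points where `θ` is
  -- dual to the frame.
  let l : Fin r → ∀ X, TangentProlongation I F E X := fun i =>
    coreLiftFun I χ • (tangentLift I F E (w i) - ∑ j, Ω i j • coreLift I F E (θ j))
  have hl : ∀ i X, l i X = χ X.proj • (tangentLift I F E (w i) X -
      ∑ j, Ω i j X • vert I F X (θ j X.proj)) := fun i X => by
    simp only [l, Pi.smul_apply', Pi.sub_apply, Finset.sum_apply, coreLift_eq_vert]; rfl
  refine ⟨r, fun i => χ • w i, θ, l, fun i => ⟨smoothSections_smul hχ (hw i).1, fun x => ?_⟩,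
    hθ, fun i => ⟨?_, fun X => ?_⟩, fun i X => ?_, fun i x v v' => ?_, ?_⟩
  · exact (W x).smul_mem _ ((hw i).2 x)
  · exact smoothSections_smul (contMDiff_coreLiftFun hχ) (smoothSections_sub
      (tangentLift_mem (hw i).1) (smoothSections_sum fun j _ =>
        smoothSections_smul (hΩ i j) (coreLift_mem (hθ j))))
  · rw [hl]
    by_cases hx : χ X.proj = 0
    · rw [hx, zero_smul]; exact (L X).zero_mem
    obtain ⟨hx1, -, hx2⟩ := hsupp (subset_tsupport χ hx)
    refine (L X).smul_mem _ (hL.mem_iff.2 fun e he => ?_)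
    have he' := hL.double.basePt_mem he
    rw [← hx2] at he'
    have h2 : C.prolongPairing X (tangentLift I F E (w i) X) e =
        C.prolongPairing X (tangentLift I F E (w i) X)
          (∑ j, C.pairing X.proj (θ j X.proj) (basePt I E X e) • hL.liftAt (hw j).2 X) := by
      refine hL.pairing_congr ?_ he (Submodule.sum_mem _ fun j _ =>
        (L X).smul_mem _ (hL.liftAt_mem (hw j).2 X)) ?_
      · rw [basePt_tangentLift]; exact (hw i).2 _
      · conv_lhs => rw [eq_sum_of_dual hx1 he']
        simp only [map_sum, map_smul, hL.basePt_liftAt]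
    rw [map_sub, LinearMap.sub_apply, h2]
    simp only [map_sum, map_smul, LinearMap.sum_apply, LinearMap.smul_apply,
      C.prolongPairing_vert_left, smul_eq_mul, Ω]
    rw [sub_eq_zero]
    exact Finset.sum_congr rfl fun j _ => mul_comm _ _
  · rw [hl, map_smul, map_sub, map_sum, basePt_tangentLift]
    simp only [map_smul, basePt_vert, smul_zero, Finset.sum_const_zero, sub_zero]
    rfl
  · have h2 : ∀ v : V, fibSnd I E (⟨x, v⟩ : TangentBundle I M) (l i ⟨x, v⟩) =
        χ x • (fibSnd I E (⟨x, v⟩ : TangentBundle I M) (tangentLift I F E (w i) ⟨x, v⟩) -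
          ∑ j, Ω i j ⟨x, v⟩ • fibCoord F x (θ j x)) := fun v => by
      rw [hl, map_smul, map_sub, map_sum]
      simp only [map_smul, fibSnd_vert]
    have h3 : ∀ j, Ω i j ⟨x, v + v'⟩ = Ω i j ⟨x, v⟩ + Ω i j ⟨x, v'⟩ := fun j =>
      hL.pairing_liftAt_add (hw i) (hw j) x v v'
    rw [h2, h2, h2, tangentLift_isAdditiveLift (w i) x v v']
    simp only [h3, add_smul, Finset.sum_add_distrib]
    rw [← smul_add]
    congr 1
    abel
  · filter_upwards [hnear, h1] with x hx hx1
    simpa only [Pi.smul_apply', hx1, one_smul] using ⟨hx.1, hx.2.2⟩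

end

end IsVBDirac

end AdaptedFrames

/-! ### Submanifolds that are linear in the preferred charts. -/

section Submanifolds

variable {V : Type*} [NormedAddCommGroup V] [NormedSpace ℝ V] {H : Type*} [TopologicalSpace H]
  {I : ModelWithCorners ℝ V H} {N : Type*} [TopologicalSpace N] [ChartedSpace H N]

/-- The set `S` is, in the domain of the preferred chart at `p`, given by a linear subspace. -/
def IsLinearAt (I : ModelWithCorners ℝ V H) (S : Set N) (p : N) (U : Submodule ℝ V) : Prop :=
  ∀ q ∈ (chartAt H p).source, q ∈ S ↔ extChartAt I p q ∈ U

lemma isEmbeddedSubmanifold_of_isLinearAt [IsManifold I ∞ N] {S : Set N} {U : Submodule ℝ V}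
    (h : ∀ p ∈ S, IsLinearAt I S p U) : IsEmbeddedSubmanifold I S := fun p hp =>
  ⟨chartAt H p, IsManifold.chart_mem_maximalAtlas p, mem_chart_source H p, U, h p hp⟩

lemma vderiv_eq_fderiv [I.Boundaryless] {G : Type*} [NormedAddCommGroup G] [NormedSpace ℝ G]
    {f : N → G} {p : N} (hf : MDifferentiableAt I 𝓘(ℝ, G) f p) (v : TangentSpace I p) :
    vderiv I f p v = fderiv ℝ (f ∘ (extChartAt I p).symm) (extChartAt I p p) v := by
  rw [vderiv, hf.mfderiv, I.range_eq_univ, fderivWithin_univ]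
  rfl

/-- The derivative, in a direction tangent to a submanifold, of a function with values in a
subspace along the submanifold. -/
lemma vderiv_mem [I.Boundaryless] {S : Set N} {U : Submodule ℝ V} {p : N} (hS : IsLinearAt I S p U)
    (hp : p ∈ S) {G : Type*} [NormedAddCommGroup G] [NormedSpace ℝ G] [FiniteDimensional ℝ G]
    {f : N → G} (hf : MDifferentiableAt I 𝓘(ℝ, G) f p) {D : Submodule ℝ G}
    (hD : ∀ᶠ q in 𝓝 p, q ∈ S → f q ∈ D) {v : V} (hv : v ∈ U) :
    vderiv I f p v ∈ D := by
  refine (congrArg (· ∈ D) (vderiv_eq_fderiv hf v)).mpr ?_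
  set g := f ∘ (extChartAt I p).symm with hg
  set z := extChartAt I p p with hz
  have hgd : DifferentiableAt ℝ g z := by
    have := hf.differentiableWithinAt_writtenInExtChartAt
    rw [I.range_eq_univ, differentiableWithinAt_univ] at this
    exact this
  -- The segment in the chart in direction `v` stays in `S`. Along it the difference quotients of
  -- `f` lie in `D`, which is closed.
  have hline : HasDerivAt (fun t : ℝ => z + t • v) v 0 := by
    have := ((hasDerivAt_id (0 : ℝ)).smul_const v).const_add z
    simpa using this
  have hc : HasDerivAt (fun t : ℝ => g (z + t • v)) (fderiv ℝ g z v) 0 := by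
    have h0 : z = (fun t : ℝ => z + t • v) 0 := by simp
    have h1 : HasFDerivAt g (fderiv ℝ g z) ((fun t : ℝ => z + t • v) 0) := by
      rw [← h0]; exact hgd.hasFDerivAt
    exact h1.comp_hasDerivAt 0 hline
  have hcont : Filter.Tendsto (fun t : ℝ => z + t • v) (𝓝 0) (𝓝 z) := by
    have := hline.continuousAt.tendsto
    simpa using this
  have hsymm : Filter.Tendsto (extChartAt I p).symm (𝓝 z) (𝓝 p) := by
    have := (continuousAt_extChartAt_symm (I := I) p).tendsto
    rwa [extChartAt_to_inv] at this
  have htarget : ∀ᶠ y in 𝓝 z, y ∈ (extChartAt I p).target := extChartAt_target_mem_nhds p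
  have hin : ∀ᶠ t : ℝ in 𝓝 0, g (z + t • v) ∈ D := by
    filter_upwards [hcont.eventually htarget, (hsymm.comp hcont).eventually hD] with t ht hq
    refine hq ((hS _ ?_).2 ?_)
    · rw [← extChartAt_source I p]; exact (extChartAt I p).map_target ht
    · rw [Function.comp_apply, (extChartAt I p).right_inv ht]
      exact U.add_mem ((hS p (mem_chart_source H p)).1 hp) (U.smul_mem t hv)
  refine (D.closed_of_finiteDimensional).mem_of_tendsto hc.tendsto_slope ?_
  filter_upwards [hin.filter_mono nhdsWithin_le_nhds] with t ht
  rw [slope, vsub_eq_sub]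
  exact D.smul_mem _ (D.sub_mem ht hin.self_of_nhds)

end Submanifolds

/-! ### The bases of the two graphs are submanifolds. -/

section Bases

variable {V : Type*} [NormedAddCommGroup V] [NormedSpace ℝ V] {H : Type*} [TopologicalSpace H]
  {I : ModelWithCorners ℝ V H} {M : Type*} [TopologicalSpace M] [ChartedSpace H M]
  [IsManifold I ∞ M]

/-- The vector part of a tangent vector, in the preferred chart. -/
def vecPart (X : TangentBundle I M) : V := X.2

variable (I M) in
/-- The graph of the addition of `TM → M`. -/
def addBase : Set (TangentBundle I M × TangentBundle I M × TangentBundle I M) :=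
  {p | p.2.1.proj = p.1.proj ∧ p.2.2.proj = p.1.proj ∧ vecPart p.1 = vecPart p.2.1 + vecPart p.2.2}

variable (V) in
/-- The tangent space of `addBase` in charts. -/
def addBaseModel : Submodule ℝ ((V × V) × (V × V) × (V × V)) where
  carrier := {z | z.2.1.1 = z.1.1 ∧ z.2.2.1 = z.1.1 ∧ z.1.2 = z.2.1.2 + z.2.2.2}
  add_mem' := by
    rintro a b ⟨h1, h2, h3⟩ ⟨h1', h2', h3'⟩
    exact ⟨by simp [h1, h1'], by simp [h2, h2'], by simp [h3, h3']; abel⟩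
  zero_mem' := by simp
  smul_mem' := by
    rintro c a ⟨h1, h2, h3⟩
    exact ⟨by simp [h1], by simp [h2], by simp [h3]⟩

variable (I M) in
/-- The graph of the projection `TM → M`. -/
def projBase : Set (M × TangentBundle I M) := {p | p.2.proj = p.1}

variable (V) in
/-- The tangent space of `projBase` in charts. -/
def projBaseModel : Submodule ℝ (V × V × V) where
  carrier := {z | z.2.1 = z.1}
  add_mem' := by
    rintro a b h1 h1'
    exact congrArg₂ (· + ·) h1 h1'
  zero_mem' := rfl
  smul_mem' := by
    rintro c a h1
    exact congrArg (c • ·) h1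

lemma isLinearAt_projBase {p : M × TangentBundle I M} (hp : p ∈ projBase I M) :
    IsLinearAt (I.prod I.tangent) (projBase I M) p (projBaseModel V) := by
  obtain ⟨x, X⟩ := p
  obtain rfl : X.proj = x := hp
  rintro ⟨y, Y⟩ hq
  have hq1 : y ∈ (chartAt H X.proj).source := hq.1
  have hq2 : Y.proj ∈ (chartAt H X.proj).source := (TangentBundle.mem_chart_source_iff Y X).1 hq.2
  rw [extChartAt_prod]
  change Y.proj = y ↔ (extChartAt I.tangent X Y).1 = extChartAt I X.proj y
  rw [extChartAt_tangent hq2]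
  rw [← extChartAt_source I] at hq1 hq2
  exact ((extChartAt I X.proj).injOn.eq_iff hq2 hq1).symm

/-- The three vectors of a point of `addBase` share their base point, so the three charts of `TM`
are the differential of one chart of `M`. This differential is linear on tangent spaces and turns
the equations of `addBase` into linear ones. -/
lemma isLinearAt_addBase {p : TangentBundle I M × TangentBundle I M × TangentBundle I M}
    (hp : p ∈ addBase I M) :
    IsLinearAt (I.tangent.prod (I.tangent.prod I.tangent)) (addBase I M) p (addBaseModel V) := by
  obtain ⟨X, X₂, X₃⟩ := p
  obtain ⟨h2, h3, -⟩ : X₂.proj = X.proj ∧ X₃.proj = X.proj ∧ _ := hp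
  rintro ⟨Y, Y₂, Y₃⟩ hq
  have hq1 : Y.proj ∈ (chartAt H X.proj).source := (TangentBundle.mem_chart_source_iff Y X).1 hq.1
  have hq2 : Y₂.proj ∈ (chartAt H X₂.proj).source :=
    (TangentBundle.mem_chart_source_iff Y₂ X₂).1 hq.2.1
  have hq3 : Y₃.proj ∈ (chartAt H X₃.proj).source :=
    (TangentBundle.mem_chart_source_iff Y₃ X₃).1 hq.2.2
  rw [extChartAt_prod, extChartAt_prod]
  change _ ↔ (extChartAt I.tangent X₂ Y₂).1 = (extChartAt I.tangent X Y).1 ∧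
    (extChartAt I.tangent X₃ Y₃).1 = (extChartAt I.tangent X Y).1 ∧
    (extChartAt I.tangent X Y).2 =
      (extChartAt I.tangent X₂ Y₂).2 + (extChartAt I.tangent X₃ Y₃).2
  rw [extChartAt_tangent hq1, extChartAt_tangent hq2, extChartAt_tangent hq3]
  rw [h2] at hq2 ⊢
  rw [h3] at hq3 ⊢
  have hinj : ∀ {y y' : M}, y ∈ (chartAt H X.proj).source → y' ∈ (chartAt H X.proj).source →
      (extChartAt I X.proj y = extChartAt I X.proj y' ↔ y = y') := fun {y y'} hy hy' => by
    rw [← extChartAt_source I] at hy hy'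
    exact (extChartAt I X.proj).injOn.eq_iff hy hy'
  dsimp only
  rw [hinj hq2 hq1, hinj hq3 hq1]
  refine and_congr_right fun e2 => and_congr_right fun e3 => ?_
  obtain ⟨y, v⟩ := Y
  obtain ⟨y₂, v₂⟩ := Y₂
  obtain ⟨y₃, v₃⟩ := Y₃
  dsimp only at e2 e3 hq1
  subst e2 e3
  change v = v₂ + v₃ ↔ vderiv I (extChartAt I X.proj) y₃ v =
    vderiv I (extChartAt I X.proj) y₃ v₂ + vderiv I (extChartAt I X.proj) y₃ v₃
  constructor
  · intro h
    rw [show v = v₂ + v₃ from h]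
    exact vderiv_add _ _ _
  · intro h
    -- Equality of the chart images yields equality of the vectors because the chart of `TM` is
    -- injective on its source.
    have h4 : (⟨y₃, v⟩ : TangentBundle I M) = ⟨y₃, v₂ + v₃⟩ := by
      have hs : ∀ u, (⟨y₃, u⟩ : TangentBundle I M) ∈ (extChartAt I.tangent X).source := fun u => by
        rw [extChartAt_source]; exact mem_chartAt_tangent hq1
      refine (extChartAt I.tangent X).injOn (hs _) (hs _) ?_
      rw [extChartAt_tangent (Z := ⟨y₃, v⟩) hq1, extChartAt_tangent (Z := ⟨y₃, v₂ + v₃⟩) hq1]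
      refine Prod.ext rfl ?_
      exact h.trans (vderiv_add _ _ _).symm
    exact congrArg vecPart h4

end Bases

/-! ### Frames indexed by finite types and frames of the annihilator. -/

section GeneralFrames

variable {V : Type*} [NormedAddCommGroup V] [NormedSpace ℝ V] {H : Type*} [TopologicalSpace H]
  {I : ModelWithCorners ℝ V H} {N : Type*} [TopologicalSpace N] [ChartedSpace H N]

/-- Frames of the graphs are naturally indexed by disjoint unions of index sets. -/
lemma isVectorSubbundle_of_frame {Q : N → Type*} [∀ p, AddCommGroup (Q p)] [∀ p, Module ℝ (Q p)]
    {Γ : Set (∀ p, Q p)} {K : ∀ p, Set (Q p)} (h : IsEmbeddedSubmanifold I (baseOf K))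
    (hf : ∀ p ∈ baseOf K, ∃ (ι : Type) (_ : Fintype ι) (s : ι → ∀ q, Q q), (∀ i, s i ∈ Γ) ∧
      ∀ᶠ q in 𝓝 p, q ∈ baseOf K → LinearIndependent ℝ (fun i => s i q) ∧
        (Submodule.span ℝ (Set.range fun i => s i q) : Set (Q q)) = K q) :
    IsVectorSubbundle I Γ K where
  embedded := h
  frame p hp := by
    obtain ⟨ι, _, s, hs, h⟩ := hf p hp
    refine ⟨Fintype.card ι, fun i => s ((Fintype.equivFin ι).symm i), fun i => hs _, ?_⟩
    filter_upwards [h] with q hq hqK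
    obtain ⟨h1, h2⟩ := hq hqK
    refine ⟨h1.comp _ (Fintype.equivFin ι).symm.injective, ?_⟩
    rw [← h2]
    congr 2
    exact (Fintype.equivFin ι).symm.surjective.range_comp (fun i => s i q)

variable [IsManifold I ∞ N]
  {F : Type*} [NormedAddCommGroup F] [NormedSpace ℝ F] {E : N → Type*}
  [∀ x, AddCommGroup (E x)] [∀ x, Module ℝ (E x)] [∀ x, TopologicalSpace (E x)]
  [TopologicalSpace (TotalSpace F E)] [FiberBundle F E] [VectorBundle ℝ F E]
  [ContMDiffVectorBundle ∞ F E I] [FiniteDimensional ℝ V] [T2Space N] [FiniteDimensional ℝ F]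

/-- The annihilator of a subbundle with respect to the pairing. -/
def CourantAlgebroid.annihilator (C : CourantAlgebroid I F E) (W : ∀ x, Submodule ℝ (E x)) (x : N) :
    Submodule ℝ (E x) where
  carrier := {k | ∀ u ∈ W x, C.pairing x k u = 0}
  add_mem' := fun h h' u hu => by rw [map_add, LinearMap.add_apply, h u hu, h' u hu, add_zero]
  zero_mem' := fun u _ => by rw [map_zero, LinearMap.zero_apply]
  smul_mem' := fun c k h u hu => by rw [map_smul, LinearMap.smul_apply, h u hu, smul_zero]

omit [FiniteDimensional ℝ V] [T2Space N] [FiniteDimensional ℝ F] in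
lemma eventually_linearIndependent {ι : Type*} [Finite ι] {s : ι → ∀ y, E y}
    (hs : ∀ i, s i ∈ smoothSections I F E) {x : N} (h : LinearIndependent ℝ fun i => s i x) :
    ∀ᶠ y in 𝓝 x, LinearIndependent ℝ fun i => s i y := by
  have h1 : ContinuousAt (fun y => fun i => coordRep F x (s i) y) x :=
    continuousAt_pi.2 fun i =>
      (contMDiffAt_coordRep (hs i x) (mem_baseSet_trivializationAt F E x)).continuousAt
  have h2 : LinearIndependent ℝ (fun i => coordRep F x (s i) x) :=
    h.map' (fibCoord F x).toLinearMap
      (LinearMap.ker_eq_bot.2 (fibCoord F x).injective)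
  filter_upwards [h1.eventually h2.eventually, baseSet_mem_nhds F E x] with y hy hy'
  refine LinearIndependent.of_comp ((trivializationAt F E x).continuousLinearEquivAt ℝ y hy').toLinearMap ?_
  exact hy

/-- Local frames of the annihilator of a subbundle. -/
lemma CourantAlgebroid.exists_annihilator_frame (C : CourantAlgebroid I F E)
    {W : ∀ x, Submodule ℝ (E x)}
    (hW : IsVectorSubbundle I (smoothSections I F E) (fun x => (W x : Set (E x)))) (x : N) :
    ∃ (m : ℕ) (k : Fin m → ∀ y, E y), (∀ i, k i ∈ sectionsOf I F (C.annihilator W)) ∧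
      ∀ᶠ y in 𝓝 x, LinearIndependent ℝ (fun i => k i y) ∧
        Submodule.span ℝ (Set.range fun i => k i y) = C.annihilator W y := by
  obtain ⟨r, w, hw, hspan⟩ := exists_frame_sectionsOf hW x
  obtain ⟨θ, hθ, hdual⟩ := C.exists_dual_sections (fun i => (hw i).1) hspan.self_of_nhds.1
  have hnear := hdual.and hspan
  obtain ⟨χ, hχ, h1, hsupp⟩ := exists_cutoff I hnear
  have hfin : ∀ y, FiniteDimensional ℝ (E y) := fun y =>
    (fibCoord F (E := E) y).symm.toLinearEquiv.finiteDimensional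
  -- The annihilator is the kernel of the pairings with the frame, which are jointly surjective
  -- because of the dual sections. Its rank is therefore constant near `x`.
  have hrank : ∀ y, (∀ i j, C.pairing y (θ i y) (w j y) = (1 : Matrix (Fin r) (Fin r) ℝ) i j) →
      Submodule.span ℝ (Set.range fun i => w i y) = W y →
      r + Module.finrank ℝ (C.annihilator W y) = Module.finrank ℝ F := fun y hy1 hy2 => by
    have := hfin y
    let φ : E y →ₗ[ℝ] Fin r → ℝ := LinearMap.pi fun j => (C.pairing y).flip (w j y)
    have hφ : LinearMap.ker φ = C.annihilator W y := by
      ext u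
      rw [LinearMap.mem_ker]
      constructor
      · intro hu v hv
        rw [← hy2] at hv
        obtain ⟨c, rfl⟩ := (Submodule.mem_span_range_iff_exists_fun ℝ).1 hv
        rw [map_sum]
        refine Finset.sum_eq_zero fun j _ => ?_
        have := congrFun hu j
        rw [map_smul, show C.pairing y u (w j y) = 0 from this, smul_zero]
      · intro hu
        ext j
        refine hu _ ?_
        rw [← hy2]
        exact Submodule.subset_span ⟨j, rfl⟩
    have hsurj : LinearMap.range φ = ⊤ := LinearMap.range_eq_top.2 fun c => by
      refine ⟨∑ i, c i • θ i y, ?_⟩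
      ext j
      simp [φ, hy1, Matrix.one_apply]
    have h2 := LinearMap.finrank_range_add_finrank_ker φ
    rw [hsurj, finrank_top, Module.finrank_fin_fun, hφ] at h2
    rw [h2]
    exact (fibCoord F (E := E) y).toLinearEquiv.finrank_eq
  have := hfin x
  let b := Module.finBasis ℝ (C.annihilator W x)
  choose η hη h2 using fun i => exists_section_eq I F x (b i : E x)
  have hs : ∀ i y, (χ • (η i - ∑ j, (fun y => C.pairing y (η i y) (w j y)) • θ j)) y =
      χ y • (η i y - ∑ j, C.pairing y (η i y) (w j y) • θ j y) := fun i y => by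
    simp only [Pi.smul_apply', Pi.sub_apply, Finset.sum_apply]
  -- Removing the components along `θ` makes an arbitrary extension of a basis vector orthogonal to
  -- the frame of `W`; at `x` nothing is removed.
  have hk : ∀ i, χ • (η i - ∑ j, (fun y => C.pairing y (η i y) (w j y)) • θ j) ∈
      sectionsOf I F (C.annihilator W) := fun i => by
    refine ⟨smoothSections_smul hχ (smoothSections_sub (hη i) (smoothSections_sum fun j _ =>
      smoothSections_smul (C.pairing_smooth _ (hη i) _ (hw j).1) (hθ j))), fun y => ?_⟩
    rw [hs]
    by_cases hy : χ y = 0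
    · rw [hy, zero_smul]; exact Submodule.zero_mem _
    obtain ⟨hy1, -, hy2⟩ := hsupp (subset_tsupport χ hy)
    refine Submodule.smul_mem _ _ fun v hv => ?_
    rw [← hy2] at hv
    obtain ⟨c, rfl⟩ := (Submodule.mem_span_range_iff_exists_fun ℝ).1 hv
    rw [map_sum]
    refine Finset.sum_eq_zero fun j _ => ?_
    simp [hy1, Matrix.one_apply]
  have hx : ∀ i, (χ • (η i - ∑ j, (fun y => C.pairing y (η i y) (w j y)) • θ j)) x = b i := fun i => by
    rw [hs, h1.self_of_nhds, one_smul, h2]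
    have : ∀ j, C.pairing x (b i : E x) (w j x) = 0 := fun j => (b i).2 _ ((hw j).2 x)
    simp [this]
  refine ⟨_, _, hk, ?_⟩
  have hli : LinearIndependent ℝ fun i =>
      (χ • (η i - ∑ j, (fun y => C.pairing y (η i y) (w j y)) • θ j)) x := by
    simp only [hx]
    exact b.linearIndependent.map' _ (Submodule.ker_subtype _)
  filter_upwards [hnear, eventually_linearIndependent (fun i => (hk i).1) hli] with y hy hy'
  refine ⟨hy', ?_⟩
  have := hfin y
  refine Submodule.eq_of_le_of_finrank_eq ?_ ?_
  · rw [Submodule.span_le]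
    rintro _ ⟨i, rfl⟩
    exact (hk i).2 y
  · rw [finrank_span_eq_card hy', Fintype.card_fin]
    have e1 := hrank y hy.1 hy.2.2
    have e2 := hrank x hnear.self_of_nhds.1 hnear.self_of_nhds.2.2
    omega

end GeneralFrames

/-! ### The graphs in fibre coordinates. -/

section Graphs

variable {V : Type*} [NormedAddCommGroup V] [NormedSpace ℝ V] {H : Type*} [TopologicalSpace H]
  {I : ModelWithCorners ℝ V H} {M : Type*} [TopologicalSpace M] [ChartedSpace H M]
  [IsManifold I ∞ M]
  {F : Type*} [NormedAddCommGroup F] [NormedSpace ℝ F] {E : M → Type*}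
  [∀ x, AddCommGroup (E x)] [∀ x, Module ℝ (E x)] [∀ x, TopologicalSpace (E x)]
  [TopologicalSpace (TotalSpace F E)] [FiberBundle F E] [VectorBundle ℝ F E]
  [ContMDiffVectorBundle ∞ F E I]
  {W : ∀ x, Submodule ℝ (E x)} {L : ∀ X, Submodule ℝ (TangentProlongation I F E X)}

/-- The condition that the first element of a triple is the sum of the others, for the addition
of `T𝔼 → 𝔼`. -/
def IsAddTriple {p : TangentBundle I M × TangentBundle I M × TangentBundle I M}
    (d : TangentProlongation I F E p.1 × TangentProlongation I F E p.2.1 ×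
      TangentProlongation I F E p.2.2) : Prop :=
  fibFst I E p.2.1 d.2.1 = fibFst I E p.1 d.1 ∧ fibFst I E p.2.2 d.2.2 = fibFst I E p.1 d.1 ∧
    fibSnd I E p.1 d.1 = fibSnd I E p.2.1 d.2.1 + fibSnd I E p.2.2 d.2.2

/-- Eliminates the tangent vectors to 𝔼. Being tangent at one point means equal base points in `M`
and equal fibre coordinates; the sum in the tangent space is the sum of the components along the
base and along the fibre. -/
lemma mem_graphAdd {p : TangentBundle I M × TangentBundle I M × TangentBundle I M}
    {d : TangentProlongation I F E p.1 × TangentProlongation I F E p.2.1 ×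
      TangentProlongation I F E p.2.2} :
    d ∈ graphAdd L p ↔ p ∈ addBase I M ∧
      (d.1 ∈ L p.1 ∧ d.2.1 ∈ L p.2.1 ∧ d.2.2 ∈ L p.2.2) ∧ IsAddTriple d := by
  constructor
  · rintro ⟨h1, h2, h3, w, ξ₂, ξ₃, e2, e3, e1⟩
    let f : TotalSpace (F × F) (TangentProlongation I F E) → M × V × F × F :=
      fun z => (z.1.1, z.1.2, z.2)
    have e1 : (w.proj, (tangentCoord w (ξ₂ + ξ₃)).1, (trivializationAt F E w.proj w).2,
      (tangentCoord w (ξ₂ + ξ₃)).2) = f ⟨p.1, d.1⟩ := congrArg f e1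
    have e2 : (w.proj, (tangentCoord w ξ₂).1, (trivializationAt F E w.proj w).2,
      (tangentCoord w ξ₂).2) = f ⟨p.2.1, d.2.1⟩ := congrArg f e2
    have e3 : (w.proj, (tangentCoord w ξ₃).1, (trivializationAt F E w.proj w).2,
      (tangentCoord w ξ₃).2) = f ⟨p.2.2, d.2.2⟩ := congrArg f e3
    rw [map_add] at e1
    refine ⟨⟨(congrArg (·.1) e2).symm.trans (congrArg (·.1) e1),
      (congrArg (·.1) e3).symm.trans (congrArg (·.1) e1), ?_⟩, ⟨h1, h2, h3⟩,
      (congrArg (·.2.2.1) e2).symm.trans (congrArg (·.2.2.1) e1),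
      (congrArg (·.2.2.1) e3).symm.trans (congrArg (·.2.2.1) e1), ?_⟩
    · exact (congrArg (·.2.1) e1).symm.trans
        (congrArg₂ (· + ·) (congrArg (·.2.1) e2) (congrArg (·.2.1) e3))
    · exact (congrArg (·.2.2.2) e1).symm.trans
        (congrArg₂ (· + ·) (congrArg (·.2.2.2) e2) (congrArg (·.2.2.2) e3))
  · rintro ⟨hp, ⟨h1, h2, h3⟩, hd⟩
    refine ⟨h1, h2, h3, ?_⟩
    clear h1 h2 h3
    obtain ⟨⟨x, v⟩, ⟨x₂, v₂⟩, ⟨x₃, v₃⟩⟩ := p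
    obtain ⟨d₁, d₂, d₃⟩ := d
    obtain ⟨e2, e3, e1⟩ := hp
    dsimp only at e2 e3
    subst e2 e3
    have e1 : v = v₂ + v₃ := e1
    subst e1
    obtain ⟨a2, a3, a1⟩ := hd
    obtain ⟨u, hu⟩ := (fibCoord F (E := E) x₃).surjective (fibFst I E ⟨x₃, v₂ + v₃⟩ d₁)
    obtain ⟨ξ₂, hξ₂⟩ := exists_tangentCoord_eq (I := I) (⟨x₃, u⟩ : TotalSpace F E) v₂
      (fibSnd I E ⟨x₃, v₂⟩ d₂)
    obtain ⟨ξ₃, hξ₃⟩ := exists_tangentCoord_eq (I := I) (⟨x₃, u⟩ : TotalSpace F E) v₃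
      (fibSnd I E ⟨x₃, v₃⟩ d₃)
    have key : ∀ (ξ : TangentSpace (I.prod 𝓘(ℝ, F)) (⟨x₃, u⟩ : TotalSpace F E)) (v : V)
        (d : TangentProlongation I F E ⟨x₃, v⟩), fibFst I E ⟨x₃, v⟩ d = fibCoord F x₃ u →
        tangentCoord (⟨x₃, u⟩ : TotalSpace F E) ξ = (v, fibSnd I E ⟨x₃, v⟩ d) →
        tangentIdent I F E ⟨⟨x₃, u⟩, ξ⟩ = ⟨⟨x₃, v⟩, d⟩ := fun ξ v d hd hξ => by
      rw [tangentIdent_mk, hξ]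
      exact congrArg (TotalSpace.mk (⟨x₃, v⟩ : TangentBundle I M)) (fib_ext hd.symm rfl)
    refine ⟨⟨x₃, u⟩, ξ₂, ξ₃, key ξ₂ v₂ d₂ (a2.trans hu.symm) hξ₂,
      key ξ₃ v₃ d₃ (a3.trans hu.symm) hξ₃, key (ξ₂ + ξ₃) _ d₁ hu.symm ?_⟩
    rw [map_add, hξ₂, hξ₃]
    exact Prod.ext rfl a1.symm

lemma mem_graphProj {p : M × TangentBundle I M} {d : E p.1 × TangentProlongation I F E p.2} :
    d ∈ graphProj W L p ↔ p ∈ projBase I M ∧ (d.1 ∈ W p.1 ∧ d.2 ∈ L p.2) ∧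
      fibFst I E p.2 d.2 = fibCoord F p.1 d.1 := by
  constructor
  · rintro ⟨h1, h2, ξ, e⟩
    let f : TotalSpace (F × F) (TangentProlongation I F E) → M × F := fun z => (z.1.1, z.2.1)
    have e1 : (p.1, fibCoord F p.1 d.1) = f ⟨p.2, d.2⟩ := congrArg f e
    exact ⟨(congrArg Prod.fst e1).symm, ⟨h1, h2⟩, (congrArg Prod.snd e1).symm⟩
  · rintro ⟨hp, ⟨h1, h2⟩, h3⟩
    refine ⟨h1, h2, ?_⟩
    clear h1 h2
    obtain ⟨x, ⟨x', v⟩⟩ := p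
    obtain ⟨u, d⟩ := d
    obtain rfl : x' = x := hp
    obtain ⟨ξ, hξ⟩ := exists_tangentCoord_eq (I := I) (⟨x', u⟩ : TotalSpace F E) v
      (fibSnd I E ⟨x', v⟩ d)
    refine ⟨ξ, ?_⟩
    rw [tangentIdent_mk, hξ]
    exact congrArg (TotalSpace.mk (⟨x', v⟩ : TangentBundle I M)) (fib_ext h3.symm rfl)

lemma isAddTriple_zero (p : TangentBundle I M × TangentBundle I M × TangentBundle I M) :
    IsAddTriple (I := I) (F := F) (E := E) (p := p) 0 := by
  simp [IsAddTriple]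

lemma baseOf_graphAdd : baseOf (graphAdd L) = addBase I M := by
  ext p
  refine ⟨fun ⟨d, hd⟩ => (mem_graphAdd.1 hd).1, fun hp => ⟨0, mem_graphAdd.2 ⟨hp,
    ⟨(L _).zero_mem, (L _).zero_mem, (L _).zero_mem⟩, isAddTriple_zero p⟩⟩⟩

lemma baseOf_graphProj : baseOf (graphProj W L) = projBase I M := by
  ext p
  refine ⟨fun ⟨d, hd⟩ => (mem_graphProj.1 hd).1, fun hp => ⟨0, mem_graphProj.2 ⟨hp,
    ⟨(W _).zero_mem, (L _).zero_mem⟩, ?_⟩⟩⟩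
  simp

end Graphs

/-! ### The graph of the projection is a subbundle. -/

section GraphSubbundles

variable {V : Type*} [NormedAddCommGroup V] [NormedSpace ℝ V] {H : Type*} [TopologicalSpace H]
  {I : ModelWithCorners ℝ V H} {M : Type*} [TopologicalSpace M] [ChartedSpace H M]
  [IsManifold I ∞ M]
  {F : Type*} [NormedAddCommGroup F] [NormedSpace ℝ F] {E : M → Type*}
  [∀ x, AddCommGroup (E x)] [∀ x, Module ℝ (E x)] [∀ x, TopologicalSpace (E x)]
  [TopologicalSpace (TotalSpace F E)] [FiberBundle F E] [VectorBundle ℝ F E]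
  [ContMDiffVectorBundle ∞ F E I]
  {W : ∀ x, Submodule ℝ (E x)} {L : ∀ X, Submodule ℝ (TangentProlongation I F E X)}

/-- The fibre of the graph of the addition, as a subspace. -/
def addFibre (L : ∀ X, Submodule ℝ (TangentProlongation I F E X))
    (p : TangentBundle I M × TangentBundle I M × TangentBundle I M) :
    Submodule ℝ (TangentProlongation I F E p.1 × TangentProlongation I F E p.2.1 ×
      TangentProlongation I F E p.2.2) where
  carrier := {d | (d.1 ∈ L p.1 ∧ d.2.1 ∈ L p.2.1 ∧ d.2.2 ∈ L p.2.2) ∧ IsAddTriple d}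
  add_mem' := by
    rintro a b ⟨⟨h1, h2, h3⟩, e2, e3, e1⟩ ⟨⟨h1', h2', h3'⟩, e2', e3', e1'⟩
    refine ⟨⟨(L _).add_mem h1 h1', (L _).add_mem h2 h2', (L _).add_mem h3 h3'⟩, ?_, ?_, ?_⟩ <;>
    simp only [Prod.fst_add, Prod.snd_add, map_add, e1, e2, e3, e1', e2', e3']
    abel
  zero_mem' := ⟨⟨(L _).zero_mem, (L _).zero_mem, (L _).zero_mem⟩, isAddTriple_zero p⟩
  smul_mem' := by
    rintro c a ⟨⟨h1, h2, h3⟩, e2, e3, e1⟩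
    refine ⟨⟨(L _).smul_mem c h1, (L _).smul_mem c h2, (L _).smul_mem c h3⟩, ?_, ?_, ?_⟩ <;>
    simp only [Prod.smul_fst, Prod.smul_snd, map_smul, e1, e2, e3, smul_add]

/-- The fibre of the graph of the projection, as a subspace. -/
def projFibre (W : ∀ x, Submodule ℝ (E x)) (L : ∀ X, Submodule ℝ (TangentProlongation I F E X))
    (p : M × TangentBundle I M) : Submodule ℝ (E p.1 × TangentProlongation I F E p.2) where
  carrier := {d | (d.1 ∈ W p.1 ∧ d.2 ∈ L p.2) ∧ fibFst I E p.2 d.2 = fibCoord F p.1 d.1}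
  add_mem' := by
    rintro a b ⟨⟨h1, h2⟩, e⟩ ⟨⟨h1', h2'⟩, e'⟩
    exact ⟨⟨(W _).add_mem h1 h1', (L _).add_mem h2 h2'⟩, by
      simp only [Prod.fst_add, Prod.snd_add, map_add, e, e']⟩
  zero_mem' := ⟨⟨(W _).zero_mem, (L _).zero_mem⟩, by simp⟩
  smul_mem' := by
    rintro c a ⟨⟨h1, h2⟩, e⟩
    exact ⟨⟨(W _).smul_mem c h1, (L _).smul_mem c h2⟩, by
      simp only [Prod.smul_fst, Prod.smul_snd, map_smul, e]⟩

lemma coe_addFibre {p : TangentBundle I M × TangentBundle I M × TangentBundle I M}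
    (hp : p ∈ addBase I M) : (addFibre L p : Set _) = graphAdd L p := by
  ext d
  exact ⟨fun h => mem_graphAdd.2 ⟨hp, h⟩, fun h => (mem_graphAdd.1 h).2⟩

lemma coe_projFibre {p : M × TangentBundle I M} (hp : p ∈ projBase I M) :
    (projFibre W L p : Set _) = graphProj W L p := by
  ext d
  exact ⟨fun h => mem_graphProj.2 ⟨hp, h⟩, fun h => (mem_graphProj.1 h).2⟩

lemma vert_injective (X : TangentBundle I M) :
    Function.Injective (vert I F X : E X.proj →ₗ[ℝ] TangentProlongation I F E X) :=
  (injective_iff_map_eq_zero _).2 fun u hu => by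
    have := congrArg (fibSnd I E X) hu
    rw [fibSnd_vert, map_zero] at this
    exact (fibCoord F X.proj).injective (this.trans (map_zero _).symm)

lemma coeffs_eq_zero {r m : ℕ} {w : Fin r → ∀ x, E x} {k : Fin m → ∀ x, E x}
    {l : Fin r → ∀ X, TangentProlongation I F E X}
    (hlw : ∀ i X, basePt I E X (l i X) = w i X.proj) {X : TangentBundle I M}
    (hw : LinearIndependent ℝ fun i => w i X.proj) (hk : LinearIndependent ℝ fun i => k i X.proj)
    {a : Fin r → ℝ} {b : Fin m → ℝ}
    (h : ∑ i, a i • l i X + ∑ i, b i • vert I F X (k i X.proj) = 0) :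
    (∀ i, a i = 0) ∧ ∀ i, b i = 0 := by
  have h1 := congrArg (basePt (F := F) I E X) h
  simp only [map_add, map_sum, map_smul, hlw, basePt_vert, smul_zero, Finset.sum_const_zero,
    add_zero, map_zero] at h1
  have ha := Fintype.linearIndependent_iff.1 hw _ h1
  refine ⟨ha, Fintype.linearIndependent_iff.1 hk _ (vert_injective (I := I) (F := F) X ?_)⟩
  simpa [ha] using h

variable [FiniteDimensional ℝ V] [T2Space M] [FiniteDimensional ℝ F] [I.Boundaryless]
  {C : CourantAlgebroid I F E}

namespace IsVBDirac

variable (hL : IsVBDirac C.prolong W L)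
include hL

/-- Local data for `L`: a frame of `W`, linear lifts to `L`, and a frame of the core. -/
lemma exists_adapted_frame (x₀ : M) :
    ∃ (r m : ℕ) (w : Fin r → ∀ x, E x) (l : Fin r → ∀ X, TangentProlongation I F E X)
      (k : Fin m → ∀ x, E x),
      (∀ i, w i ∈ sectionsOf I F W) ∧ (∀ i, l i ∈ sectionsOf I.tangent (F × F) L) ∧
      (∀ i, k i ∈ smoothSections I F E) ∧ (∀ i X, vert I F X (k i X.proj) ∈ L X) ∧
      (∀ i X, basePt I E X (l i X) = w i X.proj) ∧ (∀ i, IsAdditiveLift (l i)) ∧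
      ∀ᶠ x in 𝓝 x₀, LinearIndependent ℝ (fun i => w i x) ∧
        Submodule.span ℝ (Set.range fun i => w i x) = W x ∧
        LinearIndependent ℝ (fun i => k i x) ∧ ∀ X : TangentBundle I M, X.proj = x →
          ∀ d ∈ L X, basePt I E X d = 0 → ∃ c : Fin m → ℝ, d = ∑ i, c i • vert I F X (k i X.proj) := by
  obtain ⟨r, w, θ, l, hw, hθ, hl, hlw, hla, h1⟩ := hL.exists_linear_lifts x₀
  obtain ⟨m, k, hk, h2⟩ := C.exists_annihilator_frame hL.double.side x₀
  refine ⟨r, m, w, l, k, hw, hl, fun i => (hk i).1, fun i X => hL.vert_mem_iff.2 ((hk i).2 _),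
    hlw, hla, ?_⟩
  filter_upwards [h1, h2] with x hx hx'
  refine ⟨linearIndependent_of_dual hx.1, hx.2, hx'.1, ?_⟩
  rintro X rfl d hd h0
  obtain ⟨a, rfl⟩ := eq_vert_of_basePt h0
  have ha : a ∈ C.annihilator W X.proj := hL.vert_mem_iff.1 hd
  rw [← hx'.2] at ha
  obtain ⟨c, rfl⟩ := (Submodule.mem_span_range_iff_exists_fun ℝ).1 ha
  exact ⟨c, by rw [map_sum]; simp only [map_smul]⟩

/-- A frame is given by the pairs of `w i` with its lift `l i` and the pairs of zero with a core
section: subtracting lifts leaves an element with base point zero, that is, a core element. -/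
theorem isVectorSubbundle_graphProj :
    IsVectorSubbundle (I.prod I.tangent) (prodSections I F I.tangent (F × F) W L)
      (graphProj W L) := by
  refine isVectorSubbundle_of_frame ?_ fun p hp => ?_
  · rw [baseOf_graphProj]
    exact isEmbeddedSubmanifold_of_isLinearAt fun p hp => isLinearAt_projBase hp
  rw [baseOf_graphProj] at hp ⊢
  obtain ⟨r, m, w, l, k, hw, hl, hk, hkL, hlw, hla, hnear⟩ := hL.exists_adapted_frame p.1
  let s : Fin r ⊕ Fin m → ∀ q : M × TangentBundle I M, E q.1 × TangentProlongation I F E q.2 :=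
    Sum.elim (fun i q => (w i q.1, l i q.2)) (fun i q => (0, vert I F q.2 (k i q.2.proj)))
  refine ⟨Fin r ⊕ Fin m, inferInstance, s, ?_, ?_⟩
  · rintro (i | i)
    · exact ⟨(hw i).1.comp contMDiff_fst, (hl i).1.comp contMDiff_snd,
        fun q => ⟨(hw i).2 _, (hl i).2 _⟩⟩
    · exact ⟨(contMDiff_zeroSection ℝ E).comp contMDiff_fst,
        (coreLift_mem (hk i)).comp contMDiff_snd, fun q => ⟨(W _).zero_mem, hkL i q.2⟩⟩
  filter_upwards [continuous_fst.continuousAt.eventually hnear] with q hq hqp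
  obtain ⟨hw1, hw2, hk1, hk2⟩ := hq
  obtain ⟨x, X⟩ := q
  obtain rfl : X.proj = x := hqp
  dsimp only at hw1 hw2 hk1 hk2 ⊢
  have hsum : ∀ c : Fin r ⊕ Fin m → ℝ, ∑ i, c i • s i (X.proj, X) =
      (∑ i, c (.inl i) • w i X.proj, ∑ i, c (.inl i) • l i X +
        ∑ i, c (.inr i) • vert I F X (k i X.proj)) := fun c => by
    rw [Fintype.sum_sum_type]
    refine Prod.ext ?_ ?_
    · simp [s, Prod.fst_sum]
    · simp [s, Prod.snd_sum]
  constructor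
  · refine Fintype.linearIndependent_iff.2 fun c hc => ?_
    rw [hsum] at hc
    have h := coeffs_eq_zero hlw hw1 hk1 (congrArg Prod.snd hc)
    rintro (i | i)
    exacts [h.1 i, h.2 i]
  · rw [← coe_projFibre (show (X.proj, X) ∈ projBase I M from rfl)]
    refine congrArg _ (le_antisymm (Submodule.span_le.2 ?_) ?_)
    · rintro _ ⟨i | i, rfl⟩
      · exact ⟨⟨(hw i).2 _, (hl i).2 _⟩, (basePt_eq_iff _ _ _).1 (hlw i X)⟩
      · exact ⟨⟨(W _).zero_mem, hkL i X⟩, (map_zero (fibCoord F X.proj)).symm⟩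
    · rintro ⟨u, d⟩ ⟨⟨hu, hd⟩, e⟩
      have e : basePt I E X d = u := (basePt_eq_iff _ _ _).2 e
      have hu : u ∈ W X.proj := hu
      rw [← hw2] at hu
      obtain ⟨a, rfl⟩ := (Submodule.mem_span_range_iff_exists_fun ℝ).1 hu
      obtain ⟨b, hb⟩ := hk2 X rfl (d - ∑ i, a i • l i X)
        ((L X).sub_mem hd (Submodule.sum_mem _ fun i _ => (L X).smul_mem _ ((hl i).2 X))) (by
          rw [map_sub, map_sum, e]; simp only [map_smul, hlw, sub_self])
      refine (Submodule.mem_span_range_iff_exists_fun ℝ).2 ⟨Sum.elim a b, ?_⟩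
      rw [hsum]
      refine Prod.ext rfl ?_
      simp only [Sum.elim_inl, Sum.elim_inr, ← hb]
      abel

end IsVBDirac

end GraphSubbundles

/-! ### The graph of the addition is a subbundle. -/

section GraphAddSubbundle

variable {V : Type*} [NormedAddCommGroup V] [NormedSpace ℝ V] {H : Type*} [TopologicalSpace H]
  {I : ModelWithCorners ℝ V H} {M : Type*} [TopologicalSpace M] [ChartedSpace H M]
  [IsManifold I ∞ M]
  {F : Type*} [NormedAddCommGroup F] [NormedSpace ℝ F] {E : M → Type*}
  [∀ x, AddCommGroup (E x)] [∀ x, Module ℝ (E x)] [∀ x, TopologicalSpace (E x)]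
  [TopologicalSpace (TotalSpace F E)] [FiberBundle F E] [VectorBundle ℝ F E]
  [ContMDiffVectorBundle ∞ F E I]
  {W : ∀ x, Submodule ℝ (E x)} {L : ∀ X, Submodule ℝ (TangentProlongation I F E X)}
  [FiniteDimensional ℝ V] [T2Space M] [FiniteDimensional ℝ F] [I.Boundaryless]
  {C : CourantAlgebroid I F E}

lemma map_add_eq_left {A B : Type*} [AddCommGroup A] [Module ℝ A] [AddCommGroup B] [Module ℝ B]
    (f : A →ₗ[ℝ] B) {a b : A} {u : B} (ha : f a = u) (hb : f b = 0) : f (a + b) = u := by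
  rw [map_add, ha, hb, add_zero]

namespace IsVBDirac

variable (hL : IsVBDirac C.prolong W L)
include hL

/-- A frame is given by the triples (l, l, l), (k, k, 0) and (k, 0, k), with `l` the linear lifts
and `k` the core sections. Linearity of the lifts in the tangent vector is exactly what puts the
first kind into the graph. -/
theorem isVectorSubbundle_graphAdd :
    IsVectorSubbundle (I.tangent.prod (I.tangent.prod I.tangent))
      (cubeSections I.tangent (F × F) L) (graphAdd L) := by
  refine isVectorSubbundle_of_frame ?_ fun p hp => ?_
  · rw [baseOf_graphAdd]
    exact isEmbeddedSubmanifold_of_isLinearAt fun p hp => isLinearAt_addBase hp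
  rw [baseOf_graphAdd] at hp ⊢
  obtain ⟨r, m, w, l, k, hw, hl, hk, hkL, hlw, hla, hnear⟩ := hL.exists_adapted_frame p.1.proj
  let s : Fin r ⊕ (Fin m ⊕ Fin m) →
      ∀ q : TangentBundle I M × TangentBundle I M × TangentBundle I M,
        TangentProlongation I F E q.1 × TangentProlongation I F E q.2.1 ×
          TangentProlongation I F E q.2.2 :=
    Sum.elim (fun i q => (l i q.1, l i q.2.1, l i q.2.2))
      (Sum.elim (fun i q => (coreLift I F E (k i) q.1, coreLift I F E (k i) q.2.1, 0))
        (fun i q => (coreLift I F E (k i) q.1, 0, coreLift I F E (k i) q.2.2)))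
  have h21 : ContMDiff (I.tangent.prod (I.tangent.prod I.tangent)) I.tangent ∞
      (fun q : TangentBundle I M × TangentBundle I M × TangentBundle I M => q.2.1) :=
    contMDiff_fst.comp contMDiff_snd
  have h22 : ContMDiff (I.tangent.prod (I.tangent.prod I.tangent)) I.tangent ∞
      (fun q : TangentBundle I M × TangentBundle I M × TangentBundle I M => q.2.2) :=
    contMDiff_snd.comp contMDiff_snd
  have hkm := fun i => coreLift_mem (I := I) (hk i)
  have h0 := contMDiff_zeroSection (IB := I.tangent) (n := ∞) ℝ (F := F × F)
    (TangentProlongation I F E)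
  refine ⟨Fin r ⊕ (Fin m ⊕ Fin m), inferInstance, s, ?_, ?_⟩
  · rintro (i | i | i)
    · exact ⟨(hl i).1.comp contMDiff_fst, (hl i).1.comp h21, (hl i).1.comp h22,
        fun q => ⟨(hl i).2 _, (hl i).2 _, (hl i).2 _⟩⟩
    · exact ⟨(hkm i).comp contMDiff_fst, (hkm i).comp h21, h0.comp h22,
        fun q => ⟨hkL i _, hkL i _, (L _).zero_mem⟩⟩
    · exact ⟨(hkm i).comp contMDiff_fst, h0.comp h21, (hkm i).comp h22,
        fun q => ⟨hkL i _, (L _).zero_mem, hkL i _⟩⟩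
  filter_upwards [((contMDiff_proj_tangent (I := I) (M := M)).continuous.comp
    continuous_fst).continuousAt.eventually hnear] with q hq hqp
  obtain ⟨hw1, hw2, hk1, hk2⟩ := hq
  have hq0 := hqp
  obtain ⟨⟨x, v⟩, ⟨x₂, v₂⟩, ⟨x₃, v₃⟩⟩ := q
  obtain ⟨e2, e3, e1⟩ := hqp
  dsimp only at e2 e3
  subst e2 e3
  have e1 : v = v₂ + v₃ := e1
  have hla' : ∀ i, fibSnd I E ⟨x₃, v⟩ (l i ⟨x₃, v⟩) = fibSnd I E ⟨x₃, v₂⟩ (l i ⟨x₃, v₂⟩) +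
      fibSnd I E ⟨x₃, v₃⟩ (l i ⟨x₃, v₃⟩) := fun i => by
    subst e1
    exact hla i x₃ v₂ v₃
  clear e1
  dsimp only [Function.comp] at hw1 hw2 hk1 hk2
  have hsum : ∀ c : Fin r ⊕ (Fin m ⊕ Fin m) → ℝ, ∑ i, c i • s i (⟨x₃, v⟩, ⟨x₃, v₂⟩, ⟨x₃, v₃⟩) =
      (∑ i, c (.inl i) • l i ⟨x₃, v⟩ +
          (∑ i, c (.inr (.inl i)) • vert I F ⟨x₃, v⟩ (k i x₃) +
          ∑ i, c (.inr (.inr i)) • vert I F ⟨x₃, v⟩ (k i x₃)),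
        ∑ i, c (.inl i) • l i ⟨x₃, v₂⟩ + ∑ i, c (.inr (.inl i)) • vert I F ⟨x₃, v₂⟩ (k i x₃),
        ∑ i, c (.inl i) • l i ⟨x₃, v₃⟩ + ∑ i, c (.inr (.inr i)) • vert I F ⟨x₃, v₃⟩ (k i x₃)) :=
      fun c => by
    rw [Fintype.sum_sum_type, Fintype.sum_sum_type]
    refine Prod.ext ?_ (Prod.ext ?_ ?_)
    · simp [s, Prod.fst_sum, coreLift_eq_vert]
    · simp [s, Prod.snd_sum, Prod.fst_sum, coreLift_eq_vert]
    · simp [s, Prod.snd_sum, coreLift_eq_vert]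
  constructor
  · refine Fintype.linearIndependent_iff.2 fun c hc => ?_
    rw [hsum] at hc
    have h2 := coeffs_eq_zero (X := ⟨x₃, v₂⟩) hlw hw1 hk1 (congrArg (·.2.1) hc)
    have h3 := coeffs_eq_zero (X := ⟨x₃, v₃⟩) hlw hw1 hk1 (congrArg (·.2.2) hc)
    rintro (i | i | i)
    exacts [h2.1 i, h2.2 i, h3.2 i]
  · rw [← coe_addFibre hq0]
    refine congrArg _ (le_antisymm (Submodule.span_le.2 ?_) ?_)
    · rintro _ ⟨i | i | i, rfl⟩
      · have hf : ∀ v : V, fibFst I E ⟨x₃, v⟩ (l i ⟨x₃, v⟩) = fibCoord F x₃ (w i x₃) := fun v =>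
          (basePt_eq_iff _ _ _).1 (hlw i ⟨x₃, v⟩)
        exact ⟨⟨(hl i).2 _, (hl i).2 _, (hl i).2 _⟩, (hf v₂).trans (hf v).symm,
          (hf v₃).trans (hf v).symm, hla' i⟩
      · exact ⟨⟨hkL i _, hkL i _, (L _).zero_mem⟩, rfl, map_zero _, by
          dsimp only [s, Sum.elim_inl, Sum.elim_inr]
          rw [map_zero, add_zero]; rfl⟩
      · exact ⟨⟨hkL i _, (L _).zero_mem, hkL i _⟩, map_zero _, rfl, by
          dsimp only [s, Sum.elim_inl, Sum.elim_inr]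
          rw [map_zero, zero_add]; rfl⟩
    · rintro ⟨d₁, d₂, d₃⟩ ⟨⟨hd1, hd2, hd3⟩, a2, a3, a1⟩
      dsimp only at hd1 hd2 hd3 a1 a2 a3
      have hu := hL.double.basePt_mem hd1
      have hu : basePt I E ⟨x₃, v⟩ d₁ ∈ W x₃ := hu
      rw [← hw2] at hu
      obtain ⟨a, ha⟩ := (Submodule.mem_span_range_iff_exists_fun ℝ).1 hu
      have hl1 : ∀ v : V, ∑ i, a i • l i ⟨x₃, v⟩ ∈ L ⟨x₃, v⟩ := fun v =>
        Submodule.sum_mem _ fun i _ => (L _).smul_mem _ ((hl i).2 _)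
      have hl2 : ∀ v' : V, fibFst I E ⟨x₃, v'⟩ (∑ i, a i • l i ⟨x₃, v'⟩) =
          fibFst I E ⟨x₃, v⟩ d₁ := fun v' => by
        rw [← fibCoord_basePt, ← fibCoord_basePt]
        refine congrArg (fibCoord F x₃) (Eq.trans ?_ ha)
        rw [map_sum]; simp only [map_smul, hlw]
      -- All three entries have the same base point. Subtracting the combination of lifts over it
      -- leaves core elements; those of `d₂` and `d₃` are free, and `d₁` is then determined by
      -- additivity.
      have hdec : ∀ (v' : V) (d : TangentProlongation I F E ⟨x₃, v'⟩), d ∈ L ⟨x₃, v'⟩ →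
          fibFst I E ⟨x₃, v'⟩ d = fibFst I E ⟨x₃, v⟩ d₁ →
          ∃ c : Fin m → ℝ, d - ∑ i, a i • l i ⟨x₃, v'⟩ =
            ∑ i, c i • vert I F ⟨x₃, v'⟩ (k i x₃) := fun v' d hd hd' => by
        refine hk2 ⟨x₃, v'⟩ rfl _ ((L _).sub_mem hd (hl1 v')) ((basePt_eq_iff _ _ _).2 ?_)
        rw [map_sub, hl2, hd', sub_self, map_zero]
      obtain ⟨b, hb⟩ := hdec v₂ d₂ hd2 a2
      obtain ⟨c, hc⟩ := hdec v₃ d₃ hd3 a3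
      refine (Submodule.mem_span_range_iff_exists_fun ℝ).2 ⟨Sum.elim a (Sum.elim b c), ?_⟩
      rw [hsum]
      simp only [Sum.elim_inl, Sum.elim_inr]
      have hd2' : ∑ i, a i • l i ⟨x₃, v₂⟩ + ∑ i, b i • vert I F ⟨x₃, v₂⟩ (k i x₃) = d₂ := by
        rw [← hb]; abel
      have hd3' : ∑ i, a i • l i ⟨x₃, v₃⟩ + ∑ i, c i • vert I F ⟨x₃, v₃⟩ (k i x₃) = d₃ := by
        rw [← hc]; abel
      have hd1' : ∑ i, a i • l i ⟨x₃, v⟩ + (∑ i, b i • vert I F ⟨x₃, v⟩ (k i x₃) +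
          ∑ i, c i • vert I F ⟨x₃, v⟩ (k i x₃)) = d₁ := by
        refine fib_ext ?_ ?_
        · refine map_add_eq_left _ (hl2 v) ?_
          simp [fibFst_vert]
        · rw [a1, ← hd2', ← hd3']
          simp only [map_add, map_sum, map_smul, fibSnd_vert, hla', smul_add,
            Finset.sum_add_distrib]
          abel
      exact Prod.ext hd1' (Prod.ext hd2' hd3')

end IsVBDirac

end GraphAddSubbundle

/-! ### Partial derivatives on products. -/

section PartialDerivatives

variable {V₁ : Type*} [NormedAddCommGroup V₁] [NormedSpace ℝ V₁] {H₁ : Type*}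
  [TopologicalSpace H₁] {I₁ : ModelWithCorners ℝ V₁ H₁} {N₁ : Type*} [TopologicalSpace N₁]
  [ChartedSpace H₁ N₁]
  {V₂ : Type*} [NormedAddCommGroup V₂] [NormedSpace ℝ V₂] {H₂ : Type*}
  [TopologicalSpace H₂] {I₂ : ModelWithCorners ℝ V₂ H₂} {N₂ : Type*} [TopologicalSpace N₂]
  [ChartedSpace H₂ N₂]
  {V₃ : Type*} [NormedAddCommGroup V₃] [NormedSpace ℝ V₃] {H₃ : Type*}
  [TopologicalSpace H₃] {I₃ : ModelWithCorners ℝ V₃ H₃} {N₃ : Type*} [TopologicalSpace N₃]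
  [ChartedSpace H₃ N₃]
  {G : Type*} [NormedAddCommGroup G] [NormedSpace ℝ G]

lemma vderiv_prod {f : N₁ × N₂ → G} {p : N₁ × N₂}
    (hf : MDifferentiableAt (I₁.prod I₂) 𝓘(ℝ, G) f p) (v : TangentSpace (I₁.prod I₂) p) :
    vderiv (I₁.prod I₂) f p v =
      vderiv I₁ (fun z => f (z, p.2)) p.1 v.1 + vderiv I₂ (fun z => f (p.1, z)) p.2 v.2 :=
  mfderiv_prod_eq_add_apply hf

variable {f : N₁ × N₂ × N₃ → G} {p : N₁ × N₂ × N₃}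
  (hf : MDifferentiableAt (I₁.prod (I₂.prod I₃)) 𝓘(ℝ, G) f p)
  (v₁ : TangentSpace I₁ p.1) (v₂ : TangentSpace I₂ p.2.1) (v₃ : TangentSpace I₃ p.2.2)
include hf

lemma vderiv_triple₁ : vderiv (I₁.prod (I₂.prod I₃)) f p (v₁, v₂, v₃) =
    vderiv I₁ (fun z => f (z, p.2.1, p.2.2)) p.1 v₁ +
      vderiv (I₂.prod I₃) (fun z => f (p.1, z.1, z.2)) (p.2.1, p.2.2) (v₂, v₃) :=
  vderiv_prod hf (v₁, v₂, v₃)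

lemma vderiv_triple : vderiv (I₁.prod (I₂.prod I₃)) f p (v₁, v₂, v₃) =
    vderiv I₁ (fun z => f (z, p.2.1, p.2.2)) p.1 v₁ +
      (vderiv I₂ (fun z => f (p.1, z, p.2.2)) p.2.1 v₂ +
        vderiv I₃ (fun z => f (p.1, p.2.1, z)) p.2.2 v₃) := by
  have h : vderiv (I₂.prod I₃) (fun z => f (p.1, z.1, z.2)) (p.2.1, p.2.2) (v₂, v₃) =
      vderiv I₂ (fun z => f (p.1, z, p.2.2)) p.2.1 v₂ +
        vderiv I₃ (fun z => f (p.1, p.2.1, z)) p.2.2 v₃ :=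
    vderiv_prod (f := fun z : N₂ × N₃ => f (p.1, z.1, z.2)) (p := (p.2.1, p.2.2))
      (MDifferentiableAt.comp (I' := I₁.prod (I₂.prod I₃)) (p.2.1, p.2.2) hf
        (mdifferentiableAt_const.prodMk (mdifferentiableAt_fst.prodMk mdifferentiableAt_snd)))
      (v₂, v₃)
  rw [vderiv_triple₁ hf, h]

lemma vderiv_triple₂ : vderiv (I₁.prod (I₂.prod I₃)) f p (v₁, v₂, v₃) =
    vderiv I₂ (fun z => f (p.1, z, p.2.2)) p.2.1 v₂ +
      vderiv (I₁.prod I₃) (fun z => f (z.1, p.2.1, z.2)) (p.1, p.2.2) (v₁, v₃) := by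
  have h : vderiv (I₁.prod I₃) (fun z => f (z.1, p.2.1, z.2)) (p.1, p.2.2) (v₁, v₃) =
      vderiv I₁ (fun z => f (z, p.2.1, p.2.2)) p.1 v₁ +
        vderiv I₃ (fun z => f (p.1, p.2.1, z)) p.2.2 v₃ :=
    vderiv_prod (f := fun z : N₁ × N₃ => f (z.1, p.2.1, z.2)) (p := (p.1, p.2.2))
      (MDifferentiableAt.comp (I' := I₁.prod (I₂.prod I₃)) (p.1, p.2.2) hf
        (mdifferentiableAt_fst.prodMk (mdifferentiableAt_const.prodMk mdifferentiableAt_snd)))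
      (v₁, v₃)
  rw [vderiv_triple hf, h]
  abel

lemma vderiv_triple₃ : vderiv (I₁.prod (I₂.prod I₃)) f p (v₁, v₂, v₃) =
    vderiv I₃ (fun z => f (p.1, p.2.1, z)) p.2.2 v₃ +
      vderiv (I₁.prod I₂) (fun z => f (z.1, z.2, p.2.2)) (p.1, p.2.1) (v₁, v₂) := by
  have h : vderiv (I₁.prod I₂) (fun z => f (z.1, z.2, p.2.2)) (p.1, p.2.1) (v₁, v₂) =
      vderiv I₁ (fun z => f (z, p.2.1, p.2.2)) p.1 v₁ +
        vderiv I₂ (fun z => f (p.1, z, p.2.2)) p.2.1 v₂ :=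
    vderiv_prod (f := fun z : N₁ × N₂ => f (z.1, z.2, p.2.2)) (p := (p.1, p.2.1))
      (MDifferentiableAt.comp (I' := I₁.prod (I₂.prod I₃)) (p.1, p.2.1) hf
        (mdifferentiableAt_fst.prodMk (mdifferentiableAt_snd.prodMk mdifferentiableAt_const)))
      (v₁, v₂)
  rw [vderiv_triple hf, h]
  abel

end PartialDerivatives

/-! ### Derivatives of functions with values in a subspace of a fibre. -/

section FibreDerivatives

variable {V : Type*} [NormedAddCommGroup V] [NormedSpace ℝ V] {H : Type*} [TopologicalSpace H]
  {N : Type*} [TopologicalSpace N] [ChartedSpace H N]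
  {F : Type*} [NormedAddCommGroup F] [NormedSpace ℝ F] [FiniteDimensional ℝ F] {E : N → Type*}
  [∀ x, AddCommGroup (E x)] [∀ x, Module ℝ (E x)] [∀ x, TopologicalSpace (E x)]
  [TopologicalSpace (TotalSpace F E)] [FiberBundle F E] [VectorBundle ℝ F E]
  {V' : Type*} [NormedAddCommGroup V'] [NormedSpace ℝ V'] {H' : Type*}
  [TopologicalSpace H'] {J : ModelWithCorners ℝ V' H'} [J.Boundaryless] {P : Type*}
  [TopologicalSpace P] [ChartedSpace H' P]

/-- An instance of `vderiv_mem` in which the submanifold is the whole parameter space. -/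
lemma fibreDeriv_mem {n : N} {g : P → E n} {p : P} {A : Submodule ℝ (E n)} (hg : ∀ q, g q ∈ A)
    (hd : MDifferentiableAt J 𝓘(ℝ, F) (fun q => (trivializationAt F E n ⟨n, g q⟩).2) p)
    (v : TangentSpace J p) : fibreDeriv J F g p v ∈ A := by
  let e : E n ≃L[ℝ] F :=
    (trivializationAt F E n).continuousLinearEquivAt ℝ n (mem_baseSet_trivializationAt F E n)
  have h1 : IsLinearAt J (Set.univ : Set P) p ⊤ := fun q _ => by simp
  have h2 : vderiv J (fun q => (trivializationAt F E n ⟨n, g q⟩).2) p v ∈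
      A.map (e : E n →ₗ[ℝ] F) :=
    vderiv_mem h1 (Set.mem_univ p) hd
      (.of_forall fun q _ => Submodule.mem_map_of_mem (f := (e : E n →ₗ[ℝ] F)) (hg q)) trivial
  obtain ⟨a, ha, h3⟩ := h2
  have h4 : fibreDeriv J F g p v = a :=
    (congrArg ((trivializationAt F E n).symmL ℝ n) h3.symm).trans
      ((Trivialization.symmL_apply _ (mem_baseSet_trivializationAt F E n) _).trans
        ((trivializationAt F E n).symm_apply_apply_mk (mem_baseSet_trivializationAt F E n) a))
  rwa [h4]

end FibreDerivatives

/-! ### Compatibility of the prolongation with the addition of T𝔼 → 𝔼. -/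

section AddTriples

variable {V : Type*} [NormedAddCommGroup V] [NormedSpace ℝ V] {H : Type*} [TopologicalSpace H]
  {I : ModelWithCorners ℝ V H} {M : Type*} [TopologicalSpace M] [ChartedSpace H M]
  [IsManifold I ∞ M]
  {F : Type*} [NormedAddCommGroup F] [NormedSpace ℝ F] {E : M → Type*}
  [∀ x, AddCommGroup (E x)] [∀ x, Module ℝ (E x)] [∀ x, TopologicalSpace (E x)]
  [TopologicalSpace (TotalSpace F E)] [FiberBundle F E] [VectorBundle ℝ F E]
  [ContMDiffVectorBundle ∞ F E I]
  [FiniteDimensional ℝ V] [T2Space M] [FiniteDimensional ℝ F] [I.Boundaryless]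

/-- The tangent transition functions preserve the addition of `T𝔼 → 𝔼`. -/
lemma tangentTransition_mem_addBaseModel {y x : M} {v v₂ v₃ : V} (hv : v = v₂ + v₃)
    {z : (F × F) × (F × F) × (F × F)} (hz : z ∈ addBaseModel F) :
    (tangentTransition I F E y x ⟨y, v⟩ z.1, tangentTransition I F E y x ⟨y, v₂⟩ z.2.1,
      tangentTransition I F E y x ⟨y, v₃⟩ z.2.2) ∈ addBaseModel F := by
  obtain ⟨h2, h3, h1⟩ := hz
  have hd : dTransition I F E y x ⟨y, v⟩ = dTransition I F E y x ⟨y, v₂⟩ +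
      dTransition I F E y x ⟨y, v₃⟩ := by
    rw [hv]; exact map_add (mfderiv I 𝓘(ℝ, F →L[ℝ] F) (transition F E y x) y) v₂ v₃
  refine ⟨congrArg (transition F E y x y) h2, congrArg (transition F E y x y) h3, ?_⟩
  change dTransition I F E y x ⟨y, v⟩ z.1.1 + transition F E y x y z.1.2 =
    (dTransition I F E y x ⟨y, v₂⟩ z.2.1.1 + transition F E y x y z.2.1.2) +
    (dTransition I F E y x ⟨y, v₃⟩ z.2.2.1 + transition F E y x y z.2.2.2)
  rw [hd, h1, h2, h3, map_add, add_apply]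
  abel

variable (C : CourantAlgebroid I F E) {x : M} {v v₂ v₃ : V}
  {d : TangentProlongation I F E ⟨x, v⟩ × TangentProlongation I F E ⟨x, v₂⟩ ×
    TangentProlongation I F E ⟨x, v₃⟩}

/-- The base component of the anchor depends only on the base point. The vertical component is a
derivative along the tangent vector plus a term linear in the fibre velocity, hence additive. So
anchors of additive triples are tangent to the base of the graph. -/
lemma IsAddTriple.anchor_mem (hv : v = v₂ + v₃)
    (hd : IsAddTriple (p := (⟨x, v⟩, ⟨x, v₂⟩, ⟨x, v₃⟩)) d) :
    ((C.prolongAnchor ⟨x, v⟩ d.1 : V × V), (C.prolongAnchor ⟨x, v₂⟩ d.2.1 : V × V),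
      (C.prolongAnchor ⟨x, v₃⟩ d.2.2 : V × V)) ∈ addBaseModel V := by
  obtain ⟨h2, h3, h1⟩ := hd
  have e : ∀ (v : V) (d : TangentProlongation I F E ⟨x, v⟩), (C.prolongAnchor ⟨x, v⟩ d : V × V) =
      ((C.anchor x (constSection I E x (fibFst I E ⟨x, v⟩ d) x) : V) + 0,
        (flatDeriv I V x (fun y => C.anchor y (constSection I E x (fibFst I E ⟨x, v⟩ d) y)) v : V) +
        (C.anchor x (constSection I E x (fibSnd I E ⟨x, v⟩ d) x) : V)) := fun v d => rfl
  rw [e, e, e]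
  dsimp only at h1 h2 h3
  refine ⟨by simp only; rw [h2], by simp only; rw [h3], ?_⟩
  simp only
  rw [h1, h2, h3, constSection_add, Pi.add_apply, map_add, hv]
  have h4 := flatDeriv_add (I := I) (F := V) x
    (fun y => C.anchor y (constSection I E x (fibFst I E ⟨x, v⟩ d.1) y)) v₂ v₃
  refine (congrArg (· + _) h4).trans ?_
  exact add_add_add_comm _ _ _ _

/-- The bracket of flat sections has a base point that depends only on base points. Its fibre
velocity is a derivative along the tangent vector plus terms linear in one of the two fibre
velocities. -/
lemma IsAddTriple.prolongTensor (hv : v = v₂ + v₃)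
    {e : TangentProlongation I F E ⟨x, v⟩ × TangentProlongation I F E ⟨x, v₂⟩ ×
      TangentProlongation I F E ⟨x, v₃⟩}
    (hd : IsAddTriple (p := (⟨x, v⟩, ⟨x, v₂⟩, ⟨x, v₃⟩)) d)
    (he : IsAddTriple (p := (⟨x, v⟩, ⟨x, v₂⟩, ⟨x, v₃⟩)) e) :
    IsAddTriple (p := (⟨x, v⟩, ⟨x, v₂⟩, ⟨x, v₃⟩))
      (C.prolongTensor ⟨x, v⟩ d.1 e.1, C.prolongTensor ⟨x, v₂⟩ d.2.1 e.2.1,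
        C.prolongTensor ⟨x, v₃⟩ d.2.2 e.2.2) := by
  obtain ⟨h2, h3, h1⟩ := hd
  obtain ⟨k2, k3, k1⟩ := he
  dsimp only at h1 h2 h3 k1 k2 k3
  have hc : ∀ u : F, constSection I E x u ∈ smoothSections I F E := constSection_mem x
  refine ⟨?_, ?_, ?_⟩
  · simp only [CourantAlgebroid.prolongTensor, map_add, fibFst_tangentLift, fibFst_coreLift, h2, k2]
  · simp only [CourantAlgebroid.prolongTensor, map_add, fibFst_tangentLift, fibFst_coreLift, h3, k3]
  · simp only [CourantAlgebroid.prolongTensor, map_add, fibSnd_coreLift, h1, h2, h3, k1, k2, k3]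
    subst hv
    rw [tangentLift_isAdditiveLift, constSection_add, constSection_add,
      C.bracket_add_right _ (hc _) _ (hc _) _ (hc _), C.bracket_add_left _ (hc _) _ (hc _) _ (hc _)]
    simp only [coordRep_add _ _ _ (mem_baseSet_trivializationAt F E x)]
    abel

/-- The graph of the addition is isotropic. -/
lemma IsAddTriple.pairing_eq (hv : v = v₂ + v₃)
    {e : TangentProlongation I F E ⟨x, v⟩ × TangentProlongation I F E ⟨x, v₂⟩ ×
      TangentProlongation I F E ⟨x, v₃⟩}
    (hd : IsAddTriple (p := (⟨x, v⟩, ⟨x, v₂⟩, ⟨x, v₃⟩)) d)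
    (he : IsAddTriple (p := (⟨x, v⟩, ⟨x, v₂⟩, ⟨x, v₃⟩)) e) :
    C.prolongPairing ⟨x, v⟩ d.1 e.1 =
      C.prolongPairing ⟨x, v₂⟩ d.2.1 e.2.1 + C.prolongPairing ⟨x, v₃⟩ d.2.2 e.2.2 := by
  obtain ⟨⟨a, b⟩, ⟨a₂, b₂⟩, ⟨a₃, b₃⟩⟩ := d
  obtain ⟨⟨c, f⟩, ⟨c₂, f₂⟩, ⟨c₃, f₃⟩⟩ := e
  obtain ⟨h2, h3, h1⟩ : a₂ = a ∧ a₃ = a ∧ b = b₂ + b₃ := hd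
  obtain ⟨k2, k3, k1⟩ : c₂ = c ∧ c₃ = c ∧ f = f₂ + f₃ := he
  subst h2 h3 k2 k3 h1 k1 hv
  exact C.prolongPairing_fibMk_add x v₂ v₃ _ b₂ b₃ _ f₂ f₃

/-- The graph of the addition is maximal isotropic. -/
lemma isAddTriple_of_pairing (hv : v = v₂ + v₃)
    (h : ∀ e : TangentProlongation I F E ⟨x, v⟩ × TangentProlongation I F E ⟨x, v₂⟩ ×
      TangentProlongation I F E ⟨x, v₃⟩, IsAddTriple (p := (⟨x, v⟩, ⟨x, v₂⟩, ⟨x, v₃⟩)) e →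
      C.prolongPairing ⟨x, v⟩ d.1 e.1 =
        C.prolongPairing ⟨x, v₂⟩ d.2.1 e.2.1 + C.prolongPairing ⟨x, v₃⟩ d.2.2 e.2.2) :
    IsAddTriple (p := (⟨x, v⟩, ⟨x, v₂⟩, ⟨x, v₃⟩)) d := by
  have h2 : basePt I E ⟨x, v₂⟩ d.2.1 = basePt I E ⟨x, v⟩ d.1 := by
    refine eq_of_pairing (C.pairing_nondegenerate x) fun k => ?_
    -- The triple (k, k, 0) of vertical vectors is additive and its pairings see only base points;
    -- varying `k` equates the first two.
    have h1 := h (vert I F ⟨x, v⟩ k, vert I F ⟨x, v₂⟩ k, 0)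
      ⟨rfl, map_zero _, by
        dsimp only
        rw [map_zero, add_zero]; rfl⟩
    dsimp only at h1
    rw [map_zero, add_zero, C.prolongPairing_vert_right, C.prolongPairing_vert_right] at h1
    rw [C.pairing_symm x _ k, C.pairing_symm x _ k]
    exact h1.symm
  have h3 : basePt I E ⟨x, v₃⟩ d.2.2 = basePt I E ⟨x, v⟩ d.1 := by
    refine eq_of_pairing (C.pairing_nondegenerate x) fun k => ?_
    have h1 := h (vert I F ⟨x, v⟩ k, 0, vert I F ⟨x, v₃⟩ k)
      ⟨map_zero _, rfl, by
        dsimp only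
        rw [map_zero, zero_add]; rfl⟩
    dsimp only at h1
    rw [map_zero, zero_add, C.prolongPairing_vert_right, C.prolongPairing_vert_right] at h1
    rw [C.pairing_symm x _ k, C.pairing_symm x _ k]
    exact h1.symm
  have h2' : fibFst I E ⟨x, v₂⟩ d.2.1 = fibFst I E ⟨x, v⟩ d.1 := by
    rw [← fibCoord_basePt, ← fibCoord_basePt]; exact congrArg _ h2
  have h3' : fibFst I E ⟨x, v₃⟩ d.2.2 = fibFst I E ⟨x, v⟩ d.1 := by
    rw [← fibCoord_basePt, ← fibCoord_basePt]; exact congrArg _ h3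
  refine ⟨h2', h3', ?_⟩
  -- The sum prescribed by the last two entries. Any `w` is the first entry of an additive triple,
  -- so by isotropy `d'` and `d.1` have the same pairings.
  let d' : TangentProlongation I F E ⟨x, v⟩ := fibMk I F E ⟨x, v⟩ (fibFst I E ⟨x, v⟩ d.1)
    (fibSnd I E ⟨x, v₂⟩ d.2.1 + fibSnd I E ⟨x, v₃⟩ d.2.2)
  have hd' : IsAddTriple (p := (⟨x, v⟩, ⟨x, v₂⟩, ⟨x, v₃⟩)) (d', d.2.1, d.2.2) := ⟨h2', h3', rfl⟩
  suffices hs : d.1 = d' from congrArg (fibSnd I E ⟨x, v⟩) hs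
  refine C.prolong_ext fun w => ?_
  let e : TangentProlongation I F E ⟨x, v⟩ × TangentProlongation I F E ⟨x, v₂⟩ ×
      TangentProlongation I F E ⟨x, v₃⟩ := (w, fibMk I F E ⟨x, v₂⟩ (fibFst I E ⟨x, v⟩ w)
    (fibSnd I E ⟨x, v⟩ w), fibMk I F E ⟨x, v₃⟩ (fibFst I E ⟨x, v⟩ w) 0)
  have he : IsAddTriple (p := (⟨x, v⟩, ⟨x, v₂⟩, ⟨x, v₃⟩)) e := ⟨rfl, rfl, (add_zero _).symm⟩
  exact (h e he).trans (hd'.pairing_eq C hv he).symm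

end AddTriples

/-! ### The graph of the addition is closed under the bracket. -/

section GraphAddBracket

variable {V : Type*} [NormedAddCommGroup V] [NormedSpace ℝ V] {H : Type*} [TopologicalSpace H]
  {I : ModelWithCorners ℝ V H} {M : Type*} [TopologicalSpace M] [ChartedSpace H M]
  [IsManifold I ∞ M]
  {F : Type*} [NormedAddCommGroup F] [NormedSpace ℝ F] {E : M → Type*}
  [∀ x, AddCommGroup (E x)] [∀ x, Module ℝ (E x)] [∀ x, TopologicalSpace (E x)]
  [TopologicalSpace (TotalSpace F E)] [FiberBundle F E] [VectorBundle ℝ F E]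
  [ContMDiffVectorBundle ∞ F E I]
  {W : ∀ x, Submodule ℝ (E x)} {L : ∀ X, Submodule ℝ (TangentProlongation I F E X)}
  [FiniteDimensional ℝ V] [T2Space M] [FiniteDimensional ℝ F] [I.Boundaryless]
  {C : CourantAlgebroid I F E}

lemma flatDeriv_prolongation (X : TangentBundle I M) (s : ∀ X, TangentProlongation I F E X)
    (ξ : TangentSpace I.tangent X) : flatDeriv I.tangent (F × F) X s ξ =
      vderiv I.tangent (coordRep (F × F) X s) X ξ :=
  symmL_prolongation_self X _

lemma vderiv_prodMk {N : Type*} [TopologicalSpace N] [ChartedSpace H N] {G G' : Type*}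
    [NormedAddCommGroup G] [NormedSpace ℝ G] [NormedAddCommGroup G'] [NormedSpace ℝ G']
    {f : N → G} {g : N → G'} {x : N} (hf : MDifferentiableAt I 𝓘(ℝ, G) f x)
    (hg : MDifferentiableAt I 𝓘(ℝ, G') g x) (v : TangentSpace I x) :
    vderiv I (fun y => (f y, g y)) x v = (vderiv I f x v, vderiv I g x v) :=
  vderiv_eq ⟨hf.hasMFDerivAt.1.prodMk hg.hasMFDerivAt.1,
    hf.hasMFDerivAt.2.prodMk hg.hasMFDerivAt.2⟩ v

section ParamBracket

variable {V' : Type*} [NormedAddCommGroup V'] [NormedSpace ℝ V'] {H' : Type*}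
  [TopologicalSpace H'] {J : ModelWithCorners ℝ V' H'} {P : Type*}
  [TopologicalSpace P] [ChartedSpace H' P]

lemma fibreDeriv_prolongation {X : TangentBundle I M} (g : P → TangentProlongation I F E X) (p : P)
    (ξ : TangentSpace J p) : fibreDeriv J (F × F) g p ξ = vderiv J
      (fun q => (trivializationAt (F × F) (TangentProlongation I F E) X ⟨X, g q⟩).2) p ξ :=
  symmL_prolongation_self X _

namespace IsVBDirac

variable (hL : IsVBDirac C.prolong W L)
  {σ τ : ∀ X : TangentBundle I M, P → TangentProlongation I F E X} {X : TangentBundle I M} {p : P}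
  {v w : TangentSpace J p}

/-- The bracket of sections depending on parameters, in terms of the total derivatives `A`, `B`
and `K`. -/
lemma pairing_paramBracket {A B K Q e : TangentProlongation I F E X}
    (hA : A = flatDeriv I.tangent (F × F) X (fun Z => τ Z p) (C.prolongAnchor X (σ X p)) +
      fibreDeriv J (F × F) (τ X) p v)
    (hB : B = flatDeriv I.tangent (F × F) X (fun Z => σ Z p) (C.prolongAnchor X (τ X p)) +
      fibreDeriv J (F × F) (σ X) p w)
    (hK : K = flatDeriv I.tangent (F × F) X (fun Z => σ Z p) (C.prolongAnchor X e) + Q)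
    (hQ : Q ∈ L X) (hτ : τ X p ∈ L X) :
    C.prolongPairing X (hL.dirac.lieAlgebroid.paramBracket J σ τ X p v w) e =
      C.prolongPairing X A e - C.prolongPairing X B e +
        C.prolongPairing X (C.prolongTensor X (σ X p) (τ X p)) e +
        C.prolongPairing X K (τ X p) := by
  have h1 : hL.dirac.lieAlgebroid.paramBracket J σ τ X p v w =
      C.prolongBracket (fun Z => σ Z p) (fun Z => τ Z p) X + fibreDeriv J (F × F) (τ X) p v -
        fibreDeriv J (F × F) (σ X) p w := rfl
  -- The product bracket contains no parameter derivative of this kind. It may nevertheless be added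
  -- to `K`, since elements of `L` pair to zero; this completes `K` to a total derivative.
  have h2 := hL.pairing_eq_zero hQ hτ
  rw [h1, hA, hB, hK]
  simp only [map_add, map_sub, LinearMap.add_apply, LinearMap.sub_apply, h2,
    C.pairing_prolongBracket]
  ring

end IsVBDirac

end ParamBracket

lemma pairing_eq_of_mem_addBaseModel (C : CourantAlgebroid I F E) {x : M} {v v₂ v₃ : V}
    (hv : v = v₂ + v₃) {a : TangentProlongation I F E ⟨x, v⟩}
    {a₂ : TangentProlongation I F E ⟨x, v₂⟩} {a₃ : TangentProlongation I F E ⟨x, v₃⟩}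
    (ha : ((a : F × F), (a₂ : F × F), (a₃ : F × F)) ∈ addBaseModel F)
    {e : TangentProlongation I F E ⟨x, v⟩ × TangentProlongation I F E ⟨x, v₂⟩ ×
      TangentProlongation I F E ⟨x, v₃⟩}
    (he : IsAddTriple (p := (⟨x, v⟩, ⟨x, v₂⟩, ⟨x, v₃⟩)) e) :
    C.prolongPairing ⟨x, v⟩ a e.1 =
      C.prolongPairing ⟨x, v₂⟩ a₂ e.2.1 + C.prolongPairing ⟨x, v₃⟩ a₃ e.2.2 :=
  IsAddTriple.pairing_eq C hv (d := (a, a₂, a₃)) ha he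

section Components

variable (X₁ X₂ X₃ : TangentBundle I M)
  (σ : ∀ p : TangentBundle I M × TangentBundle I M × TangentBundle I M,
    TangentProlongation I F E p.1 × TangentProlongation I F E p.2.1 ×
      TangentProlongation I F E p.2.2)

/-- The components of a section of `(T𝔼)³` in the preferred trivializations. -/
noncomputable def cubeRep (q : TangentBundle I M × TangentBundle I M × TangentBundle I M) :
    (F × F) × (F × F) × (F × F) :=
  ((trivializationAt (F × F) (TangentProlongation I F E) X₁ ⟨q.1, (σ q).1⟩).2,
    (trivializationAt (F × F) (TangentProlongation I F E) X₂ ⟨q.2.1, (σ q).2.1⟩).2,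
    (trivializationAt (F × F) (TangentProlongation I F E) X₃ ⟨q.2.2, (σ q).2.2⟩).2)

/-- The first component of a section of `(T𝔼)³`. -/
def cubeSlice₁ (X : TangentBundle I M) (q : TangentBundle I M × TangentBundle I M) :
    TangentProlongation I F E X := (σ (X, q.1, q.2)).1

/-- The second component of a section of `(T𝔼)³`. -/
def cubeSlice₂ (X : TangentBundle I M) (q : TangentBundle I M × TangentBundle I M) :
    TangentProlongation I F E X := (σ (q.1, X, q.2)).2.1

/-- The third component of a section of `(T𝔼)³`. -/
def cubeSlice₃ (X : TangentBundle I M) (q : TangentBundle I M × TangentBundle I M) :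
    TangentProlongation I F E X := (σ (q.1, q.2, X)).2.2

variable {σ}

lemma cubeRep_mem_addBaseModel {x : M} {v v₂ v₃ : V}
    (h : ∀ q ∈ addBase I M, IsAddTriple (σ q))
    {q : TangentBundle I M × TangentBundle I M × TangentBundle I M} (hq : q ∈ addBase I M) :
    cubeRep (⟨x, v⟩ : TangentBundle I M) ⟨x, v₂⟩ ⟨x, v₃⟩ σ q ∈ addBaseModel F := by
  have hs := h q hq
  obtain ⟨⟨y, u⟩, ⟨y₂, u₂⟩, ⟨y₃, u₃⟩⟩ := q
  obtain ⟨e2, e3, e1⟩ := hq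
  dsimp only at e2 e3
  subst e2 e3
  exact tangentTransition_mem_addBaseModel (I := I) (E := E) (y := y₃) (x := x) e1
    (z := σ (⟨y₃, u⟩, ⟨y₃, u₂⟩, ⟨y₃, u₃⟩)) hs

variable (hσ : σ ∈ cubeSections I.tangent (F × F) L)
include hσ

lemma mdifferentiableAt_cubeRep :
    MDifferentiableAt (I.tangent.prod (I.tangent.prod I.tangent)) 𝓘(ℝ, F × F)
        (fun q => (cubeRep X₁ X₂ X₃ σ q).1) (X₁, X₂, X₃) ∧
      MDifferentiableAt (I.tangent.prod (I.tangent.prod I.tangent)) 𝓘(ℝ, F × F)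
        (fun q => (cubeRep X₁ X₂ X₃ σ q).2.1) (X₁, X₂, X₃) ∧
      MDifferentiableAt (I.tangent.prod (I.tangent.prod I.tangent)) 𝓘(ℝ, F × F)
        (fun q => (cubeRep X₁ X₂ X₃ σ q).2.2) (X₁, X₂, X₃) :=
  ⟨((contMDiffAt_totalSpace.1 (hσ.1 (X₁, X₂, X₃))).2).mdifferentiableAt (by simp),
    ((contMDiffAt_totalSpace.1 (hσ.2.1 (X₁, X₂, X₃))).2).mdifferentiableAt (by simp),
    ((contMDiffAt_totalSpace.1 (hσ.2.2.1 (X₁, X₂, X₃))).2).mdifferentiableAt (by simp)⟩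

lemma vderiv_cubeRep (ξ₁ : TangentSpace I.tangent X₁) (ξ₂ : TangentSpace I.tangent X₂)
    (ξ₃ : TangentSpace I.tangent X₃) :
    vderiv (I.tangent.prod (I.tangent.prod I.tangent)) (cubeRep X₁ X₂ X₃ σ) (X₁, X₂, X₃)
        (ξ₁, ξ₂, ξ₃) =
      (flatDeriv I.tangent (F × F) X₁ (fun Z => cubeSlice₁ σ Z (X₂, X₃)) ξ₁ +
          fibreDeriv (I.tangent.prod I.tangent) (F × F) (cubeSlice₁ σ X₁) (X₂, X₃) (ξ₂, ξ₃),
        flatDeriv I.tangent (F × F) X₂ (fun Z => cubeSlice₂ σ Z (X₁, X₃)) ξ₂ +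
          fibreDeriv (I.tangent.prod I.tangent) (F × F) (cubeSlice₂ σ X₂) (X₁, X₃) (ξ₁, ξ₃),
        flatDeriv I.tangent (F × F) X₃ (fun Z => cubeSlice₃ σ Z (X₁, X₂)) ξ₃ +
          fibreDeriv (I.tangent.prod I.tangent) (F × F) (cubeSlice₃ σ X₃) (X₁, X₂) (ξ₁, ξ₂)) := by
  obtain ⟨h1, h2, h3⟩ := mdifferentiableAt_cubeRep X₁ X₂ X₃ hσ
  refine (vderiv_prodMk h1 (h2.prodMk_space h3) _).trans (Prod.ext ?_
    ((vderiv_prodMk h2 h3 _).trans (Prod.ext ?_ ?_)))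
  · exact (vderiv_triple₁ h1 ξ₁ ξ₂ ξ₃).trans (congrArg₂ (· + ·)
      (flatDeriv_prolongation X₁ _ ξ₁).symm (fibreDeriv_prolongation _ _ _).symm)
  · exact (vderiv_triple₂ h2 ξ₁ ξ₂ ξ₃).trans (congrArg₂ (· + ·)
      (flatDeriv_prolongation X₂ _ ξ₂).symm (fibreDeriv_prolongation _ _ _).symm)
  · exact (vderiv_triple₃ h3 ξ₁ ξ₂ ξ₃).trans (congrArg₂ (· + ·)
      (flatDeriv_prolongation X₃ _ ξ₃).symm (fibreDeriv_prolongation _ _ _).symm)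

lemma fibreDeriv_cubeSlice_mem (ξ₁ : TangentSpace I.tangent X₁) (ξ₂ : TangentSpace I.tangent X₂)
    (ξ₃ : TangentSpace I.tangent X₃) :
    fibreDeriv (I.tangent.prod I.tangent) (F × F) (cubeSlice₁ σ X₁) (X₂, X₃) (ξ₂, ξ₃) ∈ L X₁ ∧
    fibreDeriv (I.tangent.prod I.tangent) (F × F) (cubeSlice₂ σ X₂) (X₁, X₃) (ξ₁, ξ₃) ∈ L X₂ ∧
    fibreDeriv (I.tangent.prod I.tangent) (F × F) (cubeSlice₃ σ X₃) (X₁, X₂) (ξ₁, ξ₂) ∈ L X₃ := by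
  obtain ⟨h1, h2, h3⟩ := mdifferentiableAt_cubeRep X₁ X₂ X₃ hσ
  refine ⟨fibreDeriv_mem (fun q => (hσ.2.2.2 (X₁, q.1, q.2)).1) ?_ _,
    fibreDeriv_mem (fun q => (hσ.2.2.2 (q.1, X₂, q.2)).2.1) ?_ _,
    fibreDeriv_mem (fun q => (hσ.2.2.2 (q.1, q.2, X₃)).2.2) ?_ _⟩
  · have := MDifferentiableAt.comp (I' := I.tangent.prod (I.tangent.prod I.tangent))
      (f := fun q : TangentBundle I M × TangentBundle I M => (X₁, q.1, q.2)) (X₂, X₃) h1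
      (mdifferentiableAt_const.prodMk (mdifferentiableAt_fst.prodMk mdifferentiableAt_snd))
    exact this
  · have := MDifferentiableAt.comp (I' := I.tangent.prod (I.tangent.prod I.tangent))
      (f := fun q : TangentBundle I M × TangentBundle I M => (q.1, X₂, q.2)) (X₁, X₃) h2
      (mdifferentiableAt_fst.prodMk (mdifferentiableAt_const.prodMk mdifferentiableAt_snd))
    exact this
  · have := MDifferentiableAt.comp (I' := I.tangent.prod (I.tangent.prod I.tangent))
      (f := fun q : TangentBundle I M × TangentBundle I M => (q.1, q.2, X₃)) (X₁, X₂) h3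
      (mdifferentiableAt_fst.prodMk (mdifferentiableAt_snd.prodMk mdifferentiableAt_const))
    exact this

lemma cubeSlice_mem :
    (fun Z => cubeSlice₁ σ Z (X₂, X₃)) ∈ sectionsOf I.tangent (F × F) L ∧
    (fun Z => cubeSlice₂ σ Z (X₁, X₃)) ∈ sectionsOf I.tangent (F × F) L ∧
    (fun Z => cubeSlice₃ σ Z (X₁, X₂)) ∈ sectionsOf I.tangent (F × F) L :=
  ⟨⟨hσ.1.comp (contMDiff_id.prodMk contMDiff_const), fun Z => (hσ.2.2.2 (Z, X₂, X₃)).1⟩,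
    ⟨hσ.2.1.comp (contMDiff_const.prodMk (contMDiff_id.prodMk contMDiff_const)),
      fun Z => (hσ.2.2.2 (X₁, Z, X₃)).2.1⟩,
    ⟨hσ.2.2.1.comp (contMDiff_const.prodMk (contMDiff_const.prodMk contMDiff_id)),
      fun Z => (hσ.2.2.2 (X₁, X₂, Z)).2.2⟩⟩

end Components

namespace IsVBDirac

variable (hL : IsVBDirac C.prolong W L)

/-- The graph of the addition of `L → W` is a Lie subalgebroid. -/
theorem isLieSubalgebroid_graphAdd : IsLieSubalgebroid
    (I.tangent.prod (I.tangent.prod I.tangent)) (cubeSections I.tangent (F × F) L)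
    (cubeBracket hL.dirac.lieAlgebroid) (graphAdd L) := by
  refine ⟨hL.isVectorSubbundle_graphAdd, fun σ hσ τ hτ hσK hτK p hp => ?_⟩
  rw [baseOf_graphAdd] at hσK hτK hp
  have hσA : ∀ q ∈ addBase I M, IsAddTriple (σ q) := fun q hq => (mem_graphAdd.1 (hσK q hq)).2.2
  have hτA : ∀ q ∈ addBase I M, IsAddTriple (τ q) := fun q hq => (mem_graphAdd.1 (hτK q hq)).2.2
  have hp0 := hp
  obtain ⟨⟨x, v⟩, ⟨x₂, v₂⟩, ⟨x₃, v₃⟩⟩ := p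
  obtain ⟨e2, e3, e1⟩ := hp
  dsimp only at e2 e3
  subst e2 e3
  have hv : v = v₂ + v₃ := e1
  clear e1
  have hσp := hσA _ hp0
  have hτp := hτA _ hp0
  have hfσ := fibreDeriv_cubeSlice_mem (I := I) ⟨x₃, v⟩ ⟨x₃, v₂⟩ ⟨x₃, v₃⟩ hσ
  have hfτ := fibreDeriv_cubeSlice_mem (I := I) ⟨x₃, v⟩ ⟨x₃, v₂⟩ ⟨x₃, v₃⟩ hτ
  have hsσ := cubeSlice_mem (I := I) ⟨x₃, v⟩ ⟨x₃, v₂⟩ ⟨x₃, v₃⟩ hσ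
  have hsτ := cubeSlice_mem (I := I) ⟨x₃, v⟩ ⟨x₃, v₂⟩ ⟨x₃, v₃⟩ hτ
  refine mem_graphAdd.2 ⟨hp0, ⟨?_, ?_, ?_⟩, ?_⟩
  · exact (L _).sub_mem ((L _).add_mem (hL.dirac.involutive _ hsσ.1 _ hsτ.1 _) (hfτ 0 _ _).1)
      (hfσ 0 _ _).1
  · exact (L _).sub_mem ((L _).add_mem (hL.dirac.involutive _ hsσ.2.1 _ hsτ.2.1 _) (hfτ _ 0 _).2.1)
      (hfσ _ 0 _).2.1
  · exact (L _).sub_mem ((L _).add_mem (hL.dirac.involutive _ hsσ.2.2 _ hsτ.2.2 _) (hfτ _ _ 0).2.2)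
      (hfσ _ _ 0).2.2
  refine isAddTriple_of_pairing C hv fun e he => ?_
  have hlin := isLinearAt_addBase hp0
  -- Along the base of the graph, the components of the sections form additive triples, and anchors
  -- of additive triples are tangent to that base. So total derivatives along such anchors are again
  -- additive triples.
  have hD : ∀ (ρ : ∀ p : TangentBundle I M × TangentBundle I M × TangentBundle I M,
      TangentProlongation I F E p.1 × TangentProlongation I F E p.2.1 ×
        TangentProlongation I F E p.2.2), ρ ∈ cubeSections I.tangent (F × F) L →
      (∀ q ∈ addBase I M, IsAddTriple (ρ q)) → ∀ d : TangentProlongation I F E ⟨x₃, v⟩ ×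
        TangentProlongation I F E ⟨x₃, v₂⟩ × TangentProlongation I F E ⟨x₃, v₃⟩,
      IsAddTriple (p := (⟨x₃, v⟩, ⟨x₃, v₂⟩, ⟨x₃, v₃⟩)) d →
      vderiv (I.tangent.prod (I.tangent.prod I.tangent)) (cubeRep ⟨x₃, v⟩ ⟨x₃, v₂⟩ ⟨x₃, v₃⟩ ρ)
        (⟨x₃, v⟩, ⟨x₃, v₂⟩, ⟨x₃, v₃⟩) (C.prolongAnchor ⟨x₃, v⟩ d.1, C.prolongAnchor ⟨x₃, v₂⟩ d.2.1,
          C.prolongAnchor ⟨x₃, v₃⟩ d.2.2) ∈ addBaseModel F := fun ρ hρ hρA d hd => by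
    obtain ⟨h1, h2, h3⟩ := mdifferentiableAt_cubeRep (I := I) ⟨x₃, v⟩ ⟨x₃, v₂⟩ ⟨x₃, v₃⟩ hρ
    refine vderiv_mem hlin hp0 (h1.prodMk_space (h2.prodMk_space h3))
      (.of_forall fun q hq => cubeRep_mem_addBaseModel hρA hq) ?_
    exact hd.anchor_mem C hv
  have hA := hD τ hτ hτA _ hσp
  have hB := hD σ hσ hσA _ hτp
  have hK := hD σ hσ hσA _ he
  rw [vderiv_cubeRep _ _ _ hτ] at hA
  rw [vderiv_cubeRep _ _ _ hσ] at hB hK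
  have hA' := pairing_eq_of_mem_addBaseModel C hv hA he
  have hB' := pairing_eq_of_mem_addBaseModel C hv hB he
  have hK' := pairing_eq_of_mem_addBaseModel C hv hK hτp
  have hT' := IsAddTriple.pairing_eq C hv (hσp.prolongTensor C hv hτp) he
  -- The three components of the bracket are expanded into total derivatives and the bracket of flat
  -- sections. Each of the four terms is additive over the triple, by isotropy of the graph.
  have k1 := hL.pairing_paramBracket (J := I.tangent.prod I.tangent) (σ := cubeSlice₁ σ)
    (τ := cubeSlice₁ τ) (X := ⟨x₃, v⟩) (p := (⟨x₃, v₂⟩, ⟨x₃, v₃⟩)) (e := e.1)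
    (v := (C.prolongAnchor ⟨x₃, v₂⟩ (σ (⟨x₃, v⟩, ⟨x₃, v₂⟩, ⟨x₃, v₃⟩)).2.1,
      C.prolongAnchor ⟨x₃, v₃⟩ (σ (⟨x₃, v⟩, ⟨x₃, v₂⟩, ⟨x₃, v₃⟩)).2.2))
    (w := (C.prolongAnchor ⟨x₃, v₂⟩ (τ (⟨x₃, v⟩, ⟨x₃, v₂⟩, ⟨x₃, v₃⟩)).2.1,
      C.prolongAnchor ⟨x₃, v₃⟩ (τ (⟨x₃, v⟩, ⟨x₃, v₂⟩, ⟨x₃, v₃⟩)).2.2)) rfl rfl rfl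
    (hfσ 0 (C.prolongAnchor _ e.2.1) (C.prolongAnchor _ e.2.2)).1 (hsτ.1.2 _)
  have k2 := hL.pairing_paramBracket (J := I.tangent.prod I.tangent) (σ := cubeSlice₂ σ)
    (τ := cubeSlice₂ τ) (X := ⟨x₃, v₂⟩) (p := (⟨x₃, v⟩, ⟨x₃, v₃⟩)) (e := e.2.1)
    (v := (C.prolongAnchor ⟨x₃, v⟩ (σ (⟨x₃, v⟩, ⟨x₃, v₂⟩, ⟨x₃, v₃⟩)).1,
      C.prolongAnchor ⟨x₃, v₃⟩ (σ (⟨x₃, v⟩, ⟨x₃, v₂⟩, ⟨x₃, v₃⟩)).2.2))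
    (w := (C.prolongAnchor ⟨x₃, v⟩ (τ (⟨x₃, v⟩, ⟨x₃, v₂⟩, ⟨x₃, v₃⟩)).1,
      C.prolongAnchor ⟨x₃, v₃⟩ (τ (⟨x₃, v⟩, ⟨x₃, v₂⟩, ⟨x₃, v₃⟩)).2.2)) rfl rfl rfl
    (hfσ (C.prolongAnchor _ e.1) 0 (C.prolongAnchor _ e.2.2)).2.1 (hsτ.2.1.2 _)
  have k3 := hL.pairing_paramBracket (J := I.tangent.prod I.tangent) (σ := cubeSlice₃ σ)
    (τ := cubeSlice₃ τ) (X := ⟨x₃, v₃⟩) (p := (⟨x₃, v⟩, ⟨x₃, v₂⟩)) (e := e.2.2)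
    (v := (C.prolongAnchor ⟨x₃, v⟩ (σ (⟨x₃, v⟩, ⟨x₃, v₂⟩, ⟨x₃, v₃⟩)).1,
      C.prolongAnchor ⟨x₃, v₂⟩ (σ (⟨x₃, v⟩, ⟨x₃, v₂⟩, ⟨x₃, v₃⟩)).2.1))
    (w := (C.prolongAnchor ⟨x₃, v⟩ (τ (⟨x₃, v⟩, ⟨x₃, v₂⟩, ⟨x₃, v₃⟩)).1,
      C.prolongAnchor ⟨x₃, v₂⟩ (τ (⟨x₃, v⟩, ⟨x₃, v₂⟩, ⟨x₃, v₃⟩)).2.1)) rfl rfl rfl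
    (hfσ (C.prolongAnchor _ e.1) (C.prolongAnchor _ e.2.1) 0).2.2 (hsτ.2.2.2 _)
  refine k1.trans (Eq.trans ?_ (congrArg₂ (· + ·) k2 k3).symm)
  have key : ∀ a a₂ a₃ b b₂ b₃ c c₂ c₃ d d₂ d₃ : ℝ, a = a₂ + a₃ → b = b₂ + b₃ → c = c₂ + c₃ →
      d = d₂ + d₃ → a - b + c + d = (a₂ - b₂ + c₂ + d₂) + (a₃ - b₃ + c₃ + d₃) := by
    intros; linarith
  exact key _ _ _ _ _ _ _ _ _ _ _ _ hA' hB' hT' hK'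

end IsVBDirac

end GraphAddBracket

/-! ### Derivatives of sections of `L` along the fibres of `TM`. -/

section VerticalDerivative

variable {V : Type*} [NormedAddCommGroup V] [NormedSpace ℝ V] {H : Type*} [TopologicalSpace H]
  {I : ModelWithCorners ℝ V H}

lemma hasDerivAt_chart_line [I.Boundaryless] {N : Type*} [TopologicalSpace N] [ChartedSpace H N]
    {G : Type*} [NormedAddCommGroup G] [NormedSpace ℝ G] {f : N → G} {p : N}
    (hf : MDifferentiableAt I 𝓘(ℝ, G) f p) (v : V) :
    HasDerivAt (fun t : ℝ => f ((extChartAt I p).symm (extChartAt I p p + t • v)))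
      (vderiv I f p v) 0 := by
  rw [show vderiv I f p v = _ from vderiv_eq_fderiv hf v]
  set g := f ∘ (extChartAt I p).symm with hg
  set z := extChartAt I p p with hz
  have hgd : DifferentiableAt ℝ g z := by
    have := hf.differentiableWithinAt_writtenInExtChartAt
    rw [I.range_eq_univ, differentiableWithinAt_univ] at this
    exact this
  have hline : HasDerivAt (fun t : ℝ => z + t • v) v 0 := by
    have := ((hasDerivAt_id (0 : ℝ)).smul_const v).const_add z
    simpa using this
  have h1 : HasFDerivAt g (fderiv ℝ g z) ((fun t : ℝ => z + t • v) 0) := by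
    rw [show (fun t : ℝ => z + t • v) 0 = z by simp]; exact hgd.hasFDerivAt
  exact h1.comp_hasDerivAt 0 hline

lemma hasDerivAt_linear {G : Type*} [NormedAddCommGroup G] [NormedSpace ℝ G]
    [FiniteDimensional ℝ G] (φ : G →ₗ[ℝ] ℝ) {f : ℝ → G} {f' : G} {t : ℝ} (hf : HasDerivAt f f' t) :
    HasDerivAt (fun t => φ (f t)) (φ f') t :=
  φ.toContinuousLinearMap.hasFDerivAt.comp_hasDerivAt t hf

variable {M : Type*} [TopologicalSpace M] [ChartedSpace H M]
  [IsManifold I ∞ M]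
  {F : Type*} [NormedAddCommGroup F] [NormedSpace ℝ F] {E : M → Type*}
  [∀ x, AddCommGroup (E x)] [∀ x, Module ℝ (E x)] [∀ x, TopologicalSpace (E x)]
  [TopologicalSpace (TotalSpace F E)] [FiberBundle F E] [VectorBundle ℝ F E]
  [ContMDiffVectorBundle ∞ F E I]
  {W : ∀ x, Submodule ℝ (E x)} {L : ∀ X, Submodule ℝ (TangentProlongation I F E X)}

lemma IsDoubleVectorSubbundle.smul_mem (hL : IsDoubleVectorSubbundle W L) {x : M} {v : V} {a b : F}
    (t : ℝ) (h : fibMk I F E ⟨x, v⟩ a b ∈ L ⟨x, v⟩) :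
    fibMk I F E ⟨x, t • v⟩ a (t • b) ∈ L ⟨x, t • v⟩ := by
  have hu := hL.basePt_mem h
  obtain ⟨u, rfl⟩ := (fibCoord F (E := E) x).surjective a
  rw [basePt_fibMk] at hu
  change (fibCoord F x).symm _ ∈ W x at hu
  rw [ContinuousLinearEquiv.symm_apply_apply] at hu
  obtain ⟨D, hD⟩ := hL.exists_fibreOver_eq hu
  obtain ⟨ξ, hξ⟩ := exists_tangentCoord_eq (I := I) (⟨x, u⟩ : TotalSpace F E) v b
  have h1 : ξ ∈ D := by
    rw [← SetLike.mem_coe, hD, mem_fibreOver, hξ]; exact h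
  have h3 := D.smul_mem t h1
  rw [← SetLike.mem_coe, hD, mem_fibreOver, map_smul, hξ] at h3
  exact h3

variable [FiniteDimensional ℝ V] [T2Space M] [FiniteDimensional ℝ F] [I.Boundaryless]
  {C : CourantAlgebroid I F E}

variable (C) in
lemma CourantAlgebroid.prolongPairing_fibMk_smul (x : M) (v : V) (t : ℝ) (a b c e : F) :
    C.prolongPairing ⟨x, t • v⟩ (fibMk I F E ⟨x, t • v⟩ a (t • b))
        (fibMk I F E ⟨x, t • v⟩ c (t • e)) =
      t * C.prolongPairing ⟨x, v⟩ (fibMk I F E ⟨x, v⟩ a b) (fibMk I F E ⟨x, v⟩ c e) := by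
  have h : ∀ f : M → ℝ, tangentLiftFun I f ⟨x, t • v⟩ = t * tangentLiftFun I f ⟨x, v⟩ := fun f =>
    map_smul (mfderiv I 𝓘(ℝ, ℝ) f x) t v
  simp only [C.prolongPairing_apply, fibFst_fibMk, fibSnd_fibMk, h, constSection_smul,
    Pi.smul_apply, map_smul, LinearMap.smul_apply, smul_eq_mul]
  ring

/-- The derivative of a section of `T𝔼 → TM` along a fibre of `TM`. -/
lemma hasDerivAt_vertical {s : ∀ X, TangentProlongation I F E X} (hs : s ∈ prolongSections I F E)
    (x : M) (u v : V) : HasDerivAt (fun t : ℝ => (s ⟨x, u + t • v⟩ : F × F))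
      (flatDeriv I.tangent (F × F) (⟨x, u⟩ : TangentBundle I M) s ((0 : V), v) : F × F) 0 := by
  have h1 := hasDerivAt_chart_line (I := I.tangent) (p := (⟨x, u⟩ : TangentBundle I M))
    (mdifferentiableAt_coordRep hs) ((0 : V), v)
  have h2 : ∀ w : V, extChartAt I.tangent (⟨x, u⟩ : TangentBundle I M) ⟨x, w⟩ =
      (extChartAt I x x, w) := fun w =>
    (extChartAt_tangent (X := (⟨x, u⟩ : TangentBundle I M)) (Z := ⟨x, w⟩)
      (mem_chart_source H x)).trans (Prod.ext rfl (vderiv_extChartAt_self x w))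
  have h3 : ∀ t : ℝ, (extChartAt I.tangent (⟨x, u⟩ : TangentBundle I M)).symm
      (extChartAt I.tangent (⟨x, u⟩ : TangentBundle I M) ⟨x, u⟩ + t • ((0 : V), v)) =
        ⟨x, u + t • v⟩ := fun t => by
    have h4 : extChartAt I.tangent (⟨x, u⟩ : TangentBundle I M) ⟨x, u⟩ + t • ((0 : V), v) =
        extChartAt I.tangent (⟨x, u⟩ : TangentBundle I M) ⟨x, u + t • v⟩ := by
      rw [h2 u, h2 (u + t • v)]; simp
    rw [h4]
    refine (extChartAt I.tangent (⟨x, u⟩ : TangentBundle I M)).left_inv ?_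
    rw [extChartAt_source]; exact mem_chartAt_tangent (mem_chart_source H x)
  refine (h1.congr_of_eventuallyEq (.of_forall fun t => ?_)).congr_deriv
    (flatDeriv_prolongation (⟨x, u⟩ : TangentBundle I M) s _).symm
  refine Eq.trans ?_ (congrArg (coordRep (F × F) (⟨x, u⟩ : TangentBundle I M) s) (h3 t)).symm
  exact (coordRep_prolongation_self (⟨x, u + t • v⟩ : TangentBundle I M) s).symm

namespace IsVBDirac

variable (hL : IsVBDirac C.prolong W L)
include hL

/-- The pairing of elements of `L` with the derivative, along a fibre of `TM`, of a section of `L`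
depends only on base points. -/
lemma pairing_flatDeriv_vertical {s : ∀ X, TangentProlongation I F E X}
    (hs : s ∈ sectionsOf I.tangent (F × F) L) {x : M} {u v : V} {c e r : F}
    (he : fibMk I F E ⟨x, u⟩ c e ∈ L ⟨x, u⟩) (hr : fibMk I F E ⟨x, v⟩ c r ∈ L ⟨x, v⟩) :
    C.prolongPairing ⟨x, u⟩ (flatDeriv I.tangent (F × F) (⟨x, u⟩ : TangentBundle I M) s ((0 : V), v))
        (fibMk I F E ⟨x, u⟩ c e) =
      -C.prolongPairing ⟨x, v⟩ (fibMk I F E ⟨x, v⟩ (fibFst I E ⟨x, u⟩ (s ⟨x, u⟩)) 0)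
        (fibMk I F E ⟨x, v⟩ c r) := by
  let φ : F × F →ₗ[ℝ] ℝ := (C.prolongPairing ⟨x, u⟩).flip (fibMk I F E ⟨x, u⟩ c e)
  let ψ : F × F →ₗ[ℝ] ℝ := (C.prolongPairing ⟨x, v⟩).flip (fibMk I F E ⟨x, v⟩ c r) ∘ₗ
    (LinearMap.inl ℝ F F ∘ₗ LinearMap.fst ℝ F F)
  have hd := hasDerivAt_vertical hs.1 x u v
  -- Over `u + t • v`, the sum in `L → W` of the first element and `t` times the second lies in `L`,
  -- hence is orthogonal to `s`. Expanding this sum gives the identity, whose derivative at `t = 0`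
  -- is the claim.
  have key : ∀ t : ℝ, φ (s ⟨x, u + t • v⟩) = -(t * ψ (s ⟨x, u + t • v⟩)) := fun t => by
    have h1 := hL.pairing_eq_zero (hs.2 ⟨x, u + t • v⟩) (hL.double.add_mem he (hL.double.smul_mem t hr))
    have h2 := C.prolongPairing_fibMk_add x u (t • v) (fibFst I E ⟨x, u + t • v⟩ (s ⟨x, u + t • v⟩))
      (fibSnd I E ⟨x, u + t • v⟩ (s ⟨x, u + t • v⟩)) (t • 0) c e (t • r)
    rw [C.prolongPairing_fibMk_smul, smul_zero, add_zero, fibMk_eta] at h2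
    have h3 : φ (s ⟨x, u + t • v⟩) + t * ψ (s ⟨x, u + t • v⟩) = 0 := h2.symm.trans h1
    linarith
  have h1 : HasDerivAt (fun t : ℝ => φ (s ⟨x, u + t • v⟩)) (φ (flatDeriv I.tangent (F × F)
      (⟨x, u⟩ : TangentBundle I M) s ((0 : V), v))) 0 :=
    hasDerivAt_linear φ hd
  have h2 : HasDerivAt (fun t : ℝ => ψ (s ⟨x, u + t • v⟩)) (ψ (flatDeriv I.tangent (F × F)
      (⟨x, u⟩ : TangentBundle I M) s ((0 : V), v))) 0 :=
    hasDerivAt_linear ψ hd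
  have h3 := ((hasDerivAt_id (0 : ℝ)).mul h2).neg
  have h4 : (fun t : ℝ => φ (s ⟨x, u + t • v⟩)) = fun t => -(t * ψ (s ⟨x, u + t • v⟩)) :=
    funext key
  rw [h4] at h1
  have h5 := h1.unique h3
  have h6 : (⟨x, u + (0 : ℝ) • v⟩ : TangentBundle I M) = ⟨x, u⟩ := by
    rw [zero_smul, add_zero]
  have h7 : ∀ Z : TangentBundle I M, Z = ⟨x, u⟩ → ψ (s Z) = ψ (s ⟨x, u⟩) := by
    rintro _ rfl; rfl
  refine h5.trans ?_
  simp only [id, zero_mul, add_zero, one_mul]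
  exact congrArg (-·) (h7 _ h6)

end IsVBDirac

end VerticalDerivative

/-! ### Base points of brackets. -/

section BasePoints

variable {V : Type*} [NormedAddCommGroup V] [NormedSpace ℝ V] {H : Type*} [TopologicalSpace H]
  {I : ModelWithCorners ℝ V H} {M : Type*} [TopologicalSpace M] [ChartedSpace H M]
  [IsManifold I ∞ M]
  {F : Type*} [NormedAddCommGroup F] [NormedSpace ℝ F] {E : M → Type*}
  [∀ x, AddCommGroup (E x)] [∀ x, Module ℝ (E x)] [∀ x, TopologicalSpace (E x)]
  [TopologicalSpace (TotalSpace F E)] [FiberBundle F E] [VectorBundle ℝ F E]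
  [ContMDiffVectorBundle ∞ F E I]
  {W : ∀ x, Submodule ℝ (E x)} {L : ∀ X, Submodule ℝ (TangentProlongation I F E X)}
  [FiniteDimensional ℝ V] [T2Space M] [FiniteDimensional ℝ F] [I.Boundaryless]
  {C : CourantAlgebroid I F E}

variable (C) in
lemma CourantAlgebroid.prolongAnchor_vert (X : TangentBundle I M) (k : E X.proj) :
    C.prolongAnchor X (vert I F X k) = ((0 : V), (C.anchor X.proj k : V)) := by
  obtain ⟨τ, hτ, rfl⟩ := exists_section_eq I F X.proj k
  exact C.prolongAnchor_coreLift τ X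

variable (C) in
lemma CourantAlgebroid.fst_prolongAnchor (X : TangentBundle I M) (d : TangentProlongation I F E X) :
    (C.prolongAnchor X d : V × V).1 = C.anchor X.proj (basePt I E X d) :=
  (add_zero _).trans (congrArg (C.anchor X.proj)
    ((constSection_self X.proj (fibFst I E X d)).trans (fibCoord_symm_apply _ _).symm))

variable (C) in
lemma CourantAlgebroid.basePt_prolongTensor (X : TangentBundle I M)
    (d e : TangentProlongation I F E X) : basePt I E X (C.prolongTensor X d e) =
      C.bracket (constSection I E X.proj (fibFst I E X d))
        (constSection I E X.proj (fibFst I E X e)) X.proj := by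
  rw [CourantAlgebroid.prolongTensor, map_add, basePt_tangentLift, coreLift_eq_vert, basePt_vert,
    add_zero]

namespace IsVBDirac

variable (hL : IsVBDirac C.prolong W L)
include hL

/-- Up to derivatives of the two sections, the base point of the bracket of two sections of `L`
depends only on their base points. -/
theorem basePt_bracket_compare {s t s' t' : ∀ X, TangentProlongation I F E X}
    (hs : s ∈ sectionsOf I.tangent (F × F) L) (ht : t ∈ sectionsOf I.tangent (F × F) L)
    (hs' : s' ∈ sectionsOf I.tangent (F × F) L) (ht' : t' ∈ sectionsOf I.tangent (F × F) L)
    {x : M} {u u' : V} (h1 : fibFst I E ⟨x, u⟩ (s ⟨x, u⟩) = fibFst I E ⟨x, u'⟩ (s' ⟨x, u'⟩))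
    (h2 : fibFst I E ⟨x, u⟩ (t ⟨x, u⟩) = fibFst I E ⟨x, u'⟩ (t' ⟨x, u'⟩)) :
    (basePt I E ⟨x, u⟩ (C.prolongBracket s t ⟨x, u⟩) -
      basePt I E ⟨x, u⟩ (flatDeriv I.tangent (F × F) (⟨x, u⟩ : TangentBundle I M) t (C.prolongAnchor ⟨x, u⟩ (s ⟨x, u⟩))) +
      basePt I E ⟨x, u⟩
        (flatDeriv I.tangent (F × F) (⟨x, u⟩ : TangentBundle I M) s (C.prolongAnchor ⟨x, u⟩ (t ⟨x, u⟩))) : E x) =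
    basePt I E ⟨x, u'⟩ (C.prolongBracket s' t' ⟨x, u'⟩) -
      basePt I E ⟨x, u'⟩
        (flatDeriv I.tangent (F × F) (⟨x, u'⟩ : TangentBundle I M) t' (C.prolongAnchor ⟨x, u'⟩ (s' ⟨x, u'⟩))) +
      basePt I E ⟨x, u'⟩
        (flatDeriv I.tangent (F × F) (⟨x, u'⟩ : TangentBundle I M) s' (C.prolongAnchor ⟨x, u'⟩ (t' ⟨x, u'⟩))) := by
  -- Pairing with the vertical vector of `c` detects base points. The derivative terms on the left
  -- cancel those of the bracket formula, leaving the bracket of flat sections, which depends only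
  -- on base points, and one vertical derivative of `s`.
  have key : ∀ (s t : ∀ X, TangentProlongation I F E X) (hs : s ∈ sectionsOf I.tangent (F × F) L)
      (ht : t ∈ sectionsOf I.tangent (F × F) L) (u : V) (c : E x),
      C.pairing x c (basePt I E ⟨x, u⟩ (C.prolongBracket s t ⟨x, u⟩) -
        basePt I E ⟨x, u⟩ (flatDeriv I.tangent (F × F) (⟨x, u⟩ : TangentBundle I M) t
          (C.prolongAnchor ⟨x, u⟩ (s ⟨x, u⟩))) +
        basePt I E ⟨x, u⟩ (flatDeriv I.tangent (F × F) (⟨x, u⟩ : TangentBundle I M) s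
          (C.prolongAnchor ⟨x, u⟩ (t ⟨x, u⟩))) : E x) =
      C.pairing x c (C.bracket (constSection I E x (fibFst I E ⟨x, u⟩ (s ⟨x, u⟩)))
        (constSection I E x (fibFst I E ⟨x, u⟩ (t ⟨x, u⟩))) x) +
      C.prolongPairing ⟨x, u⟩ (flatDeriv I.tangent (F × F) (⟨x, u⟩ : TangentBundle I M) s ((0 : V), (C.anchor x c : V)))
        (t ⟨x, u⟩) := fun s t hs ht u c => by
    have h := C.pairing_prolongBracket s t ⟨x, u⟩ (vert I F ⟨x, u⟩ c)
    rw [C.prolongPairing_vert_right, C.prolongPairing_vert_right, C.prolongPairing_vert_right,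
      C.prolongPairing_vert_right, C.basePt_prolongTensor] at h
    have h0 : C.prolongAnchor ⟨x, u⟩ (vert I F ⟨x, u⟩ c) = ((0 : V), (C.anchor x c : V)) :=
      C.prolongAnchor_vert ⟨x, u⟩ c
    rw [h0] at h
    refine (map_add (C.pairing x c) _ _).trans ?_
    refine (congrArg (· + _) (map_sub (C.pairing x c) _ _)).trans ?_
    have h' : ∀ a b b' d e : ℝ, a = b - b' + d + e → a - b + b' = d + e := by
      intros; linarith
    exact h' _ _ _ _ _ h
  refine eq_of_pairing (p := (C.pairing x).flip) (fun a ha => ?_) fun c => ?_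
  · refine C.pairing_nondegenerate x a fun b => ?_
    rw [C.pairing_symm]; exact ha b
  refine (key s t hs ht u c).trans (Eq.trans ?_ (key s' t' hs' ht' u' c).symm)
  have hb : basePt I E ⟨x, u⟩ (t ⟨x, u⟩) ∈ W x :=
    hL.double.basePt_mem (ht.2 ⟨x, u⟩)
  -- An element of `L` over the anchor of `c`, with the base point of `t`. It serves for both sides,
  -- as base points agree, and evaluates the two vertical derivatives by the same expression.
  obtain ⟨r, hr, hr'⟩ := hL.exists_basePt_eq (⟨x, (C.anchor x c : V)⟩ : TangentBundle I M) hb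
  have hr' := ((basePt_eq_iff _ _ _).1 hr').trans (fibCoord_basePt _ _)
  have hrm : fibMk I F E ⟨x, (C.anchor x c : V)⟩ (fibFst I E ⟨x, u⟩ (t ⟨x, u⟩))
      (fibSnd I E ⟨x, (C.anchor x c : V)⟩ r) ∈ L ⟨x, (C.anchor x c : V)⟩ := by
    rw [← show _ = fibFst I E ⟨x, u⟩ (t ⟨x, u⟩) from hr']; exact hr
  have e1 := hL.pairing_flatDeriv_vertical hs (x := x) (u := u) (ht.2 ⟨x, u⟩) hrm
  rw [h2] at hrm
  have e2 := hL.pairing_flatDeriv_vertical hs' (x := x) (u := u') (ht'.2 ⟨x, u'⟩) hrm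
  have e3 := congrArg (fun a => -C.prolongPairing ⟨x, (C.anchor x c : V)⟩
    (fibMk I F E ⟨x, (C.anchor x c : V)⟩ (fibFst I E ⟨x, u'⟩ (s' ⟨x, u'⟩)) 0)
    (fibMk I F E ⟨x, (C.anchor x c : V)⟩ a (fibSnd I E ⟨x, (C.anchor x c : V)⟩ r))) h2
  rw [h1] at e1 ⊢
  rw [h2]
  exact congrArg _ (e1.trans (e3.trans e2.symm))

end IsVBDirac

section ProductSections

lemma vderiv_clm_comp {N : Type*} [TopologicalSpace N] [ChartedSpace H N] {G G' : Type*}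
    [NormedAddCommGroup G] [NormedSpace ℝ G] [NormedAddCommGroup G'] [NormedSpace ℝ G']
    (φ : G →L[ℝ] G') {f : N → G} {x : N} (hf : MDifferentiableAt I 𝓘(ℝ, G) f x)
    (v : TangentSpace I x) : vderiv I (fun y => φ (f y)) x v = φ (vderiv I f x v) :=
  vderiv_eq (φ.hasMFDerivAt.comp x hf.hasMFDerivAt) v

/-- Along the submanifold the pair of functions takes values in the diagonal, which is a linear
subspace, so `vderiv_mem` applies. -/
lemma vderiv_eq_of_projBase {G : Type*} [NormedAddCommGroup G] [NormedSpace ℝ G]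
    [FiniteDimensional ℝ G] {α β : M × TangentBundle I M → G} {X : TangentBundle I M}
    (hα : MDifferentiableAt (I.prod I.tangent) 𝓘(ℝ, G) α (X.proj, X))
    (hβ : MDifferentiableAt (I.prod I.tangent) 𝓘(ℝ, G) β (X.proj, X))
    (h : ∀ᶠ q in 𝓝 (X.proj, X), q ∈ projBase I M → α q = β q) (ξ : V × V) :
    vderiv (I.prod I.tangent) α (X.proj, X) (ξ.1, ξ) =
      vderiv (I.prod I.tangent) β (X.proj, X) (ξ.1, ξ) := by
  have hp : ((X.proj, X) : M × TangentBundle I M) ∈ projBase I M := rfl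
  have h1 := vderiv_mem (I := I.prod I.tangent) (isLinearAt_projBase hp) hp
    (hα.prodMk_space hβ) (D := LinearMap.eqLocus (LinearMap.fst ℝ G G) (LinearMap.snd ℝ G G))
    (by filter_upwards [h] with q hq hq'; exact hq hq') (v := (ξ.1, ξ)) rfl
  have h2 := vderiv_prodMk hα hβ ((ξ.1, ξ) : V × V × V)
  exact (congrArg Prod.fst h2).symm.trans (Eq.trans h1 (congrArg Prod.snd h2))

variable (σ : ∀ p : M × TangentBundle I M, E p.1 × TangentProlongation I F E p.2)

/-- The first component of a section of `𝔼 × T𝔼`. -/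
def prodSlice₁ (y : M) (Z : TangentBundle I M) : E y := (σ (y, Z)).1

/-- The second component of a section of `𝔼 × T𝔼`. -/
def prodSlice₂ (Z : TangentBundle I M) (y : M) : TangentProlongation I F E Z := (σ (y, Z)).2

variable {σ}

lemma transition_fibCoord {x y : M} (hy : y ∈ (trivializationAt F E x).baseSet) (u : E y) :
    transition F E y x y (fibCoord F y u) = (trivializationAt F E x ⟨y, u⟩).2 := by
  have hy' := mem_baseSet_trivializationAt F E y
  refine (Trivialization.coordChangeL_apply (R := ℝ) (trivializationAt F E y)
    (trivializationAt F E x) ⟨hy', hy⟩ _).trans ?_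
  rw [fibCoord_apply, (trivializationAt F E y).symm_apply_apply_mk hy' u]

/-- The total derivatives, in a direction tangent to the graph of the projection `TM → M`, of the
components of a section with values in the graph of the projection `T𝔼 → 𝔼`. -/
theorem basePt_totalDeriv
    (h1 : ContMDiff (I.prod I.tangent) (I.prod 𝓘(ℝ, F)) ∞ fun p => TotalSpace.mk' F p.1 (σ p).1)
    (h2 : ContMDiff (I.prod I.tangent) (I.tangent.prod 𝓘(ℝ, F × F)) ∞
      fun p => TotalSpace.mk' (F × F) p.2 (σ p).2) {X : TangentBundle I M}
    (hσ : ∀ᶠ q in 𝓝 (X.proj, X), q ∈ projBase I M →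
      fibFst I E q.2 (σ q).2 = fibCoord F q.1 (σ q).1) (ξ : V × V) :
    basePt I E X (flatDeriv I.tangent (F × F) X (fun Z => prodSlice₂ σ Z X.proj) ξ +
      fibreDeriv I (F × F) (prodSlice₂ σ X) X.proj ξ.1) =
    flatDeriv I F X.proj (fun y => prodSlice₁ σ y X) ξ.1 +
      fibreDeriv I.tangent F (prodSlice₁ σ X.proj) X ξ := by
  have d1 := (contMDiffAt_totalSpace.1 (h1 (X.proj, X))).2.mdifferentiableAt (by simp)
  have d2 := (contMDiffAt_totalSpace.1 (h2 (X.proj, X))).2.mdifferentiableAt (by simp)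
  have d3 := (ContinuousLinearMap.fst ℝ F F).mdifferentiableAt.comp (X.proj, X) d2
  -- The transition functions of T𝔼 act on base points by those of 𝔼. So on `projBase` the
  -- hypothesis says that the two coordinate representatives agree, and the direction given by `ξ.1`
  -- and `ξ` is tangent to `projBase`.
  have h := vderiv_eq_of_projBase d3 d1 (by
    filter_upwards [hσ, (continuous_fst.tendsto _).eventually (baseSet_mem_nhds F E X.proj)]
      with q hq hq' hqp
    have hq := hq hqp
    obtain ⟨y, Z⟩ := q
    obtain rfl : Z.proj = y := hqp
    refine Eq.trans ?_ (transition_fibCoord hq' _)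
    exact congrArg (transition F E Z.proj X.proj Z.proj) hq) ξ
  have h3 := vderiv_clm_comp (ContinuousLinearMap.fst ℝ F F) d2 ((ξ.1, ξ) : V × V × V)
  have h4 := vderiv_prod d1 ((ξ.1, ξ) : V × V × V)
  have h5 := vderiv_prod d2 ((ξ.1, ξ) : V × V × V)
  refine (fibCoord F X.proj).injective ((fibCoord_basePt X _).trans ?_)
  have h6 : (flatDeriv I.tangent (F × F) X (fun Z => prodSlice₂ σ Z X.proj) ξ +
      fibreDeriv I (F × F) (prodSlice₂ σ X) X.proj ξ.1 : F × F) = _ :=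
    ((congrArg₂ (· + ·) (flatDeriv_prolongation X _ ξ) (fibreDeriv_prolongation _ _ _)).trans
      (add_comm _ _)).trans h5.symm
  refine (congrArg Prod.fst h6).trans (h3.symm.trans (h.trans (h4.trans ?_)))
  refine ((fibCoord F X.proj).symm_apply_eq.1 ?_)
  rw [map_add, fibCoord_symm_apply, fibCoord_symm_apply]
  rfl

end ProductSections

end BasePoints

/-! ### The Lie algebroid structure on `W`. -/

section SideAlgebroid

variable {V : Type*} [NormedAddCommGroup V] [NormedSpace ℝ V] {H : Type*} [TopologicalSpace H]
  {I : ModelWithCorners ℝ V H} {M : Type*} [TopologicalSpace M] [ChartedSpace H M]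
  [IsManifold I ∞ M]
  {F : Type*} [NormedAddCommGroup F] [NormedSpace ℝ F] {E : M → Type*}
  [∀ x, AddCommGroup (E x)] [∀ x, Module ℝ (E x)] [∀ x, TopologicalSpace (E x)]
  [TopologicalSpace (TotalSpace F E)] [FiberBundle F E] [VectorBundle ℝ F E]
  [ContMDiffVectorBundle ∞ F E I]
  {W : ∀ x, Submodule ℝ (E x)} {L : ∀ X, Submodule ℝ (TangentProlongation I F E X)}

variable (L) in
/-- The section `s` of `L → TM` is projectable, near `X`, to the section `w` of `𝔼`. -/
def IsLiftAt (s : ∀ X, TangentProlongation I F E X) (w : ∀ x, E x) (X : TangentBundle I M) : Prop :=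
  s ∈ sectionsOf I.tangent (F × F) L ∧ ∀ᶠ Z in 𝓝 X, basePt I E Z (s Z) = w Z.proj

lemma IsLiftAt.eventually {s : ∀ X, TangentProlongation I F E X} {w : ∀ x, E x}
    {X : TangentBundle I M} (h : IsLiftAt L s w X) : ∀ᶠ Z in 𝓝 X, IsLiftAt L s w Z := by
  filter_upwards [eventually_eventually_nhds.2 h.2] with Z hZ using ⟨h.1, hZ⟩

variable [FiniteDimensional ℝ V] [T2Space M] [FiniteDimensional ℝ F] [I.Boundaryless]
  {C : CourantAlgebroid I F E}

lemma fibreDeriv_const {V' : Type*} [NormedAddCommGroup V'] [NormedSpace ℝ V'] {H' : Type*}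
    [TopologicalSpace H'] {J : ModelWithCorners ℝ V' H'} {P : Type*} [TopologicalSpace P]
    [ChartedSpace H' P] {x : M} (u : E x) (p : P) (v : TangentSpace J p) :
    fibreDeriv J F (fun _ => u) p v = 0 :=
  (congrArg ((trivializationAt F E x).symmL ℝ x) (vderiv_const _ v)).trans (map_zero _)

lemma IsLiftAt.basePt_flatDeriv {s : ∀ X, TangentProlongation I F E X} {w : ∀ x, E x}
    {X : TangentBundle I M} (hs : IsLiftAt L s w X) (hw : w ∈ smoothSections I F E) (ξ : V × V) :
    basePt I E X (flatDeriv I.tangent (F × F) X s ξ) = flatDeriv I F X.proj w ξ.1 := by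
  have h := basePt_totalDeriv (I := I) (F := F) (E := E) (σ := fun q => (w q.1, s q.2))
    (hw.comp contMDiff_fst) (hs.1.1.comp contMDiff_snd) (X := X) (by
      filter_upwards [(continuous_snd.tendsto ((X.proj, X) : M × TangentBundle I M)).eventually hs.2]
        with q hq hqp
      obtain ⟨y, Z⟩ := q
      obtain rfl : Z.proj = y := hqp
      exact (basePt_eq_iff _ _ _).1 hq) ξ
  have h1 : fibreDeriv I (F × F) (fun _ : M => s X) X.proj ξ.1 = 0 := fibreDeriv_const _ _ _
  have h2 : fibreDeriv I.tangent F (fun _ : TangentBundle I M => w X.proj) X ξ = 0 :=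
    fibreDeriv_const _ _ _
  have h3 : basePt I E X (flatDeriv I.tangent (F × F) X s ξ + fibreDeriv I (F × F) (fun _ : M => s X)
      X.proj ξ.1) = flatDeriv I F X.proj w ξ.1 +
        fibreDeriv I.tangent F (fun _ : TangentBundle I M => w X.proj) X ξ := h
  rwa [h1, h2, add_zero, add_zero] at h3

variable (C) in
lemma IsLiftAt.fst_anchor {s : ∀ X, TangentProlongation I F E X} {w : ∀ x, E x}
    {X : TangentBundle I M} (hs : IsLiftAt L s w X) :
    (C.prolongAnchor X (s X) : V × V).1 = C.anchor X.proj (w X.proj) := by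
  rw [C.fst_prolongAnchor, hs.2.self_of_nhds]

lemma IsLiftAt.smul {s : ∀ X, TangentProlongation I F E X} {w : ∀ x, E x}
    {X : TangentBundle I M} (hs : IsLiftAt L s w X) {f : M → ℝ} (hf : ContMDiff I 𝓘(ℝ, ℝ) ∞ f) :
    IsLiftAt L (fun Z => coreLiftFun I f Z • s Z) (fun x => f x • w x) X := by
  refine ⟨⟨smoothSections_smul (contMDiff_coreLiftFun hf) hs.1.1,
    fun Z => (L Z).smul_mem _ (hs.1.2 Z)⟩, ?_⟩
  filter_upwards [hs.2] with Z hZ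
  rw [map_smul, hZ, coreLiftFun]

lemma IsLiftAt.const_smul {s : ∀ X, TangentProlongation I F E X} {w : ∀ x, E x}
    {X : TangentBundle I M} (hs : IsLiftAt L s w X) (c : ℝ) : IsLiftAt L (c • s) (c • w) X :=
  hs.smul (f := fun _ => c) contMDiff_const

lemma IsLiftAt.add {s t : ∀ X, TangentProlongation I F E X} {w w' : ∀ x, E x}
    {X : TangentBundle I M} (hs : IsLiftAt L s w X) (ht : IsLiftAt L t w' X) :
    IsLiftAt L (s + t) (w + w') X := by
  refine ⟨⟨smoothSections_add hs.1.1 ht.1.1, fun Z => (L Z).add_mem (hs.1.2 Z) (ht.1.2 Z)⟩, ?_⟩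
  filter_upwards [hs.2, ht.2] with Z hZ hZ'
  rw [Pi.add_apply, map_add, hZ, hZ', Pi.add_apply]

/-- Along the zero section of `TM`, pairings of `w` are pairings of the smooth section `s` with core
lifts. -/
lemma IsLiftAt.contMDiffAt (C : CourantAlgebroid I F E) {s : ∀ X, TangentProlongation I F E X}
    {w : ∀ x, E x} {x : M} (hs : IsLiftAt L s w ⟨x, 0⟩) :
    ContMDiffAt I (I.prod 𝓘(ℝ, F)) ∞ (fun y => TotalSpace.mk' F y (w y)) x := by
  refine contMDiffAt_of_pairing C.pairing_smooth (C.pairing_nondegenerate x) fun σ hσ => ?_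
  have h0 : ContMDiff I I.tangent ∞ (fun y => (⟨y, 0⟩ : TangentBundle I M)) :=
    contMDiff_zeroSection ℝ (TangentSpace I (M := M))
  refine ((C.contMDiff_prolongPairing s hs.1.1 _ (coreLift_mem hσ)).comp h0 x).congr_of_eventuallyEq
    ?_
  filter_upwards [h0.continuous.continuousAt.eventually hs.2] with y hy
  rw [C.pairing_symm]
  refine (congrArg (C.pairing y (σ y)) hy).symm.trans ?_
  exact (C.prolongPairing_vert_right (X := ⟨y, 0⟩) (σ y) (s ⟨y, 0⟩)).symm

open Classical in
variable (C L) in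
/-- The bracket on sections of `W`: lift to sections of `L`, and project the bracket of the lifts. -/
noncomputable def sideBracket (w₁ w₂ : ∀ x, E x) (x : M) : E x :=
  -- For sections of `W` such lifts exist over every tangent vector; the zero vector is just one
  -- choice, and the value zero is never taken by default.
  if h : ∃ p : (∀ X, TangentProlongation I F E X) × ∀ X, TangentProlongation I F E X,
    IsLiftAt L p.1 w₁ ⟨x, 0⟩ ∧ IsLiftAt L p.2 w₂ ⟨x, 0⟩ then
    basePt I E ⟨x, 0⟩ (C.prolongBracket h.choose.1 h.choose.2 ⟨x, 0⟩) else 0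

namespace IsVBDirac

variable (hL : IsVBDirac C.prolong W L)
include hL

lemma exists_isLiftAt {w : ∀ x, E x} (hw : w ∈ sectionsOf I F W) (X : TangentBundle I M) :
    ∃ s, IsLiftAt L s w X := by
  obtain ⟨s, hs, h⟩ := hL.exists_lift hw.1 X (.of_forall hw.2)
  exact ⟨s, hs, h⟩

variable {w₁ w₂ : ∀ x, E x} (hw₁ : w₁ ∈ sectionsOf I F W) (hw₂ : w₂ ∈ sectionsOf I F W)
  {s t : ∀ X, TangentProlongation I F E X}
include hw₁ hw₂

/-- For lifts of `w₁` and `w₂`, the derivative terms in `basePt_bracket_compare` are derivatives of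
`w₁` and `w₂` along each other's anchors. They are the same for all lifts and over all tangent
vectors at `x`. -/
lemma basePt_bracket_congr {s' t' : ∀ X, TangentProlongation I F E X} {x : M} {u u' : V}
    (hs : IsLiftAt L s w₁ ⟨x, u⟩) (ht : IsLiftAt L t w₂ ⟨x, u⟩) (hs' : IsLiftAt L s' w₁ ⟨x, u'⟩)
    (ht' : IsLiftAt L t' w₂ ⟨x, u'⟩) :
    (basePt I E ⟨x, u⟩ (C.prolongBracket s t ⟨x, u⟩) : E x) =
      basePt I E ⟨x, u'⟩ (C.prolongBracket s' t' ⟨x, u'⟩) := by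
  have h := hL.basePt_bracket_compare hs.1 ht.1 hs'.1 ht'.1 (x := x) (u := u) (u' := u')
    (((basePt_eq_iff _ _ _).1 hs.2.self_of_nhds).trans
      ((basePt_eq_iff _ _ _).1 hs'.2.self_of_nhds).symm)
    (((basePt_eq_iff _ _ _).1 ht.2.self_of_nhds).trans
      ((basePt_eq_iff _ _ _).1 ht'.2.self_of_nhds).symm)
  have k1 := (ht.basePt_flatDeriv hw₂.1 (C.prolongAnchor ⟨x, u⟩ (s ⟨x, u⟩))).trans
    (congrArg _ (hs.fst_anchor C))
  have k2 := (hs.basePt_flatDeriv hw₁.1 (C.prolongAnchor ⟨x, u⟩ (t ⟨x, u⟩))).trans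
    (congrArg _ (ht.fst_anchor C))
  have k1' := (ht'.basePt_flatDeriv hw₂.1 (C.prolongAnchor ⟨x, u'⟩ (s' ⟨x, u'⟩))).trans
    (congrArg _ (hs'.fst_anchor C))
  have k2' := (hs'.basePt_flatDeriv hw₁.1 (C.prolongAnchor ⟨x, u'⟩ (t' ⟨x, u'⟩))).trans
    (congrArg _ (ht'.fst_anchor C))
  have key : ∀ a a' b b' c c' : E x, a - b + c = a' - b' + c' → b = b' → c = c' → a = a' := by
    rintro a a' b b' c c' h rfl rfl
    simpa using h
  exact key _ _ _ _ _ _ h (k1.trans k1'.symm) (k2.trans k2'.symm)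

lemma basePt_bracket {X : TangentBundle I M} (hs : IsLiftAt L s w₁ X) (ht : IsLiftAt L t w₂ X) :
    basePt I E X (C.prolongBracket s t X) = sideBracket L C w₁ w₂ X.proj := by
  obtain ⟨x, u⟩ := X
  obtain ⟨s', hs'⟩ := hL.exists_isLiftAt hw₁ (⟨x, 0⟩ : TangentBundle I M)
  obtain ⟨t', ht'⟩ := hL.exists_isLiftAt hw₂ (⟨x, 0⟩ : TangentBundle I M)
  have h : ∃ p : (∀ X, TangentProlongation I F E X) × ∀ X, TangentProlongation I F E X,
      IsLiftAt L p.1 w₁ ⟨x, 0⟩ ∧ IsLiftAt L p.2 w₂ ⟨x, 0⟩ := ⟨(s', t'), hs', ht'⟩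
  refine Eq.trans ?_ (dif_pos h).symm
  exact hL.basePt_bracket_congr hw₁ hw₂ (x := x) (u' := 0) hs ht h.choose_spec.1 h.choose_spec.2

lemma isLiftAt_bracket {X : TangentBundle I M} (hs : IsLiftAt L s w₁ X) (ht : IsLiftAt L t w₂ X) :
    IsLiftAt L (C.prolongBracket s t) (sideBracket L C w₁ w₂) X := by
  refine ⟨hL.dirac.lieAlgebroid.bracket_mem s hs.1 t ht.1, ?_⟩
  filter_upwards [hs.eventually, ht.eventually] with Z hZ hZ' using hL.basePt_bracket hw₁ hw₂ hZ hZ'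

/-- The bracket of two lifts is a local lift of the bracket, and anything with a local lift is
smooth with values in `W`. -/
lemma sideBracket_mem : sideBracket L C w₁ w₂ ∈ sectionsOf I F W := by
  have h : ∀ x : M, ∃ s, IsLiftAt L s (sideBracket L C w₁ w₂) ⟨x, 0⟩ := fun x => by
    obtain ⟨s, hs⟩ := hL.exists_isLiftAt hw₁ (⟨x, 0⟩ : TangentBundle I M)
    obtain ⟨t, ht⟩ := hL.exists_isLiftAt hw₂ (⟨x, 0⟩ : TangentBundle I M)
    exact ⟨_, hL.isLiftAt_bracket hw₁ hw₂ hs ht⟩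
  refine ⟨fun x => ?_, fun x => ?_⟩
  · obtain ⟨s, hs⟩ := h x
    exact hs.contMDiffAt C
  · obtain ⟨s, hs⟩ := h x
    have h1 := hL.double.basePt_mem (hs.1.2 ⟨x, 0⟩)
    rw [hs.2.self_of_nhds] at h1
    exact h1

end IsVBDirac

/-- The Lie algebroid structure on the side bundle of a `𝒱ℬ`-Dirac structure. -/
noncomputable def IsVBDirac.sideAlgebroid (hL : IsVBDirac C.prolong W L) : LieAlgebroid I F W where
  subbundle := hL.double.side
  anchor := C.anchor
  anchor_smooth σ hσ := C.anchor_smooth σ hσ.1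
  bracket := sideBracket L C
  bracket_mem σ hσ τ hτ := hL.sideBracket_mem hσ hτ
  -- This and the remaining identities are the base points, over the zero tangent vector, of the
  -- same identities for lifts in `L`.
  bracket_add σ hσ τ hτ τ' hτ' := by
    funext x
    obtain ⟨s, hs⟩ := hL.exists_isLiftAt hσ (⟨x, 0⟩ : TangentBundle I M)
    obtain ⟨t, ht⟩ := hL.exists_isLiftAt hτ (⟨x, 0⟩ : TangentBundle I M)
    obtain ⟨t', ht'⟩ := hL.exists_isLiftAt hτ' (⟨x, 0⟩ : TangentBundle I M)
    have hττ : τ + τ' ∈ sectionsOf I F W :=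
      ⟨smoothSections_add hτ.1 hτ'.1, fun x => (W x).add_mem (hτ.2 x) (hτ'.2 x)⟩
    have h := congrFun (hL.dirac.lieAlgebroid.bracket_add s hs.1 t ht.1 t' ht'.1) ⟨x, 0⟩
    refine (hL.basePt_bracket hσ hττ hs (ht.add ht')).symm.trans ((congrArg _ h).trans ?_)
    exact (map_add _ _ _).trans (congrArg₂ (· + ·) (hL.basePt_bracket hσ hτ hs ht)
      (hL.basePt_bracket hσ hτ' hs ht'))
  bracket_smul c σ hσ τ hτ := by
    funext x
    obtain ⟨s, hs⟩ := hL.exists_isLiftAt hσ (⟨x, 0⟩ : TangentBundle I M)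
    obtain ⟨t, ht⟩ := hL.exists_isLiftAt hτ (⟨x, 0⟩ : TangentBundle I M)
    have hcτ : c • τ ∈ sectionsOf I F W :=
      ⟨smoothSections_const_smul c hτ.1, fun x => (W x).smul_mem c (hτ.2 x)⟩
    have h := congrFun (hL.dirac.lieAlgebroid.bracket_smul c s hs.1 t ht.1) ⟨x, 0⟩
    refine (hL.basePt_bracket hσ hcτ hs (ht.const_smul c)).symm.trans ((congrArg _ h).trans ?_)
    exact (map_smul _ _ _).trans (congrArg (c • ·) (hL.basePt_bracket hσ hτ hs ht))
  bracket_skew σ hσ τ hτ := by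
    funext x
    obtain ⟨s, hs⟩ := hL.exists_isLiftAt hσ (⟨x, 0⟩ : TangentBundle I M)
    obtain ⟨t, ht⟩ := hL.exists_isLiftAt hτ (⟨x, 0⟩ : TangentBundle I M)
    have h := congrFun (hL.dirac.lieAlgebroid.bracket_skew s hs.1 t ht.1) ⟨x, 0⟩
    refine (hL.basePt_bracket hσ hτ hs ht).symm.trans ((congrArg _ h).trans ?_)
    exact (map_neg _ _).trans (congrArg (-·) (hL.basePt_bracket hτ hσ ht hs))
  jacobi σ hσ τ hτ ρ hρ := by
    funext x
    obtain ⟨s, hs⟩ := hL.exists_isLiftAt hσ (⟨x, 0⟩ : TangentBundle I M)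
    obtain ⟨t, ht⟩ := hL.exists_isLiftAt hτ (⟨x, 0⟩ : TangentBundle I M)
    obtain ⟨r, hr⟩ := hL.exists_isLiftAt hρ (⟨x, 0⟩ : TangentBundle I M)
    have h := congrFun (hL.dirac.lieAlgebroid.jacobi s hs.1 t ht.1 r hr.1) ⟨x, 0⟩
    have e1 := hL.basePt_bracket hσ (hL.sideBracket_mem hτ hρ) hs (hL.isLiftAt_bracket hτ hρ ht hr)
    have e2 := hL.basePt_bracket hτ (hL.sideBracket_mem hρ hσ) ht (hL.isLiftAt_bracket hρ hσ hr hs)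
    have e3 := hL.basePt_bracket hρ (hL.sideBracket_mem hσ hτ) hr (hL.isLiftAt_bracket hσ hτ hs ht)
    refine (congrArg₂ (· + ·) (congrArg₂ (· + ·) e1 e2) e3).symm.trans ?_
    refine Eq.trans ?_ ((congrArg (basePt I E ⟨x, 0⟩) h).trans (map_zero _))
    exact ((map_add (basePt I E ⟨x, 0⟩) _ _).trans (congrArg (fun a => a + _)
      (map_add (basePt I E ⟨x, 0⟩) _ _))).symm
  leibniz σ hσ τ hτ f hf x := by
    obtain ⟨s, hs⟩ := hL.exists_isLiftAt hσ (⟨x, 0⟩ : TangentBundle I M)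
    obtain ⟨t, ht⟩ := hL.exists_isLiftAt hτ (⟨x, 0⟩ : TangentBundle I M)
    have hfτ : (fun x => f x • τ x) ∈ sectionsOf I F W :=
      ⟨smoothSections_smul hf hτ.1, fun x => (W x).smul_mem _ (hτ.2 x)⟩
    have h := hL.dirac.lieAlgebroid.leibniz s hs.1 t ht.1 _ (contMDiff_coreLiftFun hf)
      (⟨x, 0⟩ : TangentBundle I M)
    refine (hL.basePt_bracket hσ hfτ hs (ht.smul hf)).symm.trans ((congrArg _ h).trans ?_)
    have e1 := (derivAlong_coreLiftFun hf ⟨x, 0⟩ (C.prolongAnchor ⟨x, 0⟩ (s ⟨x, 0⟩))).trans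
      (congrArg (derivAlong I f x) (hs.fst_anchor C))
    have e2 := congrArg₂ (· • ·) e1 ht.2.self_of_nhds
    refine (map_add _ _ _).trans (congrArg₂ (· + ·) ((map_smul _ _ _).trans e2)
      ((map_smul _ _ _).trans (congrArg (f x • ·) (hL.basePt_bracket hσ hτ hs ht))))

end SideAlgebroid

/-! ### The projection to `W` is a morphism of Lie algebroids. -/

section GraphProjBracket

variable {V : Type*} [NormedAddCommGroup V] [NormedSpace ℝ V] {H : Type*} [TopologicalSpace H]
  {I : ModelWithCorners ℝ V H} {M : Type*} [TopologicalSpace M] [ChartedSpace H M]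
  [IsManifold I ∞ M]
  {F : Type*} [NormedAddCommGroup F] [NormedSpace ℝ F] {E : M → Type*}
  [∀ x, AddCommGroup (E x)] [∀ x, Module ℝ (E x)] [∀ x, TopologicalSpace (E x)]
  [TopologicalSpace (TotalSpace F E)] [FiberBundle F E] [VectorBundle ℝ F E]
  [ContMDiffVectorBundle ∞ F E I]
  {W : ∀ x, Submodule ℝ (E x)} {L : ∀ X, Submodule ℝ (TangentProlongation I F E X)}
  [FiniteDimensional ℝ V] [T2Space M] [FiniteDimensional ℝ F] [I.Boundaryless]
  {C : CourantAlgebroid I F E}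

section Slices

variable {σ : ∀ p : M × TangentBundle I M, E p.1 × TangentProlongation I F E p.2}
  (hσ : σ ∈ prodSections I F I.tangent (F × F) W L)
include hσ

lemma prodSlice₁_mem (Z : TangentBundle I M) : (fun y => prodSlice₁ σ y Z) ∈ sectionsOf I F W :=
  ⟨hσ.1.comp (contMDiff_id.prodMk contMDiff_const), fun y => (hσ.2.2 (y, Z)).1⟩

lemma prodSlice₂_mem (y : M) :
    (fun Z => prodSlice₂ σ Z y) ∈ sectionsOf I.tangent (F × F) L :=
  ⟨hσ.2.1.comp (contMDiff_const.prodMk contMDiff_id), fun Z => (hσ.2.2 (y, Z)).2⟩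

lemma fibreDeriv_prodSlice₁_mem (y : M) (Z : TangentBundle I M) (ξ : TangentSpace I.tangent Z) :
    fibreDeriv I.tangent F (prodSlice₁ σ y) Z ξ ∈ W y := by
  refine fibreDeriv_mem (fun Z => (hσ.2.2 (y, Z)).1) ?_ _
  have h := ((contMDiffAt_totalSpace.1 (hσ.1 (y, Z))).2).mdifferentiableAt (by simp)
  have := MDifferentiableAt.comp (I' := I.prod I.tangent)
    (f := fun Z : TangentBundle I M => (y, Z)) Z h
    (mdifferentiableAt_const.prodMk mdifferentiableAt_id)
  exact this

lemma fibreDeriv_prodSlice₂_mem (y : M) (Z : TangentBundle I M) (v : TangentSpace I y) :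
    fibreDeriv I (F × F) (prodSlice₂ σ Z) y v ∈ L Z := by
  refine fibreDeriv_mem (fun y => (hσ.2.2 (y, Z)).2) ?_ _
  have h := ((contMDiffAt_totalSpace.1 (hσ.2.1 (y, Z))).2).mdifferentiableAt (by simp)
  have := MDifferentiableAt.comp (I' := I.prod I.tangent)
    (f := fun y : M => (y, Z)) y h
    (mdifferentiableAt_id.prodMk mdifferentiableAt_const)
  exact this

end Slices

/-- The graph of the projection `L → W` is a Lie subalgebroid. -/
theorem IsVBDirac.isLieSubalgebroid_graphProj (hL : IsVBDirac C.prolong W L) :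
    ProjIsLieAlgebroidMorphism hL.sideAlgebroid hL.dirac.lieAlgebroid := by
  refine ⟨hL.isVectorSubbundle_graphProj, fun σ hσ τ hτ hσK hτK p hp => ?_⟩
  rw [baseOf_graphProj] at hσK hτK hp
  have hσA := fun q hq => (mem_graphProj.1 (hσK q hq)).2.2
  have hτA := fun q hq => (mem_graphProj.1 (hτK q hq)).2.2
  have hp0 := hp
  obtain ⟨x, X⟩ := p
  obtain rfl : X.proj = x := hp
  have hσ₁ := prodSlice₁_mem hσ X
  have hτ₁ := prodSlice₁_mem hτ X
  have hσ₂ := prodSlice₂_mem hσ X.proj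
  have hτ₂ := prodSlice₂_mem hτ X.proj
  refine mem_graphProj.2 ⟨hp0, ⟨?_, ?_⟩, (basePt_eq_iff _ _ _).1 ?_⟩
  · exact (W _).sub_mem ((W _).add_mem ((hL.sideBracket_mem hσ₁ hτ₁).2 _)
      (fibreDeriv_prodSlice₁_mem hτ _ _ _)) (fibreDeriv_prodSlice₁_mem hσ _ _ _)
  · exact (L _).sub_mem ((L _).add_mem (hL.dirac.involutive _ hσ₂ _ hτ₂ _)
      (fibreDeriv_prodSlice₂_mem hτ _ _ _)) (fibreDeriv_prodSlice₂_mem hσ _ _ _)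
  -- The slice of `σ` in `L` is in general not projectable to its slice in `W`. It is compared with
  -- a projectable lift `s` of the latter, which has the same base point at `X`; similarly for `τ`.
  obtain ⟨s, hs⟩ := hL.exists_isLiftAt hσ₁ X
  obtain ⟨t, ht⟩ := hL.exists_isLiftAt hτ₁ X
  have bσ : basePt I E X (σ (X.proj, X)).2 = (σ (X.proj, X)).1 :=
    (basePt_eq_iff _ _ _).2 (hσA _ hp0)
  have bτ : basePt I E X (τ (X.proj, X)).2 = (τ (X.proj, X)).1 :=
    (basePt_eq_iff _ _ _).2 (hτA _ hp0)
  have aσ : (C.prolongAnchor X (σ (X.proj, X)).2 : V × V).1 = C.anchor X.proj (σ (X.proj, X)).1 :=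
    (C.fst_prolongAnchor X _).trans (congrArg _ bσ)
  have aτ : (C.prolongAnchor X (τ (X.proj, X)).2 : V × V).1 = C.anchor X.proj (τ (X.proj, X)).1 :=
    (C.fst_prolongAnchor X _).trans (congrArg _ bτ)
  have hc := hL.basePt_bracket_compare (x := X.proj) (u := X.2) (u' := X.2) hσ₂ hτ₂ hs.1 ht.1
    ((hσA _ hp0).trans ((basePt_eq_iff _ _ _).1 hs.2.self_of_nhds).symm)
    ((hτA _ hp0).trans ((basePt_eq_iff _ _ _).1 ht.2.self_of_nhds).symm)
  have k1 := (ht.basePt_flatDeriv hτ₁.1 (C.prolongAnchor X (s X))).trans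
    (congrArg (flatDeriv I F X.proj _) (hs.fst_anchor C))
  have k2 := (hs.basePt_flatDeriv hσ₁.1 (C.prolongAnchor X (t X))).trans
    (congrArg (flatDeriv I F X.proj _) (ht.fst_anchor C))
  have k3 := hL.basePt_bracket hσ₁ hτ₁ hs ht
  have d1 := basePt_totalDeriv (X := X) hτ.1 hτ.2.1 (.of_forall hτA) (C.prolongAnchor X (σ (X.proj, X)).2)
  have d2 := basePt_totalDeriv (X := X) hσ.1 hσ.2.1 (.of_forall hσA) (C.prolongAnchor X (τ (X.proj, X)).2)
  rw [map_add, aσ] at d1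
  rw [map_add, aτ] at d2
  -- `basePt_bracket_compare` relates the two brackets up to derivatives of the slices.
  -- `basePt_totalDeriv` relates these derivatives to the parameter derivatives in the product
  -- bracket, and the corrections cancel.
  have key : ∀ b b' f f' g g' m n r r' : E X.proj, b - f + g = b' - f' + g' →
      f + m = f' + r → g + n = g' + r' → b + m - n = b' + r - r' := by
    intro b b' f f' g g' m n r r' h1 h2 h3
    have e1 : b = b' - f' + g' - g + f := by rw [← h1]; abel
    have e2 : m = f' + r - f := by rw [← h2]; abel
    have e3 : n = g' + r' - g := by rw [← h3]; abel
    rw [e1, e2, e3]; abel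
  have hc' := hc.trans (congrArg₂ (· + ·) (congrArg₂ (· - ·) k3 k1) k2)
  refine Eq.trans ?_ (key _ _ _ _ _ _ _ _ _ _ hc' d1 d2)
  exact (map_sub (basePt I E X) _ _).trans
    (congrArg (fun a => a - _) (map_add (basePt I E X) _ _))

end GraphProjBracket
end TangentLift

theorem mainTheorem6
    {V : Type*} [NormedAddCommGroup V] [NormedSpace ℝ V] [FiniteDimensional ℝ V]
    {H : Type*} [TopologicalSpace H] (I : ModelWithCorners ℝ V H) [I.Boundaryless]
    {M : Type*} [TopologicalSpace M] [ChartedSpace H M] [IsManifold I ∞ M]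
    [T2Space M] [SigmaCompactSpace M]
    {F : Type*} [NormedAddCommGroup F] [NormedSpace ℝ F] [FiniteDimensional ℝ F]
    {E : M → Type*} [∀ x, AddCommGroup (E x)] [∀ x, Module ℝ (E x)]
    [∀ x, TopologicalSpace (E x)] [TopologicalSpace (TotalSpace F E)]
    [FiberBundle F E] [VectorBundle ℝ F E] [ContMDiffVectorBundle ∞ F E I]
    (C : CourantAlgebroid I F E) :
    (∃ C' : CourantAlgebroid I.tangent (F × F) (TangentProlongation I F E),
      IsTangentProlongation C C') ∧
    ∀ C' : CourantAlgebroid I.tangent (F × F) (TangentProlongation I F E),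
      IsTangentProlongation C C' →
    ∀ (W : ∀ x, Submodule ℝ (E x)) (L : ∀ X, Submodule ℝ (TangentProlongation I F E X)),
      IsVBDirac C' W L →
    ∃ 𝓛 : LieAlgebroid I.tangent (F × F) L,
      (∀ σ ∈ sectionsOf I.tangent (F × F) L, ∀ τ ∈ sectionsOf I.tangent (F × F) L,
        𝓛.bracket σ τ = C'.bracket σ τ) ∧
      (∀ X, ∀ d ∈ L X, 𝓛.anchor X d = C'.anchor X d) ∧
      IsFlipLAVectorBundle W 𝓛 ∧
      ∃ 𝓦 : LieAlgebroid I F W, ProjIsLieAlgebroidMorphism 𝓦 𝓛 := by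
  refine ⟨⟨C.prolong, C.isTangentProlongation_prolong⟩, fun C' hC' W L hL => ?_⟩
  -- By uniqueness, the given prolongation may be replaced by the explicit one.
  have hL' := hC'.isVBDirac hL
  exact ⟨hL'.dirac.lieAlgebroid, fun σ hσ τ hτ => (hC'.bracket_eq hσ.1 hτ.1).symm,
    fun X d _ => by rw [hC'.anchor_eq]; rfl, ⟨hL.double, hL'.isLieSubalgebroid_graphAdd⟩,
    hL'.sideAlgebroid, hL'.isLieSubalgebroid_graphProj⟩
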